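/- \textbf{Setting.} For $N\in\mathbb N$ let $h=1/(N+1)$ and let $M_h,S_h\in\mathbb R^{(2N+1)\times(2N+1)}$ be the mass and stiffness matrices of quadratic ($P_2$) finite elements on the uniform mesh of $(0,1)$ with nodes $x_j=jh$ and midpoints $x_{j+1/2}=(j+\tfrac12)h$, with homogeneous Dirichlet conditions; vectors are written $F=(F_{j/2})_{1\le j\le 2N+1}$, with $F_0=F_{N+1}=0$. Put $(F,G)_{h,0}=(M_hF,G)_{\mathbb C^{2N+1}}$, and let $B_h$ be the matrix whose only non-zero entry is $-1/h$, at position $(2N+1,2N)$, so that the last component of $B_hF$ is $-F_N/h$. For $\eta\in[0,\pi]$ let $\Delta(\eta)=1+268\cos^2\frac\eta2-44\cos^4\frac\eta2$, $$\Lambda^a(\eta)=\frac{120\sin^2\frac\eta2}{11+4\cos^2\frac\eta2+\sqrt{\Delta(\eta)}},\qquad \Lambda^o(\eta)=\frac{22+8\cos^2\frac\eta2+2\sqrt{\Delta(\eta)}}{1+\sin^2\frac\eta2},$$ and, for $\alpha\in\{a,o\}$ and $1\le k\le N$, let $\lambda^\alpha=\sqrt{\Lambda^\alpha}$, $\lambda^{\alpha,k}_h=\lambda^\alpha(k\pi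 h)/h$, and let $\varphi_h^{\alpha,k}$ be the vector with nodal values $\sin(k\pi x_j)$ and midpoint values $\frac{40+\Lambda}{4(10-\Lambda)}\cos(\frac{k\pi h}2)\sin(k\pi x_{j+1/2})$, $\Lambda=\Lambda^\alpha(k\pi h)$, normalized by $(\varphi_h^{\alpha,k},\varphi_h^{\alpha,k})_{h,0}=1$ (the acoustic, $\alpha=a$, and optic, $\alpha=o$, eigenvectors, $S_h\varphi_h^{\alpha,k}=(\lambda_h^{\alpha,k})^2M_h\varphi_h^{\alpha,k}$). \textbf{Discrete controls.} Let $T>0$. Given data $Y_h^0,Y_h^1\in\mathbb C^{2N+1}$ to be controlled and a subspace $\mathcal S_h\subset\mathbb C^{2N+1}\times\mathbb C^{2N+1}$, consider $$\mathcal J_h=\frac12\int_0^T\|B_hU(t)\|^2\,dt-\operatorname{Re}\big[(Y_h^1,U(0))_{h,0}-(Y_h^0,U_t(0))_{h,0}\big],$$ where $M_hU_{tt}+S_hU=0$ on $[0,T]$ and $(U(T),U_t(T))\in\mathcal S_h$. If $\tilde U_h$ is the solution that minimizes $\mathcal J_h$, the discrete HUM control $\tilde v_h\in L^2(0,T)$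 is the last component of $B_h\tilde U_h$, i.e. $\tilde v_h(t)=-\tilde U_{h,N}(t)/h$. The space $\mathcal S_h$ and the time $T$ are of one of the following two types (the same type for all $h$): (a) \emph{Fourier truncation.} $0<\Lambda_+^a<10$ and $12<\Lambda^o_-\le\Lambda^o_+<60$ are independent of $h$, $\eta^a_+=(\Lambda^a)^{-1}(\Lambda^a_+)$ and $\eta^o_\pm=(\Lambda^o)^{-1}(\Lambda^o_\pm)$ in $[0,\pi]$, $\mathcal S_h=\mathcal T_h\times\mathcal T_h$ with $$\mathcal T_h=\operatorname{span}\{\varphi_h^{a,k}:k\pi h\le\eta^a_+\}\oplus\operatorname{span}\{\varphi_h^{o,k}:\eta^o_+\le k\pi h\le\eta^o_-\},$$ and $$T>\frac{2}{\min\{\min_{[0,\eta_+^a]}\partial_\eta\lambda^a,\ \min_{[\eta_+^o,\eta_-^o]}(-\partial_\eta\lambda^o)\}}.$$ (b) \emph{Bi-grid.} $N$ is odd, $T>2$ and $\mathcal S_h=\mathcal R_h\times\mathcal R_h$, where $\mathcal R_h$ is the space of the $F$ such that $F_{j+1/2}=\frac12(F_j+F_{j+1})$ for $0\le j\le N$ and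 $F_{2j+1}=\frac12(F_{2j}+F_{2j+2})$ for $0\le j\le(N-1)/2$. \textbf{Continuous control.} Given $(y^0,y^1)\in L^2(0,1)\times H^{-1}(0,1)$, consider $$\mathcal J=\frac12\int_0^T|u_x(1,t)|^2\,dt-\operatorname{Re}\big[\langle y^1,u(\cdot,0)\rangle-(y^0,u_t(\cdot,0))_{L^2}\big]$$ on the solutions $u\in C([0,T];H_0^1(0,1))\cap C^1([0,T];L^2(0,1))$ of $u_{tt}=u_{xx}$, $u(0,t)=u(1,t)=0$ (which are parametrized by $(u,u_t)|_{t=T}\in H_0^1\times L^2$). If $\tilde u$ is the minimizer, the continuous HUM control is $\tilde v=\tilde u_x(1,\cdot)\in L^2(0,T)$. Put $\varphi^k(x)=\sqrt2\sin(k\pi x)$, $\lambda^k=k\pi$, $\widehat y^{k,0}=(y^0,\varphi^k)_{L^2}$, $\widehat y^{k,1}=\langle y^1,\varphi^k\rangle$. \textbf{Theorem.} Let $(y^0,y^1)\in L^2(0,1)\times H^{-1}(0,1)$, and let $h$ run through a sequence of mesh sizes $1/(N+1)$ tending to $0$, with data $Y_h^0,Y_h^1\in\mathbb C^{2N+1}$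 and coefficients $\widehat y_h^{\alpha,k,i}=(Y_h^i,\varphi_h^{\alpha,k})_{h,0}$, $1\le k\le N$, $i=0,1$ (sequences in $k$ are extended by zero for $k>N$). Suppose that, weakly in $\ell^2$ as $h\to0$, $$\Big(\frac{\widehat y_h^{a,k,1}}{\lambda_h^{a,k}}\Big)_k\rightharpoonup\Big(\frac{\widehat y^{k,1}}{\lambda^k}\Big)_k,\qquad(\widehat y_h^{a,k,0})_k\rightharpoonup(\widehat y^{k,0})_k,\qquad\Big(\frac{\widehat y_h^{o,k,1}}{\lambda_h^{o,k}}\Big)_k\rightharpoonup0,\qquad(\widehat y_h^{o,k,0})_k\rightharpoonup0.$$ Then, in case (a) as in case (b), the discrete HUM controls $\tilde v_h$ and the continuous HUM control $\tilde v$ exist and are unique, and $\tilde v_h\rightharpoonup\tilde v$ weakly in $L^2(0,T)$ as $h\to0$. If moreover the four convergences above are strong in $\ell^2$, then $\tilde v_h\to\tilde v$ strongly in $L^2(0,T)$. -/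

import Mathlib

open Set Filter Topology MeasureTheory
open scoped ENNReal Matrix ContDiff ComplexConjugate

noncomputable section

namespace P2Wave

/-! ### Function spaces on the interval (0,1) -/

/-- The space `L²(0,1)` of complex-valued functions. -/
abbrev L2I : Type := Lp ℂ 2 (volume.restrict (Ioo (0 : ℝ) 1))

/-- The space `L²(0,T)` of complex-valued functions. -/
abbrev L2T (T : ℝ) : Type := Lp ℂ 2 (volume.restrict (Ioo (0 : ℝ) T))

/-- The space `ℓ²`. The entry number `n` of a sequence is used for the frequency `k = n + 1`. -/
abbrev Ell2 : Type := lp (fun _ : ℕ => ℂ) 2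

theorem integrable_mul_of_continuous (f : L2I) {g : ℝ → ℝ} (hg : Continuous g) :
    Integrable (fun x => f x * (g x : ℂ)) (volume.restrict (Ioo (0 : ℝ) 1)) := by
  have hf : Integrable f (volume.restrict (Ioo (0 : ℝ) 1)) :=
    (Lp.memLp f).integrable (by norm_num)
  obtain ⟨C, hC⟩ := isCompact_Icc.exists_bound_of_continuousOn
    (s := Icc (0 : ℝ) 1) (f := g) hg.continuousOn
  refine hf.mul_bdd (c := C) ?_ ?_
  · exact (Complex.continuous_ofReal.comp hg).aestronglyMeasurable
  · refine (ae_restrict_iff' measurableSet_Ioo).2 (Eventually.of_forall fun x hx => ?_)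
    simpa using hC x (Ioo_subset_Icc_self hx)

/-- The Sobolev space `H¹₀(0,1)`, as the set of pairs `(u, uₓ)` in `L² × L²`: here `uₓ` is the weak
derivative of `u`, and since the test functions are smooth on the whole line and are not required to
vanish at `0` and `1`, the integration by parts formula without boundary terms also says that the
traces of `u` at `0` and `1` are zero (equivalently, the extension of `u` by zero belongs to
`H¹(ℝ)`). The topology is that of `u` and `uₓ` in `L²`, i.e. the one of the `H¹₀` norm. -/
def H10 : Submodule ℂ (L2I × L2I) where
  carrier := {p | ∀ φ : ℝ → ℝ, ContDiff ℝ ∞ φ →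
    ∫ x in Ioo (0 : ℝ) 1, p.1 x * ((deriv φ x : ℝ) : ℂ) = - ∫ x in Ioo (0 : ℝ) 1, p.2 x * ((φ x : ℝ) : ℂ)}
  zero_mem' := by
    intro φ _
    have h : ∀ g : ℝ → ℂ, ∫ x in Ioo (0 : ℝ) 1, (0 : L2I) x * g x = 0 := by
      intro g
      rw [integral_congr_ae (g := fun _ => (0 : ℂ))]
      · simp
      · filter_upwards [Lp.coeFn_zero ℂ 2 (volume.restrict (Ioo (0 : ℝ) 1))] with x hx
        rw [hx]; simp
    simp only [Prod.fst_zero, Prod.snd_zero]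
    rw [h, h, neg_zero]
  add_mem' := by
    intro p q hp hq φ hφ
    have hd : Continuous (deriv φ) := hφ.continuous_deriv (by simp)
    have h : ∀ (f f' : L2I) {g : ℝ → ℝ}, Continuous g →
        ∫ x in Ioo (0 : ℝ) 1, (f + f') x * (g x : ℂ) =
          (∫ x in Ioo (0 : ℝ) 1, f x * (g x : ℂ)) + ∫ x in Ioo (0 : ℝ) 1, f' x * (g x : ℂ) := by
      intro f f' g hg
      rw [← integral_add (integrable_mul_of_continuous f hg) (integrable_mul_of_continuous f' hg)]
      refine integral_congr_ae ?_
      filter_upwards [Lp.coeFn_add f f'] with x hx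
      rw [hx, Pi.add_apply, add_mul]
    simp only [Prod.fst_add, Prod.snd_add]
    rw [h _ _ hd, h _ _ hφ.continuous, hp φ hφ, hq φ hφ]
    ring
  smul_mem' := by
    intro c p hp φ hφ
    have h : ∀ (f : L2I) (g : ℝ → ℂ),
        ∫ x in Ioo (0 : ℝ) 1, (c • f) x * g x = c * ∫ x in Ioo (0 : ℝ) 1, f x * g x := by
      intro f g
      rw [← integral_const_mul]
      refine integral_congr_ae ?_
      filter_upwards [Lp.coeFn_smul c f] with x hx
      rw [hx, Pi.smul_apply, smul_eq_mul, mul_assoc]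
    simp only [Prod.smul_fst, Prod.smul_snd]
    rw [h, h, hp φ hφ]
    ring

/-- The function `u ∈ L²(0,1)` underlying an element of `H¹₀(0,1)`. -/
def H10.fn (u : H10) : L2I := u.1.1

/-- The derivative `uₓ ∈ L²(0,1)` of an element `u` of `H¹₀(0,1)`. -/
def H10.dx (u : H10) : L2I := u.1.2

/-- `H⁻¹(0,1)`, the dual of `H¹₀(0,1)`. The duality product is written `y u`; it is linear in `y` and
antilinear in `u`, as the product `∫ y ū` of `L²(0,1)` which it extends. -/
abbrev HNegOne : Type := H10 →L⋆[ℂ] ℂ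

theorem memLp_of_continuous {g : ℝ → ℂ} (hg : Continuous g) :
    MemLp g 2 (volume.restrict (Ioo (0 : ℝ) 1)) := by
  obtain ⟨C, hC⟩ := isCompact_Icc.exists_bound_of_continuousOn
    (s := Icc (0 : ℝ) 1) (f := g) hg.continuousOn
  refine MemLp.of_bound hg.aestronglyMeasurable C ?_
  exact (ae_restrict_iff' measurableSet_Ioo).2
    (Eventually.of_forall fun x hx => hC x (Ioo_subset_Icc_self hx))

/-- The `L²`-normalized Dirichlet eigenfunction `φᵏ(x) = √2 sin(kπx)`. -/
def sineFn (k : ℕ) (x : ℝ) : ℝ := √2 * Real.sin (k * Real.pi * x)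

/-- Its derivative. -/
def sineFnDeriv (k : ℕ) (x : ℝ) : ℝ := √2 * (k * Real.pi) * Real.cos (k * Real.pi * x)

theorem hasDerivAt_sineFn (k : ℕ) (x : ℝ) : HasDerivAt (sineFn k) (sineFnDeriv k x) x := by
  have h1 : HasDerivAt (fun x : ℝ => (k : ℝ) * Real.pi * x) ((k : ℝ) * Real.pi) x := by
    simpa using (hasDerivAt_id x).const_mul ((k : ℝ) * Real.pi)
  have h := (h1.sin).const_mul (√2)
  refine h.congr_deriv ?_
  simp only [sineFnDeriv]
  ring

theorem continuous_sineFn (k : ℕ) : Continuous (sineFn k) := by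
  unfold sineFn; fun_prop

theorem continuous_sineFnDeriv (k : ℕ) : Continuous (sineFnDeriv k) := by
  unfold sineFnDeriv; fun_prop

/-- `φᵏ` as an element of `L²(0,1)`. -/
def sineL2 (k : ℕ) : L2I :=
  (memLp_of_continuous (Complex.continuous_ofReal.comp (continuous_sineFn k))).toLp _

/-- The derivative of `φᵏ` as an element of `L²(0,1)`. -/
def sineDerivL2 (k : ℕ) : L2I :=
  (memLp_of_continuous (Complex.continuous_ofReal.comp (continuous_sineFnDeriv k))).toLp _

theorem sine_mem_H10 (k : ℕ) : (sineL2 k, sineDerivL2 k) ∈ H10 := by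
  intro φ hφ
  have hd : Continuous (deriv φ) := hφ.continuous_deriv (by simp)
  have e1 : ∫ x in Ioo (0 : ℝ) 1, (sineL2 k) x * ((deriv φ x : ℝ) : ℂ) =
      ((∫ x in (0 : ℝ)..1, sineFn k x * deriv φ x : ℝ) : ℂ) := by
    rw [intervalIntegral.integral_of_le zero_le_one, integral_Ioc_eq_integral_Ioo,
      ← integral_complex_ofReal]
    refine integral_congr_ae ?_
    filter_upwards [MemLp.coeFn_toLp (memLp_of_continuous
      (Complex.continuous_ofReal.comp (continuous_sineFn k)))] with x hx
    simp only [sineL2, hx]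
    simp
  have e2 : ∫ x in Ioo (0 : ℝ) 1, (sineDerivL2 k) x * ((φ x : ℝ) : ℂ) =
      ((∫ x in (0 : ℝ)..1, sineFnDeriv k x * φ x : ℝ) : ℂ) := by
    rw [intervalIntegral.integral_of_le zero_le_one, integral_Ioc_eq_integral_Ioo,
      ← integral_complex_ofReal]
    refine integral_congr_ae ?_
    filter_upwards [MemLp.coeFn_toLp (memLp_of_continuous
      (Complex.continuous_ofReal.comp (continuous_sineFnDeriv k)))] with x hx
    simp only [sineDerivL2, hx]
    simp
  have hparts := intervalIntegral.integral_mul_deriv_eq_deriv_mul (a := (0 : ℝ)) (b := 1)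
    (u := sineFn k) (v := φ) (u' := sineFnDeriv k) (v' := deriv φ)
    (fun x _ => hasDerivAt_sineFn k x)
    (fun x _ => (hφ.differentiable (by simp) x).hasDerivAt)
    ((continuous_sineFnDeriv k).intervalIntegrable _ _) (hd.intervalIntegrable _ _)
  have h0 : sineFn k 0 = 0 := by simp [sineFn]
  have h1 : sineFn k 1 = 0 := by simp [sineFn, Real.sin_nat_mul_pi]
  simp only
  rw [e1, e2, hparts, h0, h1]
  push_cast
  ring

/-- `φᵏ` as an element of `H¹₀(0,1)`. -/
def sineH10 (k : ℕ) : H10 := ⟨(sineL2 k, sineDerivL2 k), sine_mem_H10 k⟩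

/-- The Fourier coefficient `ŷ^{k,0} = (y⁰, φᵏ)` of `y⁰ ∈ L²(0,1)`. -/
def fourierCoeff0 (y0 : L2I) (k : ℕ) : ℂ := inner ℂ (sineL2 k) y0

/-- The Fourier coefficient `ŷ^{k,1} = ⟨y¹, φᵏ⟩` of `y¹ ∈ H⁻¹(0,1)`. -/
def fourierCoeff1 (y1 : HNegOne) (k : ℕ) : ℂ := y1 (sineH10 k)

/-! ### The continuous adjoint problem and the continuous HUM control -/

/-- A finite energy solution on `[0,T]` of the wave equation with homogeneous Dirichlet conditions,
`u ∈ C([0,T]; H¹₀) ∩ C¹([0,T]; L²)`, together with its normal derivative `uₓ(1,·) ∈ L²(0,T)`.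
The equation is tested with the elements of `H¹₀`. The normal derivative is the trace of `uₓ` at
`x = 1`, that is the `L²(0,T)`-limit of the means of `uₓ(·,t)` over `(1-ε,1)`, equivalently of the
difference quotients `(u(1,t) - u(1-ε,t))/ε`. -/
structure AdjointWave (T : ℝ) where
  /-- The position `u(·,t)`. -/
  pos : ℝ → H10
  /-- The velocity `u_t(·,t)`. -/
  vel : ℝ → L2I
  /-- The normal derivative `uₓ(1,·)`. -/
  flux : L2T T
  continuousOn_pos : ContinuousOn pos (Icc 0 T)
  continuousOn_vel : ContinuousOn vel (Icc 0 T)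
  hasDeriv_pos : ∀ t ∈ Icc 0 T, HasDerivWithinAt (fun s => H10.fn (pos s)) (vel t) (Icc 0 T) t
  wave_eq : ∀ φ : H10, ∀ t ∈ Icc 0 T,
    HasDerivWithinAt (fun s => inner ℂ (H10.fn φ) (vel s)) (-inner ℂ (H10.dx φ) (H10.dx (pos t))) (Icc 0 T) t
  flux_eq : Tendsto
    (fun ε : ℝ => eLpNorm
      (fun t => (1 / ε : ℂ) * (∫ x in Ioo (1 - ε) 1, H10.dx (pos t) x) - flux t) 2
      (volume.restrict (Ioo (0 : ℝ) T)))
    (𝓝[>] 0) (𝓝 0)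

/-- The functional `𝒥`, with data `(y⁰, y¹) ∈ L² × H⁻¹` to be controlled. -/
def contFunctional {T : ℝ} (y0 : L2I) (y1 : HNegOne) (u : AdjointWave T) : ℝ :=
  1 / 2 * (∫ t in Ioo (0 : ℝ) T, ‖u.flux t‖ ^ 2)
    - (y1 (u.pos 0) - inner ℂ (u.vel 0) y0).re

/-- `v` is the HUM control of `(y⁰, y¹)` in time `T`: the normal derivative of a solution of the
adjoint problem which minimizes `𝒥` (a solution being determined by its data at `t = T`, this is
the minimization over these data). -/
def IsHUMControl (T : ℝ) (y0 : L2I) (y1 : HNegOne) (v : L2T T) : Prop :=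
  ∃ u : AdjointWave T, IsMinOn (contFunctional y0 y1) univ u ∧ v = u.flux

/-! ### The quadratic finite element semi-discretization -/

/-- The mesh size `h = 1/(N+1)`. -/
def meshSize (N : ℕ) : ℝ := 1 / ((N : ℝ) + 1)

/-- The coefficient vectors `(F_{j/2})_{1 ≤ j ≤ 2N+1}`. The index `i : Fin (2N+1)` stands for
`j = i + 1`, so that odd `i` are nodes and even `i` are midpoints. -/
abbrev GridVec (N : ℕ) : Type := Fin (2 * N + 1) → ℂ

/-- The component `F_{j/2}`, with `F_0 = F_{N+1} = 0`. -/
def halfComp {N : ℕ} (F : GridVec N) (j : ℕ) : ℂ :=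
  if h : 1 ≤ j ∧ j ≤ 2 * N + 1 then F ⟨j - 1, by omega⟩ else 0

/-- The mass matrix `M_h`. -/
def massMatrix (N : ℕ) : Matrix (Fin (2 * N + 1)) (Fin (2 * N + 1)) ℂ :=
  Matrix.of fun i j =>
    (meshSize N : ℂ) *
      (if i = j then (if Odd i.val then 4 / 15 else 8 / 15)
        else if i.val + 1 = j.val ∨ j.val + 1 = i.val then 1 / 15
        else if Odd i.val ∧ (i.val + 2 = j.val ∨ j.val + 2 = i.val) then -(1 / 30)
        else 0)

/-- The stiffness matrix `S_h`. -/
def stiffnessMatrix (N : ℕ) : Matrix (Fin (2 * N + 1)) (Fin (2 * N + 1)) ℂ :=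
  Matrix.of fun i j =>
    1 / (meshSize N : ℂ) *
      (if i = j then (if Odd i.val then 14 / 3 else 16 / 3)
        else if i.val + 1 = j.val ∨ j.val + 1 = i.val then -(8 / 3)
        else if Odd i.val ∧ (i.val + 2 = j.val ∨ j.val + 2 = i.val) then 1 / 3
        else 0)

/-- The boundary observation matrix `B_h`: its only non-zero entry is `-1/h`, in the last row and
the last but one column. -/
def observationMatrix (N : ℕ) : Matrix (Fin (2 * N + 1)) (Fin (2 * N + 1)) ℂ :=
  Matrix.of fun i j =>
    if i.val = 2 * N ∧ j.val + 1 = 2 * N then -(1 / (meshSize N : ℂ)) else 0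

/-- The discrete `L²` inner product `(F,G)_{h,0} = (M_h F, G)`, linear in `F`. -/
def innerH0 {N : ℕ} (F G : GridVec N) : ℂ := (massMatrix N *ᵥ F) ⬝ᵥ star G

/-- The discrete adjoint problem on `[0,T]`: `M_h U_tt + S_h U = 0`. -/
structure DiscreteWave (N : ℕ) (T : ℝ) where
  /-- The position `U_h(t)`. -/
  pos : ℝ → GridVec N
  /-- The velocity `U_{h,t}(t)`. -/
  vel : ℝ → GridVec N
  /-- The acceleration `U_{h,tt}(t)`. -/
  acc : ℝ → GridVec N
  hasDeriv_pos : ∀ t ∈ Icc 0 T, HasDerivWithinAt pos (vel t) (Icc 0 T) t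
  hasDeriv_vel : ∀ t ∈ Icc 0 T, HasDerivWithinAt vel (acc t) (Icc 0 T) t
  wave_eq : ∀ t ∈ Icc 0 T, massMatrix N *ᵥ acc t + stiffnessMatrix N *ᵥ pos t = 0

/-- The functional `𝒥_h`, with data `(Y⁰, Y¹)` to be controlled. -/
def discreteFunctional {N : ℕ} {T : ℝ} (Y0 Y1 : GridVec N) (U : DiscreteWave N T) : ℝ :=
  1 / 2 * (∫ t in Ioo (0 : ℝ) T, ∑ i, ‖(observationMatrix N *ᵥ U.pos t) i‖ ^ 2)
    - (innerH0 Y1 (U.pos 0) - innerH0 Y0 (U.vel 0)).re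

/-- `v` is the last component of the discrete HUM control `B_h Ũ_h(t)`, where `Ũ_h` minimizes `𝒥_h`
among the solutions of the discrete adjoint problem with data at `t = T` in the subspace `S`. -/
def IsDiscreteHUMControl {N : ℕ} (T : ℝ) (S : Submodule ℂ (GridVec N × GridVec N))
    (Y0 Y1 : GridVec N) (v : L2T T) : Prop :=
  ∃ U : DiscreteWave N T, (U.pos T, U.vel T) ∈ S ∧
    IsMinOn (discreteFunctional Y0 Y1) {W : DiscreteWave N T | (W.pos T, W.vel T) ∈ S} U ∧
    v =ᵐ[volume.restrict (Ioo (0 : ℝ) T)]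
      fun t => (observationMatrix N *ᵥ U.pos t) (Fin.last (2 * N))

/-! ### Fourier analysis of the discretization -/

/-- `Δ(η)`, in the formulas of the two Fourier symbols. -/
def symbolDisc (η : ℝ) : ℝ := 1 + 268 * Real.cos (η / 2) ^ 2 - 44 * Real.cos (η / 2) ^ 4

/-- The acoustic Fourier symbol `Λᵃ(η)`. -/
def acousticSymbol (η : ℝ) : ℝ :=
  120 * Real.sin (η / 2) ^ 2 / (11 + 4 * Real.cos (η / 2) ^ 2 + √(symbolDisc η))

/-- The optic Fourier symbol `Λᵒ(η)`. -/
def opticSymbol (η : ℝ) : ℝ :=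
  (22 + 8 * Real.cos (η / 2) ^ 2 + 2 * √(symbolDisc η)) / (1 + Real.sin (η / 2) ^ 2)

/-- The dispersion relation `λ(η) = √Λ(η)` of a Fourier symbol `Λ`. -/
def dispersion (Λ : ℝ → ℝ) (η : ℝ) : ℝ := √(Λ η)

/-- `λ_h^k = λ(kπh)/h`, the square root of the `k`-th eigenvalue of the branch with symbol `Λ`. -/
def eigenfreq (Λ : ℝ → ℝ) (N k : ℕ) : ℝ :=
  dispersion Λ (k * Real.pi * meshSize N) / meshSize N

/-- The `k`-th eigenvector of the branch with symbol `Λ`, before normalization: its value is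
`sin(kπx)` at the nodes and `(40+Λ)/(4(10-Λ)) cos(kπh/2) sin(kπx)` at the midpoints. -/
def rawEigenvector (Λ : ℝ → ℝ) (N k : ℕ) : GridVec N := fun i =>
  (((if Odd i.val then 1 else
      (40 + Λ (k * Real.pi * meshSize N)) / (4 * (10 - Λ (k * Real.pi * meshSize N)))
        * Real.cos (k * Real.pi * meshSize N / 2))
    * Real.sin (k * Real.pi * (((i.val : ℝ) + 1) / 2 * meshSize N)) : ℝ) : ℂ)

/-- The `k`-th eigenvector of the branch with symbol `Λ`, normalized in the norm of `(·,·)_{h,0}`. -/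
def eigenvector (Λ : ℝ → ℝ) (N k : ℕ) : GridVec N :=
  ((1 / √((innerH0 (rawEigenvector Λ N k) (rawEigenvector Λ N k)).re) : ℝ) : ℂ) •
    rawEigenvector Λ N k

/-- The sequence `(ŷ_h^{k,0})_{1 ≤ k ≤ N}` of Fourier coefficients of `Y` on the branch with
symbol `Λ`, extended by zero to an element of `ℓ²`. -/
def discreteSeq0 (Λ : ℝ → ℝ) {N : ℕ} (Y : GridVec N) : Ell2 :=
  ∑ n ∈ Finset.range N, lp.single 2 n (innerH0 Y (eigenvector Λ N (n + 1)))

/-- The sequence `(ŷ_h^{k,1}/λ_h^k)_{1 ≤ k ≤ N}` for the branch with symbol `Λ`, extended by zero to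
an element of `ℓ²`. -/
def discreteSeq1 (Λ : ℝ → ℝ) {N : ℕ} (Y : GridVec N) : Ell2 :=
  ∑ n ∈ Finset.range N,
    lp.single 2 n (innerH0 Y (eigenvector Λ N (n + 1)) / (eigenfreq Λ N (n + 1) : ℂ))

/-- Weak convergence of a sequence in a Hilbert space. -/
def WeaklyTendsto {E : Type*} [NormedAddCommGroup E] [InnerProductSpace ℂ E]
    (a : ℕ → E) (b : E) : Prop :=
  Tendsto (fun m => toWeakSpace ℂ E (a m)) atTop (𝓝 (toWeakSpace ℂ E b))

/-! ### The two filtered spaces -/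

/-- The inverse on `[0,π]` of the symbol `Λ`, at the value `c`. -/
def wavenumber (Λ : ℝ → ℝ) (c : ℝ) : ℝ := Function.invFunOn Λ (Icc 0 Real.pi) c

/-- The group velocity `∂_η λ(η)` on `[0,π]` (one-sided at the end points). -/
def groupVelocity (Λ : ℝ → ℝ) (η : ℝ) : ℝ := derivWithin (dispersion Λ) (Icc 0 Real.pi) η

/-- The observability time of the Fourier truncation with acoustic modes such that `Λᵃ ≤ Λa` and
optic modes such that `Λm ≤ Λᵒ ≤ Λp`, i.e. `2` over the minimal group velocity of these modes. -/
def truncationTime (Λa Λm Λp : ℝ) : ℝ :=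
  2 / min (sInf (groupVelocity acousticSymbol '' Icc 0 (wavenumber acousticSymbol Λa)))
    (sInf ((fun η => -groupVelocity opticSymbol η) ''
      Icc (wavenumber opticSymbol Λp) (wavenumber opticSymbol Λm)))

/-- The span of the acoustic eigenvectors with `kπh ≤ η₊ᵃ` and of the optic ones with
`η₊ᵒ ≤ kπh ≤ η₋ᵒ`. -/
def truncatedVecs (N : ℕ) (Λa Λm Λp : ℝ) : Submodule ℂ (GridVec N) :=
  Submodule.span ℂ {F | ∃ k : ℕ, 1 ≤ k ∧ k ≤ N ∧
      k * Real.pi * meshSize N ≤ wavenumber acousticSymbol Λa ∧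
      F = eigenvector acousticSymbol N k} ⊔
  Submodule.span ℂ {F | ∃ k : ℕ, 1 ≤ k ∧ k ≤ N ∧
      wavenumber opticSymbol Λp ≤ k * Real.pi * meshSize N ∧
      k * Real.pi * meshSize N ≤ wavenumber opticSymbol Λm ∧
      F = eigenvector opticSymbol N k}

/-- The truncated space of pairs of data. -/
def truncatedSpace (N : ℕ) (Λa Λm Λp : ℝ) : Submodule ℂ (GridVec N × GridVec N) :=
  (truncatedVecs N Λa Λm Λp).prod (truncatedVecs N Λa Λm Λp)

/-- Piecewise linear functions: each midpoint value is the mean of the two neighbouring nodal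
values. -/
def piecewiseLinear (N : ℕ) : Set (GridVec N) :=
  {F | ∀ j, j ≤ N → halfComp F (2 * j + 1) = (halfComp F (2 * j) + halfComp F (2 * j + 2)) / 2}

/-- Nodal values given by a bi-grid algorithm (`N` odd): `F_{2j+1}` is the mean of `F_{2j}` and
`F_{2j+2}` for `0 ≤ j ≤ (N-1)/2`. -/
def bigridNodal (N : ℕ) : Set (GridVec N) :=
  {F | ∀ j, 2 * j + 1 ≤ N →
    halfComp F (2 * (2 * j + 1)) = (halfComp F (2 * (2 * j)) + halfComp F (2 * (2 * j + 2))) / 2}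

theorem halfComp_zero {N : ℕ} (j : ℕ) : halfComp (0 : GridVec N) j = 0 := by
  unfold halfComp; split <;> rfl

theorem halfComp_add {N : ℕ} (F G : GridVec N) (j : ℕ) :
    halfComp (F + G) j = halfComp F j + halfComp G j := by
  unfold halfComp; split <;> simp

theorem halfComp_smul {N : ℕ} (c : ℂ) (F : GridVec N) (j : ℕ) :
    halfComp (c • F) j = c * halfComp F j := by
  unfold halfComp; split <;> simp

/-- The piecewise linear bi-grid vectors form a subspace. -/
def bigridVecs (N : ℕ) : Submodule ℂ (GridVec N) where
  carrier := piecewiseLinear N ∩ bigridNodal N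
  zero_mem' := by
    constructor <;> intro j _ <;> simp [halfComp_zero]
  add_mem' := by
    rintro F G ⟨hF, hF'⟩ ⟨hG, hG'⟩
    constructor
    · intro j hj
      simp only [halfComp_add, hF j hj, hG j hj]; ring
    · intro j hj
      simp only [halfComp_add, hF' j hj, hG' j hj]; ring
  smul_mem' := by
    rintro c F ⟨hF, hF'⟩
    constructor
    · intro j hj
      simp only [halfComp_smul, hF j hj]; ring
    · intro j hj
      simp only [halfComp_smul, hF' j hj]; ring

/-- The bi-grid space of pairs of data. -/
def bigridSpace (N : ℕ) : Submodule ℂ (GridVec N × GridVec N) :=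
  (bigridVecs N).prod (bigridVecs N)

end P2Wave

end

noncomputable section

namespace P2Wave

/-! ### Weak convergence in Hilbert spaces -/

section Weak

variable {E : Type*} [NormedAddCommGroup E] [InnerProductSpace ℂ E]

theorem WeaklyTendsto.inner_left {a : ℕ → E} {b : E} (h : WeaklyTendsto a b) (y : E) :
    Tendsto (fun m => inner ℂ y (a m)) atTop (𝓝 (inner ℂ y b)) := by
  have := ((WeakBilin.eval_continuous (topDualPairing ℂ E).flip (innerSL ℂ y)).tendsto
    (toWeakSpace ℂ E b)).comp h
  exact this

/-- Weak convergence and convergence of the norms give strong convergence. -/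
theorem tendsto_of_inner_of_norm_sq {a : ℕ → E} {b : E}
    (h : ∀ y : E, Tendsto (fun m => inner ℂ y (a m)) atTop (𝓝 (inner ℂ y b)))
    (hn : Tendsto (fun m => ‖a m‖ ^ 2) atTop (𝓝 (‖b‖ ^ 2))) : Tendsto a atTop (𝓝 b) := by
  rw [tendsto_iff_norm_sub_tendsto_zero]
  have h1 : Tendsto (fun m => ‖a m - b‖ ^ 2) atTop (𝓝 0) := by
    have e : ∀ m, ‖a m - b‖ ^ 2 = ‖a m‖ ^ 2 - 2 * (inner ℂ b (a m)).re + ‖b‖ ^ 2 := by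
      intro m
      rw [@norm_sub_sq ℂ, ← inner_re_symm]
      rfl
    have hr : Tendsto (fun m => (inner ℂ b (a m)).re) atTop (𝓝 ((inner ℂ b b : ℂ).re)) :=
      (Complex.continuous_re.tendsto _).comp (h b)
    have hb : (inner ℂ b b : ℂ).re = ‖b‖ ^ 2 := by
      have := @norm_sq_eq_re_inner ℂ _ _ _ _ b
      exact this.symm
    simp only [e]
    have := (hn.sub (hr.const_mul 2)).add_const (‖b‖ ^ 2)
    rw [hb] at this
    convert this using 2
    ring
  have h2 := (Real.continuous_sqrt.tendsto 0).comp h1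
  simp only [Real.sqrt_zero] at h2
  refine h2.congr fun m => ?_
  simp [Real.sqrt_sq]

variable [CompleteSpace E]

theorem weaklyTendsto_of_inner {a : ℕ → E} {b : E}
    (h : ∀ y : E, Tendsto (fun m => inner ℂ y (a m)) atTop (𝓝 (inner ℂ y b))) :
    WeaklyTendsto a b := by
  have hinj : Function.Injective (topDualPairing ℂ E).flip := by
    intro x y hxy
    refine ext_inner_left ℂ fun v => ?_
    have := congrArg (fun f => f (innerSL ℂ v)) hxy
    exact this
  refine (WeakBilin.tendsto_iff_forall_eval_tendsto (topDualPairing ℂ E).flip hinj).2 fun f => ?_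
  have := h ((InnerProductSpace.toDual ℂ E).symm f)
  simp only [InnerProductSpace.toDual_symm_apply] at this
  exact this

theorem exists_bound_of_inner_tendsto {a : ℕ → E} {b : E}
    (h : ∀ y : E, Tendsto (fun m => inner ℂ y (a m)) atTop (𝓝 (inner ℂ y b))) :
    ∃ C : ℝ, 0 < C ∧ ∀ m, ‖a m‖ ≤ C := by
  have hp : ∀ y : E, ∃ C, ∀ m, ‖(innerSL ℂ (a m)) y‖ ≤ C := by
    intro y
    obtain ⟨C, hC⟩ := (Metric.isBounded_range_of_tendsto _ (h y)).exists_norm_le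
    refine ⟨C, fun m => ?_⟩
    rw [innerSL_apply_apply, norm_inner_symm]
    exact hC _ ⟨m, rfl⟩
  obtain ⟨C, hC⟩ := banach_steinhaus hp
  refine ⟨max C 1, by positivity, fun m => ?_⟩
  have := hC m
  rw [innerSL_apply_norm] at this
  exact this.trans (le_max_left _ _)

/-- A bounded sequence converges weakly as soon as its inner products with a total set converge. -/
theorem inner_tendsto_of_total {a : ℕ → E} {b : E} {K : ℝ} (hK : ∀ᶠ m in atTop, ‖a m‖ ≤ K)
    (s : Set E) (hs : ∀ z : E, (∀ x ∈ s, inner ℂ x z = 0) → z = 0)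
    (h : ∀ y ∈ s, Tendsto (fun m => inner ℂ y (a m)) atTop (𝓝 (inner ℂ y b))) (y : E) :
    Tendsto (fun m => inner ℂ y (a m)) atTop (𝓝 (inner ℂ y b)) := by
  have hspan : ∀ y ∈ Submodule.span ℂ s,
      Tendsto (fun m => inner ℂ y (a m)) atTop (𝓝 (inner ℂ y b)) := by
    intro y hy
    induction hy using Submodule.span_induction with
    | mem x hx => exact h x hx
    | zero => simp
    | add x y _ _ hx hy => simpa only [inner_add_left] using hx.add hy
    | smul c x _ hx => simpa only [inner_smul_left] using hx.const_mul _
  have hdense : (Submodule.span ℂ s).topologicalClosure = ⊤ := by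
    rw [Submodule.topologicalClosure_eq_top_iff, Submodule.eq_bot_iff]
    intro z hz
    refine hs z fun x hx => ?_
    exact (Submodule.mem_orthogonal _ _).1 hz x (Submodule.subset_span hx)
  rw [Metric.tendsto_atTop]
  intro ε hε
  set K' := max K 0 + ‖b‖ + 1 with hK'
  have hK'0 : 0 < K' := by positivity
  have hy : y ∈ closure ((Submodule.span ℂ s : Submodule ℂ E) : Set E) := by
    rw [← Submodule.topologicalClosure_coe, hdense]; trivial
  obtain ⟨z, hz, hyz⟩ := Metric.mem_closure_iff.1 hy (ε / (2 * K')) (by positivity)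
  obtain ⟨m1, hm1⟩ := Metric.tendsto_atTop.1 (hspan z hz) (ε / 2) (by positivity)
  obtain ⟨m2, hm2⟩ := eventually_atTop.1 hK
  refine ⟨max m1 m2, fun m hm => ?_⟩
  have h1 := hm1 m ((le_max_left _ _).trans hm)
  have h2 := hm2 m ((le_max_right _ _).trans hm)
  rw [dist_eq_norm] at h1 ⊢
  have e : inner ℂ y (a m) - inner ℂ y b =
      (inner ℂ z (a m) - inner ℂ z b) + inner ℂ (y - z) (a m - b) := by
    simp only [inner_sub_left, inner_sub_right]; ring
  rw [e]
  have h3 : ‖inner ℂ (y - z) (a m - b)‖ ≤ ε / (2 * K') * K' := by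
    refine (norm_inner_le_norm _ _).trans ?_
    rw [dist_eq_norm] at hyz
    gcongr
    refine (norm_sub_le _ _).trans ?_
    have := le_max_left K 0
    linarith
  have h4 : ε / (2 * K') * K' = ε / 2 := by field_simp
  calc _ ≤ _ := norm_add_le _ _
    _ < ε := by linarith

end Weak

/-! ### Minimization of quadratic functionals -/

section HUM

variable {H : Type*} [NormedAddCommGroup H] [InnerProductSpace ℂ H]
  {E : Type*} [AddCommGroup E] [Module ℂ E]

theorem le_zero_of_forall_mul_le {a b : ℝ} (h : ∀ t : ℝ, 0 < t → a ≤ t * b) : a ≤ 0 := by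
  by_contra! ha
  have hb : 0 < b := by
    have := h 1 one_pos; linarith
  have := h (a / (2 * b)) (by positivity)
  have e : a / (2 * b) * b = a / 2 := by field_simp
  rw [e] at this
  linarith

/-- The Euler–Lagrange equation of `c ↦ ½‖Φ c‖² - Re (L c)`. -/
theorem quadratic_min_iff (Φ : E →ₗ[ℂ] H) (L : E →ₗ⋆[ℂ] ℂ) (c : E) :
    (∀ d, 1 / 2 * ‖Φ c‖ ^ 2 - (L c).re ≤ 1 / 2 * ‖Φ d‖ ^ 2 - (L d).re) ↔
      ∀ d, inner ℂ (Φ d) (Φ c) = L d := by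
  have expand : ∀ d, ‖Φ (c + d)‖ ^ 2 = ‖Φ c‖ ^ 2 + 2 * (inner ℂ (Φ d) (Φ c)).re + ‖Φ d‖ ^ 2 := by
    intro d
    rw [map_add, @norm_add_sq ℂ, ← inner_re_symm]
    rfl
  constructor
  · intro h
    have hre : ∀ d, (L d - inner ℂ (Φ d) (Φ c)).re ≤ 0 := by
      intro d
      refine le_zero_of_forall_mul_le (b := 1 / 2 * ‖Φ d‖ ^ 2) fun t ht => ?_
      have h1 := h (c + (t : ℂ) • d)
      rw [expand, map_smul, inner_smul_left, map_add, LinearMap.map_smulₛₗ, norm_smul] at h1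
      simp only [Complex.conj_ofReal, Complex.add_re, smul_eq_mul, Complex.re_ofReal_mul,
        Complex.norm_real, Real.norm_eq_abs, mul_pow, sq_abs] at h1
      rw [Complex.sub_re]
      have h2 : t * ((L d).re - (inner ℂ (Φ d) (Φ c)).re) ≤ t * (t * (1 / 2 * ‖Φ d‖ ^ 2)) := by
        nlinarith
      exact le_of_mul_le_mul_left h2 ht
    intro d
    have key : ∀ z : ℂ, (z * (L d - inner ℂ (Φ d) (Φ c))).re ≤ 0 := by
      intro z
      have := hre (conj z • d)
      rwa [LinearMap.map_smul, inner_smul_left, LinearMap.map_smulₛₗ, Complex.conj_conj, smul_eq_mul,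
        ← mul_sub] at this
    have := key (conj (L d - inner ℂ (Φ d) (Φ c)))
    rw [Complex.conj_mul', ← Complex.ofReal_pow, Complex.ofReal_re] at this
    have h0 : ‖L d - inner ℂ (Φ d) (Φ c)‖ = 0 := by
      have := le_antisymm this (sq_nonneg _)
      exact pow_eq_zero_iff (two_ne_zero) |>.1 this
    exact (sub_eq_zero.1 (norm_eq_zero.1 h0)).symm
  · intro h d
    have h1 := expand (d - c)
    have h2 := h (d - c)
    rw [add_sub_cancel] at h1
    rw [h1, h2, map_sub]
    simp only [Complex.sub_re]
    nlinarith [sq_nonneg ‖Φ (d - c)‖]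

/-- Minimizing over a set of states parametrized linearly. -/
theorem isMinOn_iff_of_param {W : Type*} {S : Set W} (F : W → H) (l : W → ℂ) (J : W → ℝ)
    (hJ : ∀ w ∈ S, J w = 1 / 2 * ‖F w‖ ^ 2 - (l w).re)
    (Φ : E →ₗ[ℂ] H) (L : E →ₗ⋆[ℂ] ℂ)
    (h1 : ∀ w ∈ S, ∃ c, F w = Φ c ∧ l w = L c)
    (h2 : ∀ c, ∃ w ∈ S, F w = Φ c ∧ l w = L c) (v : H) :
    (∃ w ∈ S, IsMinOn J S w ∧ v = F w) ↔
      v ∈ LinearMap.range Φ ∧ ∀ d, inner ℂ (Φ d) v = L d := by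
  constructor
  · rintro ⟨w, hw, hmin, rfl⟩
    obtain ⟨c, hc, hlc⟩ := h1 w hw
    refine ⟨⟨c, hc.symm⟩, ?_⟩
    rw [hc]
    rw [← quadratic_min_iff]
    intro d
    obtain ⟨w', hw', hd, hld⟩ := h2 d
    have := isMinOn_iff.1 hmin w' hw'
    rwa [hJ w hw, hJ w' hw', hc, hlc, hd, hld] at this
  · rintro ⟨⟨c, rfl⟩, hd⟩
    obtain ⟨w, hw, hc, hlc⟩ := h2 c
    refine ⟨w, hw, isMinOn_iff.2 fun w' hw' => ?_, hc.symm⟩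
    obtain ⟨d, hdw, hld⟩ := h1 w' hw'
    rw [hJ w hw, hJ w' hw', hc, hlc, hdw, hld]
    exact (quadratic_min_iff Φ L c).2 hd d

theorem eulerLagrange_unique (Φ : E →ₗ[ℂ] H) (L : E →ₗ⋆[ℂ] ℂ) {v w : H}
    (hv : v ∈ LinearMap.range Φ ∧ ∀ d, inner ℂ (Φ d) v = L d)
    (hw : w ∈ LinearMap.range Φ ∧ ∀ d, inner ℂ (Φ d) w = L d) : v = w := by
  obtain ⟨⟨c, rfl⟩, hc⟩ := hv
  obtain ⟨⟨d, rfl⟩, hd⟩ := hw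
  rw [← sub_eq_zero, ← map_sub, ← inner_self_eq_zero (𝕜 := ℂ)]
  conv_lhs => rw [map_sub Φ c d, inner_sub_right, ← map_sub]
  rw [hc, hd, sub_self]

theorem eulerLagrange_exists (Φ : E →ₗ[ℂ] H) (L : E →ₗ⋆[ℂ] ℂ)
    [CompleteSpace (LinearMap.range Φ)] (C : ℝ) (hL : ∀ d, ‖L d‖ ≤ C * ‖Φ d‖) :
    ∃ v, v ∈ LinearMap.range Φ ∧ ∀ d, inner ℂ (Φ d) v = L d := by
  obtain ⟨g, hg⟩ := Φ.rangeRestrict.exists_rightInverse_of_surjective Φ.range_rangeRestrict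
  have hg' : ∀ x : LinearMap.range Φ, Φ (g x) = x := by
    intro x
    have := congrArg (fun f => ((f x : LinearMap.range Φ) : H)) hg
    simpa using this
  let f : LinearMap.range Φ →ₗ[ℂ] ℂ :=
    { toFun := fun x => conj (L (g x))
      map_add' := fun x y => by simp
      map_smul' := fun a x => by
        simp }
  let f' : StrongDual ℂ (LinearMap.range Φ) := f.mkContinuous C (by
    intro x
    have := hL (g x)
    rw [hg'] at this
    simpa [f] using this)
  refine ⟨((InnerProductSpace.toDual ℂ _).symm f' : LinearMap.range Φ), Subtype.prop _, fun d => ?_⟩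
  have h1 : inner ℂ ((InnerProductSpace.toDual ℂ _).symm f') (Φ.rangeRestrict d) =
      f' (Φ.rangeRestrict d) := InnerProductSpace.toDual_symm_apply
  have h2 : L d = L (g (Φ.rangeRestrict d)) := by
    have h3 := hL (d - g (Φ.rangeRestrict d))
    rw [map_sub, map_sub, hg'] at h3
    have h4 : Φ d - (Φ.rangeRestrict d : H) = 0 := sub_self _
    rw [h4, norm_zero, mul_zero] at h3
    exact sub_eq_zero.1 (norm_le_zero_iff.1 h3)
  have h4 := congrArg conj h1
  rw [inner_conj_symm] at h4
  rw [h2]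
  calc _ = inner ℂ (Φ.rangeRestrict d) ((InnerProductSpace.toDual ℂ _).symm f') := rfl
    _ = _ := by rw [h4]; simp [f', f]

/-- For a finite-dimensional range, the bound can be replaced by an inclusion of kernels. -/
theorem eulerLagrange_exists_of_finiteDimensional (Φ : E →ₗ[ℂ] H) (L : E →ₗ⋆[ℂ] ℂ)
    [FiniteDimensional ℂ (LinearMap.range Φ)] (hL : ∀ d, Φ d = 0 → L d = 0) :
    ∃ v, v ∈ LinearMap.range Φ ∧ ∀ d, inner ℂ (Φ d) v = L d := by
  obtain ⟨g, hg⟩ := Φ.rangeRestrict.exists_rightInverse_of_surjective Φ.range_rangeRestrict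
  have hg' : ∀ x : LinearMap.range Φ, Φ (g x) = x := by
    intro x
    have := congrArg (fun f => ((f x : LinearMap.range Φ) : H)) hg
    simpa using this
  let f : LinearMap.range Φ →ₗ[ℂ] ℂ :=
    { toFun := fun x => conj (L (g x))
      map_add' := fun x y => by simp
      map_smul' := fun a x => by
        simp }
  have : CompleteSpace (LinearMap.range Φ) := FiniteDimensional.complete ℂ _
  refine eulerLagrange_exists Φ L ‖LinearMap.toContinuousLinearMap f‖ fun d => ?_
  have h2 : L d = L (g (Φ.rangeRestrict d)) := by
    have h3 := hL (d - g (Φ.rangeRestrict d)) (by rw [map_sub, hg']; simp)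
    rw [map_sub] at h3
    exact sub_eq_zero.1 h3
  have h5 := (LinearMap.toContinuousLinearMap f).le_opNorm (Φ.rangeRestrict d)
  rw [h2]
  simpa [f] using h5

end HUM

/-! ### Inequalities of Ingham type -/

/-- The oscillation `e^{iwt}`. -/
def osc (w t : ℝ) : ℂ := Complex.exp ((w * t : ℝ) * Complex.I)

theorem norm_osc (w t : ℝ) : ‖osc w t‖ = 1 := Complex.norm_exp_ofReal_mul_I _

theorem osc_add (w w' t : ℝ) : osc (w + w') t = osc w t * osc w' t := by
  rw [osc, osc, osc, ← Complex.exp_add]; push_cast; ring_nf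

theorem osc_add_right (w t t' : ℝ) : osc w (t + t') = osc w t * osc w t' := by
  rw [osc, osc, osc, ← Complex.exp_add]; push_cast; ring_nf

theorem conj_osc (w t : ℝ) : conj (osc w t) = osc (-w) t := by
  rw [osc, osc, ← Complex.exp_conj]; simp

theorem osc_zero (w : ℝ) : osc w 0 = 1 := by simp [osc]

theorem osc_zero_left (t : ℝ) : osc 0 t = 1 := by simp [osc]

theorem osc_neg_mul_osc (w t : ℝ) : osc (-w) t * osc w t = 1 := by
  rw [← osc_add, neg_add_cancel, osc_zero_left]

theorem hasDerivAt_osc (w t : ℝ) : HasDerivAt (osc w) (Complex.I * w * osc w t) t := by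
  have h1 : HasDerivAt (fun t : ℝ => ((w * t : ℝ) : ℂ) * Complex.I) (w * Complex.I) t := by
    have : HasDerivAt (fun t : ℝ => w * t) w t := by simpa using (hasDerivAt_id t).const_mul w
    exact this.ofReal_comp.mul_const _
  refine h1.cexp.congr_deriv ?_
  rw [osc]; ring

theorem continuous_osc_right (w : ℝ) : Continuous (osc w) := by
  unfold osc; fun_prop

/-- The Fourier integral of the weight `sin (πt/T)` on `[0,T]`. -/
def bumpKernel (T ξ : ℝ) : ℂ :=
  ∫ t in (0 : ℝ)..T, (Real.sin (Real.pi / T * t) : ℂ) * osc ξ t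

theorem bumpKernel_formula {T : ℝ} (hT : 0 < T) (ξ : ℝ) :
    (((Real.pi / T) ^ 2 - ξ ^ 2 : ℝ) : ℂ) * bumpKernel T ξ =
      ((Real.pi / T : ℝ) : ℂ) * (osc ξ T + 1) := by
  set a := Real.pi / T with ha
  have hd : ∀ t ∈ uIcc 0 T, HasDerivAt
      (fun t => (Complex.I * ξ * (Real.sin (a * t) : ℂ) - a * (Real.cos (a * t) : ℂ)) * osc ξ t)
      (((a ^ 2 - ξ ^ 2 : ℝ) : ℂ) * ((Real.sin (a * t) : ℂ) * osc ξ t)) t := by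
    intro t _
    have h0 : HasDerivAt (fun t : ℝ => a * t) a t := by simpa using (hasDerivAt_id t).const_mul a
    have h1 := h0.sin.ofReal_comp
    have h2 := h0.cos.ofReal_comp
    refine (((h1.const_mul (Complex.I * ξ)).sub (h2.const_mul (a : ℂ))).mul
      (hasDerivAt_osc ξ t)).congr_deriv ?_
    simp only [Pi.sub_apply]
    push_cast
    linear_combination (ξ ^ 2 * Complex.sin (a * t) * osc ξ t) * Complex.I_sq
  have hi := intervalIntegral.integral_eq_sub_of_hasDerivAt hd
    (Continuous.intervalIntegrable (by have := continuous_osc_right ξ; fun_prop) _ _)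
  have haT : a * T = Real.pi := by rw [ha]; field_simp
  rw [bumpKernel, ← intervalIntegral.integral_const_mul, hi, haT]
  simp [osc_zero]
  ring

theorem norm_bumpKernel_le {T : ℝ} (hT : 0 < T) (ξ : ℝ) : ‖bumpKernel T ξ‖ ≤ T := by
  have := intervalIntegral.norm_integral_le_of_norm_le_const (a := 0) (b := T) (C := 1)
    (f := fun t => (Real.sin (Real.pi / T * t) : ℂ) * osc ξ t) (fun t _ => by
      rw [norm_mul, norm_osc, mul_one, Complex.norm_real]
      exact Real.abs_sin_le_one _)
  simpa [bumpKernel, abs_of_pos hT] using this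

theorem bumpKernel_zero {T : ℝ} (hT : 0 < T) : bumpKernel T 0 = ((2 * T / Real.pi : ℝ) : ℂ) := by
  have h := bumpKernel_formula hT 0
  rw [osc_zero_left] at h
  have hpi := Real.pi_pos
  have h1 : (((Real.pi / T) ^ 2 - 0 ^ 2 : ℝ) : ℂ) ≠ 0 := by
    rw [Complex.ofReal_ne_zero, zero_pow two_ne_zero, sub_zero]; positivity
  apply mul_left_cancel₀ h1
  rw [h]
  norm_cast
  field_simp
  ring

theorem sq_sub_mul_norm_bumpKernel_le {T : ℝ} (hT : 0 < T) (ξ : ℝ) :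
    (ξ ^ 2 - (Real.pi / T) ^ 2) * ‖bumpKernel T ξ‖ ≤ 2 * (Real.pi / T) := by
  have h := congrArg norm (bumpKernel_formula hT ξ)
  rw [norm_mul, norm_mul, Complex.norm_real, Complex.norm_real, Real.norm_eq_abs,
    Real.norm_eq_abs, abs_of_pos (a := Real.pi / T) (by positivity)] at h
  have h1 : ‖osc ξ T + 1‖ ≤ 2 := by
    refine (norm_add_le _ _).trans ?_
    rw [norm_osc, norm_one]; norm_num
  have h2 : ξ ^ 2 - (Real.pi / T) ^ 2 ≤ |(Real.pi / T) ^ 2 - ξ ^ 2| := by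
    rw [abs_sub_comm]; exact le_abs_self _
  calc _ ≤ |(Real.pi / T) ^ 2 - ξ ^ 2| * ‖bumpKernel T ξ‖ := by gcongr
    _ = Real.pi / T * ‖osc ξ T + 1‖ := h
    _ ≤ Real.pi / T * 2 := by gcongr
    _ = _ := by ring

theorem sq_mul_norm_bumpKernel_le {T : ℝ} (hT : 0 < T) (ξ : ℝ) :
    ξ ^ 2 * ‖bumpKernel T ξ‖ ≤ 2 * (Real.pi / T) + Real.pi ^ 2 / T := by
  have h1 := sq_sub_mul_norm_bumpKernel_le hT ξ
  have h2 := mul_le_mul_of_nonneg_left (norm_bumpKernel_le hT ξ) (sq_nonneg (Real.pi / T))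
  have h3 : (Real.pi / T) ^ 2 * T = Real.pi ^ 2 / T := by field_simp
  nlinarith

theorem sum_Icc_inv_four_sq_sub_one_le (R : ℕ) :
    ∑ r ∈ Finset.Icc 1 R, 1 / (4 * (r : ℝ) ^ 2 - 1) ≤ 1 / 2 := by
  have h : ∑ r ∈ Finset.Icc 1 R, 1 / (4 * (r : ℝ) ^ 2 - 1) = 1 / 2 - 1 / (2 * (2 * (R : ℝ) + 1)) := by
    induction R with
    | zero => norm_num
    | succ n ih =>
      rw [Finset.sum_Icc_succ_top (by omega), ih]
      push_cast
      have h1 : (4 * ((n : ℝ) + 1) ^ 2 - 1) = (2 * n + 1) * (2 * n + 3) := by ring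
      rw [h1]
      field_simp
      ring
  rw [h]
  have : (0 : ℝ) ≤ 1 / (2 * (2 * R + 1)) := by positivity
  linarith

section Ingham

variable {ι : Type*}

theorem bumpKernel_neg (T ξ : ℝ) : bumpKernel T (-ξ) = conj (bumpKernel T ξ) := by
  simp only [bumpKernel, intervalIntegral, map_sub, ← integral_conj, map_mul, conj_osc,
    Complex.conj_ofReal]

/-- The finite sum `∑ f_j e^{iw_j t}`. -/
def trigSum (s : Finset ι) (f : ι → ℂ) (w : ι → ℝ) (t : ℝ) : ℂ := ∑ j ∈ s, f j * osc (w j) t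

theorem continuous_trigSum (s : Finset ι) (f : ι → ℂ) (w : ι → ℝ) :
    Continuous (trigSum s f w) := by
  unfold trigSum
  exact continuous_finsetSum _ fun j _ => continuous_const.mul (continuous_osc_right _)

theorem integral_bump_mul_trigSum (T : ℝ) (s : Finset ι) (f g : ι → ℂ) (w : ι → ℝ) :
    ∫ t in (0 : ℝ)..T, (Real.sin (Real.pi / T * t) : ℂ) *
        (conj (trigSum s g w t) * trigSum s f w t) =
      ∑ i ∈ s, ∑ j ∈ s, conj (g i) * f j * bumpKernel T (w j - w i) := by
  have e : ∀ t, (Real.sin (Real.pi / T * t) : ℂ) * (conj (trigSum s g w t) * trigSum s f w t) =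
      ∑ i ∈ s, ∑ j ∈ s, conj (g i) * f j *
        ((Real.sin (Real.pi / T * t) : ℂ) * osc (w j - w i) t) := by
    intro t
    simp only [trigSum, map_sum, map_mul, conj_osc]
    rw [Finset.sum_mul_sum, Finset.mul_sum]
    refine Finset.sum_congr rfl fun i _ => ?_
    rw [Finset.mul_sum]
    refine Finset.sum_congr rfl fun j _ => ?_
    rw [sub_eq_add_neg, osc_add]
    ring
  have hc : ∀ i j, Continuous fun t : ℝ => conj (g i) * f j *
        ((Real.sin (Real.pi / T * t) : ℂ) * osc (w j - w i) t) := by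
    intro i j
    have := continuous_osc_right (w j - w i)
    fun_prop
  simp only [e]
  rw [intervalIntegral.integral_finsetSum fun i _ => Continuous.intervalIntegrable
    (continuous_finsetSum _ fun j _ => hc i j) _ _]
  refine Finset.sum_congr rfl fun i _ => ?_
  rw [intervalIntegral.integral_finsetSum fun j _ => (hc i j).intervalIntegrable _ _]
  refine Finset.sum_congr rfl fun j _ => ?_
  rw [intervalIntegral.integral_const_mul, bumpKernel]

theorem integral_bump_mul_normSq (T : ℝ) (s : Finset ι) (f : ι → ℂ) (w : ι → ℝ) :
    ∫ t in (0 : ℝ)..T, Real.sin (Real.pi / T * t) * ‖trigSum s f w t‖ ^ 2 =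
      ∑ i ∈ s, ∑ j ∈ s, (conj (f i) * f j * bumpKernel T (w j - w i)).re := by
  have h := integral_bump_mul_trigSum T s f f w
  simp only [Complex.conj_mul', ← Complex.ofReal_pow, ← Complex.ofReal_mul] at h
  rw [intervalIntegral.integral_ofReal] at h
  have h2 := congrArg Complex.re h
  rw [Complex.ofReal_re] at h2
  rw [h2]
  simp only [Complex.re_sum]

variable [DecidableEq ι]

theorem norm_bumpKernel_le_of_gap {T γ : ℝ} (hT : 0 < T) (hγ : 2 * Real.pi < γ * T)
    {ξ : ℝ} {r : ℕ} (hr : 1 ≤ r) (h : r * γ ≤ |ξ|) :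
    ‖bumpKernel T ξ‖ ≤
      2 * T / Real.pi / (γ * T / (2 * Real.pi)) ^ 2 * (1 / (4 * (r : ℝ) ^ 2 - 1)) := by
  have hpi := Real.pi_pos
  set s := γ * T / (2 * Real.pi) with hs
  have hs1 : 1 < s := by rw [hs, lt_div_iff₀ (by positivity)]; linarith
  have hr1 : (1 : ℝ) ≤ r := by exact_mod_cast hr
  have h4 : 0 < 4 * (r : ℝ) ^ 2 - 1 := by nlinarith
  have hγs : γ = s * 2 * (Real.pi / T) := by rw [hs]; field_simp
  set a := Real.pi / T with ha
  have ha0 : 0 < a := by positivity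
  have h1 : (r * (s * 2 * a)) ^ 2 ≤ ξ ^ 2 := by
    rw [← sq_abs ξ, ← hγs]
    have : 0 ≤ γ := by rw [hγs]; positivity
    gcongr
  have h2 := sq_sub_mul_norm_bumpKernel_le hT ξ
  rw [← ha] at h2
  have h3 : s ^ 2 * (4 * (r : ℝ) ^ 2 - 1) * a ^ 2 ≤ ξ ^ 2 - a ^ 2 := by
    nlinarith [mul_nonneg (sq_nonneg a) (sub_nonneg.2 (one_le_pow₀ hs1.le : 1 ≤ s ^ 2))]
  have h5 : s ^ 2 * (4 * (r : ℝ) ^ 2 - 1) * a ^ 2 * ‖bumpKernel T ξ‖ ≤ 2 * a :=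
    (mul_le_mul_of_nonneg_right h3 (norm_nonneg _)).trans h2
  have h6 : 2 * T / Real.pi / s ^ 2 * (1 / (4 * (r : ℝ) ^ 2 - 1)) =
      2 * a / (s ^ 2 * (4 * (r : ℝ) ^ 2 - 1) * a ^ 2) := by
    rw [ha]; field_simp
  rw [h6, le_div_iff₀ (by positivity)]
  linarith

/-- The rows of the Gram matrix of a separated family are dominated by the diagonal. -/
theorem sum_norm_bumpKernel_le {T γ : ℝ} (hT : 0 < T) (hγ : 2 * Real.pi < γ * T)
    (s : Finset ι) (w : ι → ℝ)
    (hgap : ∀ i ∈ s, ∀ j ∈ s, i ≠ j → γ ≤ |w i - w j|) (i : ι) (hi : i ∈ s) :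
    ∑ j ∈ s.erase i, ‖bumpKernel T (w j - w i)‖ ≤
      2 * T / Real.pi / (γ * T / (2 * Real.pi)) ^ 2 := by
  have hpi := Real.pi_pos
  have hγ0 : 0 < γ := by
    by_contra! h
    nlinarith
  set A := 2 * T / Real.pi / (γ * T / (2 * Real.pi)) ^ 2 with hA
  have hA0 : 0 ≤ A := by positivity
  set ρ : ι → ℕ := fun j => ⌊|w j - w i| / γ⌋₊ with hρ
  have hρ1 : ∀ j ∈ s.erase i, 1 ≤ ρ j := by
    intro j hj
    rw [Finset.mem_erase] at hj
    rw [hρ, Nat.one_le_floor_iff, le_div_iff₀ hγ0, one_mul]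
    exact hgap j hj.2 i hi hj.1
  have hle : ∀ j ∈ s.erase i, ‖bumpKernel T (w j - w i)‖ ≤ A * (1 / (4 * (ρ j : ℝ) ^ 2 - 1)) := by
    intro j hj
    refine norm_bumpKernel_le_of_gap hT hγ (hρ1 j hj) ?_
    have := Nat.floor_le (a := |w j - w i| / γ) (by positivity)
    rwa [le_div_iff₀ hγ0] at this
  have hside : ∀ u ⊆ s.erase i, (∀ j ∈ u, ∀ k ∈ u, ρ j = ρ k → |w j - w k| < γ) →
      ∑ j ∈ u, ‖bumpKernel T (w j - w i)‖ ≤ A * (1 / 2) := by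
    intro u hu hinj
    have hinj' : Set.InjOn ρ u := by
      intro j hj k hk hjk
      by_contra hne
      have h1 := hinj j hj k hk hjk
      have h2 := hgap j (Finset.mem_of_mem_erase (hu hj)) k (Finset.mem_of_mem_erase (hu hk)) hne
      linarith
    calc ∑ j ∈ u, ‖bumpKernel T (w j - w i)‖ ≤ ∑ j ∈ u, A * (1 / (4 * (ρ j : ℝ) ^ 2 - 1)) :=
          Finset.sum_le_sum fun j hj => hle j (hu hj)
      _ = A * ∑ r ∈ u.image ρ, 1 / (4 * (r : ℝ) ^ 2 - 1) := by
          rw [← Finset.mul_sum, Finset.sum_image hinj']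
      _ ≤ A * ∑ r ∈ Finset.Icc 1 (u.sup ρ), 1 / (4 * (r : ℝ) ^ 2 - 1) := by
          refine mul_le_mul_of_nonneg_left (Finset.sum_le_sum_of_subset_of_nonneg ?_ ?_) hA0
          · intro r hr
            obtain ⟨j, hj, rfl⟩ := Finset.mem_image.1 hr
            exact Finset.mem_Icc.2 ⟨hρ1 j (hu hj), Finset.le_sup hj⟩
          · intro r hr _
            have : (1 : ℝ) ≤ r := by exact_mod_cast (Finset.mem_Icc.1 hr).1
            apply div_nonneg zero_le_one
            nlinarith
      _ ≤ A * (1 / 2) := mul_le_mul_of_nonneg_left (sum_Icc_inv_four_sq_sub_one_le _) hA0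
  have hfl : ∀ j k, ρ j = ρ k → ∀ x y : ℝ, x = |w j - w i| → y = |w k - w i| → |x - y| < γ := by
    rintro j k hjk x y rfl rfl
    have h1 := Nat.floor_le (a := |w j - w i| / γ) (by positivity)
    have h2 := Nat.lt_floor_add_one (|w j - w i| / γ)
    have h3 := Nat.floor_le (a := |w k - w i| / γ) (by positivity)
    have h4 := Nat.lt_floor_add_one (|w k - w i| / γ)
    simp only [hρ] at hjk
    rw [hjk] at h1 h2
    rw [le_div_iff₀ hγ0] at h1 h3
    rw [div_lt_iff₀ hγ0] at h2 h4
    rw [abs_lt]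
    constructor <;> nlinarith
  rw [← Finset.sum_filter_add_sum_filter_not (s.erase i) (fun j => 0 ≤ w j - w i)]
  have e1 := hside ((s.erase i).filter fun j => 0 ≤ w j - w i) (Finset.filter_subset _ _) (by
    intro j hj k hk hjk
    have := hfl j k hjk _ _ rfl rfl
    rwa [abs_of_nonneg (Finset.mem_filter.1 hj).2, abs_of_nonneg (Finset.mem_filter.1 hk).2,
      sub_sub_sub_cancel_right] at this)
  have e2 := hside ((s.erase i).filter fun j => ¬ 0 ≤ w j - w i) (Finset.filter_subset _ _) (by
    intro j hj k hk hjk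
    have := hfl j k hjk _ _ rfl rfl
    rw [abs_of_neg (not_le.1 (Finset.mem_filter.1 hj).2),
      abs_of_neg (not_le.1 (Finset.mem_filter.1 hk).2)] at this
    rw [abs_sub_comm]
    convert this using 2
    ring)
  linarith

/-- Schur's test for the Gram matrix of a separated family. -/
theorem abs_gram_sub_le {T γ : ℝ} (hT : 0 < T) (hγ : 2 * Real.pi < γ * T)
    (s : Finset ι) (w : ι → ℝ) (f : ι → ℂ)
    (hgap : ∀ i ∈ s, ∀ j ∈ s, i ≠ j → γ ≤ |w i - w j|) :
    |∑ i ∈ s, ∑ j ∈ s, (conj (f i) * f j * bumpKernel T (w j - w i)).re -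
        2 * T / Real.pi * ∑ i ∈ s, ‖f i‖ ^ 2| ≤
      2 * T / Real.pi / (γ * T / (2 * Real.pi)) ^ 2 * ∑ i ∈ s, ‖f i‖ ^ 2 := by
  set A := 2 * T / Real.pi / (γ * T / (2 * Real.pi)) ^ 2 with hA
  have hsplit : ∀ i ∈ s, ∑ j ∈ s, (conj (f i) * f j * bumpKernel T (w j - w i)).re =
      2 * T / Real.pi * ‖f i‖ ^ 2 +
        ∑ j ∈ s.erase i, (conj (f i) * f j * bumpKernel T (w j - w i)).re := by
    intro i hi
    rw [← Finset.add_sum_erase s _ hi, sub_self, bumpKernel_zero hT, Complex.conj_mul',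
      ← Complex.ofReal_pow, ← Complex.ofReal_mul, Complex.ofReal_re]
    ring
  rw [Finset.sum_congr rfl hsplit, Finset.sum_add_distrib, ← Finset.mul_sum, add_sub_cancel_left]
  have hbound : ∀ i ∈ s, ∀ j ∈ s.erase i, |(conj (f i) * f j * bumpKernel T (w j - w i)).re| ≤
      ‖f i‖ ^ 2 / 2 * ‖bumpKernel T (w j - w i)‖ + ‖f j‖ ^ 2 / 2 * ‖bumpKernel T (w j - w i)‖ := by
    intro i _ j _
    refine (Complex.abs_re_le_norm _).trans ?_
    rw [norm_mul, norm_mul, RCLike.norm_conj, ← add_mul]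
    gcongr
    nlinarith [sq_nonneg (‖f i‖ - ‖f j‖)]
  have h1 : ∑ i ∈ s, ∑ j ∈ s.erase i, ‖f i‖ ^ 2 / 2 * ‖bumpKernel T (w j - w i)‖ ≤
      A / 2 * ∑ i ∈ s, ‖f i‖ ^ 2 := by
    rw [Finset.mul_sum]
    refine Finset.sum_le_sum fun i hi => ?_
    rw [← Finset.mul_sum]
    have := sum_norm_bumpKernel_le hT hγ s w hgap i hi
    have h3 := mul_le_mul_of_nonneg_left this (by positivity : 0 ≤ ‖f i‖ ^ 2 / 2)
    linarith
  have h2 : ∑ i ∈ s, ∑ j ∈ s.erase i, ‖f j‖ ^ 2 / 2 * ‖bumpKernel T (w j - w i)‖ ≤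
      A / 2 * ∑ i ∈ s, ‖f i‖ ^ 2 := by
    refine le_of_eq_of_le ?_ h1
    rw [Finset.sum_comm' (t' := s) (s' := fun j => s.erase j)]
    · refine Finset.sum_congr rfl fun i _ => Finset.sum_congr rfl fun j _ => ?_
      rw [← neg_sub, bumpKernel_neg, RCLike.norm_conj]
    · intro i j
      simp only [Finset.mem_erase]
      tauto
  calc _ ≤ ∑ i ∈ s, ∑ j ∈ s.erase i, |(conj (f i) * f j * bumpKernel T (w j - w i)).re| :=
        (Finset.abs_sum_le_sum_abs _ _).trans
          (Finset.sum_le_sum fun i _ => Finset.abs_sum_le_sum_abs _ _)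
    _ ≤ ∑ i ∈ s, ∑ j ∈ s.erase i, (‖f i‖ ^ 2 / 2 * ‖bumpKernel T (w j - w i)‖ +
          ‖f j‖ ^ 2 / 2 * ‖bumpKernel T (w j - w i)‖) :=
        Finset.sum_le_sum fun i hi => Finset.sum_le_sum fun j hj => hbound i hi j hj
    _ ≤ _ := by
        simp only [Finset.sum_add_distrib]
        linarith

theorem abs_gram_sub_le_of_ne_zero {T γ : ℝ} (hT : 0 < T) (hγ : 2 * Real.pi < γ * T)
    (s : Finset ι) (w : ι → ℝ) (f : ι → ℂ)
    (hgap : ∀ i ∈ s, ∀ j ∈ s, f i ≠ 0 → f j ≠ 0 → i ≠ j → γ ≤ |w i - w j|) :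
    |∑ i ∈ s, ∑ j ∈ s, (conj (f i) * f j * bumpKernel T (w j - w i)).re -
        2 * T / Real.pi * ∑ i ∈ s, ‖f i‖ ^ 2| ≤
      2 * T / Real.pi / (γ * T / (2 * Real.pi)) ^ 2 * ∑ i ∈ s, ‖f i‖ ^ 2 := by
  have h := abs_gram_sub_le hT hγ (s.filter fun i => f i ≠ 0) w f (by
    intro i hi j hj
    rw [Finset.mem_filter] at hi hj
    exact hgap i hi.1 j hj.1 hi.2 hj.2)
  have key : ∀ F : ι → ℝ, (∀ i, f i = 0 → F i = 0) →
      ∑ i ∈ s.filter (fun i => f i ≠ 0), F i = ∑ i ∈ s, F i := fun F hF =>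
    Finset.sum_filter_of_ne fun i _ hi h0 => hi (hF i h0)
  have e : ∑ i ∈ s.filter (fun i => f i ≠ 0), ∑ j ∈ s.filter (fun i => f i ≠ 0),
        (conj (f i) * f j * bumpKernel T (w j - w i)).re =
      ∑ i ∈ s, ∑ j ∈ s, (conj (f i) * f j * bumpKernel T (w j - w i)).re := by
    rw [key _ fun i hi => by simp [hi]]
    exact Finset.sum_congr rfl fun i _ => key _ fun j hj => by simp [hj]
  rwa [e, key _ fun i hi => by simp [hi]] at h

theorem ingham_constant_pos {T γ : ℝ} (hT : 0 < T) (hγ : 2 * Real.pi < γ * T) :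
    2 * T / Real.pi / (γ * T / (2 * Real.pi)) ^ 2 < 2 * T / Real.pi := by
  have hpi := Real.pi_pos
  refine div_lt_self (by positivity) ?_
  refine one_lt_pow₀ ?_ two_ne_zero
  rw [lt_div_iff₀ (by positivity)]; linarith

/-- Ingham's inequality with a slowly varying cut-off `ψ` of the frequencies: only the frequencies
which are not cut off have to be separated. -/
theorem filtered_ingham {T γ : ℝ} (hT : 0 < T) (hγ : 2 * Real.pi < γ * T) :
    ∃ c₁ : ℝ, 0 < c₁ ∧ ∃ c₂ : ℝ, 0 ≤ c₂ ∧
      ∀ (s : Finset ι) (w : ι → ℝ) (ψ : ι → ℝ) (L : ℝ) (f : ι → ℂ),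
        (∀ i ∈ s, 0 ≤ ψ i) → (∀ i ∈ s, ψ i ≤ 1) →
        (∀ i ∈ s, ∀ j ∈ s, |ψ i - ψ j| ≤ L * |w i - w j|) →
        (∀ i ∈ s, ∀ j ∈ s, ψ i ≠ 0 → ψ j ≠ 0 → i ≠ j → γ ≤ |w i - w j|) →
        c₁ * ∑ i ∈ s, ψ i ^ 2 * ‖f i‖ ^ 2 - c₂ * (L ^ 2 * s.card * ∑ i ∈ s, ‖f i‖ ^ 2) ≤
          ∫ t in (0 : ℝ)..T, ‖trigSum s f w t‖ ^ 2 := by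
  have hpi := Real.pi_pos
  have hA := ingham_constant_pos hT hγ
  set K0 := 2 * T / Real.pi with hK0
  set A := K0 / (γ * T / (2 * Real.pi)) ^ 2 with hAdef
  set M := 2 * (Real.pi / T) + Real.pi ^ 2 / T with hM
  have hM0 : 0 < M := by positivity
  have hA0 : 0 ≤ A := by positivity
  have hK0' : 0 < K0 := by positivity
  set c := K0 - A with hc
  have hc0 : 0 < c := by rw [hc]; linarith
  set τ := c / (2 * K0) with hτ
  have hτ0 : 0 < τ := by positivity
  refine ⟨τ * c, by positivity, τ * M, by positivity, ?_⟩
  intro s w ψ L f hψ0 hψ1 hL hgap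
  set S := ∑ i ∈ s, ψ i ^ 2 * ‖f i‖ ^ 2 with hS
  set g : ι → ℂ := fun i => (ψ i : ℂ) ^ 2 * f i with hg
  set G : ι → ι → ℝ := fun i j => (conj (f i) * f j * bumpKernel T (w j - w i)).re with hG
  have hGsymm : ∀ i j, G i j = G j i := by
    intro i j
    simp only [hG]
    rw [← neg_sub, bumpKernel_neg, ← Complex.conj_re]
    simp only [map_mul, Complex.conj_conj]
    ring_nf
  -- the filtered quadratic form is coercive
  have h1 : c * S ≤ ∑ i ∈ s, ∑ j ∈ s, ψ i * ψ j * G i j := by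
    have := abs_gram_sub_le_of_ne_zero hT hγ s w (fun i => (ψ i : ℂ) * f i) (by
      intro i hi j hj h1 h2 hij
      refine hgap i hi j hj ?_ ?_ hij
      · rintro h; simp [h] at h1
      · rintro h; simp [h] at h2)
    have e1 : ∑ i ∈ s, ‖(ψ i : ℂ) * f i‖ ^ 2 = S := by
      refine Finset.sum_congr rfl fun i _ => ?_
      rw [norm_mul, mul_pow, Complex.norm_real, Real.norm_eq_abs, sq_abs]
    have e2 : ∀ i j, (conj ((ψ i : ℂ) * f i) * ((ψ j : ℂ) * f j) * bumpKernel T (w j - w i)).re =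
        ψ i * ψ j * G i j := by
      intro i j
      rw [hG, ← Complex.re_ofReal_mul]
      congr 1
      rw [map_mul, Complex.conj_ofReal]
      push_cast; ring
    simp only [e1, e2] at this
    rw [abs_le] at this
    rw [hc]; linarith [this.1]
  have h2 : ∫ t in (0 : ℝ)..T, Real.sin (Real.pi / T * t) * ‖trigSum s g w t‖ ^ 2 ≤ 2 * K0 * S := by
    have := abs_gram_sub_le_of_ne_zero hT hγ s w g (by
      intro i hi j hj h1 h2 hij
      refine hgap i hi j hj ?_ ?_ hij
      · rintro h; simp [hg, h] at h1
      · rintro h; simp [hg, h] at h2)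
    rw [← integral_bump_mul_normSq, abs_le] at this
    have e1 : ∑ i ∈ s, ‖g i‖ ^ 2 ≤ S := by
      refine Finset.sum_le_sum fun i hi => ?_
      rw [hg, norm_mul, mul_pow, norm_pow, Complex.norm_real, Real.norm_eq_abs, sq_abs]
      have : ψ i ^ 2 ≤ 1 := pow_le_one₀ (hψ0 i hi) (hψ1 i hi)
      have h3 : (ψ i ^ 2) ^ 2 ≤ ψ i ^ 2 := by nlinarith [sq_nonneg (ψ i)]
      gcongr
    have e2 : 0 ≤ ∑ i ∈ s, ‖g i‖ ^ 2 := Finset.sum_nonneg fun i _ => by positivity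
    nlinarith [this.2]
  have h3 : ∑ i ∈ s, ∑ j ∈ s, ψ i * ψ j * G i j - L ^ 2 * M / 2 * (∑ i ∈ s, ‖f i‖) ^ 2 ≤
      (∫ t in (0 : ℝ)..T, (Real.sin (Real.pi / T * t) : ℂ) *
        (conj (trigSum s g w t) * trigSum s f w t)).re := by
    rw [integral_bump_mul_trigSum]
    have e1 : (∑ i ∈ s, ∑ j ∈ s, conj (g i) * f j * bumpKernel T (w j - w i)).re =
        ∑ i ∈ s, ∑ j ∈ s, ψ i ^ 2 * G i j := by
      simp only [Complex.re_sum]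
      refine Finset.sum_congr rfl fun i _ => Finset.sum_congr rfl fun j _ => ?_
      rw [hG, ← Complex.re_ofReal_mul]
      congr 1
      rw [hg, map_mul, map_pow, Complex.conj_ofReal]
      push_cast; ring
    have e2 : ∑ i ∈ s, ∑ j ∈ s, ψ i ^ 2 * G i j = ∑ i ∈ s, ∑ j ∈ s, ψ j ^ 2 * G i j := by
      rw [Finset.sum_comm]
      refine Finset.sum_congr rfl fun i _ => Finset.sum_congr rfl fun j _ => ?_
      rw [hGsymm]
    have e3 : ∑ i ∈ s, ∑ j ∈ s, ψ i ^ 2 * G i j =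
        ∑ i ∈ s, ∑ j ∈ s, (ψ i ^ 2 + ψ j ^ 2) / 2 * G i j := by
      have : ∀ i j, (ψ i ^ 2 + ψ j ^ 2) / 2 * G i j =
          ψ i ^ 2 * G i j / 2 + ψ j ^ 2 * G i j / 2 := by intro i j; ring
      simp only [this, Finset.sum_add_distrib, ← Finset.sum_div]
      rw [← e2]; ring
    rw [e1, e3, sq (∑ i ∈ s, ‖f i‖), Finset.sum_mul_sum, Finset.mul_sum, ← Finset.sum_sub_distrib]
    refine Finset.sum_le_sum fun i hi => ?_
    rw [Finset.mul_sum, ← Finset.sum_sub_distrib]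
    refine Finset.sum_le_sum fun j hj => ?_
    have hGle : |G i j| ≤ ‖f i‖ * ‖f j‖ * ‖bumpKernel T (w j - w i)‖ := by
      refine (Complex.abs_re_le_norm _).trans (le_of_eq ?_)
      rw [norm_mul, norm_mul, RCLike.norm_conj]
    have hψL : (ψ i - ψ j) ^ 2 ≤ L ^ 2 * (w j - w i) ^ 2 := by
      have := hL i hi j hj
      rw [← sq_abs (ψ i - ψ j), ← sq_abs (w j - w i), abs_sub_comm (w j), ← mul_pow]
      exact pow_le_pow_left₀ (abs_nonneg _) this 2
    have hK := sq_mul_norm_bumpKernel_le hT (w j - w i)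
    have h5 : (ψ i - ψ j) ^ 2 * |G i j| ≤ L ^ 2 * M * (‖f i‖ * ‖f j‖) := by
      calc (ψ i - ψ j) ^ 2 * |G i j|
          ≤ L ^ 2 * (w j - w i) ^ 2 * (‖f i‖ * ‖f j‖ * ‖bumpKernel T (w j - w i)‖) := by gcongr
        _ = L ^ 2 * (‖f i‖ * ‖f j‖) * ((w j - w i) ^ 2 * ‖bumpKernel T (w j - w i)‖) := by ring
        _ ≤ L ^ 2 * (‖f i‖ * ‖f j‖) * M := by gcongr
        _ = _ := by ring
    have h6 := mul_le_mul_of_nonneg_left (neg_abs_le (G i j)) (sq_nonneg (ψ i - ψ j))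
    nlinarith
  have h4 : (∫ t in (0 : ℝ)..T, (Real.sin (Real.pi / T * t) : ℂ) *
        (conj (trigSum s g w t) * trigSum s f w t)).re ≤
      1 / (2 * τ) * (∫ t in (0 : ℝ)..T, ‖trigSum s f w t‖ ^ 2) +
        τ / 2 * ∫ t in (0 : ℝ)..T, Real.sin (Real.pi / T * t) * ‖trigSum s g w t‖ ^ 2 := by
    have cf := continuous_trigSum s f w
    have cg := continuous_trigSum s g w
    have hi : IntervalIntegrable (fun t : ℝ => (Real.sin (Real.pi / T * t) : ℂ) *
        (conj (trigSum s g w t) * trigSum s f w t)) volume 0 T :=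
      Continuous.intervalIntegrable (by
        have := Complex.continuous_conj.comp cg
        simp only [Function.comp_def] at this
        fun_prop) _ _
    have hre : (∫ t in (0 : ℝ)..T, (Real.sin (Real.pi / T * t) : ℂ) *
        (conj (trigSum s g w t) * trigSum s f w t)).re = ∫ t in (0 : ℝ)..T,
          ((Real.sin (Real.pi / T * t) : ℂ) * (conj (trigSum s g w t) * trigSum s f w t)).re := by
      have := Complex.reCLM.intervalIntegral_comp_comm hi
      exact this.symm
    rw [hre, ← intervalIntegral.integral_const_mul, ← intervalIntegral.integral_const_mul,
      ← intervalIntegral.integral_add (Continuous.intervalIntegrable (by fun_prop) _ _)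
        (Continuous.intervalIntegrable (by fun_prop) _ _)]
    refine intervalIntegral.integral_mono_on hT.le ?_
      (Continuous.intervalIntegrable (by fun_prop) _ _) ?_
    · exact ⟨hi.1.re, hi.2.re⟩
    intro t ht
    have hs0 : 0 ≤ Real.sin (Real.pi / T * t) := by
      refine Real.sin_nonneg_of_nonneg_of_le_pi (by have := ht.1; positivity) ?_
      rw [div_mul_eq_mul_div, div_le_iff₀ hT]
      have := ht.2
      gcongr
    have hs1 := Real.sin_le_one (Real.pi / T * t)
    set k := Real.sin (Real.pi / T * t)
    set X := ‖trigSum s f w t‖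
    set Y := ‖trigSum s g w t‖
    have hX : 0 ≤ X := norm_nonneg _
    have h7 : ((k : ℂ) * (conj (trigSum s g w t) * trigSum s f w t)).re ≤ k * (Y * X) := by
      refine (Complex.re_le_norm _).trans (le_of_eq ?_)
      rw [norm_mul, norm_mul, RCLike.norm_conj, Complex.norm_real, Real.norm_eq_abs,
        abs_of_nonneg hs0]
    have h8 : Y * X ≤ 1 / (2 * τ) * X ^ 2 + τ / 2 * Y ^ 2 := by
      have : 1 / (2 * τ) * X ^ 2 + τ / 2 * Y ^ 2 - Y * X = (X - τ * Y) ^ 2 / (2 * τ) := by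
        field_simp; ring
      have h9 : 0 ≤ (X - τ * Y) ^ 2 / (2 * τ) := by positivity
      linarith
    have h10 : k * (1 / (2 * τ) * X ^ 2) ≤ 1 / (2 * τ) * X ^ 2 :=
      mul_le_of_le_one_left (by positivity) hs1
    calc _ ≤ k * (Y * X) := h7
      _ ≤ k * (1 / (2 * τ) * X ^ 2 + τ / 2 * Y ^ 2) := by gcongr
      _ ≤ _ := by linarith
  have h5 : (∑ i ∈ s, ‖f i‖) ^ 2 ≤ s.card * ∑ i ∈ s, ‖f i‖ ^ 2 := sq_sum_le_card_mul_sum_sq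
  have h6 : L ^ 2 * M / 2 * (∑ i ∈ s, ‖f i‖) ^ 2 ≤
      M / 2 * (L ^ 2 * s.card * ∑ i ∈ s, ‖f i‖ ^ 2) := by
    have := mul_le_mul_of_nonneg_left h5 (by positivity : 0 ≤ L ^ 2 * M / 2)
    linarith
  set I := ∫ t in (0 : ℝ)..T, ‖trigSum s f w t‖ ^ 2
  set Q := L ^ 2 * s.card * ∑ i ∈ s, ‖f i‖ ^ 2
  have h7 : τ / 2 * (2 * K0 * S) = c / 2 * S := by rw [hτ]; field_simp
  have h8 : c / 2 * S - M / 2 * Q ≤ 1 / (2 * τ) * I := by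
    have := mul_le_mul_of_nonneg_left h2 (by positivity : 0 ≤ τ / 2)
    linarith
  have h9 := mul_le_mul_of_nonneg_left h8 (by positivity : 0 ≤ 2 * τ)
  have h10 : 2 * τ * (1 / (2 * τ) * I) = I := by field_simp
  rw [h10] at h9
  linarith

/-- The direct inequality for separated frequencies. -/
theorem ingham_upper {T γ : ℝ} (hT : 0 < T) (hγ : 0 < γ) :
    ∃ C : ℝ, 0 < C ∧ ∀ (s : Finset ι) (w : ι → ℝ) (f : ι → ℂ),
      (∀ i ∈ s, ∀ j ∈ s, i ≠ j → γ ≤ |w i - w j|) →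
      ∫ t in (0 : ℝ)..T, ‖trigSum s f w t‖ ^ 2 ≤ C * ∑ i ∈ s, ‖f i‖ ^ 2 := by
  have hpi := Real.pi_pos
  -- a window of length `T'` with `T` in its middle part
  set T' := 3 * T + 2 * Real.pi / γ with hT'
  have hT'0 : 0 < T' := by positivity
  have hγT : 2 * Real.pi < γ * T' := by
    have : γ * T' = 3 * (γ * T) + 2 * Real.pi := by rw [hT']; field_simp
    have h2 : 0 < γ * T := by positivity
    linarith
  set a := (T' - T) / 2 with ha
  have ha0 : 0 < a := by
    have : 0 < Real.pi / γ := by positivity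
    rw [ha, hT']; ring_nf; ring_nf at this; linarith
  have haT : a + T < T' := by
    have : T' = 2 * a + T := by rw [ha]; ring
    linarith
  set σ := Real.sin (Real.pi / T' * a) with hσ
  have hσ0 : 0 < σ := by
    refine Real.sin_pos_of_pos_of_lt_pi (by positivity) ?_
    rw [div_mul_eq_mul_div, div_lt_iff₀ hT'0]
    nlinarith
  have hσle : ∀ t ∈ Icc 0 T, σ ≤ Real.sin (Real.pi / T' * (t + a)) := by
    intro t ht
    have e : Real.pi / T' * (T + a) = Real.pi - Real.pi / T' * a := by
      have : T' = 2 * a + T := by rw [ha]; ring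
      field_simp
      linarith
    have hle : Real.pi / T' * (t + a) ≤ Real.pi - Real.pi / T' * a := by
      rw [← e]; gcongr; exact ht.2
    have hge : Real.pi / T' * a ≤ Real.pi / T' * (t + a) := by
      gcongr; linarith [ht.1]
    rcases le_total (Real.pi / T' * (t + a)) (Real.pi / 2) with h | h
    · refine Real.sin_le_sin_of_le_of_le_pi_div_two ?_ h hge
      have : 0 < Real.pi / T' * a := by positivity
      linarith
    · rw [← Real.sin_pi_sub (Real.pi / T' * (t + a))]
      refine Real.sin_le_sin_of_le_of_le_pi_div_two ?_ ?_ ?_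
      · have : 0 < Real.pi / T' * a := by positivity
        linarith
      · linarith
      · linarith
  set K0 := 2 * T' / Real.pi with hK0
  refine ⟨2 * K0 / σ, by positivity, fun s w f hgap => ?_⟩
  set g : ι → ℂ := fun j => f j * osc (w j) (-a) with hg
  have e : ∀ t, trigSum s f w t = trigSum s g w (t + a) := by
    intro t
    simp only [trigSum, hg]
    refine Finset.sum_congr rfl fun j _ => ?_
    rw [mul_assoc, ← osc_add_right]
    congr 2; ring
  have hng : ∀ j, ‖g j‖ = ‖f j‖ := fun j => by rw [hg, norm_mul, norm_osc, mul_one]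
  have h1 := abs_gram_sub_le hT'0 hγT s w g hgap
  rw [← integral_bump_mul_normSq, abs_le] at h1
  simp only [hng] at h1
  have h2 := ingham_constant_pos hT'0 hγT
  rw [← hK0] at h1 h2
  have cg := continuous_trigSum s g w
  have h3 : ∫ t in (0 : ℝ)..T, σ * ‖trigSum s f w t‖ ^ 2 ≤
      ∫ t in (0 : ℝ)..T', Real.sin (Real.pi / T' * t) * ‖trigSum s g w t‖ ^ 2 := by
    calc ∫ t in (0 : ℝ)..T, σ * ‖trigSum s f w t‖ ^ 2
        ≤ ∫ t in (0 : ℝ)..T, Real.sin (Real.pi / T' * (t + a)) * ‖trigSum s g w (t + a)‖ ^ 2 := by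
          have cf := continuous_trigSum s f w
          refine intervalIntegral.integral_mono_on hT.le
            (Continuous.intervalIntegrable (by fun_prop) _ _)
            (Continuous.intervalIntegrable (by fun_prop) _ _) fun t ht => ?_
          rw [e]
          exact mul_le_mul_of_nonneg_right (hσle t ht) (by positivity)
      _ = ∫ t in (0 + a)..(T + a), Real.sin (Real.pi / T' * t) * ‖trigSum s g w t‖ ^ 2 :=
          intervalIntegral.integral_comp_add_right
            (fun t => Real.sin (Real.pi / T' * t) * ‖trigSum s g w t‖ ^ 2) a
      _ ≤ _ := by
          refine intervalIntegral.integral_mono_interval (by linarith) (by linarith) (by linarith) ?_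
            (Continuous.intervalIntegrable (by fun_prop) _ _)
          refine (ae_restrict_iff' measurableSet_Ioc).2 (Eventually.of_forall fun t ht => ?_)
          refine mul_nonneg (Real.sin_nonneg_of_nonneg_of_le_pi ?_ ?_) (by positivity)
          · have := ht.1.le; positivity
          · rw [div_mul_eq_mul_div, div_le_iff₀ hT'0]
            have := ht.2
            gcongr
  rw [intervalIntegral.integral_const_mul] at h3
  rw [div_mul_eq_mul_div, le_div_iff₀ hσ0, mul_comm]
  have h4 : 0 ≤ ∑ i ∈ s, ‖f i‖ ^ 2 := Finset.sum_nonneg fun i _ => by positivity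
  nlinarith [h1.2]

end Ingham

/-! ### Exponentials in `L²(0,T)` -/

section Exponentials

theorem memLp_Ioo_of_continuous (T : ℝ) {g : ℝ → ℂ} (hg : Continuous g) :
    MemLp g 2 (volume.restrict (Ioo (0 : ℝ) T)) := by
  obtain ⟨C, hC⟩ := isCompact_Icc.exists_bound_of_continuousOn
    (s := Icc (0 : ℝ) T) (f := g) hg.continuousOn
  refine MemLp.of_bound hg.aestronglyMeasurable C ?_
  exact (ae_restrict_iff' measurableSet_Ioo).2
    (Eventually.of_forall fun x hx => hC x (Ioo_subset_Icc_self hx))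

/-- A continuous function as an element of `L²(0,T)`. -/
def contL2 (T : ℝ) (g : ℝ → ℂ) (hg : Continuous g) : L2T T := (memLp_Ioo_of_continuous T hg).toLp g

theorem coeFn_contL2 (T : ℝ) (g : ℝ → ℂ) (hg : Continuous g) :
    contL2 T g hg =ᵐ[volume.restrict (Ioo (0 : ℝ) T)] g := MemLp.coeFn_toLp _

theorem norm_sq_L2T {T : ℝ} (v : L2T T) : ‖v‖ ^ 2 = ∫ t in Ioo (0 : ℝ) T, ‖v t‖ ^ 2 := by
  have h := L2.inner_def (𝕜 := ℂ) v v
  rw [inner_self_eq_norm_sq_to_K] at h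
  simp only [inner_self_eq_norm_sq_to_K] at h
  have h2 : (((‖v‖ ^ 2 : ℝ)) : ℂ) = ((∫ t in Ioo (0 : ℝ) T, ‖v t‖ ^ 2 : ℝ) : ℂ) := by
    rw [← integral_complex_ofReal]
    simpa using h
  exact_mod_cast h2

theorem setIntegral_Ioo_eq {E : Type*} [NormedAddCommGroup E] [NormedSpace ℝ E] {T : ℝ}
    (hT : 0 ≤ T) (f : ℝ → E) : ∫ t in Ioo (0 : ℝ) T, f t = ∫ t in (0 : ℝ)..T, f t := by
  rw [intervalIntegral.integral_of_le hT, integral_Ioc_eq_integral_Ioo]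

theorem norm_sq_contL2 {T : ℝ} (hT : 0 ≤ T) (g : ℝ → ℂ) (hg : Continuous g) :
    ‖contL2 T g hg‖ ^ 2 = ∫ t in (0 : ℝ)..T, ‖g t‖ ^ 2 := by
  rw [norm_sq_L2T, ← setIntegral_Ioo_eq hT]
  refine integral_congr_ae ?_
  filter_upwards [coeFn_contL2 T g hg] with t ht
  rw [ht]

theorem inner_contL2_left {T : ℝ} (hT : 0 ≤ T) (g : ℝ → ℂ) (hg : Continuous g) (v : L2T T) :
    inner ℂ (contL2 T g hg) v = ∫ t in (0 : ℝ)..T, conj (g t) * v t := by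
  rw [L2.inner_def, ← setIntegral_Ioo_eq hT]
  refine integral_congr_ae ?_
  filter_upwards [coeFn_contL2 T g hg] with t ht
  rw [ht, RCLike.inner_apply, mul_comm]

theorem inner_contL2 {T : ℝ} (hT : 0 ≤ T) (f g : ℝ → ℂ) (hf : Continuous f) (hg : Continuous g) :
    inner ℂ (contL2 T f hf) (contL2 T g hg) = ∫ t in (0 : ℝ)..T, conj (f t) * g t := by
  rw [L2.inner_def, ← setIntegral_Ioo_eq hT]
  refine integral_congr_ae ?_
  filter_upwards [coeFn_contL2 T f hf, coeFn_contL2 T g hg] with t ht ht'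
  rw [ht, ht', RCLike.inner_apply, mul_comm]

theorem norm_contL2_le {T : ℝ} (hT : 0 ≤ T) (g : ℝ → ℂ) (hg : Continuous g) {C : ℝ} (hC0 : 0 ≤ C)
    (hC : ∀ t ∈ Icc 0 T, ‖g t‖ ≤ C) : ‖contL2 T g hg‖ ≤ C * √T := by
  refine le_of_sq_le_sq ?_ (by positivity)
  rw [norm_sq_contL2 hT, mul_pow, Real.sq_sqrt hT]
  calc ∫ t in (0 : ℝ)..T, ‖g t‖ ^ 2 ≤ ∫ t in (0 : ℝ)..T, C ^ 2 := by
        refine intervalIntegral.integral_mono_on hT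
          (Continuous.intervalIntegrable (by fun_prop) _ _)
          (Continuous.intervalIntegrable (by fun_prop) _ _) fun t ht => ?_
        exact pow_le_pow_left₀ (norm_nonneg _) (hC t ht) 2
    _ = C ^ 2 * T := by simp [mul_comm]

/-- The exponential `e^{iwt}` as an element of `L²(0,T)`. -/
def expT (T w : ℝ) : L2T T := contL2 T (osc w) (continuous_osc_right w)

theorem coeFn_sum_smul_expT {ι : Type*} (T : ℝ) (s : Finset ι) (f : ι → ℂ) (w : ι → ℝ) :
    (∑ j ∈ s, f j • expT T (w j) : L2T T) =ᵐ[volume.restrict (Ioo (0 : ℝ) T)] trigSum s f w := by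
  classical
  induction s using Finset.induction_on with
  | empty =>
    filter_upwards [Lp.coeFn_zero ℂ 2 (volume.restrict (Ioo (0 : ℝ) T))] with t ht
    rw [Finset.sum_empty, ht]; simp [trigSum]
  | insert a s ha ih =>
    rw [Finset.sum_insert ha]
    filter_upwards [ih, Lp.coeFn_add (f a • expT T (w a)) (∑ j ∈ s, f j • expT T (w j)),
      Lp.coeFn_smul (f a) (expT T (w a)), coeFn_contL2 T (osc (w a)) (continuous_osc_right _)]
      with t h1 h2 h3 h4
    rw [h2, Pi.add_apply, h1, h3, Pi.smul_apply, expT, h4, trigSum, trigSum, Finset.sum_insert ha,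
      smul_eq_mul]

theorem sum_smul_expT_eq {ι : Type*} (T : ℝ) (s : Finset ι) (f : ι → ℂ) (w : ι → ℝ) :
    ∑ j ∈ s, f j • expT T (w j) = contL2 T (trigSum s f w) (continuous_trigSum s f w) :=
  Lp.ext ((coeFn_sum_smul_expT T s f w).trans (coeFn_contL2 T _ _).symm)

theorem norm_sq_sum_smul_expT {ι : Type*} {T : ℝ} (hT : 0 ≤ T) (s : Finset ι) (f : ι → ℂ)
    (w : ι → ℝ) :
    ‖∑ j ∈ s, f j • expT T (w j)‖ ^ 2 = ∫ t in (0 : ℝ)..T, ‖trigSum s f w t‖ ^ 2 := by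
  rw [sum_smul_expT_eq, norm_sq_contL2 hT]

theorem norm_expT_le {T : ℝ} (hT : 0 ≤ T) (w : ℝ) : ‖expT T w‖ ≤ √T := by
  have := norm_contL2_le hT (osc w) (continuous_osc_right w) zero_le_one
    (fun t _ => (norm_osc w t).le)
  simpa [expT] using this

theorem norm_osc_sub_le (w w' t : ℝ) : ‖osc w t - osc w' t‖ ≤ |w - w'| * |t| := by
  have e : osc w t - osc w' t = osc w' t * (osc (w - w') t - 1) := by
    rw [mul_sub, ← osc_add]; simp
  have := Real.norm_exp_I_mul_ofReal_sub_one_le (x := (w - w') * t)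
  rw [e, norm_mul, norm_osc, one_mul, osc, mul_comm _ Complex.I]
  refine this.trans ?_
  rw [Real.norm_eq_abs, abs_mul]

theorem norm_expT_sub_le {T : ℝ} (hT : 0 ≤ T) (w w' : ℝ) :
    ‖expT T w - expT T w'‖ ≤ |w - w'| * T * √T := by
  have e : expT T w - expT T w' = contL2 T (fun t => osc w t - osc w' t)
      ((continuous_osc_right w).sub (continuous_osc_right w')) := by
    refine Lp.ext ?_
    filter_upwards [Lp.coeFn_sub (expT T w) (expT T w'), coeFn_contL2 T _ (continuous_osc_right w),
      coeFn_contL2 T _ (continuous_osc_right w'), coeFn_contL2 T (fun t => osc w t - osc w' t)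
      ((continuous_osc_right w).sub (continuous_osc_right w'))] with t h1 h2 h3 h4
    rw [h1, h4, Pi.sub_apply, expT, expT, h2, h3]
  rw [e]
  refine norm_contL2_le hT _ _ (by positivity) fun t ht => (norm_osc_sub_le w w' t).trans ?_
  rw [abs_of_nonneg ht.1]
  gcongr
  exact ht.2

theorem continuous_expT {T : ℝ} (hT : 0 ≤ T) : Continuous (expT T) := by
  rw [continuous_iff_continuousAt]
  intro w
  rw [ContinuousAt, tendsto_iff_norm_sub_tendsto_zero]
  refine squeeze_zero (fun _ => norm_nonneg _) (fun w' => norm_expT_sub_le hT w' w) ?_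
  have : Continuous fun w' => |w' - w| * T * √T := by fun_prop
  simpa using this.tendsto w

/-- Elements of `L²(0,T)` whose products with exponentials decay. -/
def HasDecay {T : ℝ} (g : L2T T) : Prop :=
  ∃ C : ℝ, 0 ≤ C ∧ ∀ w : ℝ, (1 + |w|) * ‖inner ℂ g (expT T w)‖ ≤ C

theorem norm_inner_expT_le {T : ℝ} (hT : 0 ≤ T) (g : L2T T) (w : ℝ) :
    ‖inner ℂ g (expT T w)‖ ≤ ‖g‖ * √T :=
  (norm_inner_le_norm _ _).trans (by gcongr; exact norm_expT_le hT w)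

theorem hasDecay_expT {T : ℝ} (hT : 0 ≤ T) (w₀ : ℝ) : HasDecay (expT T w₀) := by
  have h1 : ∀ w, |w - w₀| * ‖inner ℂ (expT T w₀) (expT T w)‖ ≤ 2 := by
    intro w
    rcases eq_or_ne w w₀ with rfl | hne
    · simp
    have hd : ∀ t ∈ uIcc 0 T, HasDerivAt (osc (w - w₀))
        (Complex.I * ((w - w₀ : ℝ) : ℂ) * (conj (osc w₀ t) * osc w t)) t := by
      intro t _
      refine (hasDerivAt_osc (w - w₀) t).congr_deriv ?_
      rw [conj_osc, ← osc_add, neg_add_eq_sub]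
    have hc : Continuous fun t => Complex.I * ((w - w₀ : ℝ) : ℂ) * (conj (osc w₀ t) * osc w t) := by
      have h1 := continuous_osc_right w₀
      have h2 := continuous_osc_right w
      have := Complex.continuous_conj.comp h1
      simp only [Function.comp_def] at this
      fun_prop
    have hi := intervalIntegral.integral_eq_sub_of_hasDerivAt hd (hc.intervalIntegrable _ _)
    rw [intervalIntegral.integral_const_mul] at hi
    rw [expT, expT, inner_contL2 hT]
    have h2 := congrArg norm hi
    rw [norm_mul, norm_mul, Complex.norm_I, one_mul, Complex.norm_real, Real.norm_eq_abs] at h2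
    rw [h2]
    refine (norm_sub_le _ _).trans ?_
    rw [norm_osc, norm_osc]; norm_num
  refine ⟨2 + (1 + |w₀|) * (‖expT T w₀‖ * √T), by positivity, fun w => ?_⟩
  have h2 := norm_inner_expT_le hT (expT T w₀) w
  have h3 : |w| ≤ |w - w₀| + |w₀| := by
    calc |w| = |(w - w₀) + w₀| := by ring_nf
      _ ≤ _ := abs_add_le _ _
  calc (1 + |w|) * ‖inner ℂ (expT T w₀) (expT T w)‖
      ≤ (|w - w₀| + (1 + |w₀|)) * ‖inner ℂ (expT T w₀) (expT T w)‖ :=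
        mul_le_mul_of_nonneg_right (by linarith) (norm_nonneg _)
    _ = |w - w₀| * ‖inner ℂ (expT T w₀) (expT T w)‖ +
          (1 + |w₀|) * ‖inner ℂ (expT T w₀) (expT T w)‖ := by ring
    _ ≤ _ := by gcongr; exact h1 w

theorem HasDecay.smul {T : ℝ} {g : L2T T} (hg : HasDecay g) (c : ℂ) : HasDecay (c • g) := by
  obtain ⟨C, hC0, hC⟩ := hg
  refine ⟨‖c‖ * C, by positivity, fun w => ?_⟩
  rw [inner_smul_left, norm_mul, RCLike.norm_conj, mul_left_comm]
  gcongr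
  exact hC w

/-- The test functions on `(0,T)` form a total set of elements with decay. -/
theorem eq_zero_of_forall_hasDecay {T : ℝ} (hT : 0 ≤ T) (z : L2T T)
    (h : ∀ g : L2T T, HasDecay g → inner ℂ g z = 0) : z = 0 := by
  have hz : LocallyIntegrableOn z (Ioo 0 T) volume := by
    have : IntegrableOn z (Ioo 0 T) volume :=
      (Lp.memLp z).integrable (by norm_num)
    exact this.locallyIntegrableOn
  have key := isOpen_Ioo.ae_eq_zero_of_integral_contDiff_smul_eq_zero hz (by
    intro g hg _ hsupp
    have hgc : Continuous fun t => (g t : ℂ) := Complex.continuous_ofReal.comp hg.continuous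
    have h0 : ∀ t, t ∉ Ioo 0 T → g t = 0 := fun t ht =>
      image_eq_zero_of_notMem_tsupport fun h => ht (hsupp h)
    have hdec : HasDecay (contL2 T (fun t => (g t : ℂ)) hgc) := by
      have hdc : Continuous (deriv g) := hg.continuous_deriv (by simp)
      obtain ⟨C, hC⟩ := isCompact_Icc.exists_bound_of_continuousOn
        (s := Icc (0 : ℝ) T) (f := deriv g) hdc.continuousOn
      have hb : ∀ w, |w| * ‖inner ℂ (contL2 T (fun t => (g t : ℂ)) hgc) (expT T w)‖ ≤ C * T := by
        intro w
        have hp := intervalIntegral.integral_mul_deriv_eq_deriv_mul (a := (0 : ℝ)) (b := T)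
          (u := fun t => (g t : ℂ)) (v := osc w) (u' := fun t => ((deriv g t : ℝ) : ℂ))
          (v' := fun t => Complex.I * w * osc w t)
          (fun x _ => ((hg.differentiable (by simp)) x).hasDerivAt.ofReal_comp)
          (fun x _ => hasDerivAt_osc w x)
          ((Complex.continuous_ofReal.comp hdc).intervalIntegrable _ _)
          ((continuous_const.mul (continuous_osc_right w)).intervalIntegrable _ _)
        rw [h0 T (by simp), h0 0 (by simp)] at hp
        have e : ∀ t, (g t : ℂ) * (Complex.I * w * osc w t) =
            Complex.I * w * (conj (g t : ℂ) * osc w t) := by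
          intro t; rw [Complex.conj_ofReal]; ring
        simp only [e] at hp
        rw [intervalIntegral.integral_const_mul, ← inner_contL2 hT _ _ hgc (continuous_osc_right w)]
          at hp
        have h2 := congrArg norm hp
        rw [norm_mul, norm_mul, Complex.norm_I, one_mul, Complex.norm_real, Real.norm_eq_abs] at h2
        rw [expT, h2]
        simp only [Complex.ofReal_zero, zero_mul, sub_self, zero_sub, norm_neg]
        have := intervalIntegral.norm_integral_le_of_norm_le_const (a := 0) (b := T) (C := C)
          (f := fun t => ((deriv g t : ℝ) : ℂ) * osc w t) (fun t ht => by
            rw [norm_mul, norm_osc, mul_one, Complex.norm_real]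
            rw [uIoc_of_le hT] at ht
            exact hC t (Ioc_subset_Icc_self ht))
        rwa [sub_zero, abs_of_nonneg hT] at this
      set G := contL2 T (fun t => (g t : ℂ)) hgc
      have hCT : 0 ≤ C * T := by
        have := hb 0
        simpa using this
      refine ⟨C * T + ‖G‖ * √T, by positivity, fun w => ?_⟩
      have := norm_inner_expT_le hT G w
      have := hb w
      linarith
    have := h _ hdec
    rw [inner_contL2_left hT, ← setIntegral_Ioo_eq hT] at this
    rw [← this, ← setIntegral_eq_integral_of_forall_compl_eq_zero (s := Ioo 0 T)]
    · refine integral_congr_ae (Eventually.of_forall fun t => ?_)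
      simp
    · intro t ht
      rw [h0 t ht, zero_smul])
  refine Lp.ext ?_
  filter_upwards [(ae_restrict_iff' measurableSet_Ioo).2 key,
    Lp.coeFn_zero ℂ 2 (volume.restrict (Ioo (0 : ℝ) T))] with t h1 h2
  rw [h1, h2, Pi.zero_apply]

theorem analyticAt_osc (w t : ℝ) : AnalyticAt ℝ (osc w) t := by
  have h1 : AnalyticAt ℝ (fun t : ℝ => ((w * t : ℝ) : ℂ) * Complex.I) t :=
    ((Complex.ofRealCLM.analyticAt _).comp
      (analyticAt_const.mul analyticAt_id : AnalyticAt ℝ (fun t : ℝ => w * t) t)).mul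
        analyticAt_const
  have h2 : AnalyticAt ℝ Complex.exp (((w * t : ℝ) : ℂ) * Complex.I) :=
    analyticAt_cexp.restrictScalars
  exact h2.comp_of_eq h1 rfl

/-- Exponentials with different frequencies are linearly independent on `(0,T)`. -/
theorem eq_zero_of_sum_smul_expT_eq_zero {ι : Type*} {T : ℝ} (hT : 0 < T) (s : Finset ι)
    (f : ι → ℂ) (w : ι → ℝ) (hw : Set.InjOn w s)
    (h : ∑ j ∈ s, f j • expT T (w j) = 0) : ∀ j ∈ s, f j = 0 := by
  have h1 : EqOn (trigSum s f w) (fun _ => 0) (Ioo 0 T) := by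
    refine Measure.eqOn_open_of_ae_eq (μ := volume) ?_ isOpen_Ioo
      (continuous_trigSum s f w).continuousOn continuousOn_const
    have h2 := coeFn_sum_smul_expT T s f w
    rw [h] at h2
    exact h2.symm.trans (Lp.coeFn_zero _ _ _)
  have h2 : trigSum s f w = fun _ => 0 := by
    refine AnalyticOnNhd.eq_of_eventuallyEq (𝕜 := ℝ) (z₀ := T / 2) ?_ ?_ ?_
    · intro t _
      unfold trigSum
      exact Finset.analyticAt_fun_sum _ fun j _ => analyticAt_const.mul (analyticAt_osc _ _)
    · intro t _; exact analyticAt_const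
    · filter_upwards [Ioo_mem_nhds (show 0 < T / 2 by linarith) (show T / 2 < T by linarith)]
        with t ht using h1 ht
  let e : ℝ → (Multiplicative ℝ →* ℂ) := fun v =>
    { toFun := fun t => osc v t.toAdd
      map_one' := osc_zero v
      map_mul' := fun t t' => osc_add_right v _ _ }
  have he : Function.Injective e := by
    intro v v' hvv
    have h3 : osc v = osc v' := by
      funext t
      exact congrArg (fun F : Multiplicative ℝ →* ℂ => F (Multiplicative.ofAdd t)) hvv
    have h4 := (hasDerivAt_osc v 0).unique (h3 ▸ hasDerivAt_osc v' 0)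
    simp only [osc_zero, mul_one] at h4
    exact_mod_cast mul_left_cancel₀ Complex.I_ne_zero h4
  have hli := (linearIndependent_monoidHom (Multiplicative ℝ) ℂ).comp e he
  have hli2 := (hli.comp (fun j : s => w j) (by
    intro a b hab; exact Subtype.ext (hw a.2 b.2 hab)))
  rw [Fintype.linearIndependent_iff] at hli2
  have h5 := hli2 (fun j => f j) (by
    funext t
    have := congrFun h2 t.toAdd
    rw [trigSum, ← Finset.sum_coe_sort] at this
    rw [Finset.sum_apply]
    exact this)
  intro j hj
  exact h5 ⟨j, hj⟩

end Exponentials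

/-! ### The Fourier symbols -/

section Symbols

/-- The denominator of the acoustic symbol. -/
def symbolDen (η : ℝ) : ℝ := 11 + 4 * Real.cos (η / 2) ^ 2 + √(symbolDisc η)

theorem cos_sq_le_one' (η : ℝ) : Real.cos (η / 2) ^ 2 ≤ 1 := Real.cos_sq_le_one _

theorem sin_half_sq (η : ℝ) : Real.sin (η / 2) ^ 2 = 1 - Real.cos (η / 2) ^ 2 := by
  linarith [Real.sin_sq_add_cos_sq (η / 2)]

theorem one_le_symbolDisc (η : ℝ) : 1 ≤ symbolDisc η := by
  have h1 := cos_sq_le_one' η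
  have h2 := sq_nonneg (Real.cos (η / 2))
  have e : Real.cos (η / 2) ^ 4 = (Real.cos (η / 2) ^ 2) ^ 2 := by ring
  rw [symbolDisc, e]
  nlinarith

theorem symbolDisc_le (η : ℝ) : symbolDisc η ≤ 15 ^ 2 := by
  have h1 := cos_sq_le_one' η
  have h2 := sq_nonneg (Real.cos (η / 2))
  have e : Real.cos (η / 2) ^ 4 = (Real.cos (η / 2) ^ 2) ^ 2 := by ring
  rw [symbolDisc, e]
  nlinarith

theorem one_le_sqrt_symbolDisc (η : ℝ) : 1 ≤ √(symbolDisc η) := by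
  rw [Real.one_le_sqrt]; exact one_le_symbolDisc η

theorem sqrt_symbolDisc_le (η : ℝ) : √(symbolDisc η) ≤ 15 :=
  Real.sqrt_le_iff.2 ⟨by norm_num, symbolDisc_le η⟩

theorem symbolDen_ge (η : ℝ) : 12 + 4 * Real.cos (η / 2) ^ 2 ≤ symbolDen η := by
  have := one_le_sqrt_symbolDisc η
  rw [symbolDen]; linarith

theorem twelve_le_symbolDen (η : ℝ) : 12 ≤ symbolDen η := by
  have := symbolDen_ge η
  have := sq_nonneg (Real.cos (η / 2)); linarith

theorem symbolDen_pos (η : ℝ) : 0 < symbolDen η := by linarith [twelve_le_symbolDen η]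

theorem symbolDen_le (η : ℝ) : symbolDen η ≤ 30 := by
  have := sqrt_symbolDisc_le η
  have := cos_sq_le_one' η
  rw [symbolDen]; linarith

theorem symbolDen_quadratic (η : ℝ) :
    symbolDen η ^ 2 - (22 + 8 * Real.cos (η / 2) ^ 2) * symbolDen η +
      60 * (Real.sin (η / 2) ^ 2 * (1 + Real.sin (η / 2) ^ 2)) = 0 := by
  have h := Real.sq_sqrt (zero_le_one.trans (one_le_symbolDisc η))
  have h2 : symbolDisc η = 1 + 268 * Real.cos (η / 2) ^ 2 - 44 * Real.cos (η / 2) ^ 4 := rfl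
  rw [h2] at h
  rw [sin_half_sq, symbolDen, h2]
  linear_combination h

theorem acousticSymbol_eq (η : ℝ) :
    acousticSymbol η = 120 * Real.sin (η / 2) ^ 2 / symbolDen η := rfl

theorem opticSymbol_eq (η : ℝ) :
    opticSymbol η = 2 * symbolDen η / (1 + Real.sin (η / 2) ^ 2) := by
  rw [opticSymbol, symbolDen]; ring

theorem acousticSymbol_nonneg (η : ℝ) : 0 ≤ acousticSymbol η := by
  have := symbolDen_pos η
  rw [acousticSymbol_eq]; positivity

theorem acousticSymbol_ge (η : ℝ) : 4 * Real.sin (η / 2) ^ 2 ≤ acousticSymbol η := by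
  rw [acousticSymbol_eq, le_div_iff₀ (symbolDen_pos η)]
  nlinarith [symbolDen_le η, sq_nonneg (Real.sin (η / 2))]

theorem acousticSymbol_le (η : ℝ) : acousticSymbol η ≤ 10 * Real.sin (η / 2) ^ 2 := by
  rw [acousticSymbol_eq, div_le_iff₀ (symbolDen_pos η)]
  nlinarith [twelve_le_symbolDen η, sq_nonneg (Real.sin (η / 2))]

theorem acousticSymbol_le_ten (η : ℝ) : acousticSymbol η ≤ 10 := by
  have := acousticSymbol_le η
  have := Real.sin_sq_le_one (η / 2)
  linarith

theorem twelve_le_opticSymbol (η : ℝ) : 12 ≤ opticSymbol η := by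
  have h := sq_nonneg (Real.sin (η / 2))
  have := Real.sin_sq_le_one (η / 2)
  rw [opticSymbol_eq, le_div_iff₀ (by positivity)]
  linarith [twelve_le_symbolDen η]

theorem opticSymbol_le (η : ℝ) : opticSymbol η ≤ 60 := by
  have h := sq_nonneg (Real.sin (η / 2))
  rw [opticSymbol_eq, div_le_iff₀ (by positivity)]
  linarith [symbolDen_le η]

/-- The characteristic equation, solved for `sin² (η/2)`. -/
theorem acoustic_quadratic (η : ℝ) :
    Real.sin (η / 2) ^ 2 * (acousticSymbol η ^ 2 + 16 * acousticSymbol η + 240) =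
      acousticSymbol η * (60 - acousticSymbol η) := by
  have h := symbolDen_quadratic η
  have h0 := (symbolDen_pos η).ne'
  rw [acousticSymbol_eq]
  have hc : Real.cos (η / 2) ^ 2 = 1 - Real.sin (η / 2) ^ 2 := by linarith [sin_half_sq η]
  rw [hc] at h
  set s := Real.sin (η / 2)
  set D := symbolDen η
  field_simp
  linear_combination 240 * s ^ 2 * h

theorem optic_quadratic (η : ℝ) :
    Real.sin (η / 2) ^ 2 * (opticSymbol η ^ 2 + 16 * opticSymbol η + 240) =
      opticSymbol η * (60 - opticSymbol η) := by
  have h := symbolDen_quadratic η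
  have h0 : 1 + Real.sin (η / 2) ^ 2 ≠ 0 := by positivity
  rw [opticSymbol_eq]
  have hc : Real.cos (η / 2) ^ 2 = 1 - Real.sin (η / 2) ^ 2 := by linarith [sin_half_sq η]
  rw [hc] at h
  set s := Real.sin (η / 2)
  set D := symbolDen η
  field_simp
  linear_combination 4 * (1 + s ^ 2) * h

theorem sin_half_nonneg {η : ℝ} (h : η ∈ Icc 0 Real.pi) : 0 ≤ Real.sin (η / 2) :=
  Real.sin_nonneg_of_nonneg_of_le_pi (by linarith [h.1]) (by linarith [h.2, Real.pi_pos])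

theorem cos_half_nonneg {η : ℝ} (h : η ∈ Icc 0 Real.pi) : 0 ≤ Real.cos (η / 2) :=
  Real.cos_nonneg_of_neg_pi_div_two_le_of_le (by linarith [h.1, Real.pi_pos]) (by linarith [h.2])

theorem antitoneOn_cos_half_sq : AntitoneOn (fun η => Real.cos (η / 2) ^ 2) (Icc 0 Real.pi) := by
  intro η hη η' hη' h
  have := Real.cos_le_cos_of_nonneg_of_le_pi (x := η / 2) (y := η' / 2) (by linarith [hη.1])
    (by linarith [hη'.2, Real.pi_pos]) (by linarith)
  exact pow_le_pow_left₀ (cos_half_nonneg hη') this 2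

theorem antitoneOn_symbolDen : AntitoneOn symbolDen (Icc 0 Real.pi) := by
  intro η hη η' hη' h
  have h1 : Real.cos (η' / 2) ^ 2 ≤ Real.cos (η / 2) ^ 2 := antitoneOn_cos_half_sq hη hη' h
  have h2 := cos_sq_le_one' η
  have h3 : symbolDisc η' ≤ symbolDisc η := by
    have e : ∀ c : ℝ, c ^ 4 = (c ^ 2) ^ 2 := fun c => by ring
    rw [symbolDisc, symbolDisc, e, e]
    nlinarith
  have := Real.sqrt_le_sqrt h3
  rw [symbolDen, symbolDen]; linarith

theorem contDiff_symbolDen : ContDiff ℝ 1 symbolDen := by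
  have h : ContDiff ℝ 1 symbolDisc := by unfold symbolDisc; fun_prop
  have h2 : ContDiff ℝ 1 fun η => √(symbolDisc η) :=
    h.sqrt fun η => (zero_lt_one.trans_le (one_le_symbolDisc η)).ne'
  unfold symbolDen
  fun_prop

/-- A smooth function which is the acoustic dispersion relation on `[0,π]`. -/
def acousticSpeed (η : ℝ) : ℝ := Real.sin (η / 2) * √(120 / symbolDen η)

theorem differentiable_sqrt_div_symbolDen : Differentiable ℝ fun η => √(120 / symbolDen η) := by
  have h1 : Differentiable ℝ symbolDen := contDiff_symbolDen.differentiable one_ne_zero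
  refine Differentiable.sqrt ?_ fun η => ?_
  · exact (differentiable_const _).div h1 fun η => (symbolDen_pos η).ne'
  · have := symbolDen_pos η
    positivity

theorem dispersion_acoustic_eq {η : ℝ} (hη : η ∈ Icc 0 Real.pi) :
    dispersion acousticSymbol η = acousticSpeed η := by
  have := symbolDen_pos η
  rw [dispersion, acousticSymbol_eq, acousticSpeed, mul_comm 120, mul_div_assoc,
    Real.sqrt_mul (sq_nonneg _), Real.sqrt_sq (sin_half_nonneg hη)]

theorem hasDerivAt_sin_half (η : ℝ) :
    HasDerivAt (fun η => Real.sin (η / 2)) (Real.cos (η / 2) / 2) η := by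
  have h : HasDerivAt (fun η : ℝ => η / 2) (1 / 2) η := (hasDerivAt_id η).div_const 2
  refine h.sin.congr_deriv ?_
  ring

theorem differentiable_acousticSpeed : Differentiable ℝ acousticSpeed := by
  intro η
  exact (hasDerivAt_sin_half η).differentiableAt.mul (differentiable_sqrt_div_symbolDen η)

theorem hasDerivAt_acousticSpeed_zero : HasDerivAt acousticSpeed 1 0 := by
  have h := (hasDerivAt_sin_half 0).mul (differentiable_sqrt_div_symbolDen 0).hasDerivAt
  refine h.congr_deriv ?_
  have hD : symbolDen 0 = 30 := by
    have : symbolDisc 0 = 15 ^ 2 := by simp [symbolDisc]; norm_num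
    rw [symbolDen, this, Real.sqrt_sq (by norm_num)]; simp; norm_num
  have h4 : √(120 / 30 : ℝ) = 2 := by
    rw [show (120 / 30 : ℝ) = 2 ^ 2 by norm_num, Real.sqrt_sq (by norm_num)]
  simp [hD, h4]

theorem uniqueDiffWithinAt_Icc_pi {η : ℝ} (hη : η ∈ Icc 0 Real.pi) :
    UniqueDiffWithinAt ℝ (Icc 0 Real.pi) η := uniqueDiffOn_Icc Real.pi_pos η hη

theorem groupVelocity_acoustic_eq {η : ℝ} (hη : η ∈ Icc 0 Real.pi) :
    groupVelocity acousticSymbol η = deriv acousticSpeed η := by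
  rw [groupVelocity, derivWithin_congr (f := acousticSpeed)
    (fun η hη => dispersion_acoustic_eq hη) (dispersion_acoustic_eq hη)]
  exact (differentiable_acousticSpeed η).derivWithin (uniqueDiffWithinAt_Icc_pi hη)

theorem groupVelocity_acoustic_zero : groupVelocity acousticSymbol 0 = 1 := by
  rw [groupVelocity_acoustic_eq ⟨le_rfl, Real.pi_pos.le⟩, hasDerivAt_acousticSpeed_zero.deriv]

theorem cos_half_le_groupVelocity {η : ℝ} (hη : η ∈ Icc 0 Real.pi) :
    Real.cos (η / 2) ≤ groupVelocity acousticSymbol η := by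
  rw [groupVelocity_acoustic_eq hη]
  set w : ℝ → ℝ := fun η => √(120 / symbolDen η) with hw
  have hmono : MonotoneOn w (Icc 0 Real.pi) := by
    intro η hη η' hη' h
    have h1 := antitoneOn_symbolDen hη hη' h
    have h2 := symbolDen_pos η'
    exact Real.sqrt_le_sqrt (by gcongr)
  have hd : 0 ≤ deriv w η := by
    rw [← (differentiable_sqrt_div_symbolDen η).derivWithin (uniqueDiffWithinAt_Icc_pi hη)]
    exact hmono.derivWithin_nonneg
  have h := ((hasDerivAt_sin_half η).mul (differentiable_sqrt_div_symbolDen η).hasDerivAt).deriv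
  have e : deriv acousticSpeed η = Real.cos (η / 2) / 2 * w η + Real.sin (η / 2) * deriv w η := h
  have hw2 : 2 ≤ w η := by
    refine Real.le_sqrt_of_sq_le ?_
    rw [le_div_iff₀ (symbolDen_pos η)]
    linarith [symbolDen_le η]
  rw [e]
  have := mul_nonneg (sin_half_nonneg hη) hd
  have := mul_le_mul_of_nonneg_left hw2 (cos_half_nonneg hη)
  linarith

theorem acousticSpeed_sq (η : ℝ) : acousticSpeed η ^ 2 = acousticSymbol η := by
  have := symbolDen_pos η
  rw [acousticSpeed, mul_pow, Real.sq_sqrt (by positivity), acousticSymbol_eq]; ring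

theorem acoustic_group_polynomial {A : ℝ} (h0 : 0 ≤ A) (h1 : A ≤ 9 / 2) :
    4 * (14400 - 480 * A - 76 * A ^ 2) ^ 2 ≤
      (60 - A) * (2 * A ^ 2 - 44 * A + 240) * (A ^ 2 + 16 * A + 240) ^ 2 := by
  have e : (60 - A) * (2 * A ^ 2 - 44 * A + 240) * (A ^ 2 + 16 * A + 240) ^ 2 -
      4 * (14400 - 480 * A - 76 * A ^ 2) ^ 2 =
      A ^ 2 * (806400 * (9 / 2 - A) + 2131200 + 4480 * A ^ 2 + 896 * A ^ 3 +
        2 * A ^ 4 * (50 - A)) := by ring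
  have h2 : 0 ≤ 9 / 2 - A := by linarith
  have h3 : 0 ≤ 50 - A := by linarith
  have : 0 ≤ A ^ 2 * (806400 * (9 / 2 - A) + 2131200 + 4480 * A ^ 2 + 896 * A ^ 3 +
        2 * A ^ 4 * (50 - A)) := by positivity
  linarith

theorem one_le_of_implicit_derivative {sn cs l d : ℝ} (hl : 0 < l) (hA : l ^ 2 ≤ 9 / 2)
    (hsc : sn ^ 2 + cs ^ 2 = 1)
    (hq : sn ^ 2 * ((l ^ 2) ^ 2 + 16 * l ^ 2 + 240) = l ^ 2 * (60 - l ^ 2))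
    (hE : 2 * l * d * (60 - 2 * l ^ 2 - sn ^ 2 * (2 * l ^ 2 + 16)) =
      sn * cs * ((l ^ 2) ^ 2 + 16 * l ^ 2 + 240)) : 1 ≤ d ∨ sn * cs ≤ 0 := by
  by_contra! hcon
  obtain ⟨hlt, hpos⟩ := hcon
  have hA0 : 0 < l ^ 2 := by positivity
  obtain ⟨A, hAl⟩ : ∃ A, A = l ^ 2 := ⟨_, rfl⟩
  rw [← hAl] at hA hq hE hA0
  obtain ⟨Q, hQ⟩ : ∃ Q, Q = A ^ 2 + 16 * A + 240 := ⟨_, rfl⟩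
  rw [← hQ] at hq hE
  have hQ0 : 0 < Q := by rw [hQ]; positivity
  obtain ⟨W, hW⟩ : ∃ W, W = 60 - 2 * A - sn ^ 2 * (2 * A + 16) := ⟨_, rfl⟩
  rw [← hW] at hE
  have hWQ : W * Q = 14400 - 480 * A - 76 * A ^ 2 := by
    have : W * Q = (60 - 2 * A) * Q - sn ^ 2 * Q * (2 * A + 16) := by rw [hW]; ring
    rw [this, hq, hQ]; ring
  have hW0 : 0 < W := by
    have : 0 < W * Q := by rw [hWQ]; nlinarith
    exact (pos_iff_pos_of_mul_pos this).2 hQ0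
  have h5 : sn * cs * Q < 2 * l * W := by
    rw [← hE]
    have h : 0 < 2 * l * W := by positivity
    calc 2 * l * d * W = d * (2 * l * W) := by ring
      _ < 1 * (2 * l * W) := mul_lt_mul_of_pos_right hlt h
      _ = _ := one_mul _
  have h6 : (sn * cs * Q) ^ 2 * Q ^ 2 < (2 * l * W) ^ 2 * Q ^ 2 := by
    have : 0 < sn * cs * Q := by positivity
    gcongr
  have h7 : cs ^ 2 * Q = 2 * A ^ 2 - 44 * A + 240 := by
    rw [show cs ^ 2 = 1 - sn ^ 2 by linarith, sub_mul, hq, hQ]; ring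
  have e1 : (sn * cs * Q) ^ 2 * Q ^ 2 =
      A * ((60 - A) * (2 * A ^ 2 - 44 * A + 240) * Q ^ 2) := by
    have : (sn * cs * Q) ^ 2 * Q ^ 2 = (sn ^ 2 * Q) * (cs ^ 2 * Q) * Q ^ 2 := by ring
    rw [this, h7, hq]; ring
  have e2 : (2 * l * W) ^ 2 * Q ^ 2 = A * (4 * (14400 - 480 * A - 76 * A ^ 2) ^ 2) := by
    rw [← hWQ, hAl]; ring
  rw [e1, e2] at h6
  have h8 := acoustic_group_polynomial hA0.le hA
  rw [← hQ] at h8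
  exact absurd (mul_le_mul_of_nonneg_left h8 hA0.le) (not_le.2 h6)

/-- The acoustic group velocity is at least `1` on `[0,2π/3]`. -/
theorem one_le_groupVelocity {η : ℝ} (h0 : 0 < η) (h1 : η ≤ 2 * Real.pi / 3) :
    1 ≤ groupVelocity acousticSymbol η := by
  have hpi := Real.pi_pos
  have hη : η ∈ Icc 0 Real.pi := ⟨h0.le, by linarith⟩
  rw [groupVelocity_acoustic_eq hη]
  set d := deriv acousticSpeed η with hd
  set A := acousticSymbol η with hA
  set l := acousticSpeed η with hl
  have hs0 : 0 < Real.sin (η / 2) := Real.sin_pos_of_pos_of_lt_pi (by linarith) (by linarith)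
  have hc0 : 0 < Real.cos (η / 2) :=
    Real.cos_pos_of_mem_Ioo ⟨by linarith, by linarith⟩
  have hl0 : 0 < l := by
    have := symbolDen_pos η
    rw [hl, acousticSpeed]; positivity
  have hlA : l ^ 2 = A := acousticSpeed_sq η
  have hc : (1 / 4 : ℝ) ≤ Real.cos (η / 2) ^ 2 := by
    have := Real.cos_le_cos_of_nonneg_of_le_pi (x := η / 2) (y := Real.pi / 3) (by linarith)
      (by linarith) (by linarith)
    rw [Real.cos_pi_div_three] at this
    nlinarith
  have hA10 := acousticSymbol_le_ten η
  have hA0 : 0 < A := by rw [← hlA]; positivity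
  have hq := acoustic_quadratic η
  rw [← hA] at hq hA10
  set y := Real.sin (η / 2) ^ 2 with hy
  have hyc : y = 1 - Real.cos (η / 2) ^ 2 := sin_half_sq η
  set Q := A ^ 2 + 16 * A + 240 with hQ
  have hQ0 : 0 < Q := by positivity
  have hA45 : A ≤ 9 / 2 := by
    have : A * (60 - A) ≤ 3 / 4 * Q := by rw [← hq]; gcongr; linarith
    rw [hQ] at this
    nlinarith
  -- differentiate the characteristic equation
  have hderiv := (differentiable_acousticSpeed η).hasDerivAt
  rw [← hd] at hderiv
  have hAd : HasDerivAt acousticSymbol (2 * l * d) η := by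
    have h2 := hderiv.fun_pow 2
    simp only [acousticSpeed_sq] at h2
    refine h2.congr_deriv ?_
    simp [hl]
  have hL := ((hasDerivAt_sin_half η).fun_pow 2).fun_mul
    (((hAd.fun_pow 2).fun_add (hAd.const_mul 16)).add_const 240)
  have hR := hAd.fun_mul (hAd.const_sub 60)
  simp only [acoustic_quadratic] at hL
  have hE := hL.unique hR
  simp only [← hA, ← hy] at hE
  have := one_le_of_implicit_derivative (sn := Real.sin (η / 2)) (cs := Real.cos (η / 2))
    (l := l) (d := d) hl0 (hlA ▸ hA45) (Real.sin_sq_add_cos_sq _) (by rw [hlA]; exact hq) (by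
      rw [hlA]
      norm_num at hE
      linear_combination (-1 : ℝ) * hE)
  rcases this with h | h
  · exact h
  · exact absurd (mul_pos hs0 hc0) (not_lt.2 h)

end Symbols

section Dispersion

/-- Lower bounds of the derivative on `[0,π]` give lower bounds of the increments. -/
theorem mul_sub_le_of_le_derivWithin {f : ℝ → ℝ} {a b m : ℝ} (hf : DifferentiableOn ℝ f (Icc 0 Real.pi))
    (ha : 0 ≤ a) (hb : b ≤ Real.pi)
    (hm : ∀ η ∈ Ioo a b, m ≤ derivWithin f (Icc 0 Real.pi) η) {x y : ℝ} (hx : x ∈ Icc a b)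
    (hy : y ∈ Icc a b) (hxy : x ≤ y) : m * (y - x) ≤ f y - f x := by
  have hsub : Icc a b ⊆ Icc 0 Real.pi := Icc_subset_Icc ha hb
  have hn : ∀ η ∈ Ioo a b, Icc 0 Real.pi ∈ 𝓝 η := fun η hη =>
    Icc_mem_nhds (ha.trans_lt hη.1) (hη.2.trans_le hb)
  refine (convex_Icc a b).mul_sub_le_image_sub_of_le_deriv (hf.mono hsub).continuousOn ?_ ?_
    x hx y hy hxy
  · rw [interior_Icc]
    exact hf.mono (Ioo_subset_Icc_self.trans hsub)
  · rw [interior_Icc]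
    intro η hη
    rw [← derivWithin_of_mem_nhds (hn η hη)]
    exact hm η hη

theorem differentiableOn_dispersion_acoustic :
    DifferentiableOn ℝ (dispersion acousticSymbol) (Icc 0 Real.pi) :=
  differentiable_acousticSpeed.differentiableOn.congr fun _ hη => dispersion_acoustic_eq hη

theorem sub_le_dispersion_acoustic_sub {x y : ℝ} (hx : 0 ≤ x) (hxy : x ≤ y)
    (hy : y ≤ 2 * Real.pi / 3) :
    y - x ≤ dispersion acousticSymbol y - dispersion acousticSymbol x := by
  have hpi := Real.pi_pos
  have := mul_sub_le_of_le_derivWithin (a := 0) (b := 2 * Real.pi / 3) (m := 1)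
    differentiableOn_dispersion_acoustic le_rfl (by linarith)
    (fun η hη => one_le_groupVelocity hη.1 hη.2.le) ⟨hx, hxy.trans hy⟩ ⟨hx.trans hxy, hy⟩ hxy
  linarith

theorem strictMonoOn_dispersion_acoustic :
    StrictMonoOn (dispersion acousticSymbol) (Icc 0 Real.pi) := by
  refine strictMonoOn_of_deriv_pos (convex_Icc _ _)
    differentiableOn_dispersion_acoustic.continuousOn fun η hη => ?_
  rw [interior_Icc] at hη
  have h := cos_half_le_groupVelocity (Ioo_subset_Icc_self hη)
  rw [groupVelocity, derivWithin_of_mem_nhds (Icc_mem_nhds hη.1 hη.2)] at h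
  have : 0 < Real.cos (η / 2) :=
    Real.cos_pos_of_mem_Ioo ⟨by linarith [hη.1, Real.pi_pos], by linarith [hη.2]⟩
  linarith

theorem two_mul_sin_half_le_dispersion (η : ℝ) :
    2 * Real.sin (η / 2) ≤ dispersion acousticSymbol η := by
  refine Real.le_sqrt_of_sq_le ?_
  have := acousticSymbol_ge η
  nlinarith

theorem dispersion_acoustic_le_sin {η : ℝ} (hη : η ∈ Icc 0 Real.pi) :
    dispersion acousticSymbol η ≤ 4 * Real.sin (η / 2) := by
  have h := sin_half_nonneg hη
  refine Real.sqrt_le_iff.2 ⟨by positivity, ?_⟩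
  have := acousticSymbol_le η
  nlinarith

theorem dispersion_acoustic_le (η : ℝ) : dispersion acousticSymbol η ≤ √10 :=
  Real.sqrt_le_sqrt (acousticSymbol_le_ten η)

theorem le_dispersion_optic (η : ℝ) : √12 ≤ dispersion opticSymbol η :=
  Real.sqrt_le_sqrt (twelve_le_opticSymbol η)

theorem dispersion_optic_le (η : ℝ) : dispersion opticSymbol η ≤ 8 := by
  refine Real.sqrt_le_iff.2 ⟨by norm_num, ?_⟩
  linarith [opticSymbol_le η]

theorem dispersion_optic_pos (η : ℝ) : 0 < dispersion opticSymbol η :=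
  lt_of_lt_of_le (by positivity) (le_dispersion_optic η)

theorem dispersion_acoustic_pos {η : ℝ} (hη : η ∈ Ioc 0 Real.pi) :
    0 < dispersion acousticSymbol η := by
  refine lt_of_lt_of_le ?_ (two_mul_sin_half_le_dispersion η)
  have := Real.sin_pos_of_pos_of_lt_pi (x := η / 2) (by linarith [hη.1])
    (by linarith [hη.2, Real.pi_pos])
  linarith

theorem tendsto_dispersion_acoustic {c : ℝ} (hc : 0 ≤ c) :
    Tendsto (fun h => dispersion acousticSymbol (c * h) / h) (𝓝[>] 0) (𝓝 c) := by
  have hd : HasDerivAt (fun h : ℝ => acousticSpeed (c * h)) c 0 := by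
    have h1 : HasDerivAt (fun h : ℝ => c * h) c 0 := by
      simpa using (hasDerivAt_id (0 : ℝ)).const_mul c
    have := HasDerivAt.comp_of_eq (0 : ℝ) hasDerivAt_acousticSpeed_zero h1 (by simp)
    simpa [Function.comp_def] using this
  have h2 := (hasDerivAt_iff_tendsto_slope_zero.1 hd).mono_left
    (nhdsWithin_mono 0 (fun x (hx : 0 < x) => hx.ne'))
  have hev : ∀ᶠ h in 𝓝[>] (0 : ℝ), c * h < Real.pi := by
    have : Tendsto (fun h : ℝ => c * h) (𝓝 0) (𝓝 0) := by
      simpa using (continuous_const_mul c).tendsto (0 : ℝ)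
    exact (this.mono_left nhdsWithin_le_nhds).eventually (gt_mem_nhds Real.pi_pos)
  refine h2.congr' ?_
  filter_upwards [hev, self_mem_nhdsWithin] with h h3 h4
  have h5 : (0 : ℝ) < h := h4
  rw [dispersion_acoustic_eq ⟨by positivity, h3.le⟩]
  simp [acousticSpeed, div_eq_inv_mul]

theorem differentiable_opticSymbol : Differentiable ℝ opticSymbol := by
  have h1 : Differentiable ℝ symbolDen := contDiff_symbolDen.differentiable one_ne_zero
  have e : opticSymbol = fun η => 2 * symbolDen η / (1 + Real.sin (η / 2) ^ 2) :=
    funext opticSymbol_eq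
  rw [e]
  refine (h1.const_mul 2).div (by fun_prop) fun η => ?_
  positivity

theorem opticSymbol_pos (η : ℝ) : 0 < opticSymbol η := by linarith [twelve_le_opticSymbol η]

theorem differentiable_dispersion_optic : Differentiable ℝ (dispersion opticSymbol) :=
  differentiable_opticSymbol.sqrt fun η => (opticSymbol_pos η).ne'

theorem groupVelocity_optic_le {η : ℝ} (hη : η ∈ Icc 0 Real.pi) :
    groupVelocity opticSymbol η ≤ -(3 / 8 * (Real.sin (η / 2) * Real.cos (η / 2))) := by
  have hd : Differentiable ℝ symbolDen := contDiff_symbolDen.differentiable one_ne_zero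
  have hD' : deriv symbolDen η ≤ 0 := by
    rw [← (hd η).derivWithin (uniqueDiffWithinAt_Icc_pi hη)]
    exact antitoneOn_symbolDen.derivWithin_nonpos
  have hs := sin_half_nonneg hη
  have hc := cos_half_nonneg hη
  have hs1 := Real.sin_sq_le_one (η / 2)
  have hD12 := twelve_le_symbolDen η
  have hO : HasDerivAt opticSymbol ((2 * deriv symbolDen η * (1 + Real.sin (η / 2) ^ 2) -
      2 * symbolDen η * (Real.sin (η / 2) * Real.cos (η / 2))) /
        (1 + Real.sin (η / 2) ^ 2) ^ 2) η := by
    have e : opticSymbol = fun η => 2 * symbolDen η / (1 + Real.sin (η / 2) ^ 2) :=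
      funext opticSymbol_eq
    rw [e]
    have h1 : HasDerivAt (fun η => 1 + Real.sin (η / 2) ^ 2)
        (Real.sin (η / 2) * Real.cos (η / 2)) η := by
      refine (((hasDerivAt_sin_half η).fun_pow 2).const_add 1).congr_deriv ?_
      norm_num; ring
    exact ((hd η).hasDerivAt.const_mul 2).fun_div h1 (by positivity)
  have hO' : deriv opticSymbol η ≤ -(6 * (Real.sin (η / 2) * Real.cos (η / 2))) := by
    rw [hO.deriv, div_le_iff₀ (by positivity)]
    set s := Real.sin (η / 2)
    set c := Real.cos (η / 2)
    have hsc : 0 ≤ s * c := mul_nonneg hs hc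
    have h1 : (1 + s ^ 2) ^ 2 ≤ 4 := by nlinarith [sq_nonneg s]
    have h2 : deriv symbolDen η * (1 + s ^ 2) ≤ 0 :=
      mul_nonpos_of_nonpos_of_nonneg hD' (by positivity)
    have h3 := mul_le_mul_of_nonneg_left h1 hsc
    have h4 := mul_le_mul_of_nonneg_right hD12 hsc
    linarith
  have hl := dispersion_optic_pos η
  have hl8 := dispersion_optic_le η
  rw [groupVelocity, (differentiable_dispersion_optic η).derivWithin (uniqueDiffWithinAt_Icc_pi hη)]
  have h5 : deriv (dispersion opticSymbol) η = deriv opticSymbol η / (2 * dispersion opticSymbol η) :=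
    ((differentiable_opticSymbol η).hasDerivAt.sqrt (opticSymbol_pos η).ne').deriv
  rw [h5, div_le_iff₀ (by positivity)]
  have hsc : 0 ≤ Real.sin (η / 2) * Real.cos (η / 2) := mul_nonneg hs hc
  nlinarith

theorem strictAntiOn_dispersion_optic :
    StrictAntiOn (dispersion opticSymbol) (Icc 0 Real.pi) := by
  refine strictAntiOn_of_deriv_neg (convex_Icc _ _)
    differentiable_dispersion_optic.continuous.continuousOn fun η hη => ?_
  rw [interior_Icc] at hη
  have h := groupVelocity_optic_le (Ioo_subset_Icc_self hη)
  rw [groupVelocity, derivWithin_of_mem_nhds (Icc_mem_nhds hη.1 hη.2)] at h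
  have h1 : 0 < Real.cos (η / 2) :=
    Real.cos_pos_of_mem_Ioo ⟨by linarith [hη.1, Real.pi_pos], by linarith [hη.2]⟩
  have h2 : 0 < Real.sin (η / 2) :=
    Real.sin_pos_of_pos_of_lt_pi (by linarith [hη.1]) (by linarith [hη.2, Real.pi_pos])
  have := mul_pos h2 h1
  linarith

theorem symbolDen_pi : symbolDen Real.pi = 12 := by
  rw [symbolDen, symbolDisc]; norm_num

theorem symbolDen_zero : symbolDen 0 = 30 := by
  have : symbolDisc 0 = 15 ^ 2 := by simp [symbolDisc]; norm_num
  rw [symbolDen, this, Real.sqrt_sq (by norm_num)]; simp; norm_num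

theorem continuous_acousticSymbol : Continuous acousticSymbol := by
  have e : acousticSymbol = fun η => acousticSpeed η ^ 2 := funext fun η => (acousticSpeed_sq η).symm
  rw [e]
  exact differentiable_acousticSpeed.continuous.pow 2

theorem wavenumber_acoustic {c : ℝ} (h0 : 0 < c) (h1 : c < 10) :
    wavenumber acousticSymbol c ∈ Ioo 0 Real.pi ∧
      acousticSymbol (wavenumber acousticSymbol c) = c := by
  have hz : acousticSymbol 0 = 0 := by simp [acousticSymbol]
  have hp : acousticSymbol Real.pi = 10 := by
    rw [acousticSymbol_eq, symbolDen_pi]; norm_num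
  have hmem : c ∈ acousticSymbol '' Icc 0 Real.pi := by
    refine intermediate_value_Icc Real.pi_pos.le continuous_acousticSymbol.continuousOn ?_
    rw [hz, hp]; exact ⟨h0.le, h1.le⟩
  have e : acousticSymbol (wavenumber acousticSymbol c) = c := Function.invFunOn_eq hmem
  have m : wavenumber acousticSymbol c ∈ Icc 0 Real.pi := Function.invFunOn_mem hmem
  refine ⟨⟨lt_of_le_of_ne m.1 ?_, lt_of_le_of_ne m.2 ?_⟩, e⟩
  · intro h
    rw [← h, hz] at e; exact h0.ne e
  · intro h
    rw [h, hp] at e; exact h1.ne' e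

theorem wavenumber_optic {c : ℝ} (h0 : 12 < c) (h1 : c < 60) :
    wavenumber opticSymbol c ∈ Ioo 0 Real.pi ∧
      opticSymbol (wavenumber opticSymbol c) = c := by
  have hz : opticSymbol 0 = 60 := by
    rw [opticSymbol_eq, symbolDen_zero]; norm_num
  have hp : opticSymbol Real.pi = 12 := by
    rw [opticSymbol_eq, symbolDen_pi]; norm_num
  have hmem : c ∈ opticSymbol '' Icc 0 Real.pi := by
    refine intermediate_value_Icc' Real.pi_pos.le
      differentiable_opticSymbol.continuous.continuousOn ?_
    rw [hz, hp]; exact ⟨h0.le, h1.le⟩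
  have e : opticSymbol (wavenumber opticSymbol c) = c := Function.invFunOn_eq hmem
  have m : wavenumber opticSymbol c ∈ Icc 0 Real.pi := Function.invFunOn_mem hmem
  refine ⟨⟨lt_of_le_of_ne m.1 ?_, lt_of_le_of_ne m.2 ?_⟩, e⟩
  · intro h
    rw [← h, hz] at e; exact h1.ne' e
  · intro h
    rw [h, hp] at e; exact h0.ne e

/-- The minimal group velocity `m` of the modes kept by the Fourier truncation. -/
theorem truncation_gap {T Λa Λm Λp : ℝ} (h1 : 0 < Λa) (h2 : Λa < 10) (h3 : 12 < Λm) (h4 : Λm ≤ Λp)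
    (h5 : Λp < 60) (hT : truncationTime Λa Λm Λp < T) :
    ∃ m : ℝ, 0 < m ∧ m ≤ 1 ∧ 2 < m * T ∧
      (∀ x y, 0 ≤ x → x ≤ y → y ≤ wavenumber acousticSymbol Λa →
        m * (y - x) ≤ dispersion acousticSymbol y - dispersion acousticSymbol x) ∧
      (∀ x y, wavenumber opticSymbol Λp ≤ x → x ≤ y → y ≤ wavenumber opticSymbol Λm →
        m * (y - x) ≤ dispersion opticSymbol x - dispersion opticSymbol y) := by
  obtain ⟨ha, -⟩ := wavenumber_acoustic h1 h2
  obtain ⟨hm, em⟩ := wavenumber_optic h3 (h4.trans_lt h5)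
  obtain ⟨hp, ep⟩ := wavenumber_optic (h3.trans_le h4) h5
  rw [truncationTime] at hT
  set ηa := wavenumber acousticSymbol Λa
  set ηm := wavenumber opticSymbol Λm
  set ηp := wavenumber opticSymbol Λp
  have hpm : ηp ≤ ηm := by
    by_contra! h
    have := strictAntiOn_dispersion_optic (Ioo_subset_Icc_self hm) (Ioo_subset_Icc_self hp) h
    rw [dispersion, dispersion, em, ep] at this
    exact absurd (Real.sqrt_le_sqrt h4) (not_le.2 this)
  set ma := sInf (groupVelocity acousticSymbol '' Icc 0 ηa) with hma
  set mo := sInf ((fun η => -groupVelocity opticSymbol η) '' Icc ηp ηm) with hmo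
  have hla : ∀ η ∈ Icc 0 ηa, Real.cos (ηa / 2) ≤ groupVelocity acousticSymbol η := by
    intro η hη
    refine le_trans ?_ (cos_half_le_groupVelocity ⟨hη.1, hη.2.trans ha.2.le⟩)
    exact Real.cos_le_cos_of_nonneg_of_le_pi (by linarith [hη.1])
      (by linarith [ha.2, Real.pi_pos]) (by linarith [hη.2])
  have hca : 0 < Real.cos (ηa / 2) :=
    Real.cos_pos_of_mem_Ioo ⟨by linarith [ha.1, Real.pi_pos], by linarith [ha.2]⟩
  have hso : 0 < Real.sin (ηp / 2) :=
    Real.sin_pos_of_pos_of_lt_pi (by linarith [hp.1]) (by linarith [hp.2, Real.pi_pos])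
  have hco : 0 < Real.cos (ηm / 2) :=
    Real.cos_pos_of_mem_Ioo ⟨by linarith [hm.1, Real.pi_pos], by linarith [hm.2]⟩
  set κ := 3 / 8 * (Real.sin (ηp / 2) * Real.cos (ηm / 2)) with hκ
  have hκ0 : 0 < κ := by positivity
  have hlo : ∀ η ∈ Icc ηp ηm, κ ≤ -groupVelocity opticSymbol η := by
    intro η hη
    have h := groupVelocity_optic_le (η := η) ⟨hp.1.le.trans hη.1, hη.2.trans hm.2.le⟩
    have hs : Real.sin (ηp / 2) ≤ Real.sin (η / 2) :=
      Real.sin_le_sin_of_le_of_le_pi_div_two (by linarith [hp.1, Real.pi_pos])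
        (by linarith [hη.2, hm.2]) (by linarith [hη.1])
    have hc : Real.cos (ηm / 2) ≤ Real.cos (η / 2) :=
      Real.cos_le_cos_of_nonneg_of_le_pi (by linarith [hη.1, hp.1])
        (by linarith [hm.2, Real.pi_pos]) (by linarith [hη.2])
    have : Real.sin (ηp / 2) * Real.cos (ηm / 2) ≤ Real.sin (η / 2) * Real.cos (η / 2) :=
      mul_le_mul hs hc hco.le (hso.le.trans hs)
    rw [hκ]; linarith
  have hbdda : BddBelow (groupVelocity acousticSymbol '' Icc 0 ηa) := by
    refine ⟨Real.cos (ηa / 2), ?_⟩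
    rintro _ ⟨η, hη, rfl⟩; exact hla η hη
  have hbddo : BddBelow ((fun η => -groupVelocity opticSymbol η) '' Icc ηp ηm) := by
    refine ⟨κ, ?_⟩
    rintro _ ⟨η, hη, rfl⟩; exact hlo η hη
  have hma0 : Real.cos (ηa / 2) ≤ ma := by
    refine le_csInf ⟨_, 0, ⟨le_rfl, ha.1.le⟩, rfl⟩ ?_
    rintro _ ⟨η, hη, rfl⟩; exact hla η hη
  have hmo0 : κ ≤ mo := by
    refine le_csInf ⟨_, ηp, ⟨le_rfl, hpm⟩, rfl⟩ ?_
    rintro _ ⟨η, hη, rfl⟩; exact hlo η hη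
  have hma1 : ma ≤ 1 := by
    rw [← groupVelocity_acoustic_zero]
    exact csInf_le hbdda ⟨0, ⟨le_rfl, ha.1.le⟩, rfl⟩
  have hm0 : 0 < min ma mo := lt_min (hca.trans_le hma0) (hκ0.trans_le hmo0)
  refine ⟨min ma mo, hm0, (min_le_left _ _).trans hma1, ?_, ?_, ?_⟩
  · rwa [div_lt_iff₀ hm0, mul_comm] at hT
  · intro x y hx hxy hy
    refine mul_sub_le_of_le_derivWithin (a := 0) (b := ηa) differentiableOn_dispersion_acoustic
      le_rfl ha.2.le (fun η hη => ?_) ⟨hx, hxy.trans hy⟩ ⟨hx.trans hxy, hy⟩ hxy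
    exact (min_le_left _ _).trans (csInf_le hbdda ⟨η, Ioo_subset_Icc_self hη, rfl⟩)
  · intro x y hx hxy hy
    have hd : DifferentiableOn ℝ (fun η => -dispersion opticSymbol η) (Icc 0 Real.pi) :=
      differentiable_dispersion_optic.neg.differentiableOn
    have := mul_sub_le_of_le_derivWithin (a := ηp) (b := ηm) (m := min ma mo) hd
      hp.1.le hm.2.le (fun η hη => ?_) ⟨hx, hxy.trans hy⟩ ⟨hx.trans hxy, hy⟩ hxy
    · linarith
    · rw [derivWithin.fun_neg]
      exact (min_le_right _ _).trans (csInf_le hbddo ⟨η, Ioo_subset_Icc_self hη, rfl⟩)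

end Dispersion

/-! ### The matrices on sine vectors -/

section Grid

theorem sum_fin_ite_eq {n : ℕ} (V : ℤ → ℂ) (m : ℤ) (h : m < 0 ∨ (n : ℤ) ≤ m → V m = 0) :
    ∑ j : Fin n, (if (j.val : ℤ) = m then V j.val else 0) = V m := by
  by_cases hm : 0 ≤ m ∧ m < n
  · have hlt : m.toNat < n := by omega
    rw [Finset.sum_eq_single (⟨m.toNat, hlt⟩ : Fin n)]
    · have : ((m.toNat : ℕ) : ℤ) = m := by omega
      simp [this]
    · intro j _ hj
      rw [if_neg]
      intro h2
      apply hj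
      ext
      simp only
      omega
    · simp
  · rw [h (by omega)]
    refine Finset.sum_eq_zero fun j _ => if_neg ?_
    have := j.2
    omega

/-- A row of a matrix with the sparsity pattern of `P₂` elements. -/
theorem sum_band_mul {N : ℕ} (i : Fin (2 * N + 1)) (V : ℤ → ℂ) (h0 : V (-1) = 0)
    (h1 : V (2 * N + 1) = 0) (α β γ : ℂ) :
    ∑ j : Fin (2 * N + 1), (if i = j then α else if i.val + 1 = j.val ∨ j.val + 1 = i.val then β
        else if Odd i.val ∧ (i.val + 2 = j.val ∨ j.val + 2 = i.val) then γ else 0) * V j.val =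
      α * V i.val + β * (V (i.val + 1) + V (i.val - 1)) +
        (if Odd i.val then γ * (V (i.val + 2) + V (i.val - 2)) else 0) := by
  have hi := i.2
  set γ' := if Odd i.val then γ else 0 with hγ'
  have e : ∀ j : Fin (2 * N + 1), (if i = j then α
        else if i.val + 1 = j.val ∨ j.val + 1 = i.val then β
        else if Odd i.val ∧ (i.val + 2 = j.val ∨ j.val + 2 = i.val) then γ else 0) * V j.val =
      α * (if (j.val : ℤ) = i.val then V j.val else 0) +
      β * (if (j.val : ℤ) = i.val + 1 then V j.val else 0) +
      β * (if (j.val : ℤ) = i.val - 1 then V j.val else 0) +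
      γ' * (if (j.val : ℤ) = i.val + 2 then V j.val else 0) +
      γ' * (if (j.val : ℤ) = i.val - 2 then V j.val else 0) := by
    intro j
    by_cases c1 : i = j
    · subst c1
      have e1 : ¬ ((i.val : ℤ) = i.val - 1) := by omega
      have e3 : ¬ ((i.val : ℤ) = i.val - 2) := by omega
      simp [e1, e3]
    have c1' : ¬ ((j.val : ℤ) = i.val) := by
      intro h; apply c1; ext; omega
    by_cases c2 : i.val + 1 = j.val
    · have e1 : ¬ ((j.val : ℤ) = i.val - 1) := by omega
      have e2 : ¬ ((j.val : ℤ) = i.val + 2) := by omega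
      have e3 : ¬ ((j.val : ℤ) = i.val - 2) := by omega
      have e4 : (j.val : ℤ) = i.val + 1 := by omega
      rw [if_neg c1, if_pos (Or.inl c2), if_neg c1', if_pos e4, if_neg e1, if_neg e2, if_neg e3]
      ring
    by_cases c3 : j.val + 1 = i.val
    · have e1 : (j.val : ℤ) = i.val - 1 := by omega
      have e2 : ¬ ((j.val : ℤ) = i.val + 2) := by omega
      have e3 : ¬ ((j.val : ℤ) = i.val - 2) := by omega
      have e4 : ¬ ((j.val : ℤ) = i.val + 1) := by omega
      rw [if_neg c1, if_pos (Or.inr c3), if_neg c1', if_neg e4, if_pos e1, if_neg e2, if_neg e3]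
      ring
    have e1 : ¬ ((j.val : ℤ) = i.val - 1) := by omega
    have e4 : ¬ ((j.val : ℤ) = i.val + 1) := by omega
    rw [if_neg c1, if_neg (by tauto : ¬ (i.val + 1 = j.val ∨ j.val + 1 = i.val)), if_neg c1',
      if_neg e1, if_neg e4]
    by_cases c4 : i.val + 2 = j.val
    · have e2 : (j.val : ℤ) = i.val + 2 := by omega
      have e3 : ¬ ((j.val : ℤ) = i.val - 2) := by omega
      rw [if_pos e2, if_neg e3, hγ']
      by_cases ho : Odd i.val <;> simp [ho, c4]
    by_cases c5 : j.val + 2 = i.val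
    · have e2 : ¬ ((j.val : ℤ) = i.val + 2) := by omega
      have e3 : (j.val : ℤ) = i.val - 2 := by omega
      rw [if_pos e3, if_neg e2, hγ']
      by_cases ho : Odd i.val <;> simp [ho, c5]
    have e2 : ¬ ((j.val : ℤ) = i.val + 2) := by omega
    have e3 : ¬ ((j.val : ℤ) = i.val - 2) := by omega
    rw [if_neg e2, if_neg e3, if_neg (by tauto)]
    ring
  simp only [e, Finset.sum_add_distrib, ← Finset.mul_sum]
  have hV1 : ∀ m : ℤ, m = -1 ∨ m = 2 * N + 1 → V m = 0 := by
    rintro m (rfl | rfl) <;> assumption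
  have cast : ((2 * N + 1 : ℕ) : ℤ) = 2 * N + 1 := by push_cast; ring
  rw [sum_fin_ite_eq V i.val (by omega),
    sum_fin_ite_eq V (i.val + 1) (fun h => hV1 _ (by omega)),
    sum_fin_ite_eq V (i.val - 1) (fun h => hV1 _ (by omega))]
  by_cases ho : Odd i.val
  · obtain ⟨q, hq⟩ := ho
    have ho : Odd i.val := ⟨q, hq⟩
    rw [sum_fin_ite_eq V (i.val + 2) (fun h => hV1 _ (by omega)),
      sum_fin_ite_eq V (i.val - 2) (fun h => hV1 _ (by omega)), hγ', if_pos ho, if_pos ho]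
    ring
  · rw [hγ', if_neg ho, if_neg ho]
    ring

theorem meshSize_pos (N : ℕ) : 0 < meshSize N := by
  unfold meshSize; positivity

theorem meshSize_mul (N : ℕ) : meshSize N * (N + 1) = 1 := by
  unfold meshSize; field_simp

/-- The function on the fine mesh with values `a sin(kπx)` at the nodes and `b sin(kπx)` at the
midpoints. The index `z` stands for the point `(z+1)h/2`. -/
def sineExt (N k : ℕ) (a b : ℝ) (z : ℤ) : ℝ :=
  (if Odd z then a else b) * Real.sin (k * Real.pi * (((z : ℝ) + 1) / 2 * meshSize N))

/-- The restriction of `sineExt` to the grid. -/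
def gridSine (N k : ℕ) (a b : ℝ) : GridVec N := fun i => (sineExt N k a b i.val : ℂ)

theorem sineExt_neg_one (N k : ℕ) (a b : ℝ) : sineExt N k a b (-1) = 0 := by
  simp [sineExt]

theorem sineExt_last (N k : ℕ) (a b : ℝ) : sineExt N k a b (2 * N + 1) = 0 := by
  have h := meshSize_mul N
  have e : (k : ℝ) * Real.pi * ((((2 * N + 1 : ℤ) : ℝ) + 1) / 2 * meshSize N) = k * Real.pi := by
    push_cast
    linear_combination (k * Real.pi) * h
  rw [sineExt, e, Real.sin_nat_mul_pi, mul_zero]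

theorem sin_add_sin_shift (a d : ℝ) : Real.sin (a + d) + Real.sin (a - d) =
    2 * Real.cos d * Real.sin a := by
  rw [Real.sin_add, Real.sin_sub]; ring

/-- The wave number `η = kπh`. -/
def waveNum (N k : ℕ) : ℝ := k * Real.pi * meshSize N

theorem sineExt_shift_one (N k : ℕ) (a b : ℝ) (z : ℤ) :
    sineExt N k a b (z + 1) + sineExt N k a b (z - 1) =
      2 * Real.cos (waveNum N k / 2) * sineExt N k b a z := by
  have e := sin_add_sin_shift (k * Real.pi * (((z : ℝ) + 1) / 2 * meshSize N)) (waveNum N k / 2)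
  have e1 : (k : ℝ) * Real.pi * ((((z + 1 : ℤ) : ℝ) + 1) / 2 * meshSize N) =
      k * Real.pi * (((z : ℝ) + 1) / 2 * meshSize N) + waveNum N k / 2 := by
    rw [waveNum]; push_cast; ring
  have e2 : (k : ℝ) * Real.pi * ((((z - 1 : ℤ) : ℝ) + 1) / 2 * meshSize N) =
      k * Real.pi * (((z : ℝ) + 1) / 2 * meshSize N) - waveNum N k / 2 := by
    rw [waveNum]; push_cast; ring
  simp only [sineExt]
  rw [e1, e2]
  by_cases hz : Odd z
  · have h1 : ¬ Odd (z + 1) := by rw [Int.not_odd_iff_even]; exact hz.add_one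
    have h2 : ¬ Odd (z - 1) := by rw [Int.not_odd_iff_even]; exact hz.sub_odd odd_one
    simp only [hz, h1, h2, if_true, if_false]
    linear_combination b * e
  · have hz' := Int.not_odd_iff_even.1 hz
    have h1 : Odd (z + 1) := hz'.add_one
    have h2 : Odd (z - 1) := hz'.sub_odd odd_one
    simp only [hz, h1, h2, if_true, if_false]
    linear_combination a * e

theorem sineExt_shift_two (N k : ℕ) (a b : ℝ) (z : ℤ) :
    sineExt N k a b (z + 2) + sineExt N k a b (z - 2) =
      2 * Real.cos (waveNum N k) * sineExt N k a b z := by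
  have e := sin_add_sin_shift (k * Real.pi * (((z : ℝ) + 1) / 2 * meshSize N)) (waveNum N k)
  have e1 : (k : ℝ) * Real.pi * ((((z + 2 : ℤ) : ℝ) + 1) / 2 * meshSize N) =
      k * Real.pi * (((z : ℝ) + 1) / 2 * meshSize N) + waveNum N k := by
    rw [waveNum]; push_cast; ring
  have e2 : (k : ℝ) * Real.pi * ((((z - 2 : ℤ) : ℝ) + 1) / 2 * meshSize N) =
      k * Real.pi * (((z : ℝ) + 1) / 2 * meshSize N) - waveNum N k := by
    rw [waveNum]; push_cast; ring
  have h1 : Odd (z + 2) ↔ Odd z := by simp [parity_simps]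
  have h2 : Odd (z - 2) ↔ Odd z := by simp [parity_simps]
  simp only [sineExt, h1, h2]
  rw [e1, e2]
  linear_combination (if Odd z then a else b) * e

theorem sineExt_mul (N k : ℕ) (a b : ℝ) (z : ℤ) :
    sineExt N k a b z = (if Odd z then a else b) * sineExt N k 1 1 z := by
  simp [sineExt]

theorem massMatrix_mulVec_gridSine (N k : ℕ) (a b : ℝ) :
    massMatrix N *ᵥ gridSine N k a b =
      gridSine N k
        (meshSize N * (4 / 15 * a + 2 / 15 * Real.cos (waveNum N k / 2) * b
          - 1 / 15 * Real.cos (waveNum N k) * a))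
        (meshSize N * (8 / 15 * b + 2 / 15 * Real.cos (waveNum N k / 2) * a)) := by
  funext i
  have hb := sum_band_mul i (fun z => (sineExt N k a b z : ℂ)) (by simp [sineExt_neg_one])
    (by simp [sineExt_last]) (if Odd i.val then 4 / 15 else 8 / 15) (1 / 15) (-(1 / 30))
  have e : (massMatrix N *ᵥ gridSine N k a b) i = (meshSize N : ℂ) *
      ∑ j : Fin (2 * N + 1), (if i = j then (if Odd i.val then 4 / 15 else 8 / 15)
        else if i.val + 1 = j.val ∨ j.val + 1 = i.val then 1 / 15
        else if Odd i.val ∧ (i.val + 2 = j.val ∨ j.val + 2 = i.val) then -(1 / 30) else 0) *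
          (sineExt N k a b j.val : ℂ) := by
    rw [Matrix.mulVec, dotProduct, Finset.mul_sum]
    refine Finset.sum_congr rfl fun j _ => ?_
    simp only [massMatrix, Matrix.of_apply, gridSine]
    ring
  rw [e, hb]
  simp only [← Complex.ofReal_add, sineExt_shift_one, sineExt_shift_two, gridSine]
  have hoi : Odd (i.val : ℤ) ↔ Odd i.val := Int.odd_coe_nat _
  by_cases ho : Odd i.val
  · rw [sineExt_mul N k a, sineExt_mul N k b, sineExt_mul N k (meshSize N * _)]
    simp only [hoi, ho, if_true]
    push_cast; ring
  · rw [sineExt_mul N k a, sineExt_mul N k b, sineExt_mul N k (meshSize N * _)]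
    simp only [hoi, ho, if_false]
    push_cast; ring

theorem stiffnessMatrix_mulVec_gridSine (N k : ℕ) (a b : ℝ) :
    stiffnessMatrix N *ᵥ gridSine N k a b =
      gridSine N k
        (1 / meshSize N * (14 / 3 * a - 16 / 3 * Real.cos (waveNum N k / 2) * b
          + 2 / 3 * Real.cos (waveNum N k) * a))
        (1 / meshSize N * (16 / 3 * b - 16 / 3 * Real.cos (waveNum N k / 2) * a)) := by
  funext i
  have hb := sum_band_mul i (fun z => (sineExt N k a b z : ℂ)) (by simp [sineExt_neg_one])
    (by simp [sineExt_last]) (if Odd i.val then 14 / 3 else 16 / 3) (-(8 / 3)) (1 / 3)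
  have e : (stiffnessMatrix N *ᵥ gridSine N k a b) i = 1 / (meshSize N : ℂ) *
      ∑ j : Fin (2 * N + 1), (if i = j then (if Odd i.val then 14 / 3 else 16 / 3)
        else if i.val + 1 = j.val ∨ j.val + 1 = i.val then -(8 / 3)
        else if Odd i.val ∧ (i.val + 2 = j.val ∨ j.val + 2 = i.val) then 1 / 3 else 0) *
          (sineExt N k a b j.val : ℂ) := by
    rw [Matrix.mulVec, dotProduct, Finset.mul_sum]
    refine Finset.sum_congr rfl fun j _ => ?_
    simp only [stiffnessMatrix, Matrix.of_apply, gridSine]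
    ring
  rw [e, hb]
  simp only [← Complex.ofReal_add, sineExt_shift_one, sineExt_shift_two, gridSine]
  have hoi : Odd (i.val : ℤ) ↔ Odd i.val := Int.odd_coe_nat _
  by_cases ho : Odd i.val
  · rw [sineExt_mul N k a, sineExt_mul N k b, sineExt_mul N k (1 / meshSize N * _)]
    simp only [hoi, ho, if_true]
    push_cast; ring
  · rw [sineExt_mul N k a, sineExt_mul N k b, sineExt_mul N k (1 / meshSize N * _)]
    simp only [hoi, ho, if_false]
    push_cast; ring

theorem sum_cos_arith (n : ℕ) (a d : ℝ) :
    2 * Real.sin (d / 2) * ∑ j ∈ Finset.range n, Real.cos (a + j * d) =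
      Real.sin (a + (n - 1 / 2) * d) - Real.sin (a - d / 2) := by
  induction n with
  | zero =>
    simp only [Finset.range_zero, Finset.sum_empty, mul_zero, Nat.cast_zero]
    rw [eq_comm, sub_eq_zero]; congr 1; ring
  | succ n ih =>
    rw [Finset.sum_range_succ, mul_add, ih]
    have e : 2 * Real.sin (d / 2) * Real.cos (a + n * d) =
        Real.sin (a + (((n + 1 : ℕ) : ℝ) - 1 / 2) * d) - Real.sin (a + (n - 1 / 2) * d) := by
      have h1 : a + (((n + 1 : ℕ) : ℝ) - 1 / 2) * d = (a + n * d) + d / 2 := by push_cast; ring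
      have h2 : a + ((n : ℝ) - 1 / 2) * d = (a + n * d) - d / 2 := by ring
      rw [h1, h2, Real.sin_add, Real.sin_sub]; ring
    rw [e]; ring

theorem waveNum_mem {N k : ℕ} (h1 : 1 ≤ k) (h2 : k ≤ N) : waveNum N k ∈ Ioo 0 Real.pi := by
  have hk : (1 : ℝ) ≤ k := by exact_mod_cast h1
  have hk2 : (k : ℝ) < N + 1 := by
    have : (k : ℝ) ≤ N := by exact_mod_cast h2
    linarith
  have hh := meshSize_pos N
  have hpi := Real.pi_pos
  refine ⟨by unfold waveNum; positivity, ?_⟩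
  have e := meshSize_mul N
  calc waveNum N k = Real.pi * (meshSize N * k) := by rw [waveNum]; ring
    _ < Real.pi * (meshSize N * (N + 1)) := by gcongr
    _ = Real.pi := by rw [e, mul_one]

theorem sin_waveNum_pos {N k : ℕ} (h1 : 1 ≤ k) (h2 : k ≤ N) : 0 < Real.sin (waveNum N k) :=
  Real.sin_pos_of_mem_Ioo (waveNum_mem h1 h2)

theorem waveNum_mul (N k : ℕ) : waveNum N k * (N + 1) = k * Real.pi := by
  rw [waveNum]
  linear_combination (k * Real.pi) * meshSize_mul N

theorem sum_sin_sq_mid {N k : ℕ} (h1 : 1 ≤ k) (h2 : k ≤ N) :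
    ∑ j ∈ Finset.range (N + 1), Real.sin (((j : ℝ) + 1 / 2) * waveNum N k) ^ 2 = (N + 1) / 2 := by
  have hs := (sin_waveNum_pos h1 h2).ne'
  have h := sum_cos_arith (N + 1) (waveNum N k) (2 * waveNum N k)
  have e1 : waveNum N k + (((N + 1 : ℕ) : ℝ) - 1 / 2) * (2 * waveNum N k) =
      ((2 * k : ℕ) : ℝ) * Real.pi := by
    push_cast; linear_combination 2 * waveNum_mul N k
  have e2 : waveNum N k - 2 * waveNum N k / 2 = 0 := by ring
  rw [e1, e2, Real.sin_nat_mul_pi, Real.sin_zero, sub_zero, mul_div_cancel_left₀ _ two_ne_zero] at h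
  have h0 := (mul_eq_zero.1 h).resolve_left (mul_ne_zero two_ne_zero hs)
  have e : ∀ j : ℕ, Real.sin (((j : ℝ) + 1 / 2) * waveNum N k) ^ 2 =
      1 / 2 - Real.cos (waveNum N k + j * (2 * waveNum N k)) / 2 := by
    intro j
    rw [Real.sin_sq_eq_half_sub]; congr 3; ring
  simp only [e, Finset.sum_sub_distrib, ← Finset.sum_div, h0]
  simp

theorem sum_sin_sq_node {N k : ℕ} (h1 : 1 ≤ k) (h2 : k ≤ N) :
    ∑ j ∈ Finset.range N, Real.sin (((j : ℝ) + 1) * waveNum N k) ^ 2 = (N + 1) / 2 := by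
  have hs := (sin_waveNum_pos h1 h2).ne'
  have h := sum_cos_arith (N + 1) 0 (2 * waveNum N k)
  have e1 : (0 : ℝ) + (((N + 1 : ℕ) : ℝ) - 1 / 2) * (2 * waveNum N k) =
      ((2 * k : ℕ) : ℝ) * Real.pi - waveNum N k := by
    push_cast; linear_combination 2 * waveNum_mul N k
  have e2 : 0 - 2 * waveNum N k / 2 = - waveNum N k := by ring
  have e3 : Real.sin (((2 * k : ℕ) : ℝ) * Real.pi - waveNum N k) = - Real.sin (waveNum N k) := by
    rw [Real.sin_nat_mul_pi_sub]; simp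
  rw [e1, e2, e3, Real.sin_neg, sub_self, mul_div_cancel_left₀ _ two_ne_zero] at h
  have h0 := (mul_eq_zero.1 h).resolve_left (mul_ne_zero two_ne_zero hs)
  have e : ∀ j : ℕ, Real.sin ((j : ℝ) * waveNum N k) ^ 2 =
      1 / 2 - Real.cos (0 + j * (2 * waveNum N k)) / 2 := by
    intro j
    rw [Real.sin_sq_eq_half_sub]; congr 3; ring
  have h3 : ∑ j ∈ Finset.range (N + 1), Real.sin ((j : ℝ) * waveNum N k) ^ 2 = (N + 1) / 2 := by
    simp only [e, Finset.sum_sub_distrib, ← Finset.sum_div, h0]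
    simp
  rw [Finset.sum_range_succ'] at h3
  simpa using h3

theorem sum_range_two_mul_add_one {M : Type*} [AddCommMonoid M] (f : ℕ → M) (N : ℕ) :
    ∑ i ∈ Finset.range (2 * N + 1), f i =
      ∑ j ∈ Finset.range (N + 1), f (2 * j) + ∑ j ∈ Finset.range N, f (2 * j + 1) := by
  induction N with
  | zero => simp
  | succ n ih =>
    rw [show 2 * (n + 1) + 1 = (2 * n + 1) + 1 + 1 by ring, Finset.sum_range_succ,
      Finset.sum_range_succ, ih, Finset.sum_range_succ (fun j => f (2 * j)) (n + 1),
      Finset.sum_range_succ (fun j => f (2 * j + 1)) n, show 2 * n + 1 + 1 = 2 * (n + 1) by ring]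
    abel

theorem dotProduct_gridSine {N k : ℕ} (h1 : 1 ≤ k) (h2 : k ≤ N) (a b a' b' : ℝ) :
    gridSine N k a b ⬝ᵥ star (gridSine N k a' b') =
      (((N + 1) / 2 * (a * a' + b * b') : ℝ) : ℂ) := by
  have e : gridSine N k a b ⬝ᵥ star (gridSine N k a' b') =
      ((∑ i ∈ Finset.range (2 * N + 1), sineExt N k a b i * sineExt N k a' b' i : ℝ) : ℂ) := by
    rw [← Fin.sum_univ_eq_sum_range (fun i => sineExt N k a b i * sineExt N k a' b' i)]
    push_cast
    refine Finset.sum_congr rfl fun i _ => ?_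
    simp [gridSine]
  rw [e, sum_range_two_mul_add_one]
  congr 1
  have m1 : ∀ j : ℕ, sineExt N k a b ((2 * j : ℕ) : ℤ) * sineExt N k a' b' ((2 * j : ℕ) : ℤ) =
      b * b' * Real.sin (((j : ℝ) + 1 / 2) * waveNum N k) ^ 2 := by
    intro j
    have ho : ¬ Odd ((2 * j : ℕ) : ℤ) := by
      rw [Int.not_odd_iff_even]; push_cast; exact even_two_mul _
    have e1 : (k : ℝ) * Real.pi * (((((2 * j : ℕ) : ℤ) : ℝ) + 1) / 2 * meshSize N) =
        ((j : ℝ) + 1 / 2) * waveNum N k := by rw [waveNum]; push_cast; ring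
    rw [sineExt, sineExt, if_neg ho, if_neg ho, e1]; ring
  have m2 : ∀ j : ℕ, sineExt N k a b ((2 * j + 1 : ℕ) : ℤ) * sineExt N k a' b' ((2 * j + 1 : ℕ) : ℤ) =
      a * a' * Real.sin (((j : ℝ) + 1) * waveNum N k) ^ 2 := by
    intro j
    have ho : Odd ((2 * j + 1 : ℕ) : ℤ) := by
      push_cast; exact odd_two_mul_add_one _
    have e1 : (k : ℝ) * Real.pi * (((((2 * j + 1 : ℕ) : ℤ) : ℝ) + 1) / 2 * meshSize N) =
        ((j : ℝ) + 1) * waveNum N k := by rw [waveNum]; push_cast; ring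
    rw [sineExt, sineExt, if_pos ho, if_pos ho, e1]; ring
  simp only [m1, m2, ← Finset.mul_sum, sum_sin_sq_mid h1 h2, sum_sin_sq_node h1 h2]
  ring

theorem innerH0_gridSine {N k : ℕ} (h1 : 1 ≤ k) (h2 : k ≤ N) (a b : ℝ) :
    innerH0 (gridSine N k a b) (gridSine N k a b) =
      ((1 / 30 * ((5 - 2 * Real.cos (waveNum N k / 2) ^ 2) * a ^ 2 +
        4 * Real.cos (waveNum N k / 2) * a * b + 8 * b ^ 2) : ℝ) : ℂ) := by
  rw [innerH0, massMatrix_mulVec_gridSine, dotProduct_gridSine h1 h2]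
  congr 1
  have hc : Real.cos (waveNum N k) = 2 * Real.cos (waveNum N k / 2) ^ 2 - 1 := by
    rw [← Real.cos_two_mul]; congr 1; ring
  rw [hc]
  set c := Real.cos (waveNum N k / 2)
  linear_combination (1 / 30 * ((5 - 2 * c ^ 2) * a ^ 2 + 4 * c * a * b + 8 * b ^ 2)) *
    meshSize_mul N

end Grid

/-! ### Eigenvectors and modes -/

section Modes

/-- The ratio of midpoint and nodal amplitudes of an eigenvector. -/
def midRatio (Λ : ℝ → ℝ) (η : ℝ) : ℝ := (40 + Λ η) / (4 * (10 - Λ η)) * Real.cos (η / 2)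

theorem rawEigenvector_eq (Λ : ℝ → ℝ) (N k : ℕ) :
    rawEigenvector Λ N k = gridSine N k 1 (midRatio Λ (waveNum N k)) := by
  funext i
  have hoi : Odd (i.val : ℤ) ↔ Odd i.val := Int.odd_coe_nat _
  simp only [rawEigenvector, gridSine, sineExt, hoi, midRatio, waveNum]
  push_cast
  rfl

/-- The squared norm of the raw eigenvector, as a function of the wave number. -/
def rawNormSq (Λ : ℝ → ℝ) (η : ℝ) : ℝ :=
  1 / 30 * (5 - 2 * Real.cos (η / 2) ^ 2 + 4 * Real.cos (η / 2) * midRatio Λ η + 8 * midRatio Λ η ^ 2)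

theorem rawNormSq_ge (Λ : ℝ → ℝ) (η : ℝ) : 1 / 12 ≤ rawNormSq Λ η := by
  have h := cos_sq_le_one' η
  rw [rawNormSq]
  nlinarith [sq_nonneg (Real.cos (η / 2) + 4 * midRatio Λ η)]

theorem rawNormSq_pos (Λ : ℝ → ℝ) (η : ℝ) : 0 < rawNormSq Λ η :=
  lt_of_lt_of_le (by norm_num) (rawNormSq_ge Λ η)

theorem sqrt_rawNormSq_ge (Λ : ℝ → ℝ) (η : ℝ) : 1 / 4 ≤ √(rawNormSq Λ η) := by
  refine Real.le_sqrt_of_sq_le ?_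
  have := rawNormSq_ge Λ η
  norm_num at this ⊢
  linarith

theorem innerH0_rawEigenvector (Λ : ℝ → ℝ) {N k : ℕ} (h1 : 1 ≤ k) (h2 : k ≤ N) :
    innerH0 (rawEigenvector Λ N k) (rawEigenvector Λ N k) = (rawNormSq Λ (waveNum N k) : ℂ) := by
  rw [rawEigenvector_eq, innerH0_gridSine h1 h2, rawNormSq]
  congr 1; ring

theorem smul_gridSine (N k : ℕ) (r a b : ℝ) :
    (r : ℂ) • gridSine N k a b = gridSine N k (r * a) (r * b) := by
  funext i
  simp only [gridSine, Pi.smul_apply, smul_eq_mul, sineExt]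
  split_ifs <;> push_cast <;> ring

theorem gridSine_add (N k : ℕ) (a b a' b' : ℝ) :
    gridSine N k a b + gridSine N k a' b' = gridSine N k (a + a') (b + b') := by
  funext i
  simp only [gridSine, Pi.add_apply, sineExt]
  split_ifs <;> push_cast <;> ring

theorem eigenvector_eq (Λ : ℝ → ℝ) {N k : ℕ} (h1 : 1 ≤ k) (h2 : k ≤ N) :
    eigenvector Λ N k = gridSine N k (1 / √(rawNormSq Λ (waveNum N k)))
      (1 / √(rawNormSq Λ (waveNum N k)) * midRatio Λ (waveNum N k)) := by
  rw [eigenvector, innerH0_rawEigenvector Λ h1 h2, Complex.ofReal_re, rawEigenvector_eq,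
    smul_gridSine, mul_one]

/-- The symbol of a branch: `false` is acoustic, `true` is optic. -/
def branchSymbol (b : Bool) : ℝ → ℝ := if b then opticSymbol else acousticSymbol

theorem branch_quadratic (b : Bool) (η : ℝ) :
    Real.sin (η / 2) ^ 2 * (branchSymbol b η ^ 2 + 16 * branchSymbol b η + 240) =
      branchSymbol b η * (60 - branchSymbol b η) := by
  cases b
  · exact acoustic_quadratic η
  · exact optic_quadratic η

theorem acousticSymbol_lt_ten {η : ℝ} (hη : η ∈ Ioo 0 Real.pi) : acousticSymbol η < 10 := by
  have hc : 0 < Real.cos (η / 2) :=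
    Real.cos_pos_of_mem_Ioo ⟨by linarith [hη.1, Real.pi_pos], by linarith [hη.2]⟩
  have := acousticSymbol_le η
  have := sin_half_sq η
  nlinarith

theorem branchSymbol_ne_ten (b : Bool) {η : ℝ} (hη : η ∈ Ioo 0 Real.pi) :
    10 - branchSymbol b η ≠ 0 := by
  cases b
  · exact (sub_pos.2 (acousticSymbol_lt_ten hη)).ne'
  · have : 12 ≤ branchSymbol true η := twelve_le_opticSymbol η
    intro h; linarith

theorem branchSymbol_nonneg (b : Bool) (η : ℝ) : 0 ≤ branchSymbol b η := by
  cases b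
  · exact acousticSymbol_nonneg η
  · exact (opticSymbol_pos η).le

theorem stiffness_rawEigenvector (b : Bool) {N k : ℕ} (h1 : 1 ≤ k) (h2 : k ≤ N) :
    stiffnessMatrix N *ᵥ rawEigenvector (branchSymbol b) N k =
      (((branchSymbol b (waveNum N k)) / meshSize N ^ 2 : ℝ) : ℂ) •
        (massMatrix N *ᵥ rawEigenvector (branchSymbol b) N k) := by
  have hη := waveNum_mem h1 h2
  rw [rawEigenvector_eq, stiffnessMatrix_mulVec_gridSine, massMatrix_mulVec_gridSine, smul_gridSine]
  have hq := branch_quadratic b (waveNum N k)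
  have hne := branchSymbol_ne_ten b hη
  have hh := (meshSize_pos N).ne'
  have hc : Real.cos (waveNum N k) = 2 * Real.cos (waveNum N k / 2) ^ 2 - 1 := by
    rw [← Real.cos_two_mul]; congr 1; ring
  rw [sin_half_sq] at hq
  simp only [midRatio]
  rw [hc]
  set Λ := branchSymbol b (waveNum N k)
  set c := Real.cos (waveNum N k / 2)
  congr 1
  · field_simp
    linear_combination 30 * hq
  · field_simp
    ring

theorem dispersion_sq (b : Bool) (η : ℝ) :
    dispersion (branchSymbol b) η ^ 2 = branchSymbol b η :=
  Real.sq_sqrt (branchSymbol_nonneg b η)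

theorem dispersion_branch_pos (b : Bool) {η : ℝ} (hη : η ∈ Ioo 0 Real.pi) :
    0 < dispersion (branchSymbol b) η := by
  cases b
  · exact dispersion_acoustic_pos (Ioo_subset_Ioc_self hη)
  · exact dispersion_optic_pos η

theorem dispersion_branch_ge (b : Bool) {η : ℝ} (hη : η ∈ Ioo 0 Real.pi) :
    2 / Real.pi * η ≤ dispersion (branchSymbol b) η := by
  have hpi := Real.pi_pos
  cases b
  · have h := two_mul_sin_half_le_dispersion η
    have h2 := Real.mul_le_sin (x := η / 2) (by linarith [hη.1]) (by linarith [hη.2])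
    have : 2 / Real.pi * η = 2 * (2 / Real.pi * (η / 2)) := by ring
    rw [this]
    exact (mul_le_mul_of_nonneg_left h2 two_pos.le).trans h
  · refine le_trans ?_ (le_dispersion_optic η)
    have h1 : 2 / Real.pi * η ≤ 2 := by
      rw [div_mul_eq_mul_div, div_le_iff₀ hpi]; nlinarith [hη.2]
    exact h1.trans (Real.le_sqrt_of_sq_le (by norm_num))

/-- The `n`-th frequency of a branch, for `k = n + 1`. -/
def freq (N : ℕ) (b : Bool) (n : ℕ) : ℝ := eigenfreq (branchSymbol b) N (n + 1)

theorem freq_eq (N : ℕ) (b : Bool) (n : ℕ) :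
    freq N b n = dispersion (branchSymbol b) (waveNum N (n + 1)) / meshSize N := rfl

theorem waveNum_succ_mem {N n : ℕ} (hn : n < N) : waveNum N (n + 1) ∈ Ioo 0 Real.pi :=
  waveNum_mem (by omega) (by omega)

theorem freq_pos {N n : ℕ} (b : Bool) (hn : n < N) : 0 < freq N b n :=
  div_pos (dispersion_branch_pos b (waveNum_succ_mem hn)) (meshSize_pos N)

theorem two_mul_le_freq {N n : ℕ} (b : Bool) (hn : n < N) : 2 * ((n : ℝ) + 1) ≤ freq N b n := by
  rw [freq_eq, le_div_iff₀ (meshSize_pos N)]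
  refine le_trans (le_of_eq ?_) (dispersion_branch_ge b (waveNum_succ_mem hn))
  have := Real.pi_pos.ne'
  rw [waveNum]; push_cast; field_simp

/-- The sign attached to a mode. -/
def sgn (σ : Bool) : ℝ := if σ then 1 else -1

theorem abs_sgn (σ : Bool) : |sgn σ| = 1 := by cases σ <;> simp [sgn]

theorem sgn_mul_self (σ : Bool) : sgn σ * sgn σ = 1 := by cases σ <;> simp [sgn]

/-- A mode `e^{±iλt} φ`: the branch, the sign and the index `n = k - 1`. -/
abbrev Mode : Type := Bool × Bool × ℕ

/-- The modes on the mesh with `N` interior nodes. -/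
def modes (N : ℕ) : Finset Mode := Finset.univ ×ˢ Finset.univ ×ˢ Finset.range N

theorem mem_modes {N : ℕ} {j : Mode} : j ∈ modes N ↔ j.2.2 < N := by
  simp [modes]

theorem card_modes (N : ℕ) : (modes N).card = 4 * N := by
  simp [modes]; ring

theorem sum_modes {M : Type*} [AddCommMonoid M] (N : ℕ) (f : Mode → M) :
    ∑ j ∈ modes N, f j = ∑ b, ∑ σ, ∑ n ∈ Finset.range N, f (b, σ, n) := by
  rw [modes, Finset.sum_product]
  refine Finset.sum_congr rfl fun b _ => ?_
  rw [Finset.sum_product]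

/-- The signed frequency of a mode. -/
def modeFreq (N : ℕ) (j : Mode) : ℝ := sgn j.2.1 * freq N j.1 j.2.2

theorem abs_modeFreq {N : ℕ} {j : Mode} (hj : j ∈ modes N) : |modeFreq N j| = freq N j.1 j.2.2 := by
  rw [modeFreq, abs_mul, abs_sgn, one_mul, abs_of_pos (freq_pos _ (mem_modes.1 hj))]

/-- The normalized eigenvector of a mode. -/
def modeVec (N : ℕ) (j : Mode) : GridVec N := eigenvector (branchSymbol j.1) N (j.2.2 + 1)

theorem stiffness_modeVec {N : ℕ} {j : Mode} (hj : j ∈ modes N) :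
    stiffnessMatrix N *ᵥ modeVec N j =
      ((freq N j.1 j.2.2 ^ 2 : ℝ) : ℂ) • (massMatrix N *ᵥ modeVec N j) := by
  have hn := mem_modes.1 hj
  rw [modeVec, eigenvector, Matrix.mulVec_smul, Matrix.mulVec_smul,
    stiffness_rawEigenvector j.1 (by omega) (by omega), smul_comm, freq_eq, div_pow, dispersion_sq]

/-- The observation of a mode, divided by its frequency. -/
def obsWeight (Λ : ℝ → ℝ) (N k : ℕ) : ℝ :=
  (-1) ^ k * Real.sin (waveNum N k) / (√(rawNormSq Λ (waveNum N k)) * dispersion Λ (waveNum N k))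

/-- The observation weight of a mode. -/
def modeWeight (N : ℕ) (j : Mode) : ℝ := obsWeight (branchSymbol j.1) N (j.2.2 + 1)

theorem observation_last {N : ℕ} (F : GridVec N) :
    (observationMatrix N *ᵥ F) (Fin.last (2 * N)) = -(1 / (meshSize N : ℂ)) * halfComp F (2 * N) := by
  rw [Matrix.mulVec, dotProduct]
  simp only [observationMatrix, Matrix.of_apply, Fin.val_last, true_and]
  rcases Nat.eq_zero_or_pos N with rfl | hN
  · simp [halfComp]
  · rw [halfComp, dif_pos ⟨by omega, by omega⟩, Finset.sum_eq_single (⟨2 * N - 1, by omega⟩)]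
    · rw [if_pos (by simp only; omega)]
    · intro j _ hj
      rw [if_neg, zero_mul]
      intro h; apply hj; ext; simp only; omega
    · simp

theorem observation_of_ne_last {N : ℕ} (F : GridVec N) {i : Fin (2 * N + 1)}
    (hi : i ≠ Fin.last (2 * N)) : (observationMatrix N *ᵥ F) i = 0 := by
  rw [Matrix.mulVec, dotProduct]
  refine Finset.sum_eq_zero fun j _ => ?_
  have : i.val ≠ 2 * N := fun h => hi (Fin.ext h)
  simp [observationMatrix, this]

theorem sum_norm_sq_observation {N : ℕ} (F : GridVec N) :
    ∑ i, ‖(observationMatrix N *ᵥ F) i‖ ^ 2 =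
      ‖(observationMatrix N *ᵥ F) (Fin.last (2 * N))‖ ^ 2 := by
  refine Finset.sum_eq_single _ (fun i _ hi => ?_) (by simp)
  rw [observation_of_ne_last F hi]; simp

theorem halfComp_gridSine (N k : ℕ) (a b : ℝ) (j : ℕ) (hj : j ≤ 2 * N + 2) :
    halfComp (gridSine N k a b) j =
      (((if Even j then a else b) * Real.sin (j / 2 * waveNum N k) : ℝ) : ℂ) := by
  by_cases h : 1 ≤ j ∧ j ≤ 2 * N + 1
  · rw [halfComp, dif_pos h, gridSine, sineExt]
    congr 2
    · have : Odd (((⟨j - 1, by omega⟩ : Fin (2 * N + 1)).val : ℕ) : ℤ) ↔ Even j := by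
        rw [Int.odd_coe_nat]
        simp only
        rw [Nat.odd_sub h.1]
        simp [Nat.not_odd_iff_even]
      simp only [this]
    · congr 1
      rw [waveNum]
      push_cast [Nat.cast_sub h.1]
      ring
  · rw [halfComp, dif_neg h]
    rcases Nat.eq_zero_or_pos j with rfl | h0
    · simp
    · have hj2 : j = 2 * N + 2 := by omega
      have e : ((j : ℕ) : ℝ) / 2 * waveNum N k = k * Real.pi := by
        rw [hj2]; push_cast; linear_combination waveNum_mul N k
      rw [e, Real.sin_nat_mul_pi]; simp

theorem observation_modeVec {N : ℕ} {j : Mode} (hj : j ∈ modes N) :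
    (observationMatrix N *ᵥ modeVec N j) (Fin.last (2 * N)) =
      ((freq N j.1 j.2.2 * modeWeight N j : ℝ) : ℂ) := by
  have hn := mem_modes.1 hj
  have hη := waveNum_succ_mem hn
  have hd := (dispersion_branch_pos j.1 hη).ne'
  have hq := (Real.sqrt_pos.2 (rawNormSq_pos (branchSymbol j.1) (waveNum N (j.2.2 + 1)))).ne'
  have hh := (meshSize_pos N).ne'
  rw [observation_last, modeVec, eigenvector_eq _ (by omega) (by omega),
    halfComp_gridSine _ _ _ _ _ (by omega), if_pos (even_two_mul N)]
  have e : ((2 * N : ℕ) : ℝ) / 2 * waveNum N (j.2.2 + 1) =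
      ((j.2.2 + 1 : ℕ) : ℝ) * Real.pi - waveNum N (j.2.2 + 1) := by
    push_cast
    have := waveNum_mul N (j.2.2 + 1)
    push_cast at this
    linear_combination this
  rw [e, Real.sin_nat_mul_pi_sub, freq_eq, modeWeight, obsWeight]
  rw [← Complex.ofReal_one, ← Complex.ofReal_div, ← Complex.ofReal_neg, ← Complex.ofReal_mul]
  congr 1
  field_simp

theorem abs_modeWeight_le {N : ℕ} {j : Mode} (hj : j ∈ modes N) : |modeWeight N j| ≤ 2 * Real.pi := by
  have hn := mem_modes.1 hj
  have hη := waveNum_succ_mem hn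
  have hpi := Real.pi_pos
  rw [modeWeight, obsWeight, abs_div, abs_mul, abs_pow, abs_neg, abs_one, one_pow, one_mul]
  set η := waveNum N (j.2.2 + 1)
  have hd := dispersion_branch_pos j.1 hη
  have hq := sqrt_rawNormSq_ge (branchSymbol j.1) η
  have hdη := dispersion_branch_ge j.1 hη
  rw [abs_of_pos (Real.sin_pos_of_mem_Ioo hη), abs_of_pos (by positivity),
    div_le_iff₀ (by positivity)]
  calc Real.sin η ≤ η := Real.sin_le hη.1.le
    _ = 2 * Real.pi * (1 / 4 * (2 / Real.pi * η)) := by field_simp; norm_num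
    _ ≤ 2 * Real.pi * (√(rawNormSq (branchSymbol j.1) η) * dispersion (branchSymbol j.1) η) := by
      have := hη.1
      gcongr

theorem modeWeight_ne_zero {N : ℕ} {j : Mode} (hj : j ∈ modes N) : modeWeight N j ≠ 0 := by
  have hn := mem_modes.1 hj
  have hη := waveNum_succ_mem hn
  have hd := dispersion_branch_pos j.1 hη
  have hq := Real.sqrt_pos.2 (rawNormSq_pos (branchSymbol j.1) (waveNum N (j.2.2 + 1)))
  have hs := Real.sin_pos_of_mem_Ioo hη
  rw [modeWeight, obsWeight]
  refine div_ne_zero (mul_ne_zero (pow_ne_zero _ (by norm_num)) hs.ne') (by positivity)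

theorem waveNum_lt {N k l : ℕ} (h : k < l) : waveNum N k < waveNum N l := by
  have := meshSize_pos N
  have := Real.pi_pos
  have h2 : (k : ℝ) < l := by exact_mod_cast h
  unfold waveNum
  gcongr

/-- All the frequencies are different. -/
theorem injOn_modeFreq (N : ℕ) : Set.InjOn (modeFreq N) (modes N) := by
  rintro ⟨b, σ, n⟩ hj ⟨b', σ', n'⟩ hj' h
  have hn : n < N := mem_modes.1 hj
  have hn' : n' < N := mem_modes.1 hj'
  have hf := freq_pos b hn
  have hf' := freq_pos b' hn'
  have hσ : σ = σ' := by
    simp only [modeFreq] at h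
    cases σ <;> cases σ' <;> simp [sgn] at h ⊢ <;> linarith
  subst hσ
  have h2 : freq N b n = freq N b' n' := by
    simp only [modeFreq] at h
    cases σ <;> simp [sgn] at h <;> exact h
  have hh := meshSize_pos N
  rw [freq_eq, freq_eq, div_left_inj' hh.ne'] at h2
  have hmem := Ioo_subset_Icc_self (waveNum_succ_mem hn)
  have hmem' := Ioo_subset_Icc_self (waveNum_succ_mem hn')
  have h1012 : √10 < √12 := Real.sqrt_lt_sqrt (by norm_num) (by norm_num)
  have hinj : ∀ l l' : ℕ, waveNum N (l + 1) = waveNum N (l' + 1) → l = l' := by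
    intro l l' hll
    rcases lt_trichotomy l l' with h | h | h
    · exact absurd hll (waveNum_lt (by omega)).ne
    · exact h
    · exact absurd hll (waveNum_lt (by omega)).ne'
  cases b <;> cases b'
  · have := strictMonoOn_dispersion_acoustic.injOn hmem hmem' h2
    rw [hinj n n' this]
  · have h3 := dispersion_acoustic_le (waveNum N (n + 1))
    have h4 := le_dispersion_optic (waveNum N (n' + 1))
    have h5 : dispersion acousticSymbol (waveNum N (n + 1)) =
      dispersion opticSymbol (waveNum N (n' + 1)) := h2
    linarith
  · have h3 := dispersion_acoustic_le (waveNum N (n' + 1))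
    have h4 := le_dispersion_optic (waveNum N (n + 1))
    have h5 : dispersion opticSymbol (waveNum N (n + 1)) =
      dispersion acousticSymbol (waveNum N (n' + 1)) := h2
    linarith
  · have := strictAntiOn_dispersion_optic.injOn hmem hmem' h2
    rw [hinj n n' this]

end Modes

/-! ### The solutions of the discrete adjoint problem -/

section DiscreteWaves

/-- The mass matrix is strictly diagonally dominant, hence injective. -/
theorem massMatrix_mulVec_eq_zero {N : ℕ} {v : GridVec N} (hv : massMatrix N *ᵥ v = 0) : v = 0 := by
  have hh : (meshSize N : ℂ) ≠ 0 := by exact_mod_cast (meshSize_pos N).ne'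
  obtain ⟨i, -, hi⟩ := Finset.exists_max_image Finset.univ (fun i => ‖v i‖) ⟨0, Finset.mem_univ _⟩
  set V : ℤ → ℂ := fun z => if h : 0 ≤ z ∧ z < 2 * N + 1 then v ⟨z.toNat, by omega⟩ else 0 with hV
  have hVle : ∀ z, ‖V z‖ ≤ ‖v i‖ := by
    intro z
    rw [hV]
    simp only
    split_ifs with h
    · exact hi _ (Finset.mem_univ _)
    · simp
  have hVv : ∀ j : Fin (2 * N + 1), V j.val = v j := by
    intro j
    rw [hV]
    simp only
    rw [dif_pos ⟨by omega, by omega⟩]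
    congr 1
  have hb := sum_band_mul i V (by simp [hV]) (by simp [hV])
    (if Odd i.val then 4 / 15 else 8 / 15) (1 / 15) (-(1 / 30))
  have e : (massMatrix N *ᵥ v) i = (meshSize N : ℂ) *
      ∑ j : Fin (2 * N + 1), (if i = j then (if Odd i.val then 4 / 15 else 8 / 15)
        else if i.val + 1 = j.val ∨ j.val + 1 = i.val then 1 / 15
        else if Odd i.val ∧ (i.val + 2 = j.val ∨ j.val + 2 = i.val) then -(1 / 30) else 0) *
          V j.val := by
    rw [Matrix.mulVec, dotProduct, Finset.mul_sum]
    refine Finset.sum_congr rfl fun j _ => ?_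
    simp only [massMatrix, Matrix.of_apply, hVv]
    ring
  rw [hb, hv, Pi.zero_apply] at e
  have h0 := (mul_eq_zero.1 e.symm).resolve_left hh
  rw [hVv] at h0
  have hb1 : ‖V (i.val + 1) + V (i.val - 1)‖ ≤ 2 * ‖v i‖ :=
    (norm_add_le _ _).trans (by linarith [hVle (i.val + 1), hVle (i.val - 1)])
  have hb2 : ‖V (i.val + 2) + V (i.val - 2)‖ ≤ 2 * ‖v i‖ :=
    (norm_add_le _ _).trans (by linarith [hVle (i.val + 2), hVle (i.val - 2)])
  have hvi : ‖v i‖ = 0 := by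
    have hnn := norm_nonneg (v i)
    by_cases ho : Odd i.val
    · rw [if_pos ho, if_pos ho] at h0
      have h1 : (4 / 15 : ℂ) * v i = -(1 / 15 * (V (i.val + 1) + V (i.val - 1))) +
          1 / 30 * (V (i.val + 2) + V (i.val - 2)) := by linear_combination h0
      have h2 := congrArg norm h1
      rw [norm_mul] at h2
      have h3 := norm_add_le (-(1 / 15 * (V (i.val + 1) + V (i.val - 1))))
        (1 / 30 * (V (i.val + 2) + V (i.val - 2)))
      rw [← h2, norm_neg, norm_mul, norm_mul] at h3
      norm_num at h3
      linarith
    · rw [if_neg ho, if_neg ho] at h0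
      have h1 : (8 / 15 : ℂ) * v i = -(1 / 15 * (V (i.val + 1) + V (i.val - 1))) := by
        linear_combination h0
      have h2 := congrArg norm h1
      rw [norm_mul, norm_neg, norm_mul] at h2
      norm_num at h2
      linarith
  funext j
  have := hi j (Finset.mem_univ _)
  rw [hvi] at this
  exact norm_le_zero_iff.1 this

theorem isUnit_massMatrix (N : ℕ) : IsUnit (massMatrix N) := by
  rw [← Matrix.mulVec_injective_iff_isUnit]
  intro v w h
  have : massMatrix N *ᵥ (v - w) = 0 := by rw [Matrix.mulVec_sub, h, sub_self]
  exact sub_eq_zero.1 (massMatrix_mulVec_eq_zero this)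

/-- Solutions of the discrete adjoint problem are determined by their data at `t = T`. -/
theorem DiscreteWave.ext_of_final {N : ℕ} {T : ℝ} (U W : DiscreteWave N T)
    (hp : U.pos T = W.pos T) (hv : U.vel T = W.vel T) {t : ℝ} (ht : t ∈ Icc 0 T) :
    U.pos t = W.pos t ∧ U.vel t = W.vel t := by
  set A : GridVec N →L[ℂ] GridVec N :=
    LinearMap.toContinuousLinearMap (-((massMatrix N)⁻¹ * stiffnessMatrix N)).mulVecLin with hA
  have hacc : ∀ (Z : DiscreteWave N T), ∀ t ∈ Icc 0 T, Z.acc t = A (Z.pos t) := by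
    intro Z t ht
    have h := congrArg (fun v => (massMatrix N)⁻¹ *ᵥ v) (Z.wave_eq t ht)
    simp only [Matrix.mulVec_add, Matrix.mulVec_mulVec, Matrix.mulVec_zero] at h
    rw [Matrix.nonsing_inv_mul _ ((Matrix.isUnit_iff_isUnit_det _).1 (isUnit_massMatrix N)),
      Matrix.one_mulVec] at h
    simp only [hA, LinearMap.coe_toContinuousLinearMap', Matrix.mulVecLin_apply, Matrix.neg_mulVec]
    exact eq_neg_of_add_eq_zero_left h
  set F : (GridVec N × GridVec N) →L[ℂ] (GridVec N × GridVec N) :=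
    (ContinuousLinearMap.snd ℂ _ _).prod (A.comp (ContinuousLinearMap.fst ℂ _ _)) with hF
  have hd : ∀ (Z : DiscreteWave N T), ∀ t ∈ Icc 0 T,
      HasDerivWithinAt (fun s => (Z.pos s, Z.vel s)) (F (Z.pos t, Z.vel t)) (Icc 0 T) t := by
    intro Z t ht
    have := (Z.hasDeriv_pos t ht).prodMk (Z.hasDeriv_vel t ht)
    rw [hacc Z t ht] at this
    exact this
  have hd' : ∀ (Z : DiscreteWave N T), ∀ t ∈ Ioc 0 T,
      HasDerivWithinAt (fun s => (Z.pos s, Z.vel s)) (F (Z.pos t, Z.vel t)) (Iic t) t := by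
    intro Z t ht
    refine (hd Z t (Ioc_subset_Icc_self ht)).mono_of_mem_nhdsWithin ?_
    refine mem_of_superset (Icc_mem_nhdsLE ht.1) (Icc_subset_Icc_right ht.2)
  have key := ODE_solution_unique_of_mem_Icc_left (v := fun _ z => F z) (s := fun _ => univ)
    (K := ‖F‖₊) (a := 0) (b := T)
    (f := fun s => (U.pos s, U.vel s)) (g := fun s => (W.pos s, W.vel s))
    (fun t _ => F.lipschitz.lipschitzOnWith)
    (fun t ht => (hd U t ht).continuousWithinAt) (hd' U) (fun _ _ => trivial)
    (fun t ht => (hd W t ht).continuousWithinAt) (hd' W) (fun _ _ => trivial)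
    (by simp only [hp, hv])
  have := key ht
  exact Prod.ext_iff.1 this

/-- The superposition of modes with amplitudes `c`. -/
def modeWave (N : ℕ) (T : ℝ) (c : Mode → ℂ) : DiscreteWave N T where
  pos t := ∑ j ∈ modes N, (c j / (freq N j.1 j.2.2 : ℂ) * osc (modeFreq N j) t) • modeVec N j
  vel t := ∑ j ∈ modes N, (Complex.I * sgn j.2.1 * c j * osc (modeFreq N j) t) • modeVec N j
  acc t := ∑ j ∈ modes N, (-(freq N j.1 j.2.2 : ℂ) * c j * osc (modeFreq N j) t) • modeVec N j
  hasDeriv_pos t _ := by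
    refine HasDerivAt.hasDerivWithinAt ?_
    refine HasDerivAt.fun_sum fun j hj => ?_
    refine (((hasDerivAt_osc (modeFreq N j) t).const_mul _).smul_const _).congr_deriv ?_
    have hf : (freq N j.1 j.2.2 : ℂ) ≠ 0 := by
      exact_mod_cast (freq_pos j.1 (mem_modes.1 hj)).ne'
    congr 1
    rw [modeFreq]; push_cast; field_simp
  hasDeriv_vel t _ := by
    refine HasDerivAt.hasDerivWithinAt ?_
    refine HasDerivAt.fun_sum fun j hj => ?_
    refine (((hasDerivAt_osc (modeFreq N j) t).const_mul _).smul_const _).congr_deriv ?_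
    congr 1
    have h2 : (sgn j.2.1 : ℂ) * sgn j.2.1 = 1 := by exact_mod_cast sgn_mul_self j.2.1
    have hI := Complex.I_sq
    have e : (modeFreq N j : ℂ) = sgn j.2.1 * freq N j.1 j.2.2 := by rw [modeFreq]; push_cast; rfl
    rw [e]
    linear_combination (Complex.I ^ 2 * c j * freq N j.1 j.2.2 * osc (modeFreq N j) t) * h2 +
      (c j * freq N j.1 j.2.2 * osc (modeFreq N j) t) * hI
  wave_eq t _ := by
    rw [Matrix.mulVec_sum, Matrix.mulVec_sum, ← Finset.sum_add_distrib]
    refine Finset.sum_eq_zero fun j hj => ?_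
    have hf : (freq N j.1 j.2.2 : ℂ) ≠ 0 := by
      exact_mod_cast (freq_pos j.1 (mem_modes.1 hj)).ne'
    rw [Matrix.mulVec_smul, Matrix.mulVec_smul, stiffness_modeVec hj, smul_smul, ← add_smul]
    convert zero_smul ℂ _
    push_cast; field_simp; ring

/-- The synthesis of a grid vector from coefficients on the eigenvectors. -/
def synth (N : ℕ) : (Bool → ℕ → ℂ) →ₗ[ℂ] GridVec N where
  toFun x := ∑ b, ∑ n ∈ Finset.range N, x b n • eigenvector (branchSymbol b) N (n + 1)
  map_add' x y := by
    simp only [Pi.add_apply, add_smul, Finset.sum_add_distrib]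
  map_smul' a x := by
    simp only [Pi.smul_apply, smul_assoc, ← Finset.smul_sum, RingHom.id_apply]

/-- The amplitudes of the modes of the wave with data of coefficients `x`, `y` at `t = T`. -/
def amplitude (N : ℕ) (T : ℝ) : ((Bool → ℕ → ℂ) × (Bool → ℕ → ℂ)) →ₗ[ℂ] (Mode → ℂ) where
  toFun p j := 1 / 2 * (freq N j.1 j.2.2 * p.1 j.1 j.2.2 - Complex.I * sgn j.2.1 * p.2 j.1 j.2.2) *
    osc (-modeFreq N j) T
  map_add' p q := by
    funext j; simp only [Prod.fst_add, Prod.snd_add, Pi.add_apply]; ring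
  map_smul' a p := by
    funext j; simp only [Prod.smul_fst, Prod.smul_snd, Pi.smul_apply, smul_eq_mul, RingHom.id_apply]
    ring

theorem modeWave_amplitude_pos {N : ℕ} {T : ℝ} (x y : Bool → ℕ → ℂ) :
    (modeWave N T (amplitude N T (x, y))).pos T = synth N x := by
  simp only [modeWave, synth, LinearMap.coe_mk, AddHom.coe_mk, sum_modes]
  refine Finset.sum_congr rfl fun b _ => ?_
  rw [Finset.sum_comm]
  refine Finset.sum_congr rfl fun n hn => ?_
  have hf : (freq N b n : ℂ) ≠ 0 := by
    exact_mod_cast (freq_pos b (Finset.mem_range.1 hn)).ne'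
  simp only [Fintype.sum_bool, modeVec, ← add_smul]
  congr 1
  have h1 := osc_neg_mul_osc (modeFreq N (b, true, n)) T
  have h2 := osc_neg_mul_osc (modeFreq N (b, false, n)) T
  simp only [amplitude, LinearMap.coe_mk, AddHom.coe_mk, sgn]
  field_simp
  push_cast
  linear_combination (freq N b n * x b n - Complex.I * y b n) * h1 +
    (freq N b n * x b n + Complex.I * y b n) * h2

theorem modeWave_amplitude_vel {N : ℕ} {T : ℝ} (x y : Bool → ℕ → ℂ) :
    (modeWave N T (amplitude N T (x, y))).vel T = synth N y := by
  simp only [modeWave, synth, LinearMap.coe_mk, AddHom.coe_mk, sum_modes]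
  refine Finset.sum_congr rfl fun b _ => ?_
  rw [Finset.sum_comm]
  refine Finset.sum_congr rfl fun n hn => ?_
  simp only [Fintype.sum_bool, modeVec, ← add_smul]
  congr 1
  have h1 := osc_neg_mul_osc (modeFreq N (b, true, n)) T
  have h2 := osc_neg_mul_osc (modeFreq N (b, false, n)) T
  have hI := Complex.I_sq
  simp only [amplitude, LinearMap.coe_mk, AddHom.coe_mk, sgn]
  push_cast
  linear_combination 1 / 2 * Complex.I * (freq N b n * x b n - Complex.I * y b n) * h1 -
    1 / 2 * Complex.I * (freq N b n * x b n + Complex.I * y b n) * h2 - y b n * hI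

/-- The boundary observation of a discrete wave, as an element of `L²(0,T)`. -/
def obsL2 {N : ℕ} {T : ℝ} (hT : 0 ≤ T) (U : DiscreteWave N T) : L2T T :=
  contL2 T (IccExtend hT ((Icc 0 T).domRestrict
      fun t => (observationMatrix N *ᵥ U.pos t) (Fin.last (2 * N)))) (by
    refine (continuousOn_iff_continuous_domRestrict.1 fun t ht => ?_).Icc_extend'
    have h : ContinuousWithinAt U.pos (Icc 0 T) t := (U.hasDeriv_pos t ht).continuousWithinAt
    have h2 : Continuous fun v : GridVec N => (observationMatrix N *ᵥ v) (Fin.last (2 * N)) :=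
      (continuous_apply _).comp ((observationMatrix N).mulVecLin.continuous_of_finiteDimensional)
    exact h2.continuousAt.comp_continuousWithinAt h)

theorem coeFn_obsL2 {N : ℕ} {T : ℝ} (hT : 0 ≤ T) (U : DiscreteWave N T) :
    obsL2 hT U =ᵐ[volume.restrict (Ioo (0 : ℝ) T)]
      fun t => (observationMatrix N *ᵥ U.pos t) (Fin.last (2 * N)) := by
  refine (coeFn_contL2 T _ _).trans ?_
  refine (ae_restrict_iff' measurableSet_Ioo).2 (Eventually.of_forall fun t ht => ?_)
  rw [IccExtend_of_mem hT _ (Ioo_subset_Icc_self ht)]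
  rfl

/-- The observation of a superposition of modes. -/
def modeSignal (N : ℕ) (T : ℝ) : (Mode → ℂ) →ₗ[ℂ] L2T T where
  toFun c := ∑ j ∈ modes N, ((modeWeight N j : ℂ) * c j) • expT T (modeFreq N j)
  map_add' c d := by
    simp only [Pi.add_apply, mul_add, add_smul, Finset.sum_add_distrib]
  map_smul' a c := by
    simp only [Pi.smul_apply, smul_eq_mul, RingHom.id_apply, Finset.smul_sum, smul_smul]
    refine Finset.sum_congr rfl fun j _ => ?_
    congr 1; ring

theorem obsL2_modeWave {N : ℕ} {T : ℝ} (hT : 0 ≤ T) (c : Mode → ℂ) :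
    obsL2 hT (modeWave N T c) = modeSignal N T c := by
  refine Lp.ext ((coeFn_obsL2 hT _).trans ?_)
  refine EventuallyEq.trans (Eventually.of_forall fun t => ?_)
    (coeFn_sum_smul_expT T (modes N) (fun j => (modeWeight N j : ℂ) * c j) (modeFreq N)).symm
  simp only [modeWave, trigSum, Matrix.mulVec_sum, Finset.sum_apply]
  refine Finset.sum_congr rfl fun j hj => ?_
  have hf : (freq N j.1 j.2.2 : ℂ) ≠ 0 := by
    exact_mod_cast (freq_pos j.1 (mem_modes.1 hj)).ne'
  rw [Matrix.mulVec_smul, Pi.smul_apply, observation_modeVec hj, smul_eq_mul]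
  push_cast
  field_simp

theorem discreteFunctional_eq {N : ℕ} {T : ℝ} (hT : 0 ≤ T) (Y0 Y1 : GridVec N)
    (U : DiscreteWave N T) :
    discreteFunctional Y0 Y1 U = 1 / 2 * ‖obsL2 hT U‖ ^ 2 -
      (innerH0 Y1 (U.pos 0) - innerH0 Y0 (U.vel 0)).re := by
  rw [discreteFunctional, norm_sq_L2T]
  congr 2
  refine integral_congr_ae ?_
  filter_upwards [coeFn_obsL2 hT U] with t ht
  rw [ht, sum_norm_sq_observation]

theorem innerH0_sum_smul {N : ℕ} {ι : Type*} (Y : GridVec N) (s : Finset ι) (a : ι → ℂ)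
    (F : ι → GridVec N) : innerH0 Y (∑ j ∈ s, a j • F j) = ∑ j ∈ s, conj (a j) * innerH0 Y (F j) := by
  simp only [innerH0, star_sum, star_smul, dotProduct_sum, dotProduct_smul, smul_eq_mul,
    starRingEnd_apply]

/-- The coefficients of the data on the modes. -/
def modeData (N : ℕ) (Y0 Y1 : GridVec N) (j : Mode) : ℂ :=
  innerH0 Y1 (modeVec N j) / freq N j.1 j.2.2 + Complex.I * sgn j.2.1 * innerH0 Y0 (modeVec N j)

theorem data_modeWave {N : ℕ} {T : ℝ} (Y0 Y1 : GridVec N) (c : Mode → ℂ) :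
    innerH0 Y1 ((modeWave N T c).pos 0) - innerH0 Y0 ((modeWave N T c).vel 0) =
      ∑ j ∈ modes N, conj (c j) * modeData N Y0 Y1 j := by
  simp only [modeWave, innerH0_sum_smul, osc_zero, mul_one, ← Finset.sum_sub_distrib]
  refine Finset.sum_congr rfl fun j _ => ?_
  simp only [map_mul, map_div₀, Complex.conj_ofReal, Complex.conj_I, modeData]
  ring

/-- The linear functional of the data, on the amplitudes. -/
def modeFunctional (N : ℕ) (Y0 Y1 : GridVec N) : (Mode → ℂ) →ₗ⋆[ℂ] ℂ where
  toFun c := ∑ j ∈ modes N, conj (c j) * modeData N Y0 Y1 j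
  map_add' c d := by simp only [Pi.add_apply, map_add, add_mul, Finset.sum_add_distrib]
  map_smul' a c := by
    simp only [Pi.smul_apply, smul_eq_mul, map_mul, Finset.mul_sum, mul_assoc]

/-- The amplitudes of the waves whose data at `t = T` have coefficients in `X`. -/
def amplitudes (N : ℕ) (T : ℝ) (X : Submodule ℂ (Bool → ℕ → ℂ)) : Submodule ℂ (Mode → ℂ) :=
  (X.prod X).map (amplitude N T)

/-- The Euler–Lagrange equations of the discrete HUM control. -/
theorem isDiscreteHUMControl_iff {N : ℕ} {T : ℝ} (hT : 0 ≤ T) (X : Submodule ℂ (Bool → ℕ → ℂ))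
    (Y0 Y1 : GridVec N) (v : L2T T) :
    IsDiscreteHUMControl T ((X.map (synth N)).prod (X.map (synth N))) Y0 Y1 v ↔
      v ∈ LinearMap.range ((modeSignal N T).comp (amplitudes N T X).subtype) ∧
        ∀ d : amplitudes N T X, inner ℂ (modeSignal N T d) v = modeFunctional N Y0 Y1 d := by
  have key := isMinOn_iff_of_param (H := L2T T) (E := amplitudes N T X)
    (S := {W : DiscreteWave N T | (W.pos T, W.vel T) ∈
      ((X.map (synth N)).prod (X.map (synth N)))})
    (obsL2 hT) (fun U => innerH0 Y1 (U.pos 0) - innerH0 Y0 (U.vel 0))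
    (discreteFunctional Y0 Y1) (fun U _ => discreteFunctional_eq hT Y0 Y1 U)
    ((modeSignal N T).comp (amplitudes N T X).subtype)
    ((modeFunctional N Y0 Y1).comp (amplitudes N T X).subtype) ?_ ?_ v
  · have e : IsDiscreteHUMControl T ((X.map (synth N)).prod (X.map (synth N))) Y0 Y1 v ↔
        ∃ w ∈ {W : DiscreteWave N T | (W.pos T, W.vel T) ∈
          ((X.map (synth N)).prod (X.map (synth N)))},
          IsMinOn (discreteFunctional Y0 Y1) {W : DiscreteWave N T | (W.pos T, W.vel T) ∈
          ((X.map (synth N)).prod (X.map (synth N)))} w ∧ v = obsL2 hT w := by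
      refine exists_congr fun U => and_congr_right fun _ => and_congr_right fun _ => ?_
      constructor
      · intro h; exact Lp.ext (h.trans (coeFn_obsL2 hT U).symm)
      · rintro rfl; exact coeFn_obsL2 hT U
    rw [e]
    exact key
  · rintro U ⟨⟨x, hx, hxU⟩, ⟨y, hy, hyU⟩⟩
    refine ⟨⟨amplitude N T (x, y), ⟨(x, y), ⟨hx, hy⟩, rfl⟩⟩, ?_⟩
    have hU : ∀ t ∈ Icc 0 T, U.pos t = (modeWave N T (amplitude N T (x, y))).pos t ∧
        U.vel t = (modeWave N T (amplitude N T (x, y))).vel t := fun t ht =>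
      DiscreteWave.ext_of_final _ _ (by rw [modeWave_amplitude_pos]; exact hxU.symm)
        (by rw [modeWave_amplitude_vel]; exact hyU.symm) ht
    constructor
    · rw [LinearMap.comp_apply, Submodule.subtype_apply, ← obsL2_modeWave hT]
      refine Lp.ext ((coeFn_obsL2 hT _).trans (EventuallyEq.trans ?_ (coeFn_obsL2 hT _).symm))
      refine (ae_restrict_iff' measurableSet_Ioo).2 (Eventually.of_forall fun t ht => ?_)
      simp only
      rw [(hU t (Ioo_subset_Icc_self ht)).1]
    · obtain ⟨h1, h2⟩ := hU 0 ⟨le_rfl, hT⟩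
      rw [h1, h2, data_modeWave]
      rfl
  · rintro ⟨c, ⟨⟨x, y⟩, ⟨hx, hy⟩, rfl⟩⟩
    refine ⟨modeWave N T (amplitude N T (x, y)), ⟨⟨x, hx, ?_⟩, ⟨y, hy, ?_⟩⟩, ?_, ?_⟩
    · exact (modeWave_amplitude_pos x y).symm
    · exact (modeWave_amplitude_vel x y).symm
    · exact obsL2_modeWave hT _
    · exact data_modeWave Y0 Y1 _

/-- The discrete HUM control exists and is unique, if the data of the waves with vanishing
amplitudes at the observed modes vanish. -/
theorem existsUnique_discreteHUMControl {N : ℕ} {T : ℝ} (hT : 0 < T)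
    (X : Submodule ℂ (Bool → ℕ → ℂ)) (Y0 Y1 : GridVec N) :
    ∃! v : L2T T, IsDiscreteHUMControl T ((X.map (synth N)).prod (X.map (synth N))) Y0 Y1 v := by
  set Φ := (modeSignal N T).comp (amplitudes N T X).subtype with hΦ
  set L := (modeFunctional N Y0 Y1).comp (amplitudes N T X).subtype with hL
  have hfin : FiniteDimensional ℂ (LinearMap.range Φ) := by
    have hle : LinearMap.range Φ ≤
        Submodule.span ℂ ((fun j => expT T (modeFreq N j)) '' (modes N : Set Mode)) := by
      rintro _ ⟨c, rfl⟩
      change ∑ j ∈ modes N, ((modeWeight N j : ℂ) * (c : Mode → ℂ) j) • expT T (modeFreq N j) ∈ _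
      refine Submodule.sum_mem _ fun j hj => Submodule.smul_mem _ _ (Submodule.subset_span ?_)
      exact ⟨j, hj, rfl⟩
    have : FiniteDimensional ℂ
        (Submodule.span ℂ ((fun j => expT T (modeFreq N j)) '' (modes N : Set Mode))) :=
      FiniteDimensional.span_of_finite ℂ ((modes N).finite_toSet.image _)
    exact Submodule.finiteDimensional_of_le hle
  have hker : ∀ d, Φ d = 0 → L d = 0 := by
    intro d hd
    have h1 := eq_zero_of_sum_smul_expT_eq_zero hT (modes N)
      (fun j => (modeWeight N j : ℂ) * (d : Mode → ℂ) j) (modeFreq N) (injOn_modeFreq N) hd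
    change ∑ j ∈ modes N, conj ((d : Mode → ℂ) j) * modeData N Y0 Y1 j = 0
    refine Finset.sum_eq_zero fun j hj => ?_
    have h2 := (mul_eq_zero.1 (h1 j hj)).resolve_left (by
      exact_mod_cast modeWeight_ne_zero hj)
    rw [h2, map_zero, zero_mul]
  obtain ⟨v, hv⟩ := eulerLagrange_exists_of_finiteDimensional Φ L hker
  refine ⟨v, (isDiscreteHUMControl_iff hT.le X Y0 Y1 v).2 hv, fun w hw => ?_⟩
  exact eulerLagrange_unique Φ L ((isDiscreteHUMControl_iff hT.le X Y0 Y1 w).1 hw) hv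

end DiscreteWaves

/-! ### Gaps and observation weights -/

section Gaps

theorem four_le_abs_modeFreq_sub {N : ℕ} {i j : Mode} (hi : i ∈ modes N) (hj : j ∈ modes N)
    (hσ : i.2.1 ≠ j.2.1) : 4 ≤ |modeFreq N i - modeFreq N j| := by
  have h1 := two_mul_le_freq i.1 (mem_modes.1 hi)
  have h2 := two_mul_le_freq j.1 (mem_modes.1 hj)
  have h3 : (0 : ℝ) ≤ i.2.2 := Nat.cast_nonneg _
  have h4 : (0 : ℝ) ≤ j.2.2 := Nat.cast_nonneg _
  obtain ⟨b, σ, n⟩ := i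
  obtain ⟨b', σ', n'⟩ := j
  simp only [modeFreq] at *
  cases σ <;> cases σ' <;> simp only [sgn, if_true, if_false, Bool.false_eq_true, ne_eq,
    not_true_eq_false, Bool.true_eq_false, not_false_eq_true] at hσ ⊢
  · rw [abs_sub_comm]; exact le_trans (by linarith) (le_abs_self _)
  · exact le_trans (by linarith) (le_abs_self _)

theorem abs_modeFreq_sub {N : ℕ} {i j : Mode} (hσ : i.2.1 = j.2.1) :
    |modeFreq N i - modeFreq N j| = |freq N i.1 i.2.2 - freq N j.1 j.2.2| := by
  rw [modeFreq, modeFreq, hσ, ← mul_sub, abs_mul, abs_sgn, one_mul]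

theorem pi_le_waveNum_sub {N n n' : ℕ} (h : n < n') :
    Real.pi * meshSize N ≤ waveNum N (n' + 1) - waveNum N (n + 1) := by
  have h2 : (n : ℝ) + 1 ≤ n' := by exact_mod_cast h
  have := mul_pos Real.pi_pos (meshSize_pos N)
  simp only [waveNum]
  push_cast
  nlinarith

/-- The gap between the frequencies of one branch and one sign, in an interval of wave numbers where
the increments of the dispersion relation are bounded from below. -/
theorem modeFreq_gap_of_increment {N : ℕ} {m : ℝ} (hm : 0 ≤ m) {b : Bool} {I : Set ℝ}
    (h : ∀ x ∈ I, ∀ y ∈ I, x ≤ y →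
      m * (y - x) ≤ |dispersion (branchSymbol b) y - dispersion (branchSymbol b) x|)
    {σ : Bool} {n n' : ℕ} (hn : waveNum N (n + 1) ∈ I) (hn' : waveNum N (n' + 1) ∈ I)
    (hne : n ≠ n') :
    m * Real.pi ≤ |modeFreq N (b, σ, n) - modeFreq N (b, σ, n')| := by
  wlog hlt : n < n' generalizing n n'
  · rw [abs_sub_comm]
    exact this hn' hn hne.symm (by omega)
  have h1 := h _ hn _ hn' (waveNum_lt (by omega)).le
  have h2 := pi_le_waveNum_sub (N := N) hlt
  rw [abs_modeFreq_sub (i := (b, σ, n)) (j := (b, σ, n')) rfl, abs_sub_comm]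
  simp only [freq_eq]
  rw [← sub_div, abs_div, abs_of_pos (meshSize_pos N), le_div_iff₀ (meshSize_pos N)]
  refine le_trans ?_ h1
  rw [mul_assoc]
  gcongr

/-- The acoustic and the optic frequencies are far from each other. -/
theorem eventually_branch_gap (γ : ℝ) : ∀ᶠ N in atTop, ∀ i ∈ modes N, ∀ j ∈ modes N,
    i.2.1 = j.2.1 → i.1 ≠ j.1 → γ ≤ |modeFreq N i - modeFreq N j| := by
  have hd : 0 < √12 - √10 := sub_pos.2 (Real.sqrt_lt_sqrt (by norm_num) (by norm_num))
  have ht : Tendsto (fun N : ℕ => (√12 - √10) * ((N : ℝ) + 1)) atTop atTop :=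
    (tendsto_atTop_add_const_right _ _ tendsto_natCast_atTop_atTop).const_mul_atTop hd
  filter_upwards [ht.eventually_ge_atTop γ] with N hN
  have key : ∀ n n', γ ≤ freq N true n - freq N false n' := by
    intro n n'
    rw [freq_eq, freq_eq, ← sub_div]
    have h3 := dispersion_acoustic_le (waveNum N (n' + 1))
    have h4 := le_dispersion_optic (waveNum N (n + 1))
    refine hN.trans ?_
    rw [le_div_iff₀ (meshSize_pos N), mul_assoc, mul_comm _ (meshSize N), meshSize_mul, mul_one]
    simp only [branchSymbol, if_true, Bool.false_eq_true, if_false]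
    linarith
  rintro ⟨b, σ, n⟩ - ⟨b', σ', n'⟩ - hσ hb
  rw [abs_modeFreq_sub hσ]
  cases b <;> cases b' <;> simp only [ne_eq, not_true_eq_false] at hb ⊢
  · rw [abs_sub_comm]; exact (key _ _).trans (le_abs_self _)
  · exact (key _ _).trans (le_abs_self _)

theorem abs_modeWeight_ge {N : ℕ} {j : Mode} (hj : j ∈ modes N) {s δ : ℝ} (hs : 0 < s) (hδ : 0 < δ)
    (h1 : s * dispersion (branchSymbol j.1) (waveNum N (j.2.2 + 1)) ≤
      Real.sin (waveNum N (j.2.2 + 1)))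
    (h2 : δ ≤ |10 - branchSymbol j.1 (waveNum N (j.2.2 + 1))|) :
    s / (1 + 25 / δ) ≤ |modeWeight N j| := by
  have hη := waveNum_succ_mem (mem_modes.1 hj)
  rw [modeWeight, obsWeight, abs_div, abs_mul, abs_pow, abs_neg, abs_one, one_pow, one_mul]
  set η := waveNum N (j.2.2 + 1)
  have hd := dispersion_branch_pos j.1 hη
  have hq := Real.sqrt_pos.2 (rawNormSq_pos (branchSymbol j.1) η)
  have hM : |midRatio (branchSymbol j.1) η| ≤ 25 / δ := by
    have h60 : branchSymbol j.1 η ≤ 60 := by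
      cases j.1
      · exact (acousticSymbol_le_ten η).trans (by norm_num)
      · exact opticSymbol_le η
    have h0 := branchSymbol_nonneg j.1 η
    rw [midRatio, abs_mul, abs_div, abs_mul, abs_of_nonneg (by linarith : 0 ≤ 40 + branchSymbol j.1 η),
      abs_of_pos (by norm_num : (0 : ℝ) < 4)]
    calc (40 + branchSymbol j.1 η) / (4 * |10 - branchSymbol j.1 η|) * |Real.cos (η / 2)|
        ≤ (40 + 60) / (4 * δ) * 1 := by
          gcongr
          exact Real.abs_cos_le_one _
      _ = 25 / δ := by field_simp; norm_num
  have hqM : √(rawNormSq (branchSymbol j.1) η) ≤ 1 + 25 / δ := by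
    have hM0 : 0 < 25 / δ := by positivity
    refine Real.sqrt_le_iff.2 ⟨by positivity, ?_⟩
    have h3 := Real.abs_cos_le_one (η / 2)
    have h4 : Real.cos (η / 2) * midRatio (branchSymbol j.1) η ≤ 25 / δ := by
      refine (le_abs_self _).trans ?_
      rw [abs_mul]
      exact (mul_le_of_le_one_left (abs_nonneg _) h3).trans hM
    have h5 : midRatio (branchSymbol j.1) η ^ 2 ≤ (25 / δ) ^ 2 := sq_le_sq' (abs_le.1 hM).1 (abs_le.1 hM).2
    rw [rawNormSq]
    nlinarith [sq_nonneg (Real.cos (η / 2))]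
  rw [abs_of_pos (Real.sin_pos_of_mem_Ioo hη), abs_of_pos (by positivity),
    div_le_div_iff₀ (by positivity) (by positivity)]
  calc s * (√(rawNormSq (branchSymbol j.1) η) * dispersion (branchSymbol j.1) η)
      = √(rawNormSq (branchSymbol j.1) η) * (s * dispersion (branchSymbol j.1) η) := by ring
    _ ≤ (1 + 25 / δ) * Real.sin η := by gcongr
    _ = _ := mul_comm _ _

theorem exists_modeWeight_ge_acoustic {η₀ : ℝ} (h₀ : η₀ ∈ Ioo 0 Real.pi) :
    ∃ ρ : ℝ, 0 < ρ ∧ ∀ N, ∀ j ∈ modes N, j.1 = false → waveNum N (j.2.2 + 1) ≤ η₀ →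
      ρ ≤ |modeWeight N j| := by
  have hc : 0 < Real.cos (η₀ / 2) := Real.cos_pos_of_mem_Ioo ⟨by linarith [h₀.1, Real.pi_pos],
    by linarith [h₀.2]⟩
  have hδ : 0 < 10 - acousticSymbol η₀ := sub_pos.2 (acousticSymbol_lt_ten h₀)
  refine ⟨Real.cos (η₀ / 2) / 2 / (1 + 25 / (10 - acousticSymbol η₀)), by positivity, ?_⟩
  rintro N ⟨b, σ, n⟩ hj hb hle
  simp only at hb hle
  subst hb
  have hη := waveNum_succ_mem (mem_modes.1 hj)
  simp only at hη
  refine abs_modeWeight_ge hj (by positivity) hδ ?_ ?_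
  · simp only [branchSymbol, Bool.false_eq_true, if_false]
    have h1 := dispersion_acoustic_le_sin (Ioo_subset_Icc_self hη)
    have h2 := sin_half_nonneg (Ioo_subset_Icc_self hη)
    have h3 : Real.cos (η₀ / 2) ≤ Real.cos (waveNum N (n + 1) / 2) :=
      Real.cos_le_cos_of_nonneg_of_le_pi (by linarith [hη.1]) (by linarith [h₀.2, Real.pi_pos])
        (by linarith)
    have h4 : Real.sin (waveNum N (n + 1)) =
        2 * Real.sin (waveNum N (n + 1) / 2) * Real.cos (waveNum N (n + 1) / 2) := by
      rw [← Real.sin_two_mul]; congr 1; ring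
    rw [h4]
    nlinarith [mul_le_mul_of_nonneg_left h1 hc.le, mul_le_mul_of_nonneg_left h3 h2]
  · simp only [branchSymbol, Bool.false_eq_true, if_false]
    have h1 := strictMonoOn_dispersion_acoustic.monotoneOn (Ioo_subset_Icc_self hη)
      (Ioo_subset_Icc_self h₀) hle
    rw [dispersion, dispersion, Real.sqrt_le_sqrt_iff (acousticSymbol_nonneg _)] at h1
    exact le_trans (by linarith) (le_abs_self _)

theorem exists_modeWeight_ge_optic {ηp ηm : ℝ} (hp : 0 < ηp) (hm : ηm < Real.pi) :
    ∃ ρ : ℝ, 0 < ρ ∧ ∀ N, ∀ j ∈ modes N, j.1 = true → waveNum N (j.2.2 + 1) ∈ Icc ηp ηm →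
      ρ ≤ |modeWeight N j| := by
  by_cases hpm : ηm < ηp
  · exact ⟨1, one_pos, fun N j _ _ hmem => absurd (hmem.1.trans hmem.2) (not_le.2 hpm)⟩
  push Not at hpm
  have h1 : 0 < Real.sin ηp := Real.sin_pos_of_pos_of_lt_pi hp (by linarith)
  have h2 : 0 < Real.sin ηm := Real.sin_pos_of_pos_of_lt_pi (by linarith) hm
  have hs : 0 < min (Real.sin ηp) (Real.sin ηm) := lt_min h1 h2
  refine ⟨min (Real.sin ηp) (Real.sin ηm) / 8 / (1 + 25 / 2), by positivity, ?_⟩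
  rintro N ⟨b, σ, n⟩ hj hb hmem
  simp only at hb hmem
  subst hb
  refine abs_modeWeight_ge hj (by positivity) two_pos ?_ ?_
  · simp only [branchSymbol, if_true]
    have h3 := dispersion_optic_le (waveNum N (n + 1))
    have h4 := dispersion_optic_pos (waveNum N (n + 1))
    have h5 : min (Real.sin ηp) (Real.sin ηm) ≤ Real.sin (waveNum N (n + 1)) := by
      rcases le_total (waveNum N (n + 1)) (Real.pi / 2) with h | h
      · exact (min_le_left _ _).trans (Real.sin_le_sin_of_le_of_le_pi_div_two
          (by linarith [Real.pi_pos]) h hmem.1)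
      · refine (min_le_right _ _).trans ?_
        rw [← Real.sin_pi_sub ηm, ← Real.sin_pi_sub (waveNum N (n + 1))]
        exact Real.sin_le_sin_of_le_of_le_pi_div_two (by linarith) (by linarith)
          (by linarith [hmem.2])
    nlinarith
  · simp only [branchSymbol, if_true]
    have := twelve_le_opticSymbol (waveNum N (n + 1))
    rw [abs_sub_comm]
    exact le_trans (by linarith) (le_abs_self _)

end Gaps

/-! ### Final data and amplitudes -/

section FinalData

/-- The coefficients of the data at `t = T` of a superposition of modes. -/
def finalCoeffs (N : ℕ) (T : ℝ) (c : Mode → ℂ) : (Bool → ℕ → ℂ) × (Bool → ℕ → ℂ) :=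
  (fun b n => (c (b, true, n) * osc (freq N b n) T + c (b, false, n) * osc (-freq N b n) T) / freq N b n,
   fun b n => Complex.I * (c (b, true, n) * osc (freq N b n) T - c (b, false, n) * osc (-freq N b n) T))

theorem amplitude_finalCoeffs {N : ℕ} {T : ℝ} {c : Mode → ℂ} (hc : ∀ j, j ∉ modes N → c j = 0) :
    amplitude N T (finalCoeffs N T c) = c := by
  funext ⟨b, σ, n⟩
  by_cases hn : n < N
  · have hf : (freq N b n : ℂ) ≠ 0 := by exact_mod_cast (freq_pos b hn).ne'
    have h1 := osc_neg_mul_osc (freq N b n) T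
    have hI := Complex.I_sq
    simp only [amplitude, finalCoeffs, LinearMap.coe_mk, AddHom.coe_mk, modeFreq]
    rw [mul_div_cancel₀ _ hf]
    cases σ
    · simp only [sgn, Bool.false_eq_true, if_false, neg_mul, one_mul, neg_neg]
      push_cast
      linear_combination c (b, false, n) * h1 + (1 / 2) * (c (b, true, n) * osc (freq N b n) T -
        c (b, false, n) * osc (-freq N b n) T) * osc (freq N b n) T * hI
    · simp only [sgn, if_true, one_mul]
      push_cast
      linear_combination c (b, true, n) * h1 - (1 / 2) * (c (b, true, n) * osc (freq N b n) T -
        c (b, false, n) * osc (-freq N b n) T) * osc (-freq N b n) T * hI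
  · have h1 : ∀ σ, c (b, σ, n) = 0 := fun σ => hc _ (by simpa [mem_modes] using hn)
    simp [amplitude, finalCoeffs, h1]

end FinalData

/-! ### Fourier truncation -/

section Truncation

/-- The modes kept by the Fourier truncation. -/
def IsKept (N : ℕ) (Λa Λm Λp : ℝ) (b : Bool) (n : ℕ) : Prop :=
  n < N ∧ (b = false → waveNum N (n + 1) ≤ wavenumber acousticSymbol Λa) ∧
    (b = true → waveNum N (n + 1) ∈ Icc (wavenumber opticSymbol Λp) (wavenumber opticSymbol Λm))

/-- The coefficients of the elements of the truncated space. -/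
def keptCoeffs (N : ℕ) (Λa Λm Λp : ℝ) : Submodule ℂ (Bool → ℕ → ℂ) where
  carrier := {x | ∀ b n, ¬ IsKept N Λa Λm Λp b n → x b n = 0}
  zero_mem' _ _ _ := rfl
  add_mem' hx hy b n h := by rw [Pi.add_apply, Pi.add_apply, hx b n h, hy b n h, add_zero]
  smul_mem' a x hx b n h := by rw [Pi.smul_apply, Pi.smul_apply, hx b n h, smul_zero]

theorem synth_single {N : ℕ} {b : Bool} {n : ℕ} (hn : n < N) :
    synth N (Pi.single b (Pi.single n 1)) = eigenvector (branchSymbol b) N (n + 1) := by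
  simp only [synth, LinearMap.coe_mk, AddHom.coe_mk]
  rw [Finset.sum_eq_single b, Finset.sum_eq_single n]
  · simp
  · intro l _ hl; simp [hl]
  · intro h; exact absurd (Finset.mem_range.2 hn) h
  · intro b' _ hb'; simp [hb']
  · intro h; exact absurd (Finset.mem_univ _) h

theorem truncatedVecs_eq (N : ℕ) (Λa Λm Λp : ℝ) :
    truncatedVecs N Λa Λm Λp = (keptCoeffs N Λa Λm Λp).map (synth N) := by
  have hmem : ∀ b n, IsKept N Λa Λm Λp b n →
      eigenvector (branchSymbol b) N (n + 1) ∈ (keptCoeffs N Λa Λm Λp).map (synth N) := by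
    intro b n h
    refine ⟨Pi.single b (Pi.single n 1), fun b' n' h' => ?_, synth_single h.1⟩
    by_cases hb : b' = b
    · subst hb
      rw [Pi.single_eq_same, Pi.single_eq_of_ne]
      rintro rfl; exact h' h
    · rw [Pi.single_eq_of_ne hb]; rfl
  refine le_antisymm (sup_le (Submodule.span_le.2 ?_) (Submodule.span_le.2 ?_)) ?_
  · rintro _ ⟨k, h1, h2, h3, rfl⟩
    obtain ⟨n, rfl⟩ : ∃ n, k = n + 1 := ⟨k - 1, by omega⟩
    exact hmem false n ⟨by omega, fun _ => h3, by simp⟩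
  · rintro _ ⟨k, h1, h2, h3, h4, rfl⟩
    obtain ⟨n, rfl⟩ : ∃ n, k = n + 1 := ⟨k - 1, by omega⟩
    exact hmem true n ⟨by omega, by simp, fun _ => ⟨h3, h4⟩⟩
  · rintro _ ⟨x, hx, rfl⟩
    change ∑ b, ∑ n ∈ Finset.range N, x b n • eigenvector (branchSymbol b) N (n + 1) ∈ _
    refine Submodule.sum_mem _ fun b _ => Submodule.sum_mem _ fun n hn => ?_
    by_cases h : IsKept N Λa Λm Λp b n
    · refine Submodule.smul_mem _ _ ?_
      cases b
      · exact Submodule.mem_sup_left (Submodule.subset_span ⟨n + 1, by omega, h.1, h.2.1 rfl, rfl⟩)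
      · exact Submodule.mem_sup_right (Submodule.subset_span ⟨n + 1, by omega, h.1, (h.2.2 rfl).1,
          (h.2.2 rfl).2, rfl⟩)
    · rw [hx b n h, zero_smul]
      exact Submodule.zero_mem _

theorem truncatedSpace_eq (N : ℕ) (Λa Λm Λp : ℝ) :
    truncatedSpace N Λa Λm Λp = ((keptCoeffs N Λa Λm Λp).map (synth N)).prod
      ((keptCoeffs N Λa Λm Λp).map (synth N)) := by
  rw [truncatedSpace, truncatedVecs_eq]

theorem amplitudes_keptCoeffs {N : ℕ} {T Λa Λm Λp : ℝ} {c : Mode → ℂ}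
    (hc : c ∈ amplitudes N T (keptCoeffs N Λa Λm Λp)) {j : Mode}
    (hj : ¬ IsKept N Λa Λm Λp j.1 j.2.2) : c j = 0 := by
  obtain ⟨⟨x, y⟩, ⟨hx, hy⟩, rfl⟩ := hc
  simp only [amplitude, LinearMap.coe_mk, AddHom.coe_mk]
  rw [show x j.1 j.2.2 = 0 from hx _ _ hj, show y j.1 j.2.2 = 0 from hy _ _ hj]
  ring

theorem single_mem_amplitudes_keptCoeffs {N : ℕ} {T Λa Λm Λp : ℝ} {j : Mode}
    (hj : IsKept N Λa Λm Λp j.1 j.2.2) :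
    Pi.single j 1 ∈ amplitudes N T (keptCoeffs N Λa Λm Λp) := by
  have h0 : ∀ i : Mode, ¬ IsKept N Λa Λm Λp i.1 i.2.2 → (Pi.single j 1 : Mode → ℂ) i = 0 := by
    intro i hi
    refine Pi.single_eq_of_ne ?_ _
    rintro rfl; exact hi hj
  refine ⟨finalCoeffs N T (Pi.single j 1), ⟨?_, ?_⟩, amplitude_finalCoeffs fun i hi => h0 i fun h => ?_⟩
  · intro b n h
    simp only [finalCoeffs]
    rw [h0 (b, true, n) h, h0 (b, false, n) h]; simp
  · intro b n h
    simp only [finalCoeffs]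
    rw [h0 (b, true, n) h, h0 (b, false, n) h]; simp
  · exact hi (mem_modes.2 h.1)

theorem norm_sq_modeSignal {N : ℕ} {T : ℝ} (hT : 0 ≤ T) (c : Mode → ℂ) :
    ‖modeSignal N T c‖ ^ 2 =
      ∫ t in (0 : ℝ)..T, ‖trigSum (modes N) (fun j => (modeWeight N j : ℂ) * c j) (modeFreq N) t‖ ^ 2 :=
  norm_sq_sum_smul_expT hT _ _ _

variable {T Λa Λm Λp : ℝ}

/-- Uniform observability of the truncated waves. -/
theorem observability_truncated (h1 : 0 < Λa) (h2 : Λa < 10) (h3 : 12 < Λm)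
    (h4 : Λm ≤ Λp) (h5 : Λp < 60) (hT : truncationTime Λa Λm Λp < T) :
    ∃ κ : ℝ, 0 < κ ∧ ∀ᶠ N in atTop, ∀ c ∈ amplitudes N T (keptCoeffs N Λa Λm Λp),
      κ * ∑ j ∈ modes N, ‖c j‖ ^ 2 ≤ ‖modeSignal N T c‖ ^ 2 := by
  obtain ⟨m, hm0, hm1, hmT, hinca, hinco⟩ := truncation_gap h1 h2 h3 h4 h5 hT
  obtain ⟨ha, -⟩ := wavenumber_acoustic h1 h2
  obtain ⟨hm, -⟩ := wavenumber_optic h3 (h4.trans_lt h5)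
  obtain ⟨hp, -⟩ := wavenumber_optic (h3.trans_le h4) h5
  have hpi := Real.pi_pos
  have hT0 : 0 < T := by
    by_contra! h
    nlinarith
  obtain ⟨ρa, hρa, hwa⟩ := exists_modeWeight_ge_acoustic ha
  obtain ⟨ρo, hρo, hwo⟩ := exists_modeWeight_ge_optic hp.1 hm.2
  obtain ⟨c₁, hc₁, c₂, hc₂, hI⟩ := filtered_ingham (ι := Mode) (T := T) (γ := m * Real.pi) hT0
    (by nlinarith)
  have hρ : 0 < min ρa ρo := lt_min hρa hρo
  refine ⟨c₁ * min ρa ρo ^ 2, by positivity, ?_⟩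
  filter_upwards [eventually_branch_gap (m * Real.pi)] with N hN c hc
  classical
  set s := (modes N).filter fun j => IsKept N Λa Λm Λp j.1 j.2.2 with hs
  have hsub : s ⊆ modes N := Finset.filter_subset _ _
  have hzero : ∀ j ∈ modes N, j ∉ s → c j = 0 := fun j hj hjs =>
    amplitudes_keptCoeffs hc fun h => hjs (Finset.mem_filter.2 ⟨hj, h⟩)
  have hkey := hI s (modeFreq N) (fun _ => 1) 0 (fun j => (modeWeight N j : ℂ) * c j)
    (fun _ _ => zero_le_one) (fun _ _ => le_rfl) (by simp) ?_
  · have e1 : ‖modeSignal N T c‖ ^ 2 = ∫ t in (0 : ℝ)..T,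
        ‖trigSum s (fun j => (modeWeight N j : ℂ) * c j) (modeFreq N) t‖ ^ 2 := by
      rw [← norm_sq_sum_smul_expT hT0.le]
      congr 2
      refine (Finset.sum_subset hsub fun j hj hjs => ?_).symm
      rw [hzero j hj hjs, mul_zero, zero_smul]
    have e2 : ∑ j ∈ modes N, ‖c j‖ ^ 2 = ∑ j ∈ s, ‖c j‖ ^ 2 :=
      (Finset.sum_subset hsub fun j hj hjs => by simp [hzero j hj hjs]).symm
    rw [e1, e2]
    refine le_trans ?_ hkey
    simp only [one_pow, one_mul, norm_mul, Complex.norm_real, Real.norm_eq_abs, mul_pow, ne_eq,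
      OfNat.ofNat_ne_zero, not_false_eq_true, zero_pow, zero_mul, mul_zero, sub_zero]
    rw [mul_assoc, Finset.mul_sum]
    refine mul_le_mul_of_nonneg_left (Finset.sum_le_sum fun j hj => ?_) hc₁.le
    have hjk := (Finset.mem_filter.1 hj).2
    have hw : min ρa ρo ≤ |modeWeight N j| := by
      rcases hb : j.1 with _ | _
      · exact (min_le_left _ _).trans (hwa N j (hsub hj) hb (hjk.2.1 hb))
      · exact (min_le_right _ _).trans (hwo N j (hsub hj) hb (hjk.2.2 hb))
    gcongr
  · rintro ⟨b, σ, n⟩ hi ⟨b', σ', n'⟩ hj - - hne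
    have hik := (Finset.mem_filter.1 hi).2
    have hjk := (Finset.mem_filter.1 hj).2
    by_cases hσ : σ = σ'
    · subst hσ
      by_cases hb : b = b'
      · subst hb
        have hnn : n ≠ n' := by rintro rfl; exact hne rfl
        cases b
        · refine modeFreq_gap_of_increment hm0.le (I := Icc 0 (wavenumber acousticSymbol Λa)) ?_
            ⟨(waveNum_succ_mem hik.1).1.le, hik.2.1 rfl⟩
            ⟨(waveNum_succ_mem hjk.1).1.le, hjk.2.1 rfl⟩ hnn
          intro x hx y hy hxy
          exact (hinca x y hx.1 hxy hy.2).trans (le_abs_self _)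
        · refine modeFreq_gap_of_increment hm0.le
            (I := Icc (wavenumber opticSymbol Λp) (wavenumber opticSymbol Λm)) ?_
            (hik.2.2 rfl) (hjk.2.2 rfl) hnn
          intro x hx y hy hxy
          rw [abs_sub_comm]
          exact (hinco x y hx.1 hxy hy.2).trans (le_abs_self _)
      · exact hN _ (hsub hi) _ (hsub hj) rfl hb
    · refine le_trans ?_ (four_le_abs_modeFreq_sub (hsub hi) (hsub hj) hσ)
      nlinarith [Real.pi_lt_four]

theorem tendsto_waveNum (k : ℕ) : Tendsto (fun N => waveNum N k) atTop (𝓝 0) := by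
  have h : Tendsto (fun N : ℕ => meshSize N) atTop (𝓝 0) := tendsto_one_div_add_atTop_nhds_zero_nat
  simpa [waveNum] using h.const_mul ((k : ℝ) * Real.pi)

theorem eventually_single_mem_truncated (h1 : 0 < Λa) (h2 : Λa < 10) (T : ℝ) (σ : Bool) (n : ℕ) :
    ∀ᶠ N in atTop, Pi.single (false, σ, n) 1 ∈ amplitudes N T (keptCoeffs N Λa Λm Λp) := by
  obtain ⟨ha, -⟩ := wavenumber_acoustic h1 h2
  filter_upwards [eventually_gt_atTop n, (tendsto_waveNum (n + 1)).eventually_lt_const ha.1]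
    with N hN hlt
  exact single_mem_amplitudes_keptCoeffs ⟨hN, fun _ => hlt.le, by simp⟩

end Truncation

/-! ### The bi-grid space -/

section BigridWeights

/-- The coefficients of `cos²(η/2)` times the piecewise linear interpolant of `sin(kπx)` on the
eigenvectors. -/
def bigridWeight (b : Bool) (η : ℝ) : ℝ :=
  Real.cos (η / 2) ^ 2 * (branchSymbol (!b) η * (10 - branchSymbol b η) /
    (10 * (branchSymbol (!b) η - branchSymbol b η)) * √(rawNormSq (branchSymbol b) η))

theorem bigridWeight_synth {N k : ℕ} (h1 : 1 ≤ k) (h2 : k ≤ N) :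
    ∑ b, (bigridWeight b (waveNum N k) : ℂ) • eigenvector (branchSymbol b) N k =
      ((Real.cos (waveNum N k / 2) ^ 2 : ℝ) : ℂ) • gridSine N k 1 (Real.cos (waveNum N k / 2)) := by
  have hη := waveNum_mem h1 h2
  simp only [Fintype.sum_bool, eigenvector_eq _ h1 h2, smul_gridSine, gridSine_add, bigridWeight,
    midRatio, Bool.not_true, Bool.not_false]
  set η := waveNum N k
  have hq := fun b => (Real.sqrt_pos.2 (rawNormSq_pos (branchSymbol b) η)).ne'
  have hqt := hq true
  have hqf := hq false
  have hne := fun b => branchSymbol_ne_ten b hη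
  have hnet := hne true
  have hnef := hne false
  have h12 : 12 ≤ branchSymbol true η := twelve_le_opticSymbol η
  have h10 : branchSymbol false η ≤ 10 := acousticSymbol_le_ten η
  set A := branchSymbol false η
  set O := branchSymbol true η
  have hd1 : A - O ≠ 0 := by linarith
  have hd2 : O - A ≠ 0 := by linarith
  have hd3 : A - O = -(O - A) := by ring
  congr 1
  · rw [hd3]; field_simp; ring
  · rw [hd3]; field_simp; ring

theorem sqrt_rawNormSq_optic_le (η : ℝ) : √(rawNormSq opticSymbol η) ≤ 27 / 2 := by
  have h1 := Real.abs_cos_le_one (η / 2)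
  have h12 := twelve_le_opticSymbol η
  have h60 := opticSymbol_le η
  have hM : |midRatio opticSymbol η| ≤ 25 / 2 := by
    rw [midRatio, abs_mul, abs_div, abs_mul, abs_of_pos (by linarith : 0 < 40 + opticSymbol η),
      abs_of_pos (by norm_num : (0 : ℝ) < 4), abs_of_neg (by linarith : 10 - opticSymbol η < 0)]
    calc (40 + opticSymbol η) / (4 * -(10 - opticSymbol η)) * |Real.cos (η / 2)|
        ≤ (40 + 60) / (4 * 2) * 1 := by
          gcongr
          linarith
      _ = 25 / 2 := by norm_num
  have h4 : Real.cos (η / 2) * midRatio opticSymbol η ≤ 25 / 2 := by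
    refine (le_abs_self _).trans ?_
    rw [abs_mul]
    exact (mul_le_of_le_one_left (abs_nonneg _) h1).trans hM
  have h5 : midRatio opticSymbol η ^ 2 ≤ (25 / 2) ^ 2 := sq_le_sq' (abs_le.1 hM).1 (abs_le.1 hM).2
  refine Real.sqrt_le_iff.2 ⟨by norm_num, ?_⟩
  rw [rawNormSq]
  nlinarith [sq_nonneg (Real.cos (η / 2))]

theorem mul_sqrt_rawNormSq_acoustic_le {η : ℝ} (hη : η ∈ Ioo 0 Real.pi) :
    (10 - acousticSymbol η) * √(rawNormSq acousticSymbol η) ≤ 9 * 5 := by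
  have h10 := acousticSymbol_lt_ten hη
  have h0 := acousticSymbol_nonneg η
  have hc := cos_half_nonneg (Ioo_subset_Icc_self hη)
  have hc1 := Real.cos_le_one (η / 2)
  set d := 10 - acousticSymbol η with hd
  have hd0 : 0 < d := by linarith
  have hm : d * midRatio acousticSymbol η = (40 + acousticSymbol η) / 4 * Real.cos (η / 2) := by
    rw [midRatio, ← hd]; field_simp
  have hm1 : d * midRatio acousticSymbol η ≤ 25 / 2 := by rw [hm]; nlinarith
  have hm0 : 0 ≤ d * midRatio acousticSymbol η := by
    rw [hm]; exact mul_nonneg (by linarith) hc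
  have hs : √(rawNormSq acousticSymbol η) ≤ 9 * 5 / d := by
    refine Real.sqrt_le_iff.2 ⟨by positivity, ?_⟩
    rw [div_pow, le_div_iff₀ (by positivity), rawNormSq]
    have e : 1 / 30 * (5 - 2 * Real.cos (η / 2) ^ 2 + 4 * Real.cos (η / 2) * midRatio acousticSymbol η +
        8 * midRatio acousticSymbol η ^ 2) * d ^ 2 =
        1 / 30 * ((5 - 2 * Real.cos (η / 2) ^ 2) * d ^ 2 +
          4 * Real.cos (η / 2) * (d * midRatio acousticSymbol η) * d +
          8 * (d * midRatio acousticSymbol η) ^ 2) := by ring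
    rw [e]
    have hd1 : d ≤ 10 := by linarith
    have h1 : (5 - 2 * Real.cos (η / 2) ^ 2) * d ^ 2 ≤ 5 * 10 ^ 2 := by
      gcongr
      nlinarith [sq_nonneg (Real.cos (η / 2))]
    have h2 : 4 * Real.cos (η / 2) * (d * midRatio acousticSymbol η) * d ≤ 4 * 1 * (25 / 2) * 10 := by
      gcongr
    have h3 : 8 * (d * midRatio acousticSymbol η) ^ 2 ≤ 8 * (25 / 2) ^ 2 := by gcongr
    nlinarith
  calc d * √(rawNormSq acousticSymbol η) ≤ d * (9 * 5 / d) := by gcongr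
    _ = 9 * 5 := by field_simp

/-- The quotient of a symbol by the difference of the symbols. -/
theorem optic_div_sub_le (η : ℝ) :
    opticSymbol η / (opticSymbol η - acousticSymbol η) ≤ 6 := by
  have h12 := twelve_le_opticSymbol η
  have h10 := acousticSymbol_le_ten η
  rw [div_le_iff₀ (by linarith)]
  linarith

theorem bigridWeight_acoustic (η : ℝ) : bigridWeight false η =
    Real.cos (η / 2) ^ 2 * (opticSymbol η / (opticSymbol η - acousticSymbol η) / 10 *
      ((10 - acousticSymbol η) * √(rawNormSq acousticSymbol η))) := by
  simp only [bigridWeight, branchSymbol, Bool.not_false, if_true, Bool.false_eq_true, if_false]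
  have h12 := twelve_le_opticSymbol η
  have h10 := acousticSymbol_le_ten η
  have : opticSymbol η - acousticSymbol η ≠ 0 := by linarith
  field_simp

theorem bigridWeight_optic (η : ℝ) : bigridWeight true η =
    Real.cos (η / 2) ^ 2 * (acousticSymbol η / 10 *
      ((opticSymbol η - 10) / (opticSymbol η - acousticSymbol η)) * √(rawNormSq opticSymbol η)) := by
  simp only [bigridWeight, branchSymbol, Bool.not_true, if_true, Bool.false_eq_true, if_false]
  have h12 := twelve_le_opticSymbol η
  have h10 := acousticSymbol_le_ten η
  have : opticSymbol η - acousticSymbol η ≠ 0 := by linarith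
  have h' : acousticSymbol η - opticSymbol η = -(opticSymbol η - acousticSymbol η) := by ring
  rw [h']
  field_simp
  ring

theorem bigridWeight_nonneg (b : Bool) (η : ℝ) : 0 ≤ bigridWeight b η := by
  have h12 := twelve_le_opticSymbol η
  have h10 := acousticSymbol_le_ten η
  have h0 := acousticSymbol_nonneg η
  have h1 : 0 < opticSymbol η - acousticSymbol η := by linarith
  have h2 : 0 ≤ 10 - acousticSymbol η := by linarith
  have h3 : 0 ≤ opticSymbol η - 10 := by linarith
  have h4 := (opticSymbol_pos η).le
  cases b
  · rw [bigridWeight_acoustic]; positivity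
  · rw [bigridWeight_optic]; positivity

theorem bigridWeight_acoustic_le {η : ℝ} (hη : η ∈ Ioo 0 Real.pi) :
    bigridWeight false η ≤ 27 * Real.cos (η / 2) ^ 2 := by
  have h10 := acousticSymbol_le_ten η
  have h12 := twelve_le_opticSymbol η
  have h1 := optic_div_sub_le η
  have h2 := mul_sqrt_rawNormSq_acoustic_le hη
  have h3 : 0 ≤ 10 - acousticSymbol η := by linarith
  rw [bigridWeight_acoustic, mul_comm 27]
  refine mul_le_mul_of_nonneg_left ?_ (sq_nonneg _)
  calc opticSymbol η / (opticSymbol η - acousticSymbol η) / 10 *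
        ((10 - acousticSymbol η) * √(rawNormSq acousticSymbol η)) ≤ 6 / 10 * (9 * 5) := by gcongr
    _ = 27 := by norm_num

theorem bigridWeight_optic_le (η : ℝ) :
    bigridWeight true η ≤ 27 / 2 * (Real.cos (η / 2) ^ 2 * Real.sin (η / 2) ^ 2) := by
  have h10 := acousticSymbol_le_ten η
  have h12 := twelve_le_opticSymbol η
  have h0 := acousticSymbol_nonneg η
  have h1 := acousticSymbol_le η
  have h2 := sqrt_rawNormSq_optic_le η
  have h3 : (opticSymbol η - 10) / (opticSymbol η - acousticSymbol η) ≤ 1 := by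
    rw [div_le_one (by linarith)]; linarith
  rw [bigridWeight_optic, mul_left_comm (27 / 2 : ℝ)]
  refine mul_le_mul_of_nonneg_left ?_ (sq_nonneg _)
  have h4 : 0 ≤ (opticSymbol η - 10) / (opticSymbol η - acousticSymbol η) :=
    div_nonneg (by linarith) (by linarith)
  calc acousticSymbol η / 10 * ((opticSymbol η - 10) / (opticSymbol η - acousticSymbol η)) *
        √(rawNormSq opticSymbol η) ≤ (10 * Real.sin (η / 2) ^ 2) / 10 * 1 * (27 / 2) := by gcongr
    _ = 27 / 2 * Real.sin (η / 2) ^ 2 := by ring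

theorem bigridWeight_le_cos {b : Bool} {η : ℝ} (hη : η ∈ Ioo 0 Real.pi) :
    bigridWeight b η ≤ 27 * Real.cos (η / 2) ^ 2 := by
  cases b
  · exact bigridWeight_acoustic_le hη
  · refine (bigridWeight_optic_le η).trans ?_
    nlinarith [sq_nonneg (Real.cos (η / 2)), Real.sin_sq_le_one (η / 2)]

theorem bigridWeight_optic_le_sin (η : ℝ) :
    bigridWeight true η ≤ 27 * Real.sin (η / 2) ^ 2 := by
  refine (bigridWeight_optic_le η).trans ?_
  nlinarith [sq_nonneg (Real.sin (η / 2)), Real.cos_sq_le_one (η / 2)]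

theorem bigridWeight_le {b : Bool} {η : ℝ} (hη : η ∈ Ioo 0 Real.pi) : bigridWeight b η ≤ 54 := by
  have h1 := bigridWeight_le_cos (b := b) hη
  have h2 := Real.cos_sq_le_one (η / 2)
  linarith

theorem bigridWeight_mul_dispersion_le {b : Bool} {η : ℝ} (hη : η ∈ Ioo 0 Real.pi) :
    bigridWeight b η * dispersion (branchSymbol b) η ≤ 54 * Real.sin η := by
  have hs := sin_half_nonneg (Ioo_subset_Icc_self hη)
  have hc := cos_half_nonneg (Ioo_subset_Icc_self hη)
  have hc1 := Real.cos_le_one (η / 2)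
  have hs1 := Real.sin_le_one (η / 2)
  have e : Real.sin η = 2 * Real.sin (η / 2) * Real.cos (η / 2) := by
    rw [← Real.sin_two_mul]; congr 1; ring
  have hsc := mul_nonneg hs hc
  have hd := (dispersion_branch_pos b hη).le
  rw [e]
  cases b
  · calc bigridWeight false η * dispersion (branchSymbol false) η
        ≤ (27 * Real.cos (η / 2) ^ 2) * (4 * Real.sin (η / 2)) :=
          mul_le_mul (bigridWeight_acoustic_le hη)
            (dispersion_acoustic_le_sin (Ioo_subset_Icc_self hη)) hd (by positivity)
      _ = 108 * (Real.sin (η / 2) * Real.cos (η / 2)) * Real.cos (η / 2) := by ring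
      _ ≤ 108 * (Real.sin (η / 2) * Real.cos (η / 2)) * 1 := by gcongr
      _ = _ := by ring
  · calc bigridWeight true η * dispersion (branchSymbol true) η
        ≤ (27 / 2 * (Real.cos (η / 2) ^ 2 * Real.sin (η / 2) ^ 2)) * 8 :=
          mul_le_mul (bigridWeight_optic_le η) (dispersion_optic_le η) hd (by positivity)
      _ = 108 * (Real.sin (η / 2) * Real.cos (η / 2)) * (Real.sin (η / 2) * Real.cos (η / 2)) := by ring
      _ ≤ 108 * (Real.sin (η / 2) * Real.cos (η / 2)) * 1 := by
          gcongr
          nlinarith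
      _ = _ := by ring

theorem le_bigridWeight_acoustic {η : ℝ} (h0 : 0 ≤ η) (h1 : η ≤ Real.pi / 2) :
    1 / 16 ≤ bigridWeight false η := by
  have hs : Real.sin (η / 2) ^ 2 ≤ 1 / 2 := by
    have : Real.sin (η / 2) ^ 2 = 1 / 2 - Real.cos η / 2 := by
      rw [Real.sin_sq_eq_half_sub]; congr 3; ring
    have := Real.cos_nonneg_of_neg_pi_div_two_le_of_le (by linarith [Real.pi_pos]) h1
    linarith
  have hc : 1 / 2 ≤ Real.cos (η / 2) ^ 2 := by linarith [sin_half_sq η]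
  have hA := acousticSymbol_le η
  have hA0 := acousticSymbol_nonneg η
  have h12 := twelve_le_opticSymbol η
  have hq := sqrt_rawNormSq_ge acousticSymbol η
  have h3 : 1 ≤ opticSymbol η / (opticSymbol η - acousticSymbol η) := by
    rw [one_le_div (by linarith)]; linarith
  rw [bigridWeight_acoustic]
  calc (1 : ℝ) / 16 = 1 / 2 * (1 / 10 * (5 * (1 / 4))) := by norm_num
    _ ≤ _ := by
      gcongr
      all_goals linarith

end BigridWeights

section BigridSpace

theorem sum_cos_waveNum {N m : ℕ} (h1 : 1 ≤ m) (h2 : m ≤ 2 * N + 1) :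
    ∑ k ∈ Finset.range (N + 1), Real.cos (k * waveNum N m) = (1 - (-1) ^ m) / 2 := by
  have hpos : 0 < waveNum N m := by
    have := meshSize_pos N
    have := Real.pi_pos
    have : (0 : ℝ) < m := by exact_mod_cast h1
    unfold waveNum; positivity
  have hlt : waveNum N m < 2 * Real.pi := by
    have h := waveNum_mul N m
    have h3 : (m : ℝ) ≤ 2 * N + 1 := by exact_mod_cast h2
    have hN : (0 : ℝ) < N + 1 := by positivity
    by_contra! hc
    nlinarith [Real.pi_pos]
  have hs : Real.sin (waveNum N m / 2) ≠ 0 :=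
    (Real.sin_pos_of_pos_of_lt_pi (by linarith) (by linarith)).ne'
  have h := sum_cos_arith (N + 1) 0 (waveNum N m)
  have e1 : (0 : ℝ) + (((N + 1 : ℕ) : ℝ) - 1 / 2) * waveNum N m = m * Real.pi - waveNum N m / 2 := by
    push_cast; linear_combination waveNum_mul N m
  have e2 : 0 - waveNum N m / 2 = -(waveNum N m / 2) := by ring
  rw [e1, e2, Real.sin_neg, Real.sin_nat_mul_pi_sub] at h
  simp only [zero_add] at h
  apply mul_left_cancel₀ hs
  linear_combination h / 2

theorem sum_sin_mul_sin {N a b : ℕ} (ha : 1 ≤ a) (hb : 1 ≤ b) (ha' : a ≤ N) (hb' : b ≤ N) :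
    ∑ n ∈ Finset.range N, Real.sin (((n : ℝ) + 1) * waveNum N a) *
      Real.sin (((n : ℝ) + 1) * waveNum N b) = if a = b then ((N : ℝ) + 1) / 2 else 0 := by
  wlog hlt : b ≤ a generalizing a b
  · have := this hb ha hb' ha' (by omega)
    simp only [eq_comm (a := b)] at this
    rw [← this]
    exact Finset.sum_congr rfl fun n _ => mul_comm _ _
  rcases hlt.eq_or_lt with rfl | hlt
  · rw [if_pos rfl, ← sum_sin_sq_node ha ha']
    exact Finset.sum_congr rfl fun n _ => by ring
  · rw [if_neg hlt.ne']
    have h1 := sum_cos_waveNum (N := N) (m := a - b) (by omega) (by omega)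
    have h2 := sum_cos_waveNum (N := N) (m := a + b) (by omega) (by omega)
    have hp : ((-1 : ℝ)) ^ (a - b) = (-1) ^ (a + b) := by
      rw [neg_one_pow_eq_pow_mod_two, neg_one_pow_eq_pow_mod_two (n := a + b)]
      congr 1; omega
    rw [hp, ← h2, Finset.sum_range_succ', Finset.sum_range_succ'] at h1
    have hw : waveNum N (a - b) = waveNum N a - waveNum N b := by
      simp only [waveNum]; rw [Nat.cast_sub hlt.le]; ring
    have hw2 : waveNum N (a + b) = waveNum N a + waveNum N b := by
      simp only [waveNum]; push_cast; ring
    simp only [hw, hw2, Nat.cast_zero, zero_mul, Nat.cast_add, Nat.cast_one, mul_sub,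
      mul_add, Real.cos_sub, Real.cos_add, Finset.sum_add_distrib, Finset.sum_sub_distrib,
      Real.cos_zero, add_zero, sub_zero] at h1
    linarith

/-- `halfComp` as a linear map. -/
def halfCompL (N j : ℕ) : GridVec N →ₗ[ℂ] ℂ where
  toFun F := halfComp F j
  map_add' F G := halfComp_add F G j
  map_smul' c F := halfComp_smul c F j

theorem gridVec_ext {N : ℕ} {F G : GridVec N}
    (h : ∀ j, 1 ≤ j → j ≤ 2 * N + 1 → halfComp F j = halfComp G j) : F = G := by
  funext i
  have := h (i.val + 1) (by omega) (by omega)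
  rw [halfComp, halfComp, dif_pos ⟨by omega, by omega⟩, dif_pos ⟨by omega, by omega⟩] at this
  exact this

/-- The coefficients of the elements of the bi-grid space. -/
def bigridCoeffs (N : ℕ) : Submodule ℂ (Bool → ℕ → ℂ) where
  carrier := {x | ∃ β : ℕ → ℂ, (∀ n, n < N → β (N - 1 - n) = -β n) ∧ (∀ n, N ≤ n → β n = 0) ∧
    ∀ b n, x b n = bigridWeight b (waveNum N (n + 1)) * β n}
  zero_mem' := ⟨0, by simp, by simp, by simp⟩
  add_mem' := by
    rintro x y ⟨β, h1, h2, h3⟩ ⟨β', h1', h2', h3'⟩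
    refine ⟨β + β', fun n hn => ?_, fun n hn => ?_, fun b n => ?_⟩
    · simp only [Pi.add_apply]; rw [h1 n hn, h1' n hn]; ring
    · simp only [Pi.add_apply]; rw [h2 n hn, h2' n hn]; ring
    · simp only [Pi.add_apply]; rw [h3, h3']; ring
  smul_mem' := by
    rintro a x ⟨β, h1, h2, h3⟩
    refine ⟨a • β, fun n hn => ?_, fun n hn => ?_, fun b n => ?_⟩
    · simp only [Pi.smul_apply, smul_eq_mul]; rw [h1 n hn]; ring
    · simp only [Pi.smul_apply, smul_eq_mul]; rw [h2 n hn]; ring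
    · simp only [Pi.smul_apply, smul_eq_mul]; rw [h3]; ring

theorem waveNum_reflect {N n : ℕ} (hn : n < N) :
    waveNum N (N - 1 - n + 1) = Real.pi - waveNum N (n + 1) := by
  have h : ((N - 1 - n + 1 : ℕ) : ℝ) = N - n := by
    rw [show N - 1 - n + 1 = N - n by omega, Nat.cast_sub hn.le]
  simp only [waveNum]
  rw [h]
  push_cast
  linear_combination Real.pi * meshSize_mul N

/-- The vector of the bi-grid space with coefficients `β`. -/
def bigridVec (N : ℕ) (β : ℕ → ℂ) : GridVec N :=
  ∑ n ∈ Finset.range N, β n • ((Real.cos (waveNum N (n + 1) / 2) ^ 2 : ℝ) : ℂ) •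
    gridSine N (n + 1) 1 (Real.cos (waveNum N (n + 1) / 2))

theorem synth_bigrid {N : ℕ} {x : Bool → ℕ → ℂ} {β : ℕ → ℂ}
    (hx : ∀ b n, x b n = bigridWeight b (waveNum N (n + 1)) * β n) :
    synth N x = bigridVec N β := by
  simp only [synth, LinearMap.coe_mk, AddHom.coe_mk]
  rw [Finset.sum_comm]
  refine Finset.sum_congr rfl fun n hn => ?_
  rw [← bigridWeight_synth (by omega) (Finset.mem_range.1 hn), Finset.smul_sum]
  refine Finset.sum_congr rfl fun b _ => ?_
  rw [hx, smul_smul, mul_comm (bigridWeight b _ : ℂ)]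

theorem halfComp_bigridVec (N : ℕ) (β : ℕ → ℂ) (j : ℕ) (hj : j ≤ 2 * N + 2) :
    halfComp (bigridVec N β) j = ∑ n ∈ Finset.range N, β n *
      ((Real.cos (waveNum N (n + 1) / 2) ^ 2 * ((if Even j then 1 else Real.cos (waveNum N (n + 1) / 2)) *
        Real.sin (j / 2 * waveNum N (n + 1))) : ℝ) : ℂ) := by
  change halfCompL N j (bigridVec N β) = _
  simp only [bigridVec, map_sum, map_smul, smul_eq_mul]
  refine Finset.sum_congr rfl fun n _ => ?_
  change β n * (_ * halfComp _ j) = _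
  rw [halfComp_gridSine _ _ _ _ _ hj, ← Complex.ofReal_mul]

theorem sum_range_eq_zero_of_reflect {N : ℕ} (f : ℕ → ℂ)
    (h : ∀ n, n < N → f (N - 1 - n) = -f n) : ∑ n ∈ Finset.range N, f n = 0 := by
  have h1 := Finset.sum_range_reflect f N
  have h2 : ∑ n ∈ Finset.range N, f (N - 1 - n) = -∑ n ∈ Finset.range N, f n := by
    rw [← Finset.sum_neg_distrib]
    exact Finset.sum_congr rfl fun n hn => h n (Finset.mem_range.1 hn)
  rw [h2] at h1
  linear_combination -(1 / 2) * h1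

theorem sin_nat_mul_pi_sub' (j : ℕ) (x : ℝ) :
    Real.sin ((j : ℝ) * (Real.pi - x)) = -((-1) ^ j * Real.sin (j * x)) := by
  rw [mul_sub, Real.sin_nat_mul_pi_sub]

theorem bigridVec_mem {N : ℕ} {β : ℕ → ℂ} (hβ : ∀ n, n < N → β (N - 1 - n) = -β n) :
    bigridVec N β ∈ bigridVecs N := by
  constructor
  · intro j hj
    have e1 : ¬ Even (2 * j + 1) := by simp
    have e2 : Even (2 * j + 2) := by simp [parity_simps]
    rw [halfComp_bigridVec _ _ _ (by omega), halfComp_bigridVec _ _ _ (by omega),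
      halfComp_bigridVec _ _ _ (by omega), ← Finset.sum_add_distrib, Finset.sum_div]
    refine Finset.sum_congr rfl fun n _ => ?_
    rw [if_neg e1, if_pos (even_two_mul j), if_pos e2]
    set η := waveNum N (n + 1)
    have h := sin_add_sin_shift (((2 * j + 1 : ℕ) : ℝ) / 2 * η) (η / 2)
    have e3 : ((2 * j + 1 : ℕ) : ℝ) / 2 * η + η / 2 = ((2 * j + 2 : ℕ) : ℝ) / 2 * η := by
      push_cast; ring
    have e4 : ((2 * j + 1 : ℕ) : ℝ) / 2 * η - η / 2 = ((2 * j : ℕ) : ℝ) / 2 * η := by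
      push_cast; ring
    rw [e3, e4] at h
    have h' : Real.cos (η / 2) * Real.sin (((2 * j + 1 : ℕ) : ℝ) / 2 * η) =
        (Real.sin (((2 * j : ℕ) : ℝ) / 2 * η) + Real.sin (((2 * j + 2 : ℕ) : ℝ) / 2 * η)) / 2 := by
      linarith
    rw [h']
    push_cast
    ring
  · intro j hj
    have e2 : Even (2 * (2 * j + 2)) := even_two_mul _
    rw [halfComp_bigridVec _ _ _ (by omega), halfComp_bigridVec _ _ _ (by omega),
      halfComp_bigridVec _ _ _ (by omega), ← sub_eq_zero, ← Finset.sum_add_distrib, Finset.sum_div,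
      ← Finset.sum_sub_distrib]
    simp only [if_pos (even_two_mul _), one_mul]
    have key : ∀ n, β n * ((Real.cos (waveNum N (n + 1) / 2) ^ 2 *
          Real.sin (((2 * (2 * j + 1) : ℕ) : ℝ) / 2 * waveNum N (n + 1)) : ℝ) : ℂ) -
        (β n * ((Real.cos (waveNum N (n + 1) / 2) ^ 2 *
          Real.sin (((2 * (2 * j) : ℕ) : ℝ) / 2 * waveNum N (n + 1)) : ℝ) : ℂ) +
        β n * ((Real.cos (waveNum N (n + 1) / 2) ^ 2 *
          Real.sin (((2 * (2 * j + 2) : ℕ) : ℝ) / 2 * waveNum N (n + 1)) : ℝ) : ℂ)) / 2 =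
        β n * ((2 * Real.cos (waveNum N (n + 1) / 2) ^ 2 * Real.sin (waveNum N (n + 1) / 2) ^ 2 *
          Real.sin (((2 * j + 1 : ℕ) : ℝ) * waveNum N (n + 1)) : ℝ) : ℂ) := by
      intro n
      set η := waveNum N (n + 1)
      have h := sin_add_sin_shift (((2 * j + 1 : ℕ) : ℝ) * η) η
      have e3 : ((2 * j + 1 : ℕ) : ℝ) * η + η = ((2 * (2 * j + 2) : ℕ) : ℝ) / 2 * η := by
        push_cast; ring
      have e4 : ((2 * j + 1 : ℕ) : ℝ) * η - η = ((2 * (2 * j) : ℕ) : ℝ) / 2 * η := by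
        push_cast; ring
      have e5 : ((2 * (2 * j + 1) : ℕ) : ℝ) / 2 * η = ((2 * j + 1 : ℕ) : ℝ) * η := by
        push_cast; ring
      have e6 : Real.cos η = 1 - 2 * Real.sin (η / 2) ^ 2 := by
        rw [Real.sin_sq_eq_half_sub, show 2 * (η / 2) = η by ring]; ring
      rw [e3, e4, e6] at h
      rw [e5]
      have h2 : Real.sin (((2 * (2 * j) : ℕ) : ℝ) / 2 * η) =
          2 * (1 - 2 * Real.sin (η / 2) ^ 2) * Real.sin (((2 * j + 1 : ℕ) : ℝ) * η) -
            Real.sin (((2 * (2 * j + 2) : ℕ) : ℝ) / 2 * η) := by linarith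
      rw [h2]
      push_cast
      ring
    rw [Finset.sum_congr rfl fun n _ => key n]
    refine sum_range_eq_zero_of_reflect _ fun n hn => ?_
    have hr := waveNum_reflect hn
    rw [hβ n hn, hr, sin_nat_mul_pi_sub']
    have e7 : (Real.pi - waveNum N (n + 1)) / 2 = Real.pi / 2 - waveNum N (n + 1) / 2 := by ring
    rw [e7, Real.cos_pi_div_two_sub, Real.sin_pi_div_two_sub,
      Odd.neg_one_pow (by simp [parity_simps])]
    push_cast
    ring

theorem bigridVecs_ext {N : ℕ} (hN : Odd N) {F G : GridVec N} (hF : F ∈ bigridVecs N)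
    (hG : G ∈ bigridVecs N)
    (h : ∀ l, 1 ≤ l → l ≤ N → Even l → halfComp F (2 * l) = halfComp G (2 * l)) : F = G := by
  have hz : ∀ H : GridVec N, halfComp H 0 = 0 := fun H => by rw [halfComp, dif_neg (by omega)]
  have hend : ∀ H : GridVec N, halfComp H (2 * N + 2) = 0 := fun H => by
    rw [halfComp, dif_neg (by omega)]
  have heven : ∀ l, l ≤ N + 1 → Even l → halfComp F (2 * l) = halfComp G (2 * l) := by
    intro l hl he
    rcases Nat.eq_zero_or_pos l with rfl | h0
    · rw [mul_zero, hz, hz]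
    · rcases hl.eq_or_lt with rfl | h1
      · rw [show 2 * (N + 1) = 2 * N + 2 by ring, hend, hend]
      · exact h l h0 (by omega) he
  have hnode : ∀ l, l ≤ N + 1 → halfComp F (2 * l) = halfComp G (2 * l) := by
    intro l hl
    rcases Nat.even_or_odd l with he | ⟨r, rfl⟩
    · exact heven l hl he
    · have hr : 2 * r + 1 ≤ N := by
        obtain ⟨q, rfl⟩ := hN; omega
      rw [hF.2 r hr, hG.2 r hr, heven (2 * r) (by omega) (even_two_mul r),
        heven (2 * r + 2) (by omega) (by simp [parity_simps])]
  refine gridVec_ext fun j h1 h2 => ?_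
  rcases Nat.even_or_odd' j with ⟨l, rfl | rfl⟩
  · exact hnode l (by omega)
  · rw [hF.1 l (by omega), hG.1 l (by omega), hnode l (by omega),
      show 2 * l + 2 = 2 * (l + 1) by ring, hnode (l + 1) (by omega)]

/-- The coefficients of an element of the bi-grid space. -/
def bigridTransform (N : ℕ) (F : GridVec N) (n : ℕ) : ℂ :=
  if n < N then 4 / ((N : ℂ) + 1) * ∑ j ∈ Finset.range N,
    (if Even (j + 1) then halfComp F (2 * (j + 1)) else 0) *
      (Real.sin (((j + 1 : ℕ) : ℝ) * waveNum N (n + 1)) : ℂ) else 0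

theorem bigridTransform_reflect {N : ℕ} (F : GridVec N) {n : ℕ} (hn : n < N) :
    bigridTransform N F (N - 1 - n) = -bigridTransform N F n := by
  rw [bigridTransform, bigridTransform, if_pos hn, if_pos (by omega), ← mul_neg,
    ← Finset.sum_neg_distrib]
  congr 1
  refine Finset.sum_congr rfl fun j _ => ?_
  split_ifs with he
  · rw [waveNum_reflect hn, sin_nat_mul_pi_sub', he.neg_one_pow]
    push_cast; ring
  · simp

theorem sum_bigridTransform {N : ℕ} (F : GridVec N) {l : ℕ} (h1 : 1 ≤ l) (h2 : l ≤ N)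
    (he : Even l) :
    ∑ n ∈ Finset.range N, bigridTransform N F n * (Real.sin (l * waveNum N (n + 1)) : ℂ) =
      2 * halfComp F (2 * l) := by
  have hN : ((N : ℂ) + 1) ≠ 0 := by exact_mod_cast Nat.succ_ne_zero N
  have hcomm : ∀ a n : ℕ, (a : ℝ) * waveNum N (n + 1) = ((n : ℝ) + 1) * waveNum N a := by
    intro a n; simp only [waveNum]; push_cast; ring
  have e : ∀ n ∈ Finset.range N, bigridTransform N F n * (Real.sin (l * waveNum N (n + 1)) : ℂ) =
      ∑ j ∈ Finset.range N, 4 / ((N : ℂ) + 1) *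
        (if Even (j + 1) then halfComp F (2 * (j + 1)) else 0) *
          ((Real.sin (((n : ℝ) + 1) * waveNum N (j + 1)) *
            Real.sin (((n : ℝ) + 1) * waveNum N l) : ℝ) : ℂ) := by
    intro n hn
    rw [bigridTransform, if_pos (Finset.mem_range.1 hn), Finset.mul_sum, Finset.sum_mul]
    refine Finset.sum_congr rfl fun j _ => ?_
    rw [hcomm, hcomm]
    push_cast; ring
  rw [Finset.sum_congr rfl e, Finset.sum_comm]
  simp only [← Finset.mul_sum, ← Complex.ofReal_sum]
  rw [Finset.sum_eq_single (l - 1)]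
  · rw [show l - 1 + 1 = l by omega, if_pos he, sum_sin_mul_sin h1 h1 h2 h2, if_pos rfl]
    push_cast; field_simp; ring
  · intro j hj hne
    have := Finset.mem_range.1 hj
    rw [sum_sin_mul_sin (by omega) h1 (by omega) h2, if_neg (show ¬ j + 1 = l by omega)]
    simp
  · intro h; exact absurd (Finset.mem_range.2 (by omega)) h

theorem bigridVec_bigridTransform {N : ℕ} (hN : Odd N) {F : GridVec N} (hF : F ∈ bigridVecs N) :
    bigridVec N (bigridTransform N F) = F := by
  refine bigridVecs_ext hN (bigridVec_mem fun n hn => bigridTransform_reflect F hn) hF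
    fun l h1 h2 he => ?_
  rw [halfComp_bigridVec _ _ _ (by omega)]
  simp only [if_pos (even_two_mul _), one_mul]
  have e0 : ((2 * l : ℕ) : ℝ) / 2 = l := by push_cast; ring
  simp only [e0]
  have hz := sum_range_eq_zero_of_reflect (N := N) (fun n => bigridTransform N F n *
    (((Real.cos (waveNum N (n + 1) / 2) ^ 2 - Real.sin (waveNum N (n + 1) / 2) ^ 2) *
      Real.sin (l * waveNum N (n + 1)) : ℝ) : ℂ)) (fun n hn => by
    have e7 : (Real.pi - waveNum N (n + 1)) / 2 = Real.pi / 2 - waveNum N (n + 1) / 2 := by ring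
    rw [bigridTransform_reflect F hn, waveNum_reflect hn, sin_nat_mul_pi_sub', he.neg_one_pow, e7,
      Real.cos_pi_div_two_sub, Real.sin_pi_div_two_sub]
    push_cast; ring)
  have hs := sum_bigridTransform F h1 h2 he
  have e : ∀ n ∈ Finset.range N, bigridTransform N F n * ((Real.cos (waveNum N (n + 1) / 2) ^ 2 *
      Real.sin (l * waveNum N (n + 1)) : ℝ) : ℂ) =
      1 / 2 * (bigridTransform N F n * (Real.sin (l * waveNum N (n + 1)) : ℂ)) +
      1 / 2 * (bigridTransform N F n *
        (((Real.cos (waveNum N (n + 1) / 2) ^ 2 - Real.sin (waveNum N (n + 1) / 2) ^ 2) *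
          Real.sin (l * waveNum N (n + 1)) : ℝ) : ℂ)) := by
    intro n _
    have h1 : (Real.sin (waveNum N (n + 1) / 2)) ^ 2 = 1 - Real.cos (waveNum N (n + 1) / 2) ^ 2 :=
      sin_half_sq _
    rw [h1]
    push_cast; ring
  rw [Finset.sum_congr rfl e, Finset.sum_add_distrib, ← Finset.mul_sum, ← Finset.mul_sum, hs, hz]
  ring

theorem bigridVecs_eq {N : ℕ} (hN : Odd N) : bigridVecs N = (bigridCoeffs N).map (synth N) := by
  refine le_antisymm (fun F hF => ?_) ?_
  · refine ⟨fun b n => bigridWeight b (waveNum N (n + 1)) * bigridTransform N F n,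
      ⟨bigridTransform N F, fun n hn => bigridTransform_reflect F hn, fun n hn => ?_,
        fun b n => rfl⟩, ?_⟩
    · rw [bigridTransform, if_neg (by omega)]
    · rw [synth_bigrid fun _ _ => rfl]
      exact bigridVec_bigridTransform hN hF
  · rintro _ ⟨x, ⟨β, h1, -, h3⟩, rfl⟩
    rw [synth_bigrid h3]
    exact bigridVec_mem h1

theorem bigridSpace_eq {N : ℕ} (hN : Odd N) : bigridSpace N =
    ((bigridCoeffs N).map (synth N)).prod ((bigridCoeffs N).map (synth N)) := by
  rw [bigridSpace, bigridVecs_eq hN]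

end BigridSpace

/-! ### Observability and approximation in the bi-grid space -/

section Bigrid

theorem norm_osc_amplitude_sq (N : ℕ) (T : ℝ) (x y : Bool → ℕ → ℂ) (b : Bool) (n : ℕ) :
    ∑ σ, ‖amplitude N T (x, y) (b, σ, n)‖ ^ 2 =
      1 / 2 * (‖(freq N b n : ℂ) * x b n‖ ^ 2 + ‖y b n‖ ^ 2) := by
  have h := parallelogram_law_with_norm ℝ ((freq N b n : ℂ) * x b n) (Complex.I * y b n)
  simp only [Fintype.sum_bool, amplitude, LinearMap.coe_mk, AddHom.coe_mk, norm_mul, norm_osc,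
    mul_one, sgn, if_true, Bool.false_eq_true, if_false]
  push_cast
  rw [mul_one, show (freq N b n : ℂ) * x b n - Complex.I * -1 * y b n =
    (freq N b n : ℂ) * x b n + Complex.I * y b n by ring]
  have hI : ‖Complex.I * y b n‖ = ‖y b n‖ := by rw [norm_mul, Complex.norm_I, one_mul]
  rw [hI, norm_mul, Complex.norm_real, Real.norm_eq_abs] at h
  norm_num
  linarith

/-- The energy density of a bi-grid wave. -/
def bigridDensity (N : ℕ) (β β' : ℕ → ℂ) (n : ℕ) : ℝ :=
  (Real.sin (waveNum N (n + 1)) / meshSize N) ^ 2 * ‖β n‖ ^ 2 + ‖β' n‖ ^ 2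

theorem bigridDensity_nonneg (N : ℕ) (β β' : ℕ → ℂ) (n : ℕ) : 0 ≤ bigridDensity N β β' n := by
  unfold bigridDensity; positivity

variable {N : ℕ} {T : ℝ} {x y : Bool → ℕ → ℂ} {β β' : ℕ → ℂ}

theorem amplitude_bigrid_eq (hx : ∀ b n, x b n = bigridWeight b (waveNum N (n + 1)) * β n)
    (hy : ∀ b n, y b n = bigridWeight b (waveNum N (n + 1)) * β' n) (b : Bool) (n : ℕ) :
    ∑ σ, ‖amplitude N T (x, y) (b, σ, n)‖ ^ 2 =
      1 / 2 * ((bigridWeight b (waveNum N (n + 1)) * dispersion (branchSymbol b) (waveNum N (n + 1)) /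
        meshSize N) ^ 2 * ‖β n‖ ^ 2 + bigridWeight b (waveNum N (n + 1)) ^ 2 * ‖β' n‖ ^ 2) := by
  rw [norm_osc_amplitude_sq, hx, hy]
  simp only [norm_mul, Complex.norm_real, Real.norm_eq_abs, mul_pow, sq_abs, freq_eq]
  ring

theorem amplitude_bigrid_le (hx : ∀ b n, x b n = bigridWeight b (waveNum N (n + 1)) * β n)
    (hy : ∀ b n, y b n = bigridWeight b (waveNum N (n + 1)) * β' n) (b : Bool) {n : ℕ} (hn : n < N) :
    ∑ σ, ‖amplitude N T (x, y) (b, σ, n)‖ ^ 2 ≤ 1 / 2 * 54 ^ 2 * bigridDensity N β β' n := by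
  have hη := waveNum_succ_mem hn
  have hh := meshSize_pos N
  rw [amplitude_bigrid_eq hx hy, bigridDensity]
  set η := waveNum N (n + 1)
  have h1 := bigridWeight_mul_dispersion_le (b := b) hη
  have h2 := bigridWeight_le (b := b) hη
  have h3 := bigridWeight_nonneg b η
  have hd := (dispersion_branch_pos b hη).le
  have hs := (Real.sin_pos_of_mem_Ioo hη).le
  calc 1 / 2 * ((bigridWeight b η * dispersion (branchSymbol b) η / meshSize N) ^ 2 * ‖β n‖ ^ 2 +
        bigridWeight b η ^ 2 * ‖β' n‖ ^ 2)
      ≤ 1 / 2 * ((54 * Real.sin η / meshSize N) ^ 2 * ‖β n‖ ^ 2 + 54 ^ 2 * ‖β' n‖ ^ 2) := by gcongr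
    _ = _ := by ring

theorem le_amplitude_bigrid (hx : ∀ b n, x b n = bigridWeight b (waveNum N (n + 1)) * β n)
    (hy : ∀ b n, y b n = bigridWeight b (waveNum N (n + 1)) * β' n) {n : ℕ} (hn : n < N)
    (hlow : waveNum N (n + 1) ≤ Real.pi / 2) :
    1 / 2 * (1 / 16) ^ 2 * bigridDensity N β β' n ≤
      ∑ σ, ‖amplitude N T (x, y) (false, σ, n)‖ ^ 2 := by
  have hη := waveNum_succ_mem hn
  have hh := meshSize_pos N
  rw [amplitude_bigrid_eq hx hy, bigridDensity]
  set η := waveNum N (n + 1)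
  have h1 := le_bigridWeight_acoustic hη.1.le hlow
  have hs := (Real.sin_pos_of_mem_Ioo hη).le
  have hd : Real.sin η ≤ dispersion (branchSymbol false) η := by
    refine le_trans ?_ (two_mul_sin_half_le_dispersion η)
    have h2 := sin_half_nonneg (Ioo_subset_Icc_self hη)
    have e : Real.sin η = 2 * Real.sin (η / 2) * Real.cos (η / 2) := by
      rw [← Real.sin_two_mul]; congr 1; ring
    rw [e]
    exact mul_le_of_le_one_right (by positivity) (Real.cos_le_one _)
  calc 1 / 2 * (1 / 16) ^ 2 * ((Real.sin η / meshSize N) ^ 2 * ‖β n‖ ^ 2 + ‖β' n‖ ^ 2)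
      = 1 / 2 * ((1 / 16 * Real.sin η / meshSize N) ^ 2 * ‖β n‖ ^ 2 + (1 / 16) ^ 2 * ‖β' n‖ ^ 2) := by
        ring
    _ ≤ _ := by gcongr

/-- The low frequency part of the acoustic energy. -/
def lowEnergy (N : ℕ) (c : Mode → ℂ) : ℝ :=
  ∑ j ∈ modes N, if j.1 = false ∧ waveNum N (j.2.2 + 1) ≤ Real.pi / 2 then ‖c j‖ ^ 2 else 0

/-- The energy of a bi-grid wave is controlled by its low frequency acoustic part. -/
theorem sum_le_lowEnergy {c : Mode → ℂ} (hc : c ∈ amplitudes N T (bigridCoeffs N)) :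
    ∑ j ∈ modes N, ‖c j‖ ^ 2 ≤ 54 ^ 2 * 1024 * lowEnergy N c := by
  obtain ⟨⟨x, y⟩, ⟨⟨β, hβ, -, hx⟩, ⟨β', hβ', -, hy⟩⟩, rfl⟩ := hc
  simp only at hx hy
  have h1 : ∑ j ∈ modes N, ‖amplitude N T (x, y) j‖ ^ 2 ≤
      54 ^ 2 * ∑ n ∈ Finset.range N, bigridDensity N β β' n := by
    rw [sum_modes]
    have : ∀ b : Bool, ∑ σ, ∑ n ∈ Finset.range N, ‖amplitude N T (x, y) (b, σ, n)‖ ^ 2 ≤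
        1 / 2 * 54 ^ 2 * ∑ n ∈ Finset.range N, bigridDensity N β β' n := by
      intro b
      rw [Finset.sum_comm, Finset.mul_sum]
      exact Finset.sum_le_sum fun n hn => amplitude_bigrid_le hx hy b (Finset.mem_range.1 hn)
    have h2 := this true
    have h3 := this false
    rw [Fintype.sum_bool]
    linarith
  set u : ℕ → ℝ := fun n =>
    if waveNum N (n + 1) ≤ Real.pi / 2 then bigridDensity N β β' n else 0 with hu
  have hu0 : ∀ n, 0 ≤ u n := fun n => by
    simp only [hu]; split_ifs
    · exact bigridDensity_nonneg _ _ _ _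
    · exact le_rfl
  have h2 : ∑ n ∈ Finset.range N, bigridDensity N β β' n ≤ 2 * ∑ n ∈ Finset.range N, u n := by
    have hr := Finset.sum_range_reflect u N
    rw [two_mul]
    nth_rewrite 2 [← hr]
    rw [← Finset.sum_add_distrib]
    refine Finset.sum_le_sum fun n hn => ?_
    have hn' := Finset.mem_range.1 hn
    have e := waveNum_reflect hn'
    by_cases hl : waveNum N (n + 1) ≤ Real.pi / 2
    · have : u n = bigridDensity N β β' n := if_pos hl
      linarith [hu0 (N - 1 - n)]
    · have h3 : u (N - 1 - n) = bigridDensity N β β' n := by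
        simp only [hu]
        rw [e, if_pos (by linarith [not_le.1 hl]), bigridDensity, bigridDensity, e, Real.sin_pi_sub,
          hβ n hn', hβ' n hn', norm_neg, norm_neg]
      linarith [hu0 n]
  have h3 : ∑ n ∈ Finset.range N, u n ≤ 512 * lowEnergy N (amplitude N T (x, y)) := by
    rw [lowEnergy, sum_modes, Fintype.sum_bool]
    simp only [Bool.true_eq_false, false_and, if_false, Finset.sum_const_zero, zero_add, true_and]
    rw [Finset.sum_comm, Finset.mul_sum]
    refine Finset.sum_le_sum fun n hn => ?_
    simp only [hu]
    split_ifs with hl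
    · have := le_amplitude_bigrid (T := T) hx hy (Finset.mem_range.1 hn) hl
      linarith
    · simp
  linarith

/-- The cut-off of the modes, as a function of the frequency. -/
def cutoff (a b r : ℝ) : ℝ := max 0 (min 1 ((b - r) / (b - a)))

theorem cutoff_sub_le {a b : ℝ} (hab : a < b) (r s : ℝ) :
    |cutoff a b r - cutoff a b s| ≤ |r - s| / (b - a) := by
  have hd : 0 < b - a := sub_pos.2 hab
  refine (abs_max_sub_max_le_max _ _ _ _).trans ?_
  rw [sub_self, abs_zero]
  refine max_le (by positivity) ((abs_min_sub_min_le_max _ _ _ _).trans ?_)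
  rw [sub_self, abs_zero]
  refine max_le (by positivity) ?_
  rw [← sub_div, abs_div, abs_of_pos hd, abs_sub_comm]
  apply le_of_eq
  congr 2; ring

/-- Uniform observability of the bi-grid waves. -/
theorem observability_bigrid (hT : 2 < T) :
    ∃ κ : ℝ, 0 < κ ∧ ∀ᶠ N in atTop, ∀ c ∈ amplitudes N T (bigridCoeffs N),
      κ * ∑ j ∈ modes N, ‖c j‖ ^ 2 ≤ ‖modeSignal N T c‖ ^ 2 := by
  have hpi := Real.pi_pos
  have hT0 : 0 < T := by linarith
  obtain ⟨ρ, hρ, hw⟩ := exists_modeWeight_ge_acoustic (η₀ := Real.pi / 2) ⟨by linarith, by linarith⟩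
  obtain ⟨c₁, hc₁, c₂, hc₂, hI⟩ := filtered_ingham (ι := Mode) (T := T) (γ := Real.pi) hT0
    (by nlinarith)
  set l₁ := dispersion acousticSymbol (Real.pi / 2) with hl₁
  set l₂ := dispersion acousticSymbol (2 * Real.pi / 3) with hl₂
  have hm1 : Real.pi / 2 ∈ Icc 0 Real.pi := ⟨by linarith, by linarith⟩
  have hm2 : 2 * Real.pi / 3 ∈ Icc 0 Real.pi := ⟨by linarith, by linarith⟩
  have hl : l₁ < l₂ := strictMonoOn_dispersion_acoustic hm1 hm2 (by linarith)
  have hδ : 0 < l₂ - l₁ := sub_pos.2 hl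
  set κ := c₁ * ρ ^ 2 / (2 * (54 ^ 2 * 1024)) with hκ
  have hκ0 : 0 < κ := by positivity
  refine ⟨κ, hκ0, ?_⟩
  have hlim : Tendsto (fun N : ℕ => c₂ * (4 / (l₂ - l₁) ^ 2 * (2 * Real.pi) ^ 2) * meshSize N) atTop
      (𝓝 0) := by
    have h : Tendsto (fun N : ℕ => meshSize N) atTop (𝓝 0) := tendsto_one_div_add_atTop_nhds_zero_nat
    simpa using h.const_mul (c₂ * (4 / (l₂ - l₁) ^ 2 * (2 * Real.pi) ^ 2))
  filter_upwards [hlim.eventually_lt_const hκ0] with N hN c hc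
  have hh := meshSize_pos N
  set ψ : Mode → ℝ := fun j => cutoff l₁ l₂ (meshSize N * |modeFreq N j|) with hψ
  have hfr : ∀ j ∈ modes N, meshSize N * |modeFreq N j| =
      dispersion (branchSymbol j.1) (waveNum N (j.2.2 + 1)) := by
    intro j hj
    rw [abs_modeFreq hj, freq_eq]; field_simp
  have hψne : ∀ j ∈ modes N, ψ j ≠ 0 → j.1 = false ∧ waveNum N (j.2.2 + 1) ≤ 2 * Real.pi / 3 := by
    intro j hj hne
    have hη := Ioo_subset_Icc_self (waveNum_succ_mem (mem_modes.1 hj))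
    have hlt : dispersion (branchSymbol j.1) (waveNum N (j.2.2 + 1)) < l₂ := by
      by_contra! hge
      refine hne ?_
      simp only [hψ, cutoff]
      rw [hfr j hj]
      refine max_eq_left ((min_le_right _ _).trans ?_)
      exact div_nonpos_of_nonpos_of_nonneg (by linarith) hδ.le
    have hb : j.1 = false := by
      rcases hb : j.1 with _ | _
      · rfl
      · rw [hb] at hlt
        have h1 := le_dispersion_optic (waveNum N (j.2.2 + 1))
        have h2 := dispersion_acoustic_le (2 * Real.pi / 3)
        have h3 : √10 < √12 := Real.sqrt_lt_sqrt (by norm_num) (by norm_num)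
        have h4 : dispersion opticSymbol (waveNum N (j.2.2 + 1)) < l₂ := hlt
        linarith
    refine ⟨hb, ?_⟩
    rw [hb] at hlt
    by_contra! hgt
    exact absurd (strictMonoOn_dispersion_acoustic hm2 hη hgt) (not_lt.2 hlt.le)
  have hψlow : ∀ j ∈ modes N, j.1 = false ∧ waveNum N (j.2.2 + 1) ≤ Real.pi / 2 → ψ j = 1 := by
    rintro j hj ⟨hb, hle⟩
    have hη := Ioo_subset_Icc_self (waveNum_succ_mem (mem_modes.1 hj))
    have h1 : dispersion (branchSymbol j.1) (waveNum N (j.2.2 + 1)) ≤ l₁ := by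
      rw [hb]
      exact strictMonoOn_dispersion_acoustic.monotoneOn hη hm1 hle
    simp only [hψ, cutoff]
    rw [hfr j hj, min_eq_left, max_eq_right zero_le_one]
    rw [one_le_div hδ]; linarith
  have hψ0 : ∀ j, 0 ≤ ψ j := fun j => le_max_left _ _
  have hkey := hI (modes N) (modeFreq N) ψ (meshSize N / (l₂ - l₁))
    (fun j => (modeWeight N j : ℂ) * c j) (fun j _ => hψ0 j)
    (fun j _ => max_le zero_le_one (min_le_left _ _)) ?_ ?_
  · rw [norm_sq_modeSignal hT0.le]
    refine le_trans ?_ hkey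
    have hlow := sum_le_lowEnergy hc
    have hS : ρ ^ 2 * lowEnergy N c ≤
        ∑ j ∈ modes N, ψ j ^ 2 * ‖(modeWeight N j : ℂ) * c j‖ ^ 2 := by
      rw [lowEnergy, Finset.mul_sum]
      refine Finset.sum_le_sum fun j hj => ?_
      split_ifs with hj2
      · rw [hψlow j hj hj2, one_pow, one_mul, norm_mul, Complex.norm_real, Real.norm_eq_abs, mul_pow]
        have := hw N j hj hj2.1 hj2.2
        gcongr
      · rw [mul_zero]; positivity
    have hE : ∑ j ∈ modes N, ‖(modeWeight N j : ℂ) * c j‖ ^ 2 ≤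
        (2 * Real.pi) ^ 2 * ∑ j ∈ modes N, ‖c j‖ ^ 2 := by
      rw [Finset.mul_sum]
      refine Finset.sum_le_sum fun j hj => ?_
      rw [norm_mul, Complex.norm_real, Real.norm_eq_abs, mul_pow]
      have := abs_modeWeight_le hj
      gcongr
    set Q := ∑ j ∈ modes N, ‖c j‖ ^ 2 with hQ
    have hQ0 : 0 ≤ Q := Finset.sum_nonneg fun j _ => sq_nonneg _
    have hcard : (meshSize N / (l₂ - l₁)) ^ 2 * ((modes N).card : ℝ) ≤
        4 / (l₂ - l₁) ^ 2 * meshSize N := by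
      rw [card_modes]
      push_cast
      have h1 : meshSize N * N ≤ 1 := by linarith [meshSize_mul N]
      calc (meshSize N / (l₂ - l₁)) ^ 2 * (4 * (N : ℝ))
          = 4 / (l₂ - l₁) ^ 2 * meshSize N * (meshSize N * N) := by field_simp
        _ ≤ 4 / (l₂ - l₁) ^ 2 * meshSize N * 1 := by gcongr
        _ = _ := mul_one _
    have h1 : c₂ * ((meshSize N / (l₂ - l₁)) ^ 2 * ((modes N).card : ℝ) *
        ∑ j ∈ modes N, ‖(modeWeight N j : ℂ) * c j‖ ^ 2) ≤ κ * Q := by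
      calc c₂ * ((meshSize N / (l₂ - l₁)) ^ 2 * ((modes N).card : ℝ) *
            ∑ j ∈ modes N, ‖(modeWeight N j : ℂ) * c j‖ ^ 2)
          ≤ c₂ * (4 / (l₂ - l₁) ^ 2 * meshSize N * ((2 * Real.pi) ^ 2 * Q)) := by gcongr
        _ = c₂ * (4 / (l₂ - l₁) ^ 2 * (2 * Real.pi) ^ 2) * meshSize N * Q := by ring
        _ ≤ κ * Q := by gcongr
    have h2 : 2 * κ * Q ≤ c₁ * ∑ j ∈ modes N, ψ j ^ 2 * ‖(modeWeight N j : ℂ) * c j‖ ^ 2 := by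
      calc 2 * κ * Q ≤ 2 * κ * (54 ^ 2 * 1024 * lowEnergy N c) := by gcongr
        _ = c₁ * (ρ ^ 2 * lowEnergy N c) := by rw [hκ]; field_simp
        _ ≤ _ := by gcongr
    linarith
  · intro i _ j _
    refine (cutoff_sub_le hl _ _).trans ?_
    rw [← mul_sub, abs_mul, abs_of_pos hh, mul_div_right_comm]
    exact mul_le_mul_of_nonneg_left (abs_abs_sub_abs_le _ _) (by positivity)
  · rintro ⟨b, σ, n⟩ hi ⟨b', σ', n'⟩ hj hi0 hj0 hne
    obtain ⟨hb, hlei⟩ := hψne _ hi hi0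
    obtain ⟨hb', hlej⟩ := hψne _ hj hj0
    simp only at hb hb' hlei hlej
    subst hb; subst hb'
    by_cases hσ : σ = σ'
    · subst hσ
      have hnn : n ≠ n' := by rintro rfl; exact hne rfl
      have := modeFreq_gap_of_increment zero_le_one (b := false) (I := Icc 0 (2 * Real.pi / 3))
        (fun x hx y hy hxy => by
          rw [one_mul]
          exact (sub_le_dispersion_acoustic_sub hx.1 hxy hy.2).trans (le_abs_self _)) (σ := σ)
        ⟨(waveNum_succ_mem (mem_modes.1 hi)).1.le, hlei⟩
        ⟨(waveNum_succ_mem (mem_modes.1 hj)).1.le, hlej⟩ hnn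
      rwa [one_mul] at this
    · exact Real.pi_lt_four.le.trans (four_le_abs_modeFreq_sub hi hj hσ)

/-- The elements `e_n - e_{N-1-n}`, up to a factor. -/
def reflected (N n : ℕ) (a : ℂ) : ℕ → ℂ := Pi.single n a - Pi.single (N - 1 - n) a

theorem reflected_reflect {N n l : ℕ} (a : ℂ) (hn : n < N) (hl : l < N) :
    reflected N n a (N - 1 - l) = -reflected N n a l := by
  simp only [reflected, Pi.sub_apply, Pi.single_apply]
  have h1 : N - 1 - l = n ↔ l = N - 1 - n := by omega
  have h2 : N - 1 - l = N - 1 - n ↔ l = n := by omega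
  simp only [h1, h2]
  ring

theorem bigrid_mem_amplitudes {n : ℕ} (hn : n < N) (a a' : ℂ) :
    amplitude N T (fun b l => bigridWeight b (waveNum N (l + 1)) * reflected N n a l,
      fun b l => bigridWeight b (waveNum N (l + 1)) * reflected N n a' l) ∈
        amplitudes N T (bigridCoeffs N) := by
  have h0 : ∀ a : ℂ, ∀ l, N ≤ l → reflected N n a l = 0 := by
    intro a l hl
    simp only [reflected, Pi.sub_apply]
    rw [Pi.single_eq_of_ne (by omega), Pi.single_eq_of_ne (by omega), sub_zero]
  exact ⟨_, ⟨⟨reflected N n a, fun l hl => reflected_reflect a hn hl, h0 a, fun _ _ => rfl⟩,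
    ⟨reflected N n a', fun l hl => reflected_reflect a' hn hl, h0 a', fun _ _ => rfl⟩⟩, rfl⟩

theorem norm_amplitude_le {N : ℕ} (T : ℝ) (x y : Bool → ℕ → ℂ) {j : Mode} (hj : j ∈ modes N) :
    ‖amplitude N T (x, y) j‖ ≤ freq N j.1 j.2.2 * ‖x j.1 j.2.2‖ + ‖y j.1 j.2.2‖ := by
  have hf := freq_pos j.1 (mem_modes.1 hj)
  simp only [amplitude, LinearMap.coe_mk, AddHom.coe_mk, norm_mul, norm_osc, mul_one]
  have h1 := norm_sub_le ((freq N j.1 j.2.2 : ℂ) * x j.1 j.2.2)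
    (Complex.I * sgn j.2.1 * y j.1 j.2.2)
  simp only [norm_mul, Complex.norm_real, Real.norm_eq_abs, Complex.norm_I, abs_sgn, one_mul,
    abs_of_pos hf] at h1
  have : 0 ≤ freq N j.1 j.2.2 * ‖x j.1 j.2.2‖ + ‖y j.1 j.2.2‖ := by positivity
  norm_num
  linarith

theorem freq_le (N : ℕ) (b : Bool) (n : ℕ) : freq N b n ≤ 8 / meshSize N := by
  have hh := meshSize_pos N
  rw [freq_eq]
  gcongr
  cases b
  · refine (dispersion_acoustic_le _).trans (Real.sqrt_le_iff.2 ⟨by norm_num, by norm_num⟩)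
  · exact dispersion_optic_le _

theorem meshSize_le_one (N : ℕ) : meshSize N ≤ 1 := by
  have h := meshSize_mul N
  have h2 := meshSize_pos N
  nlinarith [(Nat.cast_nonneg N : (0 : ℝ) ≤ N)]

/-- The low acoustic modes are limits of bi-grid amplitudes. -/
theorem exists_bigrid_approx (T : ℝ) (σ : Bool) (n : ℕ) :
    ∃ d : ℕ → Mode → ℂ, (∀ᶠ N in atTop, d N ∈ amplitudes N T (bigridCoeffs N)) ∧
      Tendsto (fun N => ∑ j ∈ modes N, ‖d N j - (Pi.single (false, σ, n) 1 : Mode → ℂ) j‖) atTop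
        (𝓝 0) := by
  have hpi := Real.pi_pos
  set e : Mode → ℂ := Pi.single (false, σ, n) 1 with he
  set p : ℕ → ℂ := fun N => (finalCoeffs N T e).1 false n / bigridWeight false (waveNum N (n + 1)) with hp
  set q : ℕ → ℂ := fun N => (finalCoeffs N T e).2 false n / bigridWeight false (waveNum N (n + 1)) with hq
  refine ⟨fun N => amplitude N T
    (fun b l => bigridWeight b (waveNum N (l + 1)) * reflected N n (p N) l,
      fun b l => bigridWeight b (waveNum N (l + 1)) * reflected N n (q N) l), ?_, ?_⟩
  · filter_upwards [eventually_gt_atTop n] with N hN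
    exact bigrid_mem_amplitudes hN _ _
  set K : ℝ := 27 * (((n : ℝ) + 1) * Real.pi) ^ 2 * 80 with hK
  have hlim : Tendsto (fun N : ℕ => 8 * K * meshSize N) atTop (𝓝 0) := by
    have h : Tendsto (fun N : ℕ => meshSize N) atTop (𝓝 0) := tendsto_one_div_add_atTop_nhds_zero_nat
    simpa using h.const_mul (8 * K)
  refine tendsto_of_tendsto_of_tendsto_of_le_of_le' tendsto_const_nhds hlim
    (Eventually.of_forall fun N => Finset.sum_nonneg fun j _ => norm_nonneg _) ?_
  filter_upwards [eventually_gt_atTop (2 * n + 2),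
    (tendsto_waveNum (n + 1)).eventually_lt_const (half_pos hpi)] with N hN hlow
  have hn : n < N := by omega
  have hr : N - 1 - n ≠ n := by omega
  have hh := meshSize_pos N
  have hη := waveNum_succ_mem hn
  have hbw := le_bigridWeight_acoustic hη.1.le hlow.le
  have hbw0 : (bigridWeight false (waveNum N (n + 1)) : ℂ) ≠ 0 := by
    exact_mod_cast (lt_of_lt_of_le (by norm_num) hbw).ne'
  have hsum1 : ‖e (false, true, n) * osc (freq N false n) T‖ +
      ‖e (false, false, n) * osc (-freq N false n) T‖ = 1 := by
    simp only [norm_mul, norm_osc, mul_one, he]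
    cases σ <;> simp
  have hf := freq_pos false hn
  have hf2 : 2 ≤ freq N false n := by
    have := two_mul_le_freq false hn
    have h0 : (0 : ℝ) ≤ n := Nat.cast_nonneg _
    linarith
  have hP1 : ‖(finalCoeffs N T e).1 false n‖ ≤ 1 / 2 := by
    simp only [finalCoeffs, norm_div, Complex.norm_real, Real.norm_eq_abs, abs_of_pos hf]
    rw [div_le_iff₀ hf]
    have := norm_add_le (e (false, true, n) * osc (freq N false n) T)
      (e (false, false, n) * osc (-freq N false n) T)
    linarith
  have hQ1 : ‖(finalCoeffs N T e).2 false n‖ ≤ 1 := by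
    simp only [finalCoeffs, norm_mul, Complex.norm_I, one_mul]
    rw [← hsum1]
    exact norm_sub_le _ _
  have hpN : ‖p N‖ ≤ 8 := by
    simp only [hp, norm_div, Complex.norm_real, Real.norm_eq_abs]
    rw [div_le_iff₀ (by positivity)]
    rw [abs_of_nonneg (by linarith)]
    linarith
  have hqN : ‖q N‖ ≤ 16 := by
    simp only [hq, norm_div, Complex.norm_real, Real.norm_eq_abs]
    rw [div_le_iff₀ (by positivity)]
    rw [abs_of_nonneg (by linarith)]
    linarith
  have hrefl : ∀ (a : ℂ) l, ‖reflected N n a l‖ ≤ ‖a‖ := by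
    intro a l
    simp only [reflected, Pi.sub_apply, Pi.single_apply]
    by_cases h1 : l = n
    · rw [if_pos h1, if_neg (by omega), sub_zero]
    · rw [if_neg h1, zero_sub, norm_neg]
      split_ifs <;> simp
  have hrn : ∀ a : ℂ, reflected N n a n = a := by
    intro a
    simp only [reflected, Pi.sub_apply, Pi.single_eq_same]
    rw [Pi.single_eq_of_ne hr.symm, sub_zero]
  set s2 := Real.sin (waveNum N (n + 1) / 2) ^ 2 with hs2
  have hs2le : s2 ≤ (((n : ℝ) + 1) * Real.pi * meshSize N) ^ 2 := by
    have h1 : Real.sin (waveNum N (n + 1) / 2) ≤ waveNum N (n + 1) / 2 :=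
      Real.sin_le (by linarith [hη.1])
    have h2 := sin_half_nonneg (Ioo_subset_Icc_self hη)
    have h3 : waveNum N (n + 1) = ((n : ℝ) + 1) * Real.pi * meshSize N := by
      rw [waveNum]; push_cast; ring
    rw [← h3]
    exact pow_le_pow_left₀ h2 (by linarith [hη.1]) 2
  have hsmall : ∀ b σ l, l < N → bigridWeight b (waveNum N (l + 1)) ≤ 27 * s2 →
      ‖amplitude N T (fun b l => bigridWeight b (waveNum N (l + 1)) * reflected N n (p N) l,
        fun b l => bigridWeight b (waveNum N (l + 1)) * reflected N n (q N) l) (b, σ, l)‖ ≤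
        K * meshSize N := by
    intro b σ l hl hle
    refine (norm_amplitude_le T _ _ (mem_modes.2 hl)).trans ?_
    have h0 := bigridWeight_nonneg b (waveNum N (l + 1))
    simp only [norm_mul, Complex.norm_real, Real.norm_eq_abs, abs_of_nonneg h0]
    have h1 := hrefl (p N) l
    have h2 := hrefl (q N) l
    have h3 := freq_le N b l
    have h4 := (freq_pos b hl).le
    have hone : (16 : ℝ) ≤ 16 / meshSize N := by
      rw [le_div_iff₀ hh]; linarith [meshSize_le_one N]
    calc freq N b l * (bigridWeight b (waveNum N (l + 1)) * ‖reflected N n (p N) l‖) +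
          bigridWeight b (waveNum N (l + 1)) * ‖reflected N n (q N) l‖
        ≤ 8 / meshSize N * (27 * s2 * 8) + 27 * s2 * (16 / meshSize N) := by
          gcongr
          · exact h1.trans hpN
          · exact (h2.trans hqN).trans hone
      _ = 27 * s2 * 80 / meshSize N := by ring
      _ ≤ 27 * (((n : ℝ) + 1) * Real.pi * meshSize N) ^ 2 * 80 / meshSize N := by gcongr
      _ = K * meshSize N := by rw [hK]; field_simp
  have hKh : 0 ≤ K * meshSize N := by positivity
  have hpt : ∀ b σ' l, l < N →
      ‖amplitude N T (fun b l => bigridWeight b (waveNum N (l + 1)) * reflected N n (p N) l,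
        fun b l => bigridWeight b (waveNum N (l + 1)) * reflected N n (q N) l) (b, σ', l) -
          e (b, σ', l)‖ ≤ (if l = n then K * meshSize N else 0) +
            (if l = N - 1 - n then K * meshSize N else 0) := by
    intro b σ' l hl
    by_cases h1 : l = n
    · subst h1
      rw [if_pos rfl, if_neg hr.symm, add_zero]
      cases b
      · have h2 : amplitude N T
            (fun b m => bigridWeight b (waveNum N (m + 1)) * reflected N l (p N) m,
            fun b m => bigridWeight b (waveNum N (m + 1)) * reflected N l (q N) m) (false, σ', l) =
            amplitude N T (finalCoeffs N T e) (false, σ', l) := by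
          simp only [amplitude, LinearMap.coe_mk, AddHom.coe_mk, hrn, hp, hq]
          rw [mul_div_cancel₀ _ hbw0, mul_div_cancel₀ _ hbw0]
        rw [h2, amplitude_finalCoeffs, sub_self, norm_zero]
        · exact hKh
        · intro j hj
          refine Pi.single_eq_of_ne ?_ _
          rintro rfl
          exact hj (mem_modes.2 hl)
      · have h0 : e (true, σ', l) = 0 := Pi.single_eq_of_ne (by simp) _
        rw [h0, sub_zero]
        exact hsmall true σ' l hl (bigridWeight_optic_le_sin _)
    · have h0 : e (b, σ', l) = 0 := Pi.single_eq_of_ne (by simp [h1]) _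
      rw [h0, sub_zero, if_neg h1, zero_add]
      by_cases h2 : l = N - 1 - n
      · rw [if_pos h2]
        refine hsmall b σ' l hl ?_
        refine (bigridWeight_le_cos (waveNum_succ_mem hl)).trans (le_of_eq ?_)
        rw [h2, waveNum_reflect hn, show (Real.pi - waveNum N (n + 1)) / 2 =
          Real.pi / 2 - waveNum N (n + 1) / 2 by ring, Real.cos_pi_div_two_sub]
      · have h3 : ∀ a, reflected N n a l = 0 := by
          intro a
          simp only [reflected, Pi.sub_apply]
          rw [Pi.single_eq_of_ne h1, Pi.single_eq_of_ne h2, sub_zero]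
        simp [amplitude, h3, h2]
  rw [sum_modes]
  have hbs : ∀ b σ', ∑ l ∈ Finset.range N,
      ‖amplitude N T (fun b l => bigridWeight b (waveNum N (l + 1)) * reflected N n (p N) l,
        fun b l => bigridWeight b (waveNum N (l + 1)) * reflected N n (q N) l) (b, σ', l) -
          e (b, σ', l)‖ ≤ 2 * (K * meshSize N) := by
    intro b σ'
    refine (Finset.sum_le_sum fun l hl => hpt b σ' l (Finset.mem_range.1 hl)).trans ?_
    rw [Finset.sum_add_distrib, Finset.sum_ite_eq', Finset.sum_ite_eq', if_pos, if_pos]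
    · exact (two_mul _).ge
    · exact Finset.mem_range.2 (by omega)
    · exact Finset.mem_range.2 hn
  simp only [Fintype.sum_bool]
  have h1 := hbs true true
  have h2 := hbs true false
  have h3 := hbs false true
  have h4 := hbs false false
  linarith

end Bigrid

/-! ### Square summable sequences -/

section Sequences

theorem Ell2.hasSum_norm_sq (f : Ell2) : HasSum (fun n => ‖f n‖ ^ 2) (‖f‖ ^ 2) := by
  have := lp.hasSum_norm (p := 2) (by norm_num) f
  simpa using this

theorem memℓp_two_of_summable {g : ℕ → ℂ} (h : Summable fun n => ‖g n‖ ^ 2) :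
    Memℓp g 2 := by
  refine memℓp_gen ?_
  simpa using h

theorem memℓp_mul {μ : ℕ → ℂ} {C : ℝ} (hμ : ∀ n, ‖μ n‖ ≤ C) (f : Ell2) :
    Memℓp (fun n => μ n * f n) 2 := by
  refine memℓp_two_of_summable (Summable.of_nonneg_of_le (fun n => sq_nonneg _) (fun n => ?_)
    (f.hasSum_norm_sq.summable.mul_left (C ^ 2)))
  rw [norm_mul, mul_pow]
  gcongr
  exact hμ n

/-- The product of a sequence with a multiplier. It is meaningful for bounded multipliers. -/
def ellMul (μ : ℕ → ℂ) (f : Ell2) : Ell2 := by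
  classical
  exact if h : Memℓp (fun n => μ n * f n) 2 then ⟨_, h⟩ else 0

theorem ellMul_apply {μ : ℕ → ℂ} {C : ℝ} (hμ : ∀ n, ‖μ n‖ ≤ C) (f : Ell2) (n : ℕ) :
    ellMul μ f n = μ n * f n := by
  rw [ellMul, dif_pos (memℓp_mul hμ f)]

/-- Dominated convergence for multipliers. -/
theorem tendsto_ellMul {ι : Type*} {l : Filter ι} {μ : ι → ℕ → ℂ} {ν : ℕ → ℂ} {C : ℝ}
    (hμ : ∀ i n, ‖μ i n‖ ≤ C) (hν : ∀ n, ‖ν n‖ ≤ C)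
    (hlim : ∀ n, Tendsto (fun i => μ i n) l (𝓝 (ν n))) (f : Ell2) :
    Tendsto (fun i => ellMul (μ i) f) l (𝓝 (ellMul ν f)) := by
  rw [tendsto_iff_norm_sub_tendsto_zero]
  have hsq : Tendsto (fun i => ‖ellMul (μ i) f - ellMul ν f‖ ^ 2) l (𝓝 0) := by
    have e : ∀ i, ‖ellMul (μ i) f - ellMul ν f‖ ^ 2 = ∑' n, ‖(μ i n - ν n) * f n‖ ^ 2 := by
      intro i
      rw [← (ellMul (μ i) f - ellMul ν f).hasSum_norm_sq.tsum_eq]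
      refine tsum_congr fun n => ?_
      rw [lp.coeFn_sub, Pi.sub_apply, ellMul_apply (hμ i), ellMul_apply hν, sub_mul]
    simp only [e]
    have h0 : (0 : ℝ) = ∑' n : ℕ, (0 : ℝ) := by simp
    rw [h0]
    refine tendsto_tsum_of_dominated_convergence (bound := fun n => (2 * C) ^ 2 * ‖f n‖ ^ 2)
      (f.hasSum_norm_sq.summable.mul_left _) (fun n => ?_) (Eventually.of_forall fun i n => ?_)
    · have h1 : Tendsto (fun i => (μ i n - ν n) * f n) l (𝓝 ((ν n - ν n) * f n)) :=
        ((hlim n).sub_const _).mul_const _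
      simpa using (h1.norm).pow 2
    · rw [Real.norm_of_nonneg (sq_nonneg _), norm_mul, mul_pow]
      gcongr
      refine (norm_sub_le _ _).trans ?_
      linarith [hμ i n, hν n]
  have := hsq.sqrt
  simpa using this

theorem inner_sum_single (f : ℕ → ℂ) (s : Finset ℕ) (g : Ell2) :
    inner ℂ (∑ n ∈ s, lp.single 2 n (f n) : Ell2) g = ∑ n ∈ s, conj (f n) * g n := by
  rw [sum_inner]
  refine Finset.sum_congr rfl fun n _ => ?_
  rw [lp.inner_single_left]
  simp [mul_comm]

theorem norm_sq_sum_single (f : ℕ → ℂ) (s : Finset ℕ) :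
    ‖(∑ n ∈ s, lp.single 2 n (f n) : Ell2)‖ ^ 2 = ∑ n ∈ s, ‖f n‖ ^ 2 := by
  have := lp.norm_sum_single (p := 2) (E := fun _ : ℕ => ℂ) (by norm_num) f s
  simpa using this

variable {H : Type*} [NormedAddCommGroup H] [InnerProductSpace ℂ H]

/-- The synthesis operator of a Bessel sequence. -/
theorem exists_synthesis [CompleteSpace H] (e : ℕ → H) {C : ℝ} (hC : 0 ≤ C)
    (h : ∀ (s : Finset ℕ) (f : ℕ → ℂ), ‖∑ n ∈ s, f n • e n‖ ^ 2 ≤ C * ∑ n ∈ s, ‖f n‖ ^ 2) :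
    ∃ Φ : Ell2 →L[ℂ] H, ∀ f : Ell2, HasSum (fun n => f n • e n) (Φ f) := by
  have hs : ∀ f : Ell2, Summable fun n => f n • e n := by
    intro f
    rw [summable_iff_vanishing_norm]
    intro ε hε
    have h1 := summable_iff_vanishing_norm.1 f.hasSum_norm_sq.summable (ε ^ 2 / (C + 1))
      (by positivity)
    obtain ⟨s, hs⟩ := h1
    refine ⟨s, fun t ht => ?_⟩
    have h2 := hs t ht
    rw [Real.norm_of_nonneg (Finset.sum_nonneg fun _ _ => sq_nonneg _), lt_div_iff₀ (by positivity)]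
      at h2
    have h3 := h t f
    have h4 : 0 ≤ ∑ n ∈ t, ‖f n‖ ^ 2 := Finset.sum_nonneg fun _ _ => sq_nonneg _
    exact lt_of_pow_lt_pow_left₀ 2 hε.le (by nlinarith)
  let Φ : Ell2 →ₗ[ℂ] H :=
    { toFun := fun f => ∑' n, f n • e n
      map_add' := fun f g => by
        rw [← (hs f).tsum_add (hs g)]
        exact tsum_congr fun n => by rw [lp.coeFn_add, Pi.add_apply, add_smul]
      map_smul' := fun a f => by
        rw [RingHom.id_apply, ← (hs f).tsum_const_smul]
        exact tsum_congr fun n => by rw [lp.coeFn_smul, Pi.smul_apply, smul_assoc] }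
  have hb : ∀ f, ‖Φ f‖ ≤ √C * ‖f‖ := by
    intro f
    refine le_of_sq_le_sq ?_ (by positivity)
    rw [mul_pow, Real.sq_sqrt hC]
    refine le_of_tendsto (((hs f).hasSum.norm).pow 2) (Eventually.of_forall fun s => ?_)
    refine (h s f).trans (mul_le_mul_of_nonneg_left ?_ hC)
    exact sum_le_hasSum s (fun _ _ => sq_nonneg _) f.hasSum_norm_sq
  exact ⟨Φ.mkContinuous _ hb, fun f => (hs f).hasSum⟩

end Sequences

/-! ### The normal derivative as a function of the amplitudes -/

section Flux

/-- The space of amplitudes `(c_{σ,n})` of the continuous waves. -/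
abbrev Amp : Type := PiLp 2 fun _ : Bool => Ell2

theorem Amp.hasSum_norm_sq (c : Amp) : HasSum (fun n => ∑ σ, ‖c σ n‖ ^ 2) (‖c‖ ^ 2) := by
  rw [PiLp.norm_sq_eq_of_L2]
  exact hasSum_sum fun σ _ => (c σ).hasSum_norm_sq

/-- The frequencies of the continuous waves. -/
def contFreq (n : ℕ) : ℝ := ((n : ℝ) + 1) * Real.pi

theorem contFreq_pos (n : ℕ) : 0 < contFreq n := by
  have := Real.pi_pos
  unfold contFreq; positivity

/-- The normal derivatives of the continuous modes, divided by their frequencies. -/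
def contWeight (n : ℕ) : ℝ := √2 * (-1) ^ (n + 1)

theorem abs_contWeight (n : ℕ) : |contWeight n| = √2 := by
  rw [contWeight, abs_mul, abs_pow, abs_neg, abs_one, one_pow, mul_one, abs_of_nonneg (Real.sqrt_nonneg _)]

theorem contFreq_gap {i j : ℕ × Bool} (h : i ≠ j) :
    Real.pi ≤ |sgn i.2 * contFreq i.1 - sgn j.2 * contFreq j.1| := by
  have hpi := Real.pi_pos
  obtain ⟨n, σ⟩ := i
  obtain ⟨n', σ'⟩ := j
  have h1 : (0 : ℝ) ≤ n := Nat.cast_nonneg _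
  have h2 : (0 : ℝ) ≤ n' := Nat.cast_nonneg _
  have e : sgn σ * contFreq n - sgn σ' * contFreq n' =
      (sgn σ * ((n : ℝ) + 1) - sgn σ' * ((n' : ℝ) + 1)) * Real.pi := by
    simp only [contFreq]; ring
  simp only [e]
  rw [abs_mul, abs_of_pos hpi]
  refine le_mul_of_one_le_left hpi.le ?_
  by_cases hσ : σ = σ'
  · subst hσ
    rw [← mul_sub, abs_mul, abs_sgn, one_mul]
    have hne : (n : ℤ) - n' ≠ 0 := by
      intro h0
      exact h (by rw [show n = n' by omega])
    have h3 := Int.one_le_abs hne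
    have h4 : ((|(n : ℤ) - n'| : ℤ) : ℝ) = |(n : ℝ) + 1 - (n' + 1)| := by
      push_cast; congr 1; ring
    rw [← h4]
    exact_mod_cast h3
  · cases σ <;> cases σ' <;> simp [sgn] at hσ ⊢
    · rw [abs_sub_comm]; exact le_trans (by linarith) (le_abs_self _)
    · exact le_trans (by linarith) (le_abs_self _)

theorem exists_fluxMap (T : ℝ) : ∃ Φ : Amp →L[ℂ] L2T T, 0 < T → ∀ c : Amp,
    HasSum (fun n => ∑ σ, ((contWeight n : ℂ) * c σ n) • expT T (sgn σ * contFreq n)) (Φ c) := by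
  by_cases hT : 0 < T
  swap
  · exact ⟨0, fun h => absurd h hT⟩
  obtain ⟨C, hC, hI⟩ := ingham_upper (ι := ℕ) hT Real.pi_pos
  have hσ : ∀ σ : Bool, ∃ Φ : Ell2 →L[ℂ] L2T T, ∀ f : Ell2,
      HasSum (fun n => f n • ((contWeight n : ℂ) • expT T (sgn σ * contFreq n))) (Φ f) := by
    intro σ
    refine exists_synthesis _ (C := C * 2) (by positivity) fun s f => ?_
    simp only [smul_smul]
    rw [norm_sq_sum_smul_expT hT.le s (fun n => f n * contWeight n) (fun n => sgn σ * contFreq n)]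
    refine (hI s _ _ fun i _ j _ hij => ?_).trans (le_of_eq ?_)
    · exact contFreq_gap (i := (i, σ)) (j := (j, σ)) (by simpa using hij)
    · simp only [norm_mul, Complex.norm_real, Real.norm_eq_abs, abs_contWeight, mul_pow,
        Real.sq_sqrt zero_le_two, ← Finset.sum_mul]
      ring
  choose Φ hΦ using hσ
  refine ⟨∑ σ, (Φ σ).comp (PiLp.proj 2 (fun _ : Bool => Ell2) σ), fun _ c => ?_⟩
  rw [_root_.sum_apply]
  refine hasSum_sum fun σ _ => ?_
  have := hΦ σ (c σ)
  simp only [smul_smul, mul_comm] at this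
  simp only [mul_comm] at this ⊢
  exact this

/-- The normal derivative at `x = 1`, as a function of the amplitudes. -/
def fluxMap (T : ℝ) : Amp →L[ℂ] L2T T := Classical.choose (exists_fluxMap T)

theorem hasSum_fluxMap {T : ℝ} (hT : 0 < T) (c : Amp) :
    HasSum (fun n => ∑ σ, ((contWeight n : ℂ) * c σ n) • expT T (sgn σ * contFreq n))
      (fluxMap T c) := Classical.choose_spec (exists_fluxMap T) hT c

/-- Observability of the continuous waves. -/
theorem observability_fluxMap {T : ℝ} (hT : 2 < T) :
    ∃ κ : ℝ, 0 < κ ∧ ∀ c : Amp, κ * ‖c‖ ^ 2 ≤ ‖fluxMap T c‖ ^ 2 := by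
  have hT0 : 0 < T := by linarith
  obtain ⟨c₁, hc₁, c₂, hc₂, hI⟩ := filtered_ingham (ι := ℕ × Bool) (T := T) (γ := Real.pi) hT0
    (by nlinarith [Real.pi_pos])
  refine ⟨c₁ * 2, by positivity, fun c => ?_⟩
  refine le_of_tendsto_of_tendsto' ((c.hasSum_norm_sq.tendsto_sum_nat).const_mul (c₁ * 2))
    (((hasSum_fluxMap hT0 c).tendsto_sum_nat.norm).pow 2) fun M => ?_
  have h1 := hI (Finset.range M ×ˢ Finset.univ) (fun i => sgn i.2 * contFreq i.1) (fun _ => 1) 0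
    (fun i => (contWeight i.1 : ℂ) * c i.2 i.1) (fun _ _ => zero_le_one) (fun _ _ => le_rfl) (by simp)
    (fun i _ j _ _ _ hij => contFreq_gap hij)
  rw [← norm_sq_sum_smul_expT hT0.le, Finset.sum_product, Finset.sum_product,
    Finset.sum_product] at h1
  refine le_trans (le_of_eq ?_) h1
  simp only [one_pow, one_mul, norm_mul, Complex.norm_real, Real.norm_eq_abs, mul_pow,
    abs_contWeight, Real.sq_sqrt zero_le_two, ne_eq, OfNat.ofNat_ne_zero, not_false_eq_true,
    zero_pow, zero_mul, mul_zero, sub_zero, ← Finset.mul_sum]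
  ring

/-- The Euler–Lagrange equation of the continuous problem has a solution. -/
theorem exists_fluxMap_eulerLagrange {T : ℝ} (hT : 2 < T) (ℓ : Amp) :
    ∃ v, v ∈ LinearMap.range (fluxMap T : Amp →ₗ[ℂ] L2T T) ∧
      ∀ d, inner ℂ (fluxMap T d) v = inner ℂ d ℓ := by
  obtain ⟨κ, hκ, hobs⟩ := observability_fluxMap hT
  have hle : ∀ d, ‖d‖ ≤ (√κ)⁻¹ * ‖fluxMap T d‖ := by
    intro d
    have hs : 0 < √κ := Real.sqrt_pos.2 hκ
    rw [inv_mul_eq_div, le_div_iff₀ hs]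
    refine le_of_sq_le_sq ?_ (norm_nonneg _)
    rw [mul_pow, Real.sq_sqrt hκ.le, mul_comm]
    exact hobs d
  have hanti : AntilipschitzWith (Real.toNNReal (√κ)⁻¹) (fluxMap T) := by
    refine AddMonoidHomClass.antilipschitz_of_bound _ fun d => ?_
    rw [Real.coe_toNNReal _ (by positivity)]
    exact hle d
  have hcl : IsClosed (LinearMap.range (fluxMap T : Amp →ₗ[ℂ] L2T T) : Set (L2T T)) := by
    have := hanti.isClosed_range (fluxMap T).uniformContinuous
    convert this using 1
    exact LinearMap.coe_range (fluxMap T : Amp →ₗ[ℂ] L2T T)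
  have : CompleteSpace (LinearMap.range (fluxMap T : Amp →ₗ[ℂ] L2T T)) := hcl.completeSpace_coe
  let L : Amp →ₗ⋆[ℂ] ℂ :=
    { toFun := fun d => inner ℂ d ℓ
      map_add' := fun d d' => inner_add_left _ _ _
      map_smul' := fun a d => by rw [inner_smul_left]; rfl }
  refine eulerLagrange_exists (fluxMap T : Amp →ₗ[ℂ] L2T T) L (‖ℓ‖ * (√κ)⁻¹) fun d => ?_
  refine (norm_inner_le_norm d ℓ).trans ?_
  rw [mul_comm, mul_assoc]
  exact mul_le_mul_of_nonneg_left (hle d) (norm_nonneg _)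

end Flux

/-! ### Fourier series on the interval -/

section FourierSeries

theorem integral_cos_int_mul_pi (m : ℤ) :
    ∫ x in (0 : ℝ)..1, Real.cos (m * Real.pi * x) = if m = 0 then 1 else 0 := by
  split_ifs with h
  · subst h; simp
  · have h0 : (m : ℝ) * Real.pi ≠ 0 := mul_ne_zero (by exact_mod_cast h) Real.pi_ne_zero
    rw [intervalIntegral.integral_comp_mul_left (fun x => Real.cos x) h0, integral_cos]
    simp [Real.sin_int_mul_pi]

theorem integral_cos_add_sub (a b : ℕ) (s : ℝ) :
    ∫ x in (0 : ℝ)..1, (Real.cos (((a : ℤ) - b : ℤ) * Real.pi * x) +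
      s * Real.cos (((a : ℤ) + b : ℤ) * Real.pi * x)) =
      (if (a : ℤ) - b = 0 then 1 else 0) + s * (if (a : ℤ) + b = 0 then 1 else 0) := by
  rw [intervalIntegral.integral_add (Continuous.intervalIntegrable (by fun_prop) _ _)
    (Continuous.intervalIntegrable (by fun_prop) _ _), intervalIntegral.integral_const_mul,
    integral_cos_int_mul_pi, integral_cos_int_mul_pi]

/-- `√2 cos(kπx)`. -/
def cosFn (k : ℕ) (x : ℝ) : ℝ := √2 * Real.cos (k * Real.pi * x)

theorem continuous_cosFn (k : ℕ) : Continuous (cosFn k) := by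
  unfold cosFn; fun_prop

/-- `√2 cos(kπx)` as an element of `L²(0,1)`. -/
def cosL2 (k : ℕ) : L2I :=
  contL2 1 (fun x => (cosFn k x : ℂ)) (Complex.continuous_ofReal.comp (continuous_cosFn k))

theorem inner_real_contL2 {f g : ℝ → ℝ} (hf : Continuous f) (hg : Continuous g) :
    inner ℂ (contL2 1 (fun x => (f x : ℂ)) (Complex.continuous_ofReal.comp hf))
      (contL2 1 (fun x => (g x : ℂ)) (Complex.continuous_ofReal.comp hg)) =
        ((∫ x in (0 : ℝ)..1, f x * g x : ℝ) : ℂ) := by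
  rw [inner_contL2 zero_le_one, ← intervalIntegral.integral_ofReal]
  simp only [Complex.conj_ofReal, Complex.ofReal_mul]

theorem sineL2_eq (k : ℕ) : sineL2 k =
    contL2 1 (fun x => (sineFn k x : ℂ)) (Complex.continuous_ofReal.comp (continuous_sineFn k)) := rfl

theorem orthonormal_sine : Orthonormal ℂ fun n => sineL2 (n + 1) := by
  rw [orthonormal_iff_ite]
  intro i j
  simp only [sineL2_eq]
  rw [inner_real_contL2 (continuous_sineFn _) (continuous_sineFn _)]
  have h := integral_cos_add_sub (i + 1) (j + 1) (-1)
  have e : ∀ x, sineFn (i + 1) x * sineFn (j + 1) x =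
      Real.cos ((((i + 1 : ℕ) : ℤ) - ((j + 1 : ℕ) : ℤ) : ℤ) * Real.pi * x) +
        -1 * Real.cos ((((i + 1 : ℕ) : ℤ) + ((j + 1 : ℕ) : ℤ) : ℤ) * Real.pi * x) := by
    intro x
    have h2 := Real.mul_self_sqrt zero_le_two
    simp only [sineFn]
    push_cast
    rw [show ((i : ℝ) + 1 - (j + 1)) * Real.pi * x = (i + 1) * Real.pi * x - (j + 1) * Real.pi * x by ring,
      show ((i : ℝ) + 1 + (j + 1)) * Real.pi * x = (i + 1) * Real.pi * x + (j + 1) * Real.pi * x by ring,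
      Real.cos_sub, Real.cos_add]
    linear_combination Real.sin ((i + 1) * Real.pi * x) * Real.sin ((j + 1) * Real.pi * x) * h2
  simp only [e, h]
  rw [if_neg (show ¬ (((i + 1 : ℕ) : ℤ) + ((j + 1 : ℕ) : ℤ) = 0) by omega)]
  by_cases hij : i = j
  · subst hij; simp
  · rw [if_neg hij, if_neg (by omega)]; simp

theorem orthonormal_cos : Orthonormal ℂ fun n => cosL2 (n + 1) := by
  rw [orthonormal_iff_ite]
  intro i j
  simp only [cosL2]
  rw [inner_real_contL2 (continuous_cosFn _) (continuous_cosFn _)]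
  have h := integral_cos_add_sub (i + 1) (j + 1) 1
  have e : ∀ x, cosFn (i + 1) x * cosFn (j + 1) x =
      Real.cos ((((i + 1 : ℕ) : ℤ) - ((j + 1 : ℕ) : ℤ) : ℤ) * Real.pi * x) +
        1 * Real.cos ((((i + 1 : ℕ) : ℤ) + ((j + 1 : ℕ) : ℤ) : ℤ) * Real.pi * x) := by
    intro x
    have h2 := Real.mul_self_sqrt zero_le_two
    simp only [cosFn]
    push_cast
    rw [show ((i : ℝ) + 1 - (j + 1)) * Real.pi * x = (i + 1) * Real.pi * x - (j + 1) * Real.pi * x by ring,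
      show ((i : ℝ) + 1 + (j + 1)) * Real.pi * x = (i + 1) * Real.pi * x + (j + 1) * Real.pi * x by ring,
      Real.cos_sub, Real.cos_add]
    linear_combination Real.cos ((i + 1) * Real.pi * x) * Real.cos ((j + 1) * Real.pi * x) * h2
  simp only [e, h]
  rw [if_neg (show ¬ (((i + 1 : ℕ) : ℤ) + ((j + 1 : ℕ) : ℤ) = 0) by omega)]
  by_cases hij : i = j
  · subst hij; simp
  · rw [if_neg hij, if_neg (by omega)]; simp

theorem integral_mul_sin_cos_pow {z : L2I} (h : ∀ n, inner ℂ (sineL2 (n + 1)) z = 0) (m k : ℕ) :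
    ∫ x in Ioo (0 : ℝ) 1, z x *
      ((Real.sin (k * Real.pi * x) * Real.cos (Real.pi * x) ^ m : ℝ) : ℂ) = 0 := by
  induction m generalizing k with
  | zero =>
    rcases Nat.eq_zero_or_pos k with rfl | hk
    · simp
    · obtain ⟨n, rfl⟩ : ∃ n, k = n + 1 := ⟨k - 1, by omega⟩
      have h1 := h n
      rw [sineL2_eq, inner_contL2_left zero_le_one, ← setIntegral_Ioo_eq zero_le_one] at h1
      have e : ∀ x, conj ((sineFn (n + 1) x : ℝ) : ℂ) * z x = (√2 : ℂ) *
          (z x * ((Real.sin (((n + 1 : ℕ) : ℝ) * Real.pi * x) * Real.cos (Real.pi * x) ^ 0 : ℝ) : ℂ)) := by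
        intro x
        rw [Complex.conj_ofReal, sineFn, pow_zero, mul_one]
        push_cast; ring
      simp only [e, integral_const_mul] at h1
      exact (mul_eq_zero.1 h1).resolve_left (by simp)
  | succ m ih =>
    rcases Nat.eq_zero_or_pos k with rfl | hk
    · simp
    · obtain ⟨n, rfl⟩ : ∃ n, k = n + 1 := ⟨k - 1, by omega⟩
      have e : ∀ x, z x * ((Real.sin (((n + 1 : ℕ) : ℝ) * Real.pi * x) *
          Real.cos (Real.pi * x) ^ (m + 1) : ℝ) : ℂ) =
          1 / 2 * (z x * ((Real.sin (((n + 1 + 1 : ℕ) : ℝ) * Real.pi * x) *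
            Real.cos (Real.pi * x) ^ m : ℝ) : ℂ)) +
          1 / 2 * (z x * ((Real.sin ((n : ℝ) * Real.pi * x) * Real.cos (Real.pi * x) ^ m : ℝ) : ℂ)) := by
        intro x
        have h1 := sin_add_sin_shift (((n + 1 : ℕ) : ℝ) * Real.pi * x) (Real.pi * x)
        rw [show ((n + 1 : ℕ) : ℝ) * Real.pi * x + Real.pi * x =
          ((n + 1 + 1 : ℕ) : ℝ) * Real.pi * x by push_cast; ring,
          show ((n + 1 : ℕ) : ℝ) * Real.pi * x - Real.pi * x = (n : ℝ) * Real.pi * x by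
            push_cast; ring] at h1
        have h2 : Real.sin (((n + 1 + 1 : ℕ) : ℝ) * Real.pi * x) =
          2 * Real.cos (Real.pi * x) * Real.sin (((n + 1 : ℕ) : ℝ) * Real.pi * x) -
            Real.sin ((n : ℝ) * Real.pi * x) := by linarith
        rw [h2]
        push_cast; ring
      simp only [e]
      rw [integral_add, integral_const_mul, integral_const_mul, ih, ih]
      · simp
      · exact (integrable_mul_of_continuous z (by fun_prop)).const_mul _
      · exact (integrable_mul_of_continuous z (by fun_prop)).const_mul _

/-- The functions `sin(kπx)` are total in `L²(0,1)`. -/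
theorem eq_zero_of_inner_sine {z : L2I} (h : ∀ n, inner ℂ (sineL2 (n + 1)) z = 0) : z = 0 := by
  have hpi := Real.pi_pos
  have hsc : Continuous fun x : ℝ => Real.sin (Real.pi * x) := by fun_prop
  have hzi : Integrable z (volume.restrict (Ioo (0 : ℝ) 1)) := (Lp.memLp z).integrable (by norm_num)
  have hpoly : ∀ p : Polynomial ℝ, ∫ x in Ioo (0 : ℝ) 1, z x *
      ((Real.sin (Real.pi * x) * p.eval (Real.cos (Real.pi * x)) : ℝ) : ℂ) = 0 := by
    intro p
    have e : ∀ x, z x * ((Real.sin (Real.pi * x) * p.eval (Real.cos (Real.pi * x)) : ℝ) : ℂ) =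
        ∑ i ∈ Finset.range (p.natDegree + 1), (p.coeff i : ℂ) * (z x *
          ((Real.sin ((1 : ℕ) * Real.pi * x) * Real.cos (Real.pi * x) ^ i : ℝ) : ℂ)) := by
      intro x
      rw [Polynomial.eval_eq_sum_range, Nat.cast_one, one_mul]
      push_cast
      rw [Finset.mul_sum, Finset.mul_sum]
      exact Finset.sum_congr rfl fun i _ => by ring
    simp only [e]
    rw [integral_finsetSum]
    · refine Finset.sum_eq_zero fun i _ => ?_
      rw [integral_const_mul, integral_mul_sin_cos_pow h, mul_zero]
    · intro i _
      exact (integrable_mul_of_continuous z (by fun_prop)).const_mul _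
  have hw : LocallyIntegrableOn (fun x => z x * (Real.sin (Real.pi * x) : ℂ)) (Ioo 0 1) volume :=
    (show IntegrableOn (fun x => z x * (Real.sin (Real.pi * x) : ℂ)) (Ioo (0 : ℝ) 1) volume from
      integrable_mul_of_continuous z hsc).locallyIntegrableOn
  have key := isOpen_Ioo.ae_eq_zero_of_integral_contDiff_smul_eq_zero hw (by
    intro g hg _ hsupp
    have hgc := hg.continuous
    have h0 : ∀ t, t ∉ Ioo (0 : ℝ) 1 → g t = 0 := fun t ht =>
      image_eq_zero_of_notMem_tsupport fun h => ht (hsupp h)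
    have e1 : ∫ x, g x • (z x * (Real.sin (Real.pi * x) : ℂ)) =
        ∫ x in Ioo (0 : ℝ) 1, z x * ((Real.sin (Real.pi * x) * g x : ℝ) : ℂ) := by
      rw [← setIntegral_eq_integral_of_forall_compl_eq_zero (s := Ioo 0 1)]
      · refine integral_congr_ae (Eventually.of_forall fun t => ?_)
        simp only [Complex.real_smul]
        push_cast; ring
      · intro t ht
        rw [h0 t ht, zero_smul]
    rw [e1]
    set I := ∫ x in Ioo (0 : ℝ) 1, ‖z x‖ with hI
    have hI0 : 0 ≤ I := integral_nonneg fun _ => norm_nonneg _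
    have hle : ∀ ε : ℝ, 0 < ε →
        ‖∫ x in Ioo (0 : ℝ) 1, z x * ((Real.sin (Real.pi * x) * g x : ℝ) : ℂ)‖ ≤ ε * I := by
      intro ε hε
      obtain ⟨p, hp⟩ := exists_polynomial_near_of_continuousOn (-1) 1
        (fun y => g (Real.arccos y / Real.pi))
        (hgc.comp (Real.continuous_arccos.div_const _)).continuousOn ε hε
      have hint1 : Integrable (fun x => z x * ((Real.sin (Real.pi * x) * g x : ℝ) : ℂ))
          (volume.restrict (Ioo (0 : ℝ) 1)) :=
        integrable_mul_of_continuous z (hsc.mul hgc)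
      have hint2 : Integrable (fun x => z x *
          ((Real.sin (Real.pi * x) * p.eval (Real.cos (Real.pi * x)) : ℝ) : ℂ))
          (volume.restrict (Ioo (0 : ℝ) 1)) :=
        integrable_mul_of_continuous z (hsc.mul (p.continuous.comp (by fun_prop)))
      rw [← sub_zero (∫ x in Ioo (0 : ℝ) 1, _), ← hpoly p, ← integral_sub hint1 hint2, hI,
        ← integral_const_mul]
      refine norm_integral_le_of_norm_le (hzi.norm.const_mul ε) ?_
      refine (ae_restrict_iff' measurableSet_Ioo).2 (Eventually.of_forall fun x hx => ?_)
      have hx1 : 0 ≤ Real.pi * x := by have := hx.1; positivity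
      have hx2 : Real.pi * x ≤ Real.pi := by nlinarith [hx.2]
      have h1 := hp (Real.cos (Real.pi * x)) ⟨Real.neg_one_le_cos _, Real.cos_le_one _⟩
      rw [Real.arccos_cos hx1 hx2, mul_div_cancel_left₀ _ hpi.ne', abs_sub_comm] at h1
      rw [← mul_sub, ← Complex.ofReal_sub, ← mul_sub, norm_mul, Complex.norm_real, norm_mul,
        Real.norm_eq_abs, Real.norm_eq_abs, mul_comm ε]
      refine mul_le_mul_of_nonneg_left ?_ (norm_nonneg _)
      calc |Real.sin (Real.pi * x)| * |g x - p.eval (Real.cos (Real.pi * x))|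
          ≤ 1 * ε := mul_le_mul (Real.abs_sin_le_one _) h1.le (abs_nonneg _) zero_le_one
        _ = ε := one_mul _
    rw [← norm_le_zero_iff]
    refine le_of_forall_pos_le_add fun ε hε => ?_
    have := hle (ε / (I + 1)) (by positivity)
    refine this.trans ?_
    rw [zero_add, div_mul_eq_mul_div, div_le_iff₀ (by positivity)]
    nlinarith)
  refine Lp.ext ?_
  filter_upwards [(ae_restrict_iff' measurableSet_Ioo).2 key, ae_restrict_mem measurableSet_Ioo,
    Lp.coeFn_zero ℂ 2 (volume.restrict (Ioo (0 : ℝ) 1))] with t h1 h2 h3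
  have hs : Real.sin (Real.pi * t) ≠ 0 :=
    (Real.sin_pos_of_pos_of_lt_pi (mul_pos hpi h2.1) (by nlinarith [h2.2])).ne'
  rw [h3, Pi.zero_apply]
  exact (mul_eq_zero.1 h1).resolve_right (by exact_mod_cast hs)

/-- The Hilbert basis of the Dirichlet eigenfunctions. -/
def sineBasis : HilbertBasis ℕ ℂ L2I :=
  HilbertBasis.mkOfOrthogonalEqBot orthonormal_sine (by
    rw [Submodule.eq_bot_iff]
    intro z hz
    refine eq_zero_of_inner_sine fun n => ?_
    exact (Submodule.mem_orthogonal _ z).1 hz _ (Submodule.subset_span ⟨n, rfl⟩))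

theorem sineBasis_apply (n : ℕ) : sineBasis n = sineL2 (n + 1) := by
  rw [sineBasis, HilbertBasis.coe_mkOfOrthogonalEqBot]

theorem sineBasis_repr (z : L2I) (n : ℕ) : sineBasis.repr z n = inner ℂ (sineL2 (n + 1)) z := by
  rw [HilbertBasis.repr_apply_apply, sineBasis_apply]

theorem inner_of_hasSum_orthonormal {H : Type*} [NormedAddCommGroup H] [InnerProductSpace ℂ H]
    {e : ℕ → H} (he : Orthonormal ℂ e) {f : ℕ → ℂ} {x : H} (h : HasSum (fun n => f n • e n) x) (k : ℕ) :
    inner ℂ (e k) x = f k := by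
  have h1 := h.mapL (innerSL ℂ (e k))
  have h2 : HasSum (fun n => (innerSL ℂ (e k)) (f n • e n)) (f k) := by
    have : ∀ n, (innerSL ℂ (e k)) (f n • e n) = if n = k then f k else 0 := by
      intro n
      rw [innerSL_apply_apply, inner_smul_right, orthonormal_iff_ite.1 he]
      by_cases hn : n = k
      · simp [hn]
      · rw [if_neg (Ne.symm hn), if_neg hn, mul_zero]
    simp only [this]
    exact hasSum_ite_eq k (f k)
  exact h1.unique h2

theorem norm_sq_sum_orthonormal {H : Type*} [NormedAddCommGroup H] [InnerProductSpace ℂ H]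
    {e : ℕ → H} (he : Orthonormal ℂ e) (s : Finset ℕ) (f : ℕ → ℂ) :
    ‖∑ n ∈ s, f n • e n‖ ^ 2 = ∑ n ∈ s, ‖f n‖ ^ 2 := by
  have h := he.inner_sum f f s
  rw [inner_self_eq_norm_sq_to_K] at h
  have h2 : ∀ n, conj (f n) * f n = ((‖f n‖ ^ 2 : ℝ) : ℂ) := by
    intro n; rw [Complex.conj_mul']; push_cast; rfl
  simp only [h2, ← Complex.ofReal_sum] at h
  rw [← Complex.ofReal_inj, ← h]
  push_cast; rfl

end FourierSeries

/-! ### Fourier analysis of the Sobolev space -/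

section Sobolev

theorem mem_H10_iff (p : L2I × L2I) : p ∈ H10 ↔ ∀ (φ : ℝ → ℝ) (hφ : ContDiff ℝ ∞ φ),
    inner ℂ (contL2 1 (fun x => ((deriv φ x : ℝ) : ℂ))
      (Complex.continuous_ofReal.comp (hφ.continuous_deriv (by simp)))) p.1 =
    -inner ℂ (contL2 1 (fun x => (φ x : ℂ)) (Complex.continuous_ofReal.comp hφ.continuous)) p.2 := by
  refine forall_congr' fun φ => forall_congr' fun hφ => ?_
  rw [inner_contL2_left zero_le_one, inner_contL2_left zero_le_one,
    ← setIntegral_Ioo_eq zero_le_one, ← setIntegral_Ioo_eq zero_le_one]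
  simp only [Complex.conj_ofReal, mul_comm]

theorem isClosed_H10 : IsClosed (H10 : Set (L2I × L2I)) := by
  have e : (H10 : Set (L2I × L2I)) = ⋂ (φ : ℝ → ℝ) (hφ : ContDiff ℝ ∞ φ), {p : L2I × L2I |
    inner ℂ (contL2 1 (fun x => ((deriv φ x : ℝ) : ℂ))
      (Complex.continuous_ofReal.comp (hφ.continuous_deriv (by simp)))) p.1 =
    -inner ℂ (contL2 1 (fun x => (φ x : ℂ)) (Complex.continuous_ofReal.comp hφ.continuous)) p.2} := by
    ext p
    simp only [mem_iInter, mem_ofPred_eq, SetLike.mem_coe, mem_H10_iff]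
  rw [e]
  refine isClosed_iInter fun φ => isClosed_iInter fun hφ => isClosed_eq ?_ ?_ <;> fun_prop

theorem sineDerivL2_eq (n : ℕ) : sineDerivL2 (n + 1) = (contFreq n : ℂ) • cosL2 (n + 1) := by
  refine Lp.ext ?_
  filter_upwards [MemLp.coeFn_toLp (memLp_of_continuous
      (Complex.continuous_ofReal.comp (continuous_sineFnDeriv (n + 1)))),
    Lp.coeFn_smul (contFreq n : ℂ) (cosL2 (n + 1)), coeFn_contL2 1 (fun x => (cosFn (n + 1) x : ℂ))
      (Complex.continuous_ofReal.comp (continuous_cosFn (n + 1)))] with x h1 h2 h3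
  rw [sineDerivL2, h1, h2, Pi.smul_apply, cosL2, h3]
  simp only [Function.comp, sineFnDeriv, cosFn, contFreq, smul_eq_mul]
  push_cast; ring

/-- The cosine coefficients of the derivative of an element of `H¹₀`. -/
theorem H10.inner_cos_dx (u : H10) (n : ℕ) :
    inner ℂ (cosL2 (n + 1)) (H10.dx u) = contFreq n * inner ℂ (sineL2 (n + 1)) (H10.fn u) := by
  have hφ : ContDiff ℝ ∞ (cosFn (n + 1)) := by unfold cosFn; fun_prop
  have h := (mem_H10_iff u.1).1 u.2 (cosFn (n + 1)) hφ
  have hd : ∀ x, deriv (cosFn (n + 1)) x = -contFreq n * sineFn (n + 1) x := by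
    intro x
    have h1 : HasDerivAt (fun x : ℝ => ((n + 1 : ℕ) : ℝ) * Real.pi * x)
        (((n + 1 : ℕ) : ℝ) * Real.pi) x := by
      simpa using (hasDerivAt_id x).const_mul (((n + 1 : ℕ) : ℝ) * Real.pi)
    have h2 := (h1.cos).const_mul (√2)
    rw [show cosFn (n + 1) = fun x => √2 * Real.cos (((n + 1 : ℕ) : ℝ) * Real.pi * x) from rfl, h2.deriv]
    simp only [contFreq, sineFn]
    push_cast; ring
  have e : contL2 1 (fun x => ((deriv (cosFn (n + 1)) x : ℝ) : ℂ))
      (Complex.continuous_ofReal.comp (hφ.continuous_deriv (by simp))) =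
      (-contFreq n : ℂ) • sineL2 (n + 1) := by
    refine Lp.ext ?_
    filter_upwards [Lp.coeFn_smul (-contFreq n : ℂ) (sineL2 (n + 1)), coeFn_contL2 1
      (fun x => (sineFn (n + 1) x : ℂ)) (Complex.continuous_ofReal.comp (continuous_sineFn (n + 1))), coeFn_contL2 1 _
      (Complex.continuous_ofReal.comp (hφ.continuous_deriv (by simp)))] with x h1 h2 h3
    rw [h1, Pi.smul_apply, sineL2_eq, h2]
    refine h3.trans ?_
    simp [hd]
  rw [e, inner_smul_left] at h
  have h2 : inner ℂ (cosL2 (n + 1)) (H10.dx u) = -(conj (-contFreq n : ℂ) * inner ℂ (sineL2 (n + 1)) u.1.1) := by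
    rw [h, neg_neg]; rfl
  rw [h2, map_neg, Complex.conj_ofReal, neg_mul, neg_neg]; rfl

theorem H10.ext_fn {u u' : H10} (h : H10.fn u = H10.fn u') : u = u' := by
  rw [← sub_eq_zero]
  have h1 : (u - u').1.1 = 0 := by
    change u.1.1 - u'.1.1 = 0
    rw [sub_eq_zero]; exact h
  set z : L2I := (u - u').1.2 with hz
  have hint : ∀ φ : ℝ → ℝ, ContDiff ℝ ∞ φ → ∫ x in Ioo (0 : ℝ) 1, z x * ((φ x : ℝ) : ℂ) = 0 := by
    intro φ hφ
    have h2 := (mem_H10_iff (u - u').1).1 (u - u').2 φ hφ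
    rw [h1, inner_zero_right, zero_eq_neg, inner_contL2_left zero_le_one,
      ← setIntegral_Ioo_eq zero_le_one] at h2
    simpa only [Complex.conj_ofReal, mul_comm] using h2
  have hw : LocallyIntegrableOn z (Ioo 0 1) volume :=
    (show IntegrableOn z (Ioo (0 : ℝ) 1) volume from
      (Lp.memLp z).integrable (by norm_num)).locallyIntegrableOn
  have key := isOpen_Ioo.ae_eq_zero_of_integral_contDiff_smul_eq_zero hw (by
    intro g hg _ hsupp
    have h0 : ∀ t, t ∉ Ioo (0 : ℝ) 1 → g t = 0 := fun t ht =>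
      image_eq_zero_of_notMem_tsupport fun h => ht (hsupp h)
    rw [← setIntegral_eq_integral_of_forall_compl_eq_zero (s := Ioo 0 1)]
    · rw [← hint g hg]
      refine integral_congr_ae (Eventually.of_forall fun t => ?_)
      simp only [Complex.real_smul, mul_comm]
    · intro t ht
      rw [h0 t ht, zero_smul])
  have hz0 : z = 0 := by
    refine Lp.ext ?_
    filter_upwards [(ae_restrict_iff' measurableSet_Ioo).2 key,
      Lp.coeFn_zero ℂ 2 (volume.restrict (Ioo (0 : ℝ) 1))] with t h1 h3
    rw [h3, Pi.zero_apply, h1]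
  exact Subtype.ext (Prod.ext h1 hz0)

theorem exists_H10_synthesis : ∃ R : Ell2 →L[ℂ] H10, ∀ a : Ell2,
    HasSum (fun n => (a n / contFreq n) • sineH10 (n + 1)) (R a) := by
  obtain ⟨A, hA⟩ := exists_synthesis (fun n => ((contFreq n : ℂ))⁻¹ • sineL2 (n + 1)) zero_le_one (by
    intro s f
    simp only [smul_smul]
    rw [norm_sq_sum_orthonormal orthonormal_sine s (fun n => f n * (contFreq n : ℂ)⁻¹), one_mul]
    refine Finset.sum_le_sum fun n _ => ?_
    gcongr
    rw [norm_mul, norm_inv, Complex.norm_real, Real.norm_of_nonneg (contFreq_pos n).le]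
    refine mul_le_of_le_one_right (norm_nonneg _) (inv_le_one_of_one_le₀ ?_)
    have := Real.pi_gt_three
    have h2 : (0 : ℝ) ≤ n := Nat.cast_nonneg _
    unfold contFreq
    nlinarith)
  obtain ⟨B, hB⟩ := exists_synthesis (fun n => cosL2 (n + 1)) zero_le_one (by
    intro s f
    rw [norm_sq_sum_orthonormal orthonormal_cos s f, one_mul])
  have hcoe : ∀ (a : Ell2) (n : ℕ), (((a n / contFreq n) • sineH10 (n + 1) : H10) : L2I × L2I) =
      (a n • (((contFreq n : ℂ))⁻¹ • sineL2 (n + 1)), a n • cosL2 (n + 1)) := by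
    intro a n
    have hne : (contFreq n : ℂ) ≠ 0 := by exact_mod_cast (contFreq_pos n).ne'
    refine Prod.ext ?_ ?_
    · change (a n / contFreq n) • sineL2 (n + 1) = _
      rw [smul_smul, div_eq_mul_inv]
    · change (a n / contFreq n) • sineDerivL2 (n + 1) = _
      rw [sineDerivL2_eq, smul_smul, div_mul_cancel₀ _ hne]
  have hsum : ∀ a : Ell2, HasSum (fun n => (((a n / contFreq n) • sineH10 (n + 1) : H10) : L2I × L2I))
      ((A.prod B) a) := by
    intro a
    simp only [hcoe]
    exact (hA a).prodMk (hB a)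
  have hmem : ∀ a, (A.prod B) a ∈ H10 := by
    intro a
    refine isClosed_H10.mem_of_tendsto (hsum a) (Eventually.of_forall fun s => ?_)
    exact H10.sum_mem fun n _ => Subtype.coe_prop _
  refine ⟨(A.prod B).codRestrict H10 hmem, fun a => ?_⟩
  have : HasSum (H10.subtype ∘ fun n => (a n / contFreq n) • sineH10 (n + 1))
      (H10.subtype ((A.prod B).codRestrict H10 hmem a)) := hsum a
  exact (Topology.IsInducing.subtypeVal.hasSum_iff (g := H10.subtype) _ _).1 this

/-- The element of `H¹₀` such that the derivative has given cosine coefficients. -/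
def H10.synth : Ell2 →L[ℂ] H10 := Classical.choose exists_H10_synthesis

theorem H10.hasSum_synth (a : Ell2) :
    HasSum (fun n => (a n / contFreq n) • sineH10 (n + 1)) (H10.synth a) :=
  Classical.choose_spec exists_H10_synthesis a

theorem H10.hasSum_dx_synth (a : Ell2) :
    HasSum (fun n => a n • cosL2 (n + 1)) (H10.dx (H10.synth a)) := by
  have h := (H10.hasSum_synth a).mapL ((ContinuousLinearMap.snd ℂ L2I L2I).comp H10.subtypeL)
  refine h.congr_fun fun n => ?_
  have hne : (contFreq n : ℂ) ≠ 0 := by exact_mod_cast (contFreq_pos n).ne'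
  change a n • cosL2 (n + 1) = (a n / contFreq n) • sineDerivL2 (n + 1)
  rw [sineDerivL2_eq, smul_smul, div_mul_cancel₀ _ hne]

theorem H10.inner_cos_dx_synth (a : Ell2) (n : ℕ) :
    inner ℂ (cosL2 (n + 1)) (H10.dx (H10.synth a)) = a n :=
  inner_of_hasSum_orthonormal orthonormal_cos (H10.hasSum_dx_synth a) n

theorem H10.inner_sine_fn_synth (a : Ell2) (n : ℕ) :
    inner ℂ (sineL2 (n + 1)) (H10.fn (H10.synth a)) = a n / contFreq n := by
  have hne : (contFreq n : ℂ) ≠ 0 := by exact_mod_cast (contFreq_pos n).ne'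
  rw [eq_div_iff hne, mul_comm, ← H10.inner_cos_dx, H10.inner_cos_dx_synth]

theorem L2I.ext_inner_sine {z z' : L2I}
    (h : ∀ n, inner ℂ (sineL2 (n + 1)) z = inner ℂ (sineL2 (n + 1)) z') : z = z' := by
  rw [← sub_eq_zero]
  refine eq_zero_of_inner_sine fun n => ?_
  rw [inner_sub_right, h, sub_self]

theorem H10.ext_inner_cos {u u' : H10}
    (h : ∀ n, inner ℂ (cosL2 (n + 1)) (H10.dx u) = inner ℂ (cosL2 (n + 1)) (H10.dx u')) : u = u' := by
  refine H10.ext_fn (L2I.ext_inner_sine fun n => ?_)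
  have hne : (contFreq n : ℂ) ≠ 0 := by exact_mod_cast (contFreq_pos n).ne'
  have := h n
  rw [H10.inner_cos_dx, H10.inner_cos_dx] at this
  exact mul_left_cancel₀ hne this

theorem H10.exists_synth_eq (u : H10) : ∃ a : Ell2, H10.synth a = u := by
  have hs : Summable fun n => ‖inner ℂ (cosL2 (n + 1)) (H10.dx u)‖ ^ 2 :=
    orthonormal_cos.inner_products_summable (H10.dx u)
  refine ⟨⟨_, memℓp_two_of_summable hs⟩, H10.ext_inner_cos fun n => ?_⟩
  rw [H10.inner_cos_dx_synth]

theorem H10.inner_dx_synth (a a' : Ell2) :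
    inner ℂ (H10.dx (H10.synth a)) (H10.dx (H10.synth a')) = inner ℂ a a' := by
  have h1 := (H10.hasSum_dx_synth a').mapL (innerSL ℂ (H10.dx (H10.synth a)))
  refine h1.unique ?_
  have h2 := lp.hasSum_inner (𝕜 := ℂ) a a'
  refine h2.congr_fun fun n => ?_
  rw [innerSL_apply_apply, inner_smul_right, ← inner_conj_symm, H10.inner_cos_dx_synth]
  simp

/-- The function with given sine coefficients. -/
def sineSynth : Ell2 ≃ₗᵢ[ℂ] L2I := sineBasis.repr.symm

theorem inner_sine_sineSynth (b : Ell2) (n : ℕ) :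
    inner ℂ (sineL2 (n + 1)) (sineSynth b) = b n := by
  rw [← sineBasis_repr, sineSynth, LinearIsometryEquiv.apply_symm_apply]

theorem H10.fn_synth {a b : Ell2} (h : ∀ n, b n = a n / contFreq n) :
    H10.fn (H10.synth a) = sineSynth b := by
  refine L2I.ext_inner_sine fun n => ?_
  rw [H10.inner_sine_fn_synth, inner_sine_sineSynth, h]

end Sobolev

/-! ### The continuous waves in terms of their amplitudes -/

section ContinuousWaves

theorem norm_osc_sub_osc_le (w t t' : ℝ) : ‖osc w t - osc w t'‖ ≤ |w| * |t - t'| := by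
  have e : ∀ s, osc w s = osc s w := fun s => by rw [osc, osc, mul_comm w s]
  rw [e t, e t', mul_comm]
  exact norm_osc_sub_le t t' w

theorem norm_osc_mul_le {ρ : ℕ → ℝ} {C : ℝ} (hρ : ∀ n, |ρ n| ≤ C) (w : ℕ → ℝ) (t : ℝ) (n : ℕ) :
    ‖osc (w n) t * ρ n‖ ≤ C := by
  rw [norm_mul, norm_osc, one_mul, Complex.norm_real]; exact hρ n

/-- The derivative in time of a superposition of oscillations. -/
theorem hasDerivAt_ellMul_osc {w ρ : ℕ → ℝ} {C : ℝ} (hρ : ∀ n, |ρ n| ≤ C)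
    (hwρ : ∀ n, |w n * ρ n| ≤ C) (f : Ell2) (t : ℝ) :
    HasDerivAt (fun s => ellMul (fun n => osc (w n) s * ρ n) f)
      (ellMul (fun n => Complex.I * w n * osc (w n) t * ρ n) f) t := by
  rw [hasDerivAt_iff_tendsto_slope]
  have hb1 : ∀ (s : ℝ) (n : ℕ), ‖((s - t : ℝ) : ℂ)⁻¹ * ((osc (w n) s - osc (w n) t) * ρ n)‖ ≤ C := by
    intro s n
    by_cases hst : s = t
    · subst hst; simp; exact (abs_nonneg _).trans (hρ n)
    · have h0 : 0 < |s - t| := abs_pos.2 (sub_ne_zero.2 hst)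
      rw [norm_mul, norm_mul, norm_inv, Complex.norm_real, Complex.norm_real, Real.norm_eq_abs,
        Real.norm_eq_abs, inv_mul_eq_div, div_le_iff₀ h0]
      calc ‖osc (w n) s - osc (w n) t‖ * |ρ n| ≤ |w n| * |s - t| * |ρ n| := by
            gcongr; exact norm_osc_sub_osc_le _ _ _
        _ = |w n * ρ n| * |s - t| := by rw [abs_mul]; ring
        _ ≤ C * |s - t| := by gcongr; exact hwρ n
  have hb2 : ∀ n, ‖Complex.I * w n * osc (w n) t * ρ n‖ ≤ C := by
    intro n
    rw [norm_mul, norm_mul, norm_mul, norm_osc, Complex.norm_I, one_mul, mul_one, Complex.norm_real,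
      Complex.norm_real, ← norm_mul]
    exact hwρ n
  have key := tendsto_ellMul (l := 𝓝[≠] t) hb1 hb2 (fun n => by
    have h1 := hasDerivAt_iff_tendsto_slope.1 (hasDerivAt_osc (w n) t)
    refine (h1.mul_const (ρ n : ℂ)).congr fun s => ?_
    rw [slope_def_module, Complex.real_smul]
    push_cast; ring) f
  refine key.congr fun s => ?_
  refine lp.ext (funext fun n => ?_)
  rw [ellMul_apply (hb1 s), slope_def_module, lp.coeFn_smul, Pi.smul_apply, lp.coeFn_sub, Pi.sub_apply,
    ellMul_apply (norm_osc_mul_le hρ w s), ellMul_apply (norm_osc_mul_le hρ w t), Complex.real_smul]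
  push_cast; ring

theorem continuous_ellMul_osc (w : ℕ → ℝ) (f : Ell2) :
    Continuous fun t => ellMul (fun n => osc (w n) t) f := by
  rw [continuous_iff_continuousAt]
  intro t
  exact tendsto_ellMul (fun s n => (norm_osc (w n) s).le) (fun n => (norm_osc (w n) t).le)
    (fun n => (continuous_osc_right (w n)).tendsto t) f

/-- The cosine coefficients of the derivative of the position at time `t`. -/
def ampPos (c : Amp) (t : ℝ) : Ell2 := ∑ σ, ellMul (fun n => osc (sgn σ * contFreq n) t) (c σ)

/-- The sine coefficients of the velocity at time `t`. -/
def ampVel (c : Amp) (t : ℝ) : Ell2 :=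
  ∑ σ, (Complex.I * sgn σ) • ellMul (fun n => osc (sgn σ * contFreq n) t) (c σ)

theorem ellMul_osc_apply (w : ℕ → ℝ) (t : ℝ) (f : Ell2) (n : ℕ) :
    ellMul (fun n => osc (w n) t) f n = osc (w n) t * f n :=
  ellMul_apply (fun n => (norm_osc (w n) t).le) f n

theorem ampPos_apply (c : Amp) (t : ℝ) (n : ℕ) :
    ampPos c t n = ∑ σ, osc (sgn σ * contFreq n) t * c σ n := by
  rw [ampPos, lp.coeFn_sum, Finset.sum_apply]
  exact Finset.sum_congr rfl fun σ _ => ellMul_osc_apply _ _ _ _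

theorem ampVel_apply (c : Amp) (t : ℝ) (n : ℕ) :
    ampVel c t n = ∑ σ, Complex.I * sgn σ * (osc (sgn σ * contFreq n) t * c σ n) := by
  rw [ampVel, lp.coeFn_sum, Finset.sum_apply]
  refine Finset.sum_congr rfl fun σ _ => ?_
  rw [lp.coeFn_smul, Pi.smul_apply, ellMul_osc_apply, smul_eq_mul]

theorem ampPos_zero (c : Amp) : ampPos c 0 = ∑ σ, c σ := by
  refine lp.ext (funext fun n => ?_)
  rw [ampPos_apply, lp.coeFn_sum, Finset.sum_apply]
  simp only [osc_zero, one_mul]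

theorem ampVel_zero (c : Amp) : ampVel c 0 = ∑ σ, (Complex.I * sgn σ) • c σ := by
  refine lp.ext (funext fun n => ?_)
  rw [ampVel_apply, lp.coeFn_sum, Finset.sum_apply]
  simp only [osc_zero, one_mul, lp.coeFn_smul, Pi.smul_apply, smul_eq_mul]

theorem continuous_ampPos (c : Amp) : Continuous (ampPos c) :=
  continuous_finsetSum _ fun _ _ => continuous_ellMul_osc _ _

theorem continuous_ampVel (c : Amp) : Continuous (ampVel c) :=
  continuous_finsetSum _ fun σ _ =>
    (continuous_ellMul_osc (fun n => sgn σ * contFreq n) (c σ)).const_smul (Complex.I * sgn σ : ℂ)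

theorem one_le_contFreq (n : ℕ) : 1 ≤ contFreq n := by
  have := Real.pi_gt_three
  have h2 : (0 : ℝ) ≤ n := Nat.cast_nonneg _
  unfold contFreq
  nlinarith

theorem abs_inv_contFreq (n : ℕ) : |(contFreq n)⁻¹| ≤ 1 := by
  rw [abs_inv, abs_of_pos (contFreq_pos n)]
  exact inv_le_one_of_one_le₀ (one_le_contFreq n)

theorem abs_sgn_mul_contFreq_mul_inv (σ : Bool) (n : ℕ) :
    |sgn σ * contFreq n * (contFreq n)⁻¹| ≤ 1 := by
  rw [mul_assoc, mul_inv_cancel₀ (contFreq_pos n).ne', mul_one, abs_sgn]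

theorem hasDerivAt_osc_div (c : Amp) (σ : Bool) (t : ℝ) :
    HasDerivAt (fun s => ellMul (fun n => osc (sgn σ * contFreq n) s * ((contFreq n)⁻¹ : ℝ)) (c σ))
      ((Complex.I * sgn σ) • ellMul (fun n => osc (sgn σ * contFreq n) t) (c σ)) t := by
  have h := hasDerivAt_ellMul_osc (w := fun n => sgn σ * contFreq n) (ρ := fun n => (contFreq n)⁻¹)
    abs_inv_contFreq (abs_sgn_mul_contFreq_mul_inv σ) (c σ) t
  refine h.congr_deriv (lp.ext (funext fun n => ?_))
  have hne : (contFreq n : ℂ) ≠ 0 := by exact_mod_cast (contFreq_pos n).ne'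
  have e : ∀ n, Complex.I * ((sgn σ * contFreq n : ℝ) : ℂ) * osc (sgn σ * contFreq n) t *
      (((contFreq n)⁻¹ : ℝ) : ℂ) = Complex.I * sgn σ * osc (sgn σ * contFreq n) t := by
    intro n
    have hne : (contFreq n : ℂ) ≠ 0 := by exact_mod_cast (contFreq_pos n).ne'
    push_cast; field_simp
  simp only [e]
  rw [lp.coeFn_smul, Pi.smul_apply, ellMul_osc_apply, smul_eq_mul, ellMul_apply (C := 1), mul_assoc]
  intro n
  rw [norm_mul, norm_mul, norm_osc, Complex.norm_I, Complex.norm_real, Real.norm_eq_abs, abs_sgn]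
  norm_num

theorem hasDerivAt_fn_ampPos (c : Amp) (t : ℝ) :
    HasDerivAt (fun s => H10.fn (H10.synth (ampPos c s))) (sineSynth (ampVel c t)) t := by
  have h := HasDerivAt.fun_sum (u := Finset.univ) fun σ _ => hasDerivAt_osc_div c σ t
  have h2 := (sineSynth.toContinuousLinearEquiv.toContinuousLinearMap.restrictScalars ℝ).hasFDerivAt.comp_hasDerivAt t h
  refine h2.congr_of_eventuallyEq (Eventually.of_forall fun s => ?_)
  refine H10.fn_synth fun n => ?_
  rw [ampPos_apply, lp.coeFn_sum, Finset.sum_apply, Finset.sum_div]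
  refine Finset.sum_congr rfl fun σ _ => ?_
  rw [ellMul_apply (norm_osc_mul_le abs_inv_contFreq _ s)]
  push_cast; ring

theorem hasDerivAt_inner_ampVel (c : Amp) (e : Ell2) (t : ℝ) :
    HasDerivAt (fun s => inner ℂ (H10.fn (H10.synth e)) (sineSynth (ampVel c s)))
      (-inner ℂ (H10.dx (H10.synth e)) (H10.dx (H10.synth (ampPos c t)))) t := by
  have h := HasDerivAt.fun_sum (u := Finset.univ) fun σ _ =>
    (hasDerivAt_osc_div c σ t).const_smul (Complex.I * sgn σ : ℂ)
  have h2 := ((innerSL ℂ e).restrictScalars ℝ).hasFDerivAt.comp_hasDerivAt t h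
  have hμ : ∀ n, ‖(((contFreq n)⁻¹ : ℝ) : ℂ)‖ ≤ 1 := fun n => by
    rw [Complex.norm_real]; exact abs_inv_contFreq n
  have h3 : HasDerivAt (fun s => inner ℂ (H10.fn (H10.synth e)) (sineSynth (ampVel c s)))
      (inner ℂ e (∑ σ, (Complex.I * sgn σ : ℂ) • ((Complex.I * sgn σ : ℂ) •
        ellMul (fun n => osc (sgn σ * contFreq n) t) (c σ)))) t := by
    refine h2.congr_of_eventuallyEq (Eventually.of_forall fun s => ?_)
    rw [H10.fn_synth (b := ellMul (fun n => (((contFreq n)⁻¹ : ℝ) : ℂ)) e) (fun n => by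
      rw [ellMul_apply hμ]; push_cast; ring)]
    refine (LinearIsometryEquiv.inner_map_map sineSynth _ _).trans ?_
    change _ = inner ℂ e (∑ σ, (Complex.I * sgn σ : ℂ) •
      ellMul (fun n => osc (sgn σ * contFreq n) s * ((contFreq n)⁻¹ : ℝ)) (c σ))
    refine (lp.hasSum_inner (𝕜 := ℂ) _ _).unique ((lp.hasSum_inner (𝕜 := ℂ) e _).congr_fun fun n => ?_)
    rw [ellMul_apply hμ, ampVel_apply, lp.coeFn_sum, Finset.sum_apply]
    simp only [lp.coeFn_smul, Pi.smul_apply, ellMul_apply (norm_osc_mul_le abs_inv_contFreq _ s),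
      RCLike.inner_apply, map_mul, Complex.conj_ofReal, smul_eq_mul, Finset.sum_mul]
    refine Finset.sum_congr rfl fun σ _ => ?_
    ring
  refine h3.congr_deriv ?_
  rw [H10.inner_dx_synth, ← inner_neg_right]
  congr 1
  refine lp.ext (funext fun n => ?_)
  rw [lp.coeFn_neg, Pi.neg_apply, ampPos_apply, lp.coeFn_sum, Finset.sum_apply, ← Finset.sum_neg_distrib]
  refine Finset.sum_congr rfl fun σ _ => ?_
  simp only [lp.coeFn_smul, Pi.smul_apply, ellMul_osc_apply, smul_eq_mul]
  have h1 : (sgn σ : ℂ) * sgn σ = 1 := by exact_mod_cast sgn_mul_self σ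
  linear_combination (osc (sgn σ * contFreq n) t * c σ n) *
    ((sgn σ : ℂ) * sgn σ * Complex.I_mul_I - h1)

/-- The solutions of the adjoint problem are superpositions of modes. -/
theorem AdjointWave.exists_amp {T : ℝ} (u : AdjointWave T) : ∃ c : Amp, ∀ t ∈ Icc 0 T,
    u.pos t = H10.synth (ampPos c t) ∧ u.vel t = sineSynth (ampVel c t) := by
  obtain ⟨a, ha⟩ := H10.exists_synth_eq (u.pos 0)
  obtain ⟨b, hb⟩ : ∃ b, sineSynth b = u.vel 0 := sineSynth.surjective _
  set c : Amp := WithLp.toLp 2 fun σ => (1 / 2 : ℂ) • (a - (Complex.I * sgn σ) • b) with hc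
  have hcn : ∀ σ n, c σ n = 1 / 2 * (a n - Complex.I * sgn σ * b n) := fun σ n => rfl
  refine ⟨c, fun t ht => ?_⟩
  have hz : ∀ (σ : Bool) (n : ℕ), inner ℂ (cosL2 (n + 1)) (H10.dx (u.pos t)) -
      Complex.I * sgn σ * inner ℂ (sineL2 (n + 1)) (u.vel t) =
      osc (sgn σ * contFreq n) t * (2 * c σ n) := by
    intro σ n
    set z : ℝ → ℂ := fun s => inner ℂ (cosL2 (n + 1)) (H10.dx (u.pos s)) -
      Complex.I * sgn σ * inner ℂ (sineL2 (n + 1)) (u.vel s) with hz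
    have hd1 : ∀ s ∈ Icc 0 T, HasDerivWithinAt
        (fun s => inner ℂ (cosL2 (n + 1)) (H10.dx (u.pos s)))
        (contFreq n * inner ℂ (sineL2 (n + 1)) (u.vel s)) (Icc 0 T) s := by
      intro s hs
      simp only [H10.inner_cos_dx]
      have h1 := ((innerSL ℂ (sineL2 (n + 1))).restrictScalars ℝ).hasFDerivAt.comp_hasDerivWithinAt s
        (u.hasDeriv_pos s hs)
      exact h1.const_mul (contFreq n : ℂ)
    have hd2 : ∀ s ∈ Icc 0 T, HasDerivWithinAt
        (fun s => inner ℂ (sineL2 (n + 1)) (u.vel s))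
        (-(contFreq n * inner ℂ (cosL2 (n + 1)) (H10.dx (u.pos s)))) (Icc 0 T) s := by
      intro s hs
      refine (u.wave_eq (sineH10 (n + 1)) s hs).congr_deriv ?_
      have : H10.dx (sineH10 (n + 1)) = (contFreq n : ℂ) • cosL2 (n + 1) := sineDerivL2_eq n
      rw [this, inner_smul_left, Complex.conj_ofReal]
    have h1 : (sgn σ : ℂ) * sgn σ = 1 := by exact_mod_cast sgn_mul_self σ
    have hdz : ∀ s ∈ Icc 0 T, HasDerivWithinAt z
        (Complex.I * (sgn σ * contFreq n : ℝ) * z s) (Icc 0 T) s := by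
      intro s hs
      refine ((hd1 s hs).sub ((hd2 s hs).const_mul (Complex.I * sgn σ))).congr_deriv ?_
      simp only [hz]
      push_cast
      linear_combination contFreq n * inner ℂ (sineL2 (n + 1)) (u.vel s) *
        ((sgn σ : ℂ) * sgn σ * Complex.I_mul_I - h1)
    have hconst : ∀ s ∈ Icc 0 T, osc (-(sgn σ * contFreq n)) s * z s =
        osc (-(sgn σ * contFreq n)) 0 * z 0 := by
      refine constant_of_has_deriv_right_zero (f := fun s => osc (-(sgn σ * contFreq n)) s * z s) ?_ ?_
      · exact (continuous_osc_right _).continuousOn.mul fun s hs => (hdz s hs).continuousWithinAt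
      · intro s hs
        have h2 := ((hasDerivAt_osc (-(sgn σ * contFreq n)) s).hasDerivWithinAt (s := Icc 0 T)).mul
          (hdz s (Ico_subset_Icc_self hs))
        have h3 : HasDerivWithinAt (fun s => osc (-(sgn σ * contFreq n)) s * z s) 0 (Icc 0 T) s := by
          refine h2.congr_deriv ?_
          push_cast; ring
        exact h3.mono_of_mem_nhdsWithin (Icc_mem_nhdsGE_of_mem hs)
    have h4 := hconst t ht
    rw [osc_zero, one_mul] at h4
    have h5 : z 0 = 2 * c σ n := by
      rw [hcn, hz]
      simp only [← ha, ← hb, H10.inner_cos_dx_synth, inner_sine_sineSynth]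
      ring
    rw [← h5, ← h4, ← mul_assoc, mul_comm (osc _ _), osc_neg_mul_osc, one_mul]
  constructor
  · refine H10.ext_inner_cos fun n => ?_
    rw [H10.inner_cos_dx_synth, ampPos_apply]
    have h1 := hz true n
    have h2 := hz false n
    simp only [Fintype.sum_bool]
    simp only [sgn, if_true, Bool.false_eq_true, if_false] at h1 h2 ⊢
    push_cast at h1 h2 ⊢
    linear_combination 1 / 2 * h1 + 1 / 2 * h2
  · refine L2I.ext_inner_sine fun n => ?_
    rw [inner_sine_sineSynth, ampVel_apply]
    have h1 := hz true n
    have h2 := hz false n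
    simp only [Fintype.sum_bool]
    simp only [sgn, if_true, Bool.false_eq_true, if_false] at h1 h2 ⊢
    push_cast at h1 h2 ⊢
    linear_combination Complex.I / 2 * h1 - Complex.I / 2 * h2 +
      inner ℂ (sineL2 (n + 1)) (u.vel t) * Complex.I_mul_I

end ContinuousWaves

/-! ### The continuous HUM control in terms of the amplitudes -/

section ContinuousControl

theorem integral_cosFn_right (n : ℕ) {ε : ℝ} (hε : 0 < ε) :
    ∫ x in (1 - ε)..1, cosFn (n + 1) x = ε * (contWeight n * Real.sinc (contFreq n * ε)) := by
  have hne := (contFreq_pos n).ne'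
  have h1 : ∀ x : ℝ, cosFn (n + 1) x = √2 * Real.cos (contFreq n * x) := by
    intro x; simp only [cosFn, contFreq]; push_cast; rfl
  simp only [h1]
  rw [intervalIntegral.integral_const_mul, intervalIntegral.integral_comp_mul_left
    (fun x => Real.cos x) hne, integral_cos, Real.sinc_of_ne_zero (mul_ne_zero hne hε.ne')]
  have h2 : Real.sin (contFreq n * 1) = 0 := by
    rw [mul_one, contFreq]; exact_mod_cast Real.sin_nat_mul_pi (n + 1)
  have h3 : Real.cos (contFreq n) = (-1) ^ (n + 1) := by
    rw [contFreq]; exact_mod_cast Real.cos_nat_mul_pi (n + 1)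
  rw [h2, mul_sub, Real.sin_sub, h2, mul_one, h3, contWeight, smul_eq_mul]
  field_simp
  ring

/-- The means of `√2 cos(kπx)` near the end point. -/
theorem setIntegral_cosL2 (n : ℕ) {ε : ℝ} (hε : 0 < ε) (hε1 : ε < 1) :
    ∫ x in Ioo (1 - ε) 1, cosL2 (n + 1) x =
      ((ε * (contWeight n * Real.sinc (contFreq n * ε)) : ℝ) : ℂ) := by
  have hsub : Ioo (1 - ε) 1 ⊆ Ioo (0 : ℝ) 1 := Ioo_subset_Ioo_left (by linarith)
  have h := coeFn_contL2 1 (fun x => (cosFn (n + 1) x : ℂ))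
    (Complex.continuous_ofReal.comp (continuous_cosFn (n + 1)))
  have h2 : ∀ᵐ x ∂(volume.restrict (Ioo (1 - ε) 1)), cosL2 (n + 1) x = (cosFn (n + 1) x : ℂ) :=
    ae_mono (Measure.restrict_mono hsub le_rfl) h
  rw [integral_congr_ae h2, integral_complex_ofReal, ← integral_Ioc_eq_integral_Ioo,
    ← intervalIntegral.integral_of_le (by linarith), integral_cosFn_right n hε]

theorem hasSum_mean_dx (a : Ell2) {ε : ℝ} (hε : 0 < ε) (hε1 : ε < 1) :
    HasSum (fun n => ((contWeight n * Real.sinc (contFreq n * ε) : ℝ) : ℂ) * a n)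
      ((1 / ε : ℂ) * ∫ x in Ioo (1 - ε) 1, H10.dx (H10.synth a) x) := by
  have hm : MeasurableSet (Ioo (1 - ε) 1) := measurableSet_Ioo
  have hfin : (volume.restrict (Ioo (0 : ℝ) 1)) (Ioo (1 - ε) 1) ≠ ⊤ := measure_ne_top _ _
  have hsub : Ioo (1 - ε) 1 ⊆ Ioo (0 : ℝ) 1 := Ioo_subset_Ioo_left (by linarith)
  have hI : ∀ z : L2I, inner ℂ (indicatorConstLp 2 hm hfin (1 : ℂ)) z = ∫ x in Ioo (1 - ε) 1, z x := by
    intro z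
    rw [L2.inner_indicatorConstLp_one, Measure.restrict_restrict hm, inter_eq_left.2 hsub]
  have h := ((H10.hasSum_dx_synth a).mapL (innerSL ℂ (indicatorConstLp 2 hm hfin (1 : ℂ)))).mul_left
    (1 / ε : ℂ)
  rw [innerSL_apply_apply, hI] at h
  refine h.congr_fun fun n => ?_
  rw [innerSL_apply_apply, inner_smul_right, hI, setIntegral_cosL2 n hε hε1]
  have hε' : (ε : ℂ) ≠ 0 := by exact_mod_cast hε.ne'
  push_cast
  field_simp

theorem coeFn_sum_L2T {T : ℝ} (s : Finset ℕ) (f : ℕ → L2T T) :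
    (∑ n ∈ s, f n : L2T T) =ᵐ[volume.restrict (Ioo (0 : ℝ) T)] fun t => ∑ n ∈ s, f n t := by
  refine (Lp.coeFn_finsetSum s f).trans (Eventually.of_forall fun t => ?_)
  simp

/-- The pointwise sum of a series converging in `L²(0,T)`. -/
theorem ae_eq_of_hasSum {T : ℝ} {f : ℕ → L2T T} {F : L2T T} (hF : HasSum f F) {g : ℕ → ℝ → ℂ}
    {G : ℝ → ℂ} (hfg : ∀ n, f n =ᵐ[volume.restrict (Ioo (0 : ℝ) T)] g n)
    (hG : ∀ t ∈ Ioo 0 T, HasSum (fun n => g n t) (G t)) :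
    G =ᵐ[volume.restrict (Ioo (0 : ℝ) T)] F := by
  have h1 := tendstoInMeasure_of_tendsto_Lp hF.tendsto_sum_nat
  obtain ⟨ns, hns, hae⟩ := h1.exists_seq_tendsto_ae
  have h2 : ∀ᵐ t ∂(volume.restrict (Ioo (0 : ℝ) T)), ∀ M : ℕ,
      (∑ n ∈ Finset.range M, f n : L2T T) t = ∑ n ∈ Finset.range M, f n t :=
    ae_all_iff.2 fun M => coeFn_sum_L2T _ _
  filter_upwards [hae, h2, ae_all_iff.2 hfg, ae_restrict_mem measurableSet_Ioo] with t h3 h4 h5 h6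
  have h7 := ((hG t h6).tendsto_sum_nat).comp hns.tendsto_atTop
  refine tendsto_nhds_unique h7 (h3.congr fun i => ?_)
  rw [h4]
  exact Finset.sum_congr rfl fun n _ => h5 n

/-- The amplitudes damped by the means over `(1-ε,1)`. -/
def sincAmp (c : Amp) (ε : ℝ) : Amp :=
  WithLp.toLp 2 fun σ => ellMul (fun n => ((Real.sinc (contFreq n * ε) : ℝ) : ℂ)) (c σ)

theorem norm_sinc_le (x : ℝ) : ‖((Real.sinc x : ℝ) : ℂ)‖ ≤ 1 := by
  rw [Complex.norm_real]; exact Real.abs_sinc_le_one x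

theorem tendsto_sincAmp (c : Amp) : Tendsto (sincAmp c) (𝓝[>] 0) (𝓝 c) := by
  have h : ∀ σ, Tendsto (fun ε : ℝ => ellMul (fun n => ((Real.sinc (contFreq n * ε) : ℝ) : ℂ)) (c σ))
      (𝓝[>] 0) (𝓝 (c σ)) := by
    intro σ
    have h1 := tendsto_ellMul (l := 𝓝[>] (0 : ℝ)) (C := 1)
      (μ := fun ε n => ((Real.sinc (contFreq n * ε) : ℝ) : ℂ)) (ν := fun _ => 1)
      (fun ε n => norm_sinc_le _) (fun _ => by simp) (fun n => by
        have : Continuous fun ε : ℝ => ((Real.sinc (contFreq n * ε) : ℝ) : ℂ) :=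
          Complex.continuous_ofReal.comp (Real.continuous_sinc.comp (continuous_const.mul continuous_id))
        have h2 := (this.tendsto 0).mono_left (nhdsWithin_le_nhds (s := Ioi 0))
        simpa using h2) (c σ)
    have e : ellMul (fun _ => 1) (c σ) = c σ :=
      lp.ext (funext fun n => by rw [ellMul_apply (C := 1) (fun _ => by simp), one_mul])
    rwa [e] at h1
  have h2 : Tendsto (fun ε => WithLp.toLp 2 fun σ =>
      ellMul (fun n => ((Real.sinc (contFreq n * ε) : ℝ) : ℂ)) (c σ)) (𝓝[>] 0)
      (𝓝 (WithLp.toLp 2 (WithLp.ofLp c))) :=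
    ((PiLp.continuous_toLp 2 fun _ : Bool => Ell2).tendsto _).comp (tendsto_pi_nhds.2 h)
  exact h2

theorem mean_dx_ae_eq {T : ℝ} (hT : 0 < T) (c : Amp) {ε : ℝ} (hε : 0 < ε) (hε1 : ε < 1) :
    (fun t => (1 / ε : ℂ) * ∫ x in Ioo (1 - ε) 1, H10.dx (H10.synth (ampPos c t)) x)
      =ᵐ[volume.restrict (Ioo (0 : ℝ) T)] fluxMap T (sincAmp c ε) := by
  refine ae_eq_of_hasSum (hasSum_fluxMap hT (sincAmp c ε)) (fun n => coeFn_sum_smul_expT T _ _ _)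
    fun t _ => (hasSum_mean_dx (ampPos c t) hε hε1).congr_fun fun n => ?_
  rw [ampPos_apply, Finset.mul_sum, trigSum]
  refine Finset.sum_congr rfl fun σ _ => ?_
  have : sincAmp c ε σ n = ((Real.sinc (contFreq n * ε) : ℝ) : ℂ) * c σ n :=
    ellMul_apply (fun n => norm_sinc_le _) (c σ) n
  rw [this]
  push_cast; ring

/-- The normal derivative of a superposition of modes. -/
theorem flux_tendsto_iff {T : ℝ} (hT : 0 < T) (c : Amp) (v : L2T T) :
    Tendsto (fun ε : ℝ => eLpNorm
      (fun t => (1 / ε : ℂ) * (∫ x in Ioo (1 - ε) 1, H10.dx (H10.synth (ampPos c t)) x) - v t) 2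
      (volume.restrict (Ioo (0 : ℝ) T))) (𝓝[>] 0) (𝓝 0) ↔ v = fluxMap T c := by
  have hlim : Tendsto (fun ε : ℝ => ‖fluxMap T (sincAmp c ε) - v‖ₑ) (𝓝[>] 0) (𝓝 ‖fluxMap T c - v‖ₑ) :=
    ((((fluxMap T).continuous.tendsto c).comp (tendsto_sincAmp c)).sub_const v).enorm
  have hev : (fun ε : ℝ => ‖fluxMap T (sincAmp c ε) - v‖ₑ) =ᶠ[𝓝[>] 0] fun ε : ℝ => eLpNorm
      (fun t => (1 / ε : ℂ) * (∫ x in Ioo (1 - ε) 1, H10.dx (H10.synth (ampPos c t)) x) - v t) 2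
      (volume.restrict (Ioo (0 : ℝ) T)) := by
    filter_upwards [Ioo_mem_nhdsGT (zero_lt_one' ℝ)] with ε hε
    rw [Lp.enorm_def]
    refine eLpNorm_congr_ae ?_
    filter_upwards [mean_dx_ae_eq hT c hε.1 hε.2, Lp.coeFn_sub (fluxMap T (sincAmp c ε)) v] with t h1 h2
    rw [h2, Pi.sub_apply, h1]
  rw [← tendsto_congr' hev]
  constructor
  · intro h
    have := tendsto_nhds_unique hlim h
    rw [enorm_eq_zero, sub_eq_zero] at this
    exact this.symm
  · rintro rfl
    simpa using hlim

/-- The wave with given amplitudes. -/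
def ampWave {T : ℝ} (hT : 0 < T) (c : Amp) : AdjointWave T where
  pos t := H10.synth (ampPos c t)
  vel t := sineSynth (ampVel c t)
  flux := fluxMap T c
  continuousOn_pos := (H10.synth.continuous.comp (continuous_ampPos c)).continuousOn
  continuousOn_vel := (sineSynth.continuous.comp (continuous_ampVel c)).continuousOn
  hasDeriv_pos t _ := (hasDerivAt_fn_ampPos c t).hasDerivWithinAt
  wave_eq φ t _ := by
    obtain ⟨e, rfl⟩ := H10.exists_synth_eq φ
    exact (hasDerivAt_inner_ampVel c e t).hasDerivWithinAt
  flux_eq := (flux_tendsto_iff hT c _).2 rfl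

theorem AdjointWave.flux_eq_fluxMap {T : ℝ} (hT : 0 < T) (u : AdjointWave T) {c : Amp}
    (h : ∀ t ∈ Icc 0 T, u.pos t = H10.synth (ampPos c t)) : u.flux = fluxMap T c := by
  rw [← flux_tendsto_iff hT c]
  refine u.flux_eq.congr fun ε => eLpNorm_congr_ae ?_
  filter_upwards [ae_restrict_mem measurableSet_Ioo] with t ht
  rw [h t (Ioo_subset_Icc_self ht)]

/-- The amplitudes of the data to be controlled. -/
def dataAmp (b0 b1 : Ell2) : Amp := WithLp.toLp 2 fun σ => b1 + (Complex.I * sgn σ) • b0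

theorem pairing_eq_inner {y0 : L2I} {y1 : HNegOne} {b0 b1 : Ell2}
    (hb0 : ∀ n, b0 n = fourierCoeff0 y0 (n + 1))
    (hb1 : ∀ n, b1 n = fourierCoeff1 y1 (n + 1) / contFreq n) (c : Amp) :
    y1 (H10.synth (ampPos c 0)) - inner ℂ (sineSynth (ampVel c 0)) y0 = inner ℂ c (dataAmp b0 b1) := by
  have h1 : ∀ a : Ell2, y1 (H10.synth a) = inner ℂ a b1 := by
    intro a
    have h := (H10.hasSum_synth a).map (y1 : H10 →+ ℂ) y1.continuous
    refine h.unique ((lp.hasSum_inner (𝕜 := ℂ) a b1).congr_fun fun n => ?_)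
    change y1 ((a n / contFreq n) • sineH10 (n + 1)) = _
    rw [map_smulₛₗ, hb1, fourierCoeff1, RCLike.inner_apply, map_div₀, Complex.conj_ofReal, smul_eq_mul]
    ring
  have h2 : ∀ b : Ell2, inner ℂ (sineSynth b) y0 = inner ℂ b b0 := by
    intro b
    have : y0 = sineSynth b0 := L2I.ext_inner_sine fun n => by
      rw [inner_sine_sineSynth, hb0]; rfl
    rw [this]
    exact LinearIsometryEquiv.inner_map_map sineSynth _ _
  rw [h1, h2, ampPos_zero, ampVel_zero, sum_inner, sum_inner, PiLp.inner_apply, ← Finset.sum_sub_distrib]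
  refine Finset.sum_congr rfl fun σ _ => ?_
  have : dataAmp b0 b1 σ = b1 + (Complex.I * sgn σ) • b0 := rfl
  rw [this, inner_add_right, inner_smul_left, inner_smul_right, map_mul, Complex.conj_I,
    Complex.conj_ofReal]
  ring

/-- The Euler–Lagrange equation of the continuous HUM control. -/
theorem isHUMControl_iff {T : ℝ} (hT : 0 < T) {y0 : L2I} {y1 : HNegOne} {b0 b1 : Ell2}
    (hb0 : ∀ n, b0 n = fourierCoeff0 y0 (n + 1))
    (hb1 : ∀ n, b1 n = fourierCoeff1 y1 (n + 1) / contFreq n) (v : L2T T) :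
    IsHUMControl T y0 y1 v ↔ v ∈ LinearMap.range (fluxMap T : Amp →ₗ[ℂ] L2T T) ∧
      ∀ d, inner ℂ (fluxMap T d) v = inner ℂ d (dataAmp b0 b1) := by
  let L : Amp →ₗ⋆[ℂ] ℂ :=
    { toFun := fun d => inner ℂ d (dataAmp b0 b1)
      map_add' := fun d d' => inner_add_left _ _ _
      map_smul' := fun a d => by rw [inner_smul_left]; rfl }
  have key := isMinOn_iff_of_param (H := L2T T) (E := Amp) (S := (univ : Set (AdjointWave T)))
    AdjointWave.flux (fun u => y1 (u.pos 0) - inner ℂ (u.vel 0) y0) (contFunctional y0 y1)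
    (fun u _ => by rw [contFunctional, norm_sq_L2T]) (fluxMap T : Amp →ₗ[ℂ] L2T T) L
    (fun u _ => by
      obtain ⟨c, hc⟩ := u.exists_amp
      refine ⟨c, u.flux_eq_fluxMap hT fun t ht => (hc t ht).1, ?_⟩
      have h0 := hc 0 ⟨le_rfl, hT.le⟩
      simp only [h0.1, h0.2]
      exact pairing_eq_inner hb0 hb1 c)
    (fun c => ⟨ampWave hT c, mem_univ _, rfl, pairing_eq_inner hb0 hb1 c⟩) v
  rw [IsHUMControl]
  simp only [mem_univ, true_and] at key
  exact key

theorem existsUnique_HUMControl {T : ℝ} (hT : 2 < T) {y0 : L2I} {y1 : HNegOne} {b0 b1 : Ell2}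
    (hb0 : ∀ n, b0 n = fourierCoeff0 y0 (n + 1))
    (hb1 : ∀ n, b1 n = fourierCoeff1 y1 (n + 1) / contFreq n) :
    ∃! v : L2T T, IsHUMControl T y0 y1 v := by
  have hT0 : 0 < T := by linarith
  obtain ⟨v, hv⟩ := exists_fluxMap_eulerLagrange hT (dataAmp b0 b1)
  refine ⟨v, (isHUMControl_iff hT0 hb0 hb1 v).2 hv, fun w hw => ?_⟩
  have hw := (isHUMControl_iff hT0 hb0 hb1 w).1 hw
  let L : Amp →ₗ⋆[ℂ] ℂ :=
    { toFun := fun d => inner ℂ d (dataAmp b0 b1)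
      map_add' := fun d d' => inner_add_left _ _ _
      map_smul' := fun a d => by rw [inner_smul_left]; rfl }
  exact eulerLagrange_unique (fluxMap T : Amp →ₗ[ℂ] L2T T) L hw hv

end ContinuousControl

/-! ### Limits of the discrete modes -/

section Limits

theorem tendsto_meshSize : Tendsto meshSize atTop (𝓝[>] 0) :=
  tendsto_nhdsWithin_iff.2 ⟨tendsto_one_div_add_atTop_nhds_zero_nat,
    Eventually.of_forall fun N => meshSize_pos N⟩

theorem waveNum_succ (N n : ℕ) : waveNum N (n + 1) = contFreq n * meshSize N := by
  rw [waveNum, contFreq]; push_cast; rfl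

theorem tendsto_freq_acoustic (n : ℕ) : Tendsto (fun N => freq N false n) atTop (𝓝 (contFreq n)) := by
  have h := (tendsto_dispersion_acoustic (contFreq_pos n).le).comp tendsto_meshSize
  refine h.congr fun N => ?_
  rw [freq_eq, waveNum_succ]; rfl

theorem tendsto_modeFreq_acoustic (σ : Bool) (n : ℕ) :
    Tendsto (fun N => modeFreq N (false, σ, n)) atTop (𝓝 (sgn σ * contFreq n)) :=
  (tendsto_freq_acoustic n).const_mul _

theorem acousticSymbol_zero : acousticSymbol 0 = 0 := by simp [acousticSymbol]

theorem tendsto_rawNormSq_acoustic : Tendsto (rawNormSq acousticSymbol) (𝓝 0) (𝓝 (1 / 2)) := by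
  have h0 : ContinuousAt acousticSymbol 0 := continuous_acousticSymbol.continuousAt
  have hm : ContinuousAt (midRatio acousticSymbol) 0 := by
    unfold midRatio
    refine ContinuousAt.mul (ContinuousAt.div (by fun_prop) (by fun_prop) ?_) (by fun_prop)
    rw [acousticSymbol_zero]; norm_num
  have hr : ContinuousAt (rawNormSq acousticSymbol) 0 := by
    unfold rawNormSq
    fun_prop
  have h := hr.tendsto
  have e : rawNormSq acousticSymbol 0 = 1 / 2 := by
    simp only [rawNormSq, midRatio, acousticSymbol_zero]; norm_num
  rwa [e] at h

theorem tendsto_modeWeight_acoustic (σ : Bool) (n : ℕ) :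
    Tendsto (fun N => modeWeight N (false, σ, n)) atTop (𝓝 (contWeight n)) := by
  have hw := contFreq_pos n
  have h1 : Tendsto (fun N => Real.sin (waveNum N (n + 1)) / meshSize N) atTop (𝓝 (contFreq n)) := by
    have hd : HasDerivAt (fun h : ℝ => Real.sin (contFreq n * h)) (contFreq n) 0 := by
      have h1 : HasDerivAt (fun h : ℝ => contFreq n * h) (contFreq n) 0 := by
        simpa using (hasDerivAt_id (0 : ℝ)).const_mul (contFreq n)
      simpa using h1.sin
    have h2 := (hasDerivAt_iff_tendsto_slope.1 hd).comp
      (tendsto_meshSize.mono_right (nhdsWithin_mono _ fun x (hx : 0 < x) => hx.ne'))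
    refine h2.congr fun N => ?_
    rw [Function.comp_apply, slope_def_field, waveNum_succ]; simp
  have h2 : Tendsto (fun N => √(rawNormSq acousticSymbol (waveNum N (n + 1)))) atTop (𝓝 √(1 / 2)) :=
    (tendsto_rawNormSq_acoustic.comp (tendsto_waveNum (n + 1))).sqrt
  have h3 := ((h1.div (h2.mul (tendsto_freq_acoustic n)) (by positivity)).const_mul ((-1) ^ (n + 1)))
  have e : (-1) ^ (n + 1) * (contFreq n / (√(1 / 2) * contFreq n)) = contWeight n := by
    have h5 : √(1 / 2 : ℝ) * √2 = 1 := by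
      rw [← Real.sqrt_mul (by norm_num)]; norm_num
    have h6 : √(1 / 2 : ℝ) ≠ 0 := by positivity
    rw [contWeight]
    field_simp
    rw [mul_comm] at h5
    linarith
  rw [e] at h3
  refine h3.congr fun N => ?_
  have hh := (meshSize_pos N).ne'
  simp only [modeWeight, obsWeight, freq_eq, branchSymbol, Bool.false_eq_true, if_false, Pi.div_apply]
  rw [mul_div_assoc]
  congr 1
  rw [mul_div_assoc', div_div_div_cancel_right₀ hh]

theorem tendsto_freq_optic (n : ℕ) : Tendsto (fun N => freq N true n) atTop atTop := by
  have h1 : Tendsto (fun N : ℕ => (N : ℝ) + 1) atTop atTop :=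
    tendsto_atTop_add_const_right _ _ tendsto_natCast_atTop_atTop
  refine tendsto_atTop_mono (fun N => ?_) h1
  have h2 : 11 ≤ opticSymbol (waveNum N (n + 1)) := by
    have hs := Real.sin_sq_le_one (waveNum N (n + 1) / 2)
    rw [opticSymbol, le_div_iff₀ (by positivity)]
    have := Real.sqrt_nonneg (symbolDisc (waveNum N (n + 1)))
    nlinarith [sq_nonneg (Real.cos (waveNum N (n + 1) / 2))]
  have h3 : 1 ≤ dispersion opticSymbol (waveNum N (n + 1)) := by
    rw [dispersion, Real.one_le_sqrt]; linarith
  rw [freq_eq, le_div_iff₀ (meshSize_pos N), mul_comm, meshSize_mul]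
  exact h3

end Limits

/-! ### Discrete amplitudes as square summable sequences -/

section Embedding

/-- The amplitudes of a branch, extended by zero. -/
def seqAmp (N : ℕ) (b : Bool) (c : Mode → ℂ) : Amp :=
  WithLp.toLp 2 fun σ => ∑ n ∈ Finset.range N, lp.single 2 n (c (b, σ, n))

theorem seqAmp_coe (N : ℕ) (b : Bool) (c : Mode → ℂ) (σ : Bool) :
    seqAmp N b c σ = ∑ n ∈ Finset.range N, lp.single 2 n (c (b, σ, n)) := rfl

theorem sum_single_apply (f : ℕ → ℂ) (N n : ℕ) :
    (∑ l ∈ Finset.range N, lp.single 2 l (f l) : Ell2) n = if n < N then f n else 0 := by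
  rw [lp.coeFn_sum, Finset.sum_apply]
  simp only [lp.single_apply, Pi.single_apply, Finset.sum_ite_eq, Finset.mem_range]

theorem seqAmp_apply (N : ℕ) (b : Bool) (c : Mode → ℂ) (σ : Bool) (n : ℕ) :
    seqAmp N b c σ n = if n < N then c (b, σ, n) else 0 := by
  rw [seqAmp_coe, sum_single_apply (fun l => c (b, σ, l))]

theorem Amp.ext {c d : Amp} (h : ∀ σ n, c σ n = d σ n) : c = d :=
  PiLp.ext fun σ => lp.ext (funext fun n => h σ n)

theorem seqAmp_sub (N : ℕ) (b : Bool) (c d : Mode → ℂ) :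
    seqAmp N b (c - d) = seqAmp N b c - seqAmp N b d := by
  refine Amp.ext fun σ n => ?_
  rw [PiLp.sub_apply, lp.coeFn_sub, Pi.sub_apply, seqAmp_apply, seqAmp_apply, seqAmp_apply]
  split_ifs <;> simp

theorem inner_seqAmp (N : ℕ) (b : Bool) (c d : Mode → ℂ) :
    inner ℂ (seqAmp N b c) (seqAmp N b d) =
      ∑ σ, ∑ n ∈ Finset.range N, conj (c (b, σ, n)) * d (b, σ, n) := by
  rw [PiLp.inner_apply]
  refine Finset.sum_congr rfl fun σ _ => ?_
  rw [seqAmp_coe, inner_sum_single (fun n => c (b, σ, n))]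
  refine Finset.sum_congr rfl fun n hn => ?_
  rw [seqAmp_apply, if_pos (Finset.mem_range.1 hn)]

theorem sum_norm_sq_seqAmp (N : ℕ) (c : Mode → ℂ) :
    ∑ b, ‖seqAmp N b c‖ ^ 2 = ∑ j ∈ modes N, ‖c j‖ ^ 2 := by
  rw [sum_modes]
  refine Finset.sum_congr rfl fun b _ => ?_
  rw [PiLp.norm_sq_eq_of_L2]
  refine Finset.sum_congr rfl fun σ _ => ?_
  rw [seqAmp_coe, norm_sq_sum_single (fun n => c (b, σ, n))]

theorem norm_seqAmp_le (N : ℕ) (b : Bool) (c : Mode → ℂ) :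
    ‖seqAmp N b c‖ ≤ ∑ j ∈ modes N, ‖c j‖ := by
  have h0 : 0 ≤ ∑ j ∈ modes N, ‖c j‖ := Finset.sum_nonneg fun _ _ => norm_nonneg _
  refine le_of_sq_le_sq ?_ h0
  calc ‖seqAmp N b c‖ ^ 2 ≤ ∑ b, ‖seqAmp N b c‖ ^ 2 :=
        Finset.single_le_sum (f := fun b => ‖seqAmp N b c‖ ^ 2) (fun _ _ => sq_nonneg _)
          (Finset.mem_univ b)
    _ = ∑ j ∈ modes N, ‖c j‖ ^ 2 := sum_norm_sq_seqAmp N c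
    _ ≤ (∑ j ∈ modes N, ‖c j‖) ^ 2 := Finset.sum_sq_le_sq_sum_of_nonneg fun _ _ => norm_nonneg _

theorem modeFunctional_eq (N : ℕ) (Y0 Y1 : GridVec N) (d : Mode → ℂ) :
    modeFunctional N Y0 Y1 d =
      ∑ b, inner ℂ (seqAmp N b d) (seqAmp N b (modeData N Y0 Y1)) := by
  change ∑ j ∈ modes N, conj (d j) * modeData N Y0 Y1 j = _
  rw [sum_modes]
  simp only [inner_seqAmp]

theorem seqAmp_modeData (N : ℕ) (b : Bool) (Y0 Y1 : GridVec N) :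
    seqAmp N b (modeData N Y0 Y1) =
      dataAmp (discreteSeq0 (branchSymbol b) Y0) (discreteSeq1 (branchSymbol b) Y1) := by
  refine Amp.ext fun σ n => ?_
  have e : dataAmp (discreteSeq0 (branchSymbol b) Y0) (discreteSeq1 (branchSymbol b) Y1) σ =
    discreteSeq1 (branchSymbol b) Y1 + (Complex.I * sgn σ) • discreteSeq0 (branchSymbol b) Y0 := rfl
  rw [e, seqAmp_apply, lp.coeFn_add, Pi.add_apply, lp.coeFn_smul, Pi.smul_apply, discreteSeq0,
    discreteSeq1, sum_single_apply (fun l => innerH0 Y0 (eigenvector (branchSymbol b) N (l + 1))),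
    sum_single_apply (fun l => innerH0 Y1 (eigenvector (branchSymbol b) N (l + 1)) /
      (eigenfreq (branchSymbol b) N (l + 1) : ℂ))]
  split_ifs
  · rfl
  · simp

/-- The coefficients of the functional `c ↦ ⟨g, modeSignal c⟩`. -/
def dualSymbol (N : ℕ) {T : ℝ} (g : L2T T) (j : Mode) : ℂ :=
  conj (modeWeight N j * inner ℂ g (expT T (modeFreq N j)))

theorem inner_modeSignal (N : ℕ) {T : ℝ} (g : L2T T) (c : Mode → ℂ) :
    inner ℂ g (modeSignal N T c) = ∑ b, inner ℂ (seqAmp N b (dualSymbol N g)) (seqAmp N b c) := by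
  simp only [inner_seqAmp, ← sum_modes N (fun j => conj (dualSymbol N g j) * c j)]
  change inner ℂ g (∑ j ∈ modes N, ((modeWeight N j : ℂ) * c j) • expT T (modeFreq N j)) = _
  rw [inner_sum]
  refine Finset.sum_congr rfl fun j _ => ?_
  rw [inner_smul_right, dualSymbol, Complex.conj_conj]
  ring

theorem norm_modeSignal_le {N : ℕ} {T : ℝ} (hT : 0 ≤ T) (c : Mode → ℂ) :
    ‖modeSignal N T c‖ ≤ 2 * Real.pi * √T * ∑ j ∈ modes N, ‖c j‖ := by
  change ‖∑ j ∈ modes N, ((modeWeight N j : ℂ) * c j) • expT T (modeFreq N j)‖ ≤ _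
  rw [Finset.mul_sum]
  refine norm_sum_le_of_le _ fun j hj => ?_
  rw [norm_smul, norm_mul, Complex.norm_real, Real.norm_eq_abs]
  have h1 := abs_modeWeight_le hj
  have h2 := norm_expT_le hT (modeFreq N j)
  have hpi := Real.pi_pos
  calc |modeWeight N j| * ‖c j‖ * ‖expT T (modeFreq N j)‖ ≤ 2 * Real.pi * ‖c j‖ * √T := by gcongr
    _ = _ := by ring

/-- The amplitude `1` on a single mode. -/
def unitAmp (σ : Bool) (n : ℕ) : Amp := PiLp.single 2 σ (lp.single 2 n (1 : ℂ))

theorem unitAmp_apply (σ σ' : Bool) (n n' : ℕ) :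
    unitAmp σ n σ' n' = if σ' = σ ∧ n' = n then 1 else 0 := by
  rw [unitAmp, PiLp.single_apply]
  by_cases h : σ' = σ
  · subst h
    simp [Pi.single_apply]
  · simp [h]

theorem inner_unitAmp (σ : Bool) (n : ℕ) (c : Amp) : inner ℂ (unitAmp σ n) c = c σ n := by
  have h : ∀ σ', inner ℂ (unitAmp σ n σ') (c σ') = if σ' = σ then c σ n else 0 := by
    intro σ'
    rw [unitAmp, PiLp.single_apply]
    by_cases h : σ' = σ
    · subst h
      simp [lp.inner_single_left]
    · rw [if_neg h, if_neg h]; exact inner_zero_left _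
  rw [PiLp.inner_apply]
  simp only [h, Finset.sum_ite_eq', Finset.mem_univ, if_true]

theorem fluxMap_unitAmp {T : ℝ} (hT : 0 < T) (σ : Bool) (n : ℕ) :
    fluxMap T (unitAmp σ n) = (contWeight n : ℂ) • expT T (sgn σ * contFreq n) := by
  refine (hasSum_fluxMap hT (unitAmp σ n)).unique ?_
  have h : ∀ n', ∑ σ', ((contWeight n' : ℂ) * unitAmp σ n σ' n') • expT T (sgn σ' * contFreq n') =
      if n' = n then (contWeight n : ℂ) • expT T (sgn σ * contFreq n) else 0 := by
    intro n'
    by_cases hn : n' = n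
    · subst hn
      rw [Finset.sum_eq_single σ]
      · simp [unitAmp_apply]
      · intro σ' _ h; simp [unitAmp_apply, h]
      · simp
    · rw [if_neg hn]
      exact Finset.sum_eq_zero fun σ' _ => by simp [unitAmp_apply, hn]
  simp only [h]
  exact hasSum_ite_eq n _

theorem seqAmp_single_acoustic {N n : ℕ} (hn : n < N) (σ : Bool) :
    seqAmp N false (Pi.single (false, σ, n) 1) = unitAmp σ n := by
  refine Amp.ext fun σ' n' => ?_
  rw [seqAmp_apply, unitAmp_apply, Pi.single_apply]
  by_cases h : σ' = σ ∧ n' = n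
  · rw [if_pos h, h.1, h.2]; simp [hn]
  · rw [if_neg h, if_neg (show ¬ ((false, σ', n') : Mode) = (false, σ, n) by simpa using h)]; simp

theorem seqAmp_single_optic (N n : ℕ) (σ : Bool) :
    seqAmp N true (Pi.single (false, σ, n) 1) = 0 := by
  refine Amp.ext fun σ' n' => ?_
  rw [seqAmp_apply]
  simp

theorem modeSignal_single {N n : ℕ} {T : ℝ} (hn : n < N) (σ : Bool) :
    modeSignal N T (Pi.single (false, σ, n) 1) =
      (modeWeight N (false, σ, n) : ℂ) • expT T (modeFreq N (false, σ, n)) := by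
  change ∑ j ∈ modes N, ((modeWeight N j : ℂ) * (Pi.single (false, σ, n) 1 : Mode → ℂ) j) •
    expT T (modeFreq N j) = _
  rw [Finset.sum_eq_single (false, σ, n)]
  · simp
  · intro j _ hj; rw [Pi.single_eq_of_ne hj]; simp
  · intro h; exact absurd (mem_modes.2 hn) h

/-- Dominated convergence in `ℓ²`. -/
theorem tendsto_ell2_of_inv_bound {ι : Type*} {l : Filter ι} {a : ι → Ell2} {b : Ell2} {C : ℝ}
    (ha : ∀ i n, ‖a i n‖ * ((n : ℝ) + 1) ≤ C) (hb : ∀ n, ‖b n‖ * ((n : ℝ) + 1) ≤ C)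
    (h : ∀ n, Tendsto (fun i => a i n) l (𝓝 (b n))) : Tendsto a l (𝓝 b) := by
  have hs : Summable fun n : ℕ => ‖(((n : ℝ) + 1)⁻¹ : ℂ)‖ ^ 2 := by
    have h1 := (summable_nat_add_iff 1).2 (Real.summable_one_div_nat_pow.2 (one_lt_two))
    refine h1.congr fun n => ?_
    have : ‖(((n : ℝ) + 1)⁻¹ : ℂ)‖ = ((n : ℝ) + 1)⁻¹ := by
      rw [← Complex.ofReal_one, ← Complex.ofReal_add, ← Complex.ofReal_inv, Complex.norm_real,
        Real.norm_of_nonneg (by positivity)]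
    rw [this]; push_cast; simp
  let f : Ell2 := ⟨_, memℓp_two_of_summable hs⟩
  have hf : ∀ n, f n = (((n : ℝ) + 1)⁻¹ : ℂ) := fun n => rfl
  have hne : ∀ n : ℕ, ((n : ℝ) + 1 : ℂ) ≠ 0 := fun n => by
    rw [← Complex.ofReal_one, ← Complex.ofReal_add]
    exact_mod_cast (by positivity : (0 : ℝ) < (n : ℝ) + 1).ne'
  have hnorm : ∀ (z : ℂ) (n : ℕ), ‖z * ((n : ℝ) + 1 : ℂ)‖ = ‖z‖ * ((n : ℝ) + 1) := fun z n => by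
    rw [norm_mul, ← Complex.ofReal_one, ← Complex.ofReal_add, Complex.norm_real,
      Real.norm_of_nonneg (by positivity)]
  have hmul : ∀ x : Ell2, (∀ n, ‖x n‖ * ((n : ℝ) + 1) ≤ C) →
      ellMul (fun n => x n * ((n : ℝ) + 1 : ℂ)) f = x := by
    intro x hx
    refine lp.ext (funext fun n => ?_)
    rw [ellMul_apply (C := C) (fun n => by rw [hnorm]; exact hx n), hf, mul_assoc,
      mul_inv_cancel₀ (hne n), mul_one]
  have key := tendsto_ellMul (l := l) (C := C) (μ := fun i n => a i n * ((n : ℝ) + 1 : ℂ))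
    (ν := fun n => b n * ((n : ℝ) + 1 : ℂ)) (fun i n => by rw [hnorm]; exact ha i n)
    (fun n => by rw [hnorm]; exact hb n) (fun n => (h n).mul_const _) f
  rw [hmul b hb] at key
  exact key.congr fun i => hmul (a i) (ha i)

theorem tendsto_toLp_amp {ι : Type*} {l : Filter ι} {a : ι → Amp} {b : Amp}
    (h : ∀ σ, Tendsto (fun i => a i σ) l (𝓝 (b σ))) : Tendsto a l (𝓝 b) := by
  have := ((PiLp.continuous_toLp 2 fun _ : Bool => Ell2).tendsto (WithLp.ofLp b)).comp
    (tendsto_pi_nhds.2 h)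
  exact this

theorem norm_dualSymbol_mul_le {N : ℕ} {T : ℝ} {g : L2T T} {C : ℝ}
    (hg : ∀ w, (1 + |w|) * ‖inner ℂ g (expT T w)‖ ≤ C) {j : Mode} (hj : j ∈ modes N) :
    ‖dualSymbol N g j‖ * (1 + freq N j.1 j.2.2) ≤ 2 * Real.pi * C := by
  rw [dualSymbol, RCLike.norm_conj, norm_mul, Complex.norm_real, ← abs_modeFreq hj, mul_assoc]
  have h1 := abs_modeWeight_le hj
  have h2 := hg (modeFreq N j)
  rw [mul_comm] at h2
  have hpi := Real.pi_pos
  exact mul_le_mul h1 h2 (by positivity) (by positivity)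

theorem seqAmp_dualSymbol_bound {N : ℕ} {T : ℝ} {g : L2T T} {C : ℝ} (hC : 0 ≤ C)
    (hg : ∀ w, (1 + |w|) * ‖inner ℂ g (expT T w)‖ ≤ C) (b σ : Bool) (n : ℕ) :
    ‖seqAmp N b (dualSymbol N g) σ n‖ * ((n : ℝ) + 1) ≤ 2 * Real.pi * C := by
  have hpi := Real.pi_pos
  rw [seqAmp_apply]
  split_ifs with hn
  · refine le_trans ?_ (norm_dualSymbol_mul_le hg (mem_modes.2 hn : ((b, σ, n) : Mode) ∈ modes N))
    have := two_mul_le_freq b hn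
    have h0 : (0 : ℝ) ≤ n := Nat.cast_nonneg _
    exact mul_le_mul_of_nonneg_left (by simp only; linarith) (norm_nonneg _)
  · simp; positivity

theorem adjoint_fluxMap_apply {T : ℝ} (hT : 0 < T) (g : L2T T) (σ : Bool) (n : ℕ) :
    (fluxMap T).adjoint g σ n = conj (contWeight n * inner ℂ g (expT T (sgn σ * contFreq n))) := by
  rw [← inner_unitAmp, ContinuousLinearMap.adjoint_inner_right, fluxMap_unitAmp hT, inner_smul_left,
    map_mul, inner_conj_symm]

/-- Convergence of the dual symbols on the acoustic branch. -/
theorem tendsto_dualSymbol_acoustic {T : ℝ} (hT : 0 < T) {g : L2T T} (hg : HasDecay g) :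
    Tendsto (fun N => seqAmp N false (dualSymbol N g)) atTop (𝓝 ((fluxMap T).adjoint g)) := by
  obtain ⟨C, hC, hg⟩ := hg
  have hpi := Real.pi_pos
  have hlim : ∀ σ n, Tendsto (fun N => seqAmp N false (dualSymbol N g) σ n) atTop
      (𝓝 ((fluxMap T).adjoint g σ n)) := by
    intro σ n
    rw [adjoint_fluxMap_apply hT]
    have h1 : Tendsto (fun N => inner ℂ g (expT T (modeFreq N (false, σ, n)))) atTop
        (𝓝 (inner ℂ g (expT T (sgn σ * contFreq n)))) :=
      Tendsto.inner tendsto_const_nhds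
        (((continuous_expT hT.le).tendsto _).comp (tendsto_modeFreq_acoustic σ n))
    have h2 : Tendsto (fun N => ((modeWeight N (false, σ, n) : ℝ) : ℂ)) atTop (𝓝 (contWeight n)) :=
      (Complex.continuous_ofReal.tendsto _).comp (tendsto_modeWeight_acoustic σ n)
    have h3 := (Complex.continuous_conj.tendsto _).comp (h2.mul h1)
    refine h3.congr' ?_
    filter_upwards [eventually_gt_atTop n] with N hN
    rw [seqAmp_apply, if_pos hN]; rfl
  refine tendsto_toLp_amp fun σ => tendsto_ell2_of_inv_bound (C := 2 * Real.pi * C)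
    (fun N n => seqAmp_dualSymbol_bound hC hg false σ n) (fun n => ?_) (hlim σ)
  refine le_of_tendsto ((hlim σ n).norm.mul_const _) (Eventually.of_forall fun N => ?_)
  exact seqAmp_dualSymbol_bound hC hg false σ n

/-- Convergence to zero of the dual symbols on the optic branch. -/
theorem tendsto_dualSymbol_optic {T : ℝ} {g : L2T T} (hg : HasDecay g) :
    Tendsto (fun N => seqAmp N true (dualSymbol N g)) atTop (𝓝 0) := by
  obtain ⟨C, hC, hg⟩ := hg
  have hpi := Real.pi_pos
  refine tendsto_toLp_amp fun σ => tendsto_ell2_of_inv_bound (C := 2 * Real.pi * C)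
    (fun N n => seqAmp_dualSymbol_bound hC hg true σ n) (fun n => ?_) fun n => ?_
  · simp; positivity
  · have h1 : Tendsto (fun N => 2 * Real.pi * C / (1 + freq N true n)) atTop (𝓝 0) :=
      tendsto_const_nhds.div_atTop (tendsto_atTop_add_const_left _ _ (tendsto_freq_optic n))
    refine squeeze_zero_norm' ?_ h1
    filter_upwards [eventually_gt_atTop n] with N hN
    rw [seqAmp_apply, if_pos hN, le_div_iff₀ (by have := freq_pos true hN; linarith)]
    exact norm_dualSymbol_mul_le hg (mem_modes.2 hN : ((true, σ, n) : Mode) ∈ modes N)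

end Embedding

/-! ### Convergence of the controls -/

section Convergence

theorem tendsto_inner_of_weak {E : Type*} [NormedAddCommGroup E] [InnerProductSpace ℂ E]
    {x y : ℕ → E} {x₀ y₀ : E} {K : ℝ} (hK : ∀ᶠ m in atTop, ‖y m‖ ≤ K) (hx : Tendsto x atTop (𝓝 x₀))
    (hy : Tendsto (fun m => inner ℂ x₀ (y m)) atTop (𝓝 (inner ℂ x₀ y₀))) :
    Tendsto (fun m => inner ℂ (x m) (y m)) atTop (𝓝 (inner ℂ x₀ y₀)) := by
  have h1 : Tendsto (fun m => inner ℂ (x m - x₀) (y m)) atTop (𝓝 0) := by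
    have h2 : Tendsto (fun m => ‖x m - x₀‖ * K) atTop (𝓝 0) := by
      simpa using (tendsto_iff_norm_sub_tendsto_zero.1 hx).mul_const K
    refine squeeze_zero_norm' ?_ h2
    filter_upwards [hK] with m hm
    exact (norm_inner_le_norm _ _).trans (mul_le_mul_of_nonneg_left hm (norm_nonneg _))
  have h3 := h1.add hy
  rw [zero_add] at h3
  refine h3.congr fun m => ?_
  rw [← inner_add_left, sub_add_cancel]

theorem tendsto_inner_zero {E : Type*} [NormedAddCommGroup E] [InnerProductSpace ℂ E]
    {x y : ℕ → E} {K : ℝ} (hK : ∀ᶠ m in atTop, ‖y m‖ ≤ K) (hx : Tendsto x atTop (𝓝 0)) :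
    Tendsto (fun m => inner ℂ (x m) (y m)) atTop (𝓝 0) := by
  have := tendsto_inner_of_weak (y₀ := 0) hK hx (by simp)
  simpa using this

/-- A family of filtered spaces, given by the coefficients in the eigenbasis, is admissible if the
discrete waves are uniformly observable and if the spaces of amplitudes approximate all acoustic
modes. -/
structure Admissible (T : ℝ) (N : ℕ → ℕ) (X : ∀ _ : ℕ, Submodule ℂ (Bool → ℕ → ℂ)) : Prop where
  observable : ∃ κ : ℝ, 0 < κ ∧ ∀ᶠ m in atTop, ∀ c ∈ amplitudes (N m) T (X m),
    κ * ∑ j ∈ modes (N m), ‖c j‖ ^ 2 ≤ ‖modeSignal (N m) T c‖ ^ 2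
  dense : ∀ σ n, ∃ d : ℕ → Mode → ℂ, (∀ᶠ m in atTop, d m ∈ amplitudes (N m) T (X m)) ∧
    Tendsto (fun m => ∑ j ∈ modes (N m), ‖d m j - (Pi.single (false, σ, n) 1 : Mode → ℂ) j‖) atTop (𝓝 0)

variable {T : ℝ} {N : ℕ → ℕ} {X : ∀ _ : ℕ, Submodule ℂ (Bool → ℕ → ℂ)}
  {Y0 Y1 : ∀ m, GridVec (N m)} {c : ℕ → Mode → ℂ} {ℓ : Amp} {K : ℝ}

theorem sum_bool_inner_le {x y : Bool → Amp} {S K : ℝ} (hx : ∑ b, ‖x b‖ ^ 2 = S ^ 2) (hS : 0 ≤ S)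
    (hy : ∀ b, ‖y b‖ ≤ K) : ‖∑ b, inner ℂ (x b) (y b)‖ ≤ 2 * S * K := by
  have hxb : ∀ b, ‖x b‖ ≤ S := fun b => le_of_sq_le_sq (hx ▸
    Finset.single_le_sum (f := fun b => ‖x b‖ ^ 2) (fun _ _ => sq_nonneg _) (Finset.mem_univ b)) hS
  calc ‖∑ b, inner ℂ (x b) (y b)‖ ≤ ∑ _b : Bool, S * K :=
        norm_sum_le_of_le _ fun b _ => (norm_inner_le_norm _ _).trans
          (mul_le_mul (hxb b) (hy b) (norm_nonneg _) hS)
    _ = 2 * S * K := by simp; ring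

/-- Uniform bounds on the optimal amplitudes and on the controls. -/
theorem exists_bound_of_eulerLagrange (hX : Admissible T N X)
    (hc : ∀ m, c m ∈ amplitudes (N m) T (X m))
    (hEL : ∀ m, ∀ d ∈ amplitudes (N m) T (X m), inner ℂ (modeSignal (N m) T d) (modeSignal (N m) T (c m)) =
      modeFunctional (N m) (Y0 m) (Y1 m) d)
    (hK0 : 0 ≤ K) (hK : ∀ m b, ‖seqAmp (N m) b (modeData (N m) (Y0 m) (Y1 m))‖ ≤ K) :
    ∃ C : ℝ, ∀ᶠ m in atTop, (∀ b, ‖seqAmp (N m) b (c m)‖ ≤ C) ∧ ‖modeSignal (N m) T (c m)‖ ≤ C := by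
  obtain ⟨κ, hκ, hobs⟩ := hX.observable
  refine ⟨max (2 * K / κ) √(2 * (2 * K / κ) * K), ?_⟩
  filter_upwards [hobs] with m hm
  set S := √(∑ j ∈ modes (N m), ‖c m j‖ ^ 2) with hS
  have hS0 : 0 ≤ S := Real.sqrt_nonneg _
  have hS2 : ∑ b, ‖seqAmp (N m) b (c m)‖ ^ 2 = S ^ 2 := by
    rw [hS, Real.sq_sqrt (Finset.sum_nonneg fun _ _ => sq_nonneg _), sum_norm_sq_seqAmp]
  have h1 : ‖modeSignal (N m) T (c m)‖ ^ 2 ≤ 2 * S * K := by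
    have h2 := hEL m (c m) (hc m)
    rw [modeFunctional_eq, inner_self_eq_norm_sq_to_K] at h2
    have h3 := sum_bool_inner_le hS2 hS0 (hK m)
    rw [← h2] at h3
    simpa using h3
  have h4 : κ * S ^ 2 ≤ 2 * S * K := by
    refine le_trans (le_of_eq ?_) ((hm (c m) (hc m)).trans h1)
    rw [← hS2, sum_norm_sq_seqAmp]
  have h5 : S ≤ 2 * K / κ := by
    rw [le_div_iff₀ hκ]
    rcases hS0.eq_or_lt with h0 | h0
    · rw [← h0]; linarith
    · nlinarith
  refine ⟨fun b => (le_of_sq_le_sq (hS2 ▸ Finset.single_le_sum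
    (f := fun b => ‖seqAmp (N m) b (c m)‖ ^ 2) (fun _ _ => sq_nonneg _) (Finset.mem_univ b)) hS0).trans
    (h5.trans (le_max_left _ _)), ?_⟩
  refine le_trans (Real.le_sqrt_of_sq_le (h1.trans ?_)) (le_max_right _ _)
  gcongr

theorem tendsto_modeSignal_single (hT : 0 < T) (σ : Bool) (n : ℕ) :
    Tendsto (fun N => modeSignal N T (Pi.single (false, σ, n) 1)) atTop (𝓝 (fluxMap T (unitAmp σ n))) := by
  rw [fluxMap_unitAmp hT]
  have h1 : Tendsto (fun N => ((modeWeight N (false, σ, n) : ℝ) : ℂ)) atTop (𝓝 (contWeight n)) :=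
    (Complex.continuous_ofReal.tendsto _).comp (tendsto_modeWeight_acoustic σ n)
  have h2 := ((continuous_expT hT.le).tendsto _).comp (tendsto_modeFreq_acoustic σ n)
  refine (h1.smul h2).congr' ?_
  filter_upwards [eventually_gt_atTop n] with N hN
  rw [modeSignal_single hN]; rfl

theorem eq_zero_of_inner_adjoint_unitAmp (hT : 2 < T) {z : Amp}
    (h : ∀ σ n, inner ℂ ((fluxMap T).adjoint (fluxMap T (unitAmp σ n))) z = 0) : z = 0 := by
  obtain ⟨κ, hκ, hobs⟩ := observability_fluxMap hT
  have h1 : (fluxMap T).adjoint (fluxMap T z) = 0 := by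
    refine Amp.ext fun σ n => ?_
    rw [← inner_unitAmp, ContinuousLinearMap.adjoint_inner_right, ← ContinuousLinearMap.adjoint_inner_left, h]
    rfl
  have h2 : ‖fluxMap T z‖ ^ 2 = 0 := by
    have h3 : inner ℂ (fluxMap T z) (fluxMap T z) = 0 := by
      rw [← ContinuousLinearMap.adjoint_inner_right, h1, inner_zero_right]
    rw [inner_self_eq_zero.1 h3]; simp
  have h4 := hobs z
  rw [h2] at h4
  have h5 : ‖z‖ ^ 2 ≤ 0 := by nlinarith [sq_nonneg ‖z‖]
  exact norm_eq_zero.1 (pow_eq_zero_iff two_ne_zero |>.1 (le_antisymm h5 (sq_nonneg _)))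

/-- The optimal acoustic amplitudes and the controls converge weakly. -/
theorem tendsto_inner_controls (hT : 2 < T) (hN : Tendsto N atTop atTop) (hX : Admissible T N X)
    (hc : ∀ m, c m ∈ amplitudes (N m) T (X m))
    (hEL : ∀ m, ∀ d ∈ amplitudes (N m) T (X m), inner ℂ (modeSignal (N m) T d) (modeSignal (N m) T (c m)) =
      modeFunctional (N m) (Y0 m) (Y1 m) d)
    (hK0 : 0 ≤ K) (hK : ∀ m b, ‖seqAmp (N m) b (modeData (N m) (Y0 m) (Y1 m))‖ ≤ K)
    (hD : ∀ y, Tendsto (fun m => inner ℂ y (seqAmp (N m) false (modeData (N m) (Y0 m) (Y1 m)))) atTop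
      (𝓝 (inner ℂ y ℓ)))
    {c₀ : Amp} (hc₀ : ∀ d, inner ℂ (fluxMap T d) (fluxMap T c₀) = inner ℂ d ℓ) :
    (∀ y, Tendsto (fun m => inner ℂ y (seqAmp (N m) false (c m))) atTop (𝓝 (inner ℂ y c₀))) ∧
    ∀ y, Tendsto (fun m => inner ℂ y (modeSignal (N m) T (c m))) atTop (𝓝 (inner ℂ y (fluxMap T c₀))) := by
  have hT0 : 0 < T := by linarith
  obtain ⟨C, hC⟩ := exists_bound_of_eulerLagrange hX hc hEL hK0 hK
  have hCA : ∀ b, ∀ᶠ m in atTop, ‖seqAmp (N m) b (c m)‖ ≤ C := fun b => hC.mono fun m hm => hm.1 b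
  have hCv : ∀ᶠ m in atTop, ‖modeSignal (N m) T (c m)‖ ≤ C := hC.mono fun m hm => hm.2
  have htest : ∀ σ n, Tendsto (fun m => inner ℂ (fluxMap T (unitAmp σ n)) (modeSignal (N m) T (c m))) atTop
      (𝓝 (inner ℂ (fluxMap T (unitAmp σ n)) (fluxMap T c₀))) := by
    intro σ n
    obtain ⟨d, hd, hdlim⟩ := hX.dense σ n
    set e : Mode → ℂ := Pi.single (false, σ, n) 1 with he
    have hsig : Tendsto (fun m => modeSignal (N m) T (d m)) atTop (𝓝 (fluxMap T (unitAmp σ n))) := by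
      have h1 : Tendsto (fun m => modeSignal (N m) T (d m - e)) atTop (𝓝 0) := by
        refine squeeze_zero_norm (fun m => norm_modeSignal_le hT0.le _) ?_
        simpa using hdlim.const_mul (2 * Real.pi * √T)
      have h2 := h1.add ((tendsto_modeSignal_single hT0 σ n).comp hN)
      rw [zero_add] at h2
      refine h2.congr fun m => ?_
      rw [Function.comp_apply, ← map_add, he, sub_add_cancel]
    have hseq : ∀ b, Tendsto (fun m => seqAmp (N m) b (d m) - seqAmp (N m) b e) atTop (𝓝 0) := by
      intro b
      refine squeeze_zero_norm (fun m => ?_) hdlim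
      rw [← seqAmp_sub]
      exact norm_seqAmp_le _ _ _
    have hseq0 : Tendsto (fun m => seqAmp (N m) false (d m)) atTop (𝓝 (unitAmp σ n)) := by
      have h1 := (hseq false).add_const (unitAmp σ n)
      rw [zero_add] at h1
      refine h1.congr' ?_
      filter_upwards [hN.eventually_gt_atTop n] with m hm
      rw [he, seqAmp_single_acoustic hm, sub_add_cancel]
    have hseq1 : Tendsto (fun m => seqAmp (N m) true (d m)) atTop (𝓝 0) := by
      refine (hseq true).congr fun m => ?_
      rw [he, seqAmp_single_optic, sub_zero]
    have hfun : Tendsto (fun m => modeFunctional (N m) (Y0 m) (Y1 m) (d m)) atTop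
        (𝓝 (inner ℂ (unitAmp σ n) ℓ)) := by
      have h1 := tendsto_inner_of_weak (Eventually.of_forall fun m => hK m false) hseq0 (hD (unitAmp σ n))
      have h2 := tendsto_inner_zero (Eventually.of_forall fun m => hK m true) hseq1
      have h3 := h2.add h1
      rw [zero_add] at h3
      refine h3.congr fun m => ?_
      rw [modeFunctional_eq, Fintype.sum_bool]
    have hsv : Tendsto (fun m => inner ℂ (modeSignal (N m) T (d m)) (modeSignal (N m) T (c m))) atTop
        (𝓝 (inner ℂ (unitAmp σ n) ℓ)) :=
      hfun.congr' (hd.mono fun m hm => (hEL m _ hm).symm)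
    have hdiff : Tendsto (fun m => inner ℂ (fluxMap T (unitAmp σ n) - modeSignal (N m) T (d m))
        (modeSignal (N m) T (c m))) atTop (𝓝 0) := by
      refine tendsto_inner_zero hCv ?_
      simpa using hsig.const_sub (fluxMap T (unitAmp σ n))
    rw [hc₀]
    have h4 := hdiff.add hsv
    rw [zero_add] at h4
    refine h4.congr fun m => ?_
    rw [← inner_add_left, sub_add_cancel]
  have hopt : ∀ g : L2T T, HasDecay g → Tendsto (fun m => inner ℂ g (modeSignal (N m) T (c m)) -
      inner ℂ ((fluxMap T).adjoint g) (seqAmp (N m) false (c m))) atTop (𝓝 0) := by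
    intro g hg
    have h1 := tendsto_inner_zero (hCA true) ((tendsto_dualSymbol_optic hg).comp hN)
    have h2 : Tendsto (fun m => inner ℂ (seqAmp (N m) false (dualSymbol (N m) g) - (fluxMap T).adjoint g)
        (seqAmp (N m) false (c m))) atTop (𝓝 0) := by
      refine tendsto_inner_zero (hCA false) ?_
      simpa using ((tendsto_dualSymbol_acoustic hT0 hg).comp hN).sub_const ((fluxMap T).adjoint g)
    have h3 := h1.add h2
    rw [add_zero] at h3
    refine h3.congr fun m => ?_
    rw [inner_modeSignal, Fintype.sum_bool, inner_sub_left, Function.comp_apply, add_sub_assoc]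
  have hamp : ∀ y, Tendsto (fun m => inner ℂ y (seqAmp (N m) false (c m))) atTop (𝓝 (inner ℂ y c₀)) := by
    refine inner_tendsto_of_total (hCA false)
      {y | ∃ σ n, y = (fluxMap T).adjoint (fluxMap T (unitAmp σ n))} (fun z hz => ?_) ?_
    · exact eq_zero_of_inner_adjoint_unitAmp hT fun σ n => hz _ ⟨σ, n, rfl⟩
    · rintro _ ⟨σ, n, rfl⟩
      have hg : HasDecay (fluxMap T (unitAmp σ n)) := by
        rw [fluxMap_unitAmp hT0]
        exact (hasDecay_expT hT0.le _).smul _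
      have h1 := (htest σ n).sub (hopt _ hg)
      rw [sub_zero, ← ContinuousLinearMap.adjoint_inner_left] at h1
      refine h1.congr fun m => ?_
      rw [sub_sub_cancel]
  refine ⟨hamp, ?_⟩
  refine inner_tendsto_of_total hCv {g | HasDecay g}
    (fun z hz => eq_zero_of_forall_hasDecay hT0.le z hz) fun g hg => ?_
  have h1 := (hopt g hg).add (hamp ((fluxMap T).adjoint g))
  rw [zero_add, ContinuousLinearMap.adjoint_inner_left] at h1
  refine h1.congr fun m => ?_
  rw [sub_add_cancel]

/-- The norms of the controls converge if the data converge strongly. -/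
theorem tendsto_norm_sq_controls (hX : Admissible T N X)
    (hc : ∀ m, c m ∈ amplitudes (N m) T (X m))
    (hEL : ∀ m, ∀ d ∈ amplitudes (N m) T (X m), inner ℂ (modeSignal (N m) T d) (modeSignal (N m) T (c m)) =
      modeFunctional (N m) (Y0 m) (Y1 m) d)
    (hK0 : 0 ≤ K) (hK : ∀ m b, ‖seqAmp (N m) b (modeData (N m) (Y0 m) (Y1 m))‖ ≤ K)
    {c₀ : Amp} (hc₀ : ∀ d, inner ℂ (fluxMap T d) (fluxMap T c₀) = inner ℂ d ℓ)
    (hA : ∀ y, Tendsto (fun m => inner ℂ y (seqAmp (N m) false (c m))) atTop (𝓝 (inner ℂ y c₀)))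
    (hD0 : Tendsto (fun m => seqAmp (N m) false (modeData (N m) (Y0 m) (Y1 m))) atTop (𝓝 ℓ))
    (hD1 : Tendsto (fun m => seqAmp (N m) true (modeData (N m) (Y0 m) (Y1 m))) atTop (𝓝 0)) :
    Tendsto (fun m => ‖modeSignal (N m) T (c m)‖ ^ 2) atTop (𝓝 (‖fluxMap T c₀‖ ^ 2)) := by
  obtain ⟨C, hC⟩ := exists_bound_of_eulerLagrange hX hc hEL hK0 hK
  have h1 := tendsto_inner_of_weak (hC.mono fun m hm => hm.1 false) hD0 (hA ℓ)
  have h2 := tendsto_inner_zero (hC.mono fun m hm => hm.1 true) hD1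
  have h3 := h2.add h1
  rw [zero_add] at h3
  have h4 := (Complex.continuous_re.tendsto _).comp h3
  have e : (inner ℂ ℓ c₀).re = ‖fluxMap T c₀‖ ^ 2 := by
    have h5 := hc₀ c₀
    rw [← inner_conj_symm, Complex.conj_re, ← h5]
    exact inner_self_eq_norm_sq (𝕜 := ℂ) _
  rw [e] at h4
  refine h4.congr fun m => ?_
  have h6 := hEL m (c m) (hc m)
  rw [modeFunctional_eq, Fintype.sum_bool] at h6
  have h7 : (inner ℂ (modeSignal (N m) T (c m)) (modeSignal (N m) T (c m))).re =
      ‖modeSignal (N m) T (c m)‖ ^ 2 := inner_self_eq_norm_sq (𝕜 := ℂ) _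
  rw [← h7, h6, Function.comp_apply, Complex.add_re, Complex.add_re,
    ← inner_conj_symm (seqAmp (N m) true (c m)), ← inner_conj_symm (seqAmp (N m) false (c m)),
    Complex.conj_re, Complex.conj_re]

theorem inner_dataAmp (y : Amp) (b0 b1 : Ell2) :
    inner ℂ y (dataAmp b0 b1) = ∑ σ, (inner ℂ (y σ) b1 + Complex.I * sgn σ * inner ℂ (y σ) b0) := by
  rw [PiLp.inner_apply]
  refine Finset.sum_congr rfl fun σ _ => ?_
  have : dataAmp b0 b1 σ = b1 + (Complex.I * sgn σ) • b0 := rfl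
  rw [this, inner_add_right, inner_smul_right]

theorem tendsto_inner_dataAmp {f0 f1 : ℕ → Ell2} {b0 b1 : Ell2} (h0 : WeaklyTendsto f0 b0)
    (h1 : WeaklyTendsto f1 b1) (y : Amp) :
    Tendsto (fun m => inner ℂ y (dataAmp (f0 m) (f1 m))) atTop (𝓝 (inner ℂ y (dataAmp b0 b1))) := by
  simp only [inner_dataAmp]
  exact tendsto_finsetSum _ fun σ _ => (h1.inner_left _).add ((h0.inner_left _).const_mul _)

theorem tendsto_dataAmp {f0 f1 : ℕ → Ell2} {b0 b1 : Ell2} (h0 : Tendsto f0 atTop (𝓝 b0))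
    (h1 : Tendsto f1 atTop (𝓝 b1)) : Tendsto (fun m => dataAmp (f0 m) (f1 m)) atTop (𝓝 (dataAmp b0 b1)) :=
  tendsto_toLp_amp fun σ => h1.add (h0.const_smul (Complex.I * sgn σ : ℂ))

theorem dataAmp_zero : dataAmp 0 0 = 0 := by
  refine Amp.ext fun σ n => ?_
  have : dataAmp 0 0 σ = 0 + (Complex.I * sgn σ) • (0 : Ell2) := rfl
  rw [this, smul_zero, add_zero]; rfl

/-- Convergence of the discrete HUM controls in admissible filtered spaces. -/
theorem convergence_of_admissible (hT : 2 < T) (hN : Tendsto N atTop atTop) (hX : Admissible T N X)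
    {y0 : L2I} {y1 : HNegOne} {b0 b1 : Ell2}
    (hb0 : ∀ n, b0 n = fourierCoeff0 y0 (n + 1))
    (hb1 : ∀ n, b1 n = fourierCoeff1 y1 (n + 1) / contFreq n)
    (hac1 : WeaklyTendsto (fun m => discreteSeq1 acousticSymbol (Y1 m)) b1)
    (hac0 : WeaklyTendsto (fun m => discreteSeq0 acousticSymbol (Y0 m)) b0)
    (hop1 : WeaklyTendsto (fun m => discreteSeq1 opticSymbol (Y1 m)) 0)
    (hop0 : WeaklyTendsto (fun m => discreteSeq0 opticSymbol (Y0 m)) 0)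
    {vh : ℕ → L2T T} {v : L2T T}
    (hvh : ∀ m, IsDiscreteHUMControl T
      (((X m).map (synth (N m))).prod ((X m).map (synth (N m)))) (Y0 m) (Y1 m) (vh m))
    (hv : IsHUMControl T y0 y1 v) :
    WeaklyTendsto vh v ∧
      (Tendsto (fun m => discreteSeq1 acousticSymbol (Y1 m)) atTop (𝓝 b1) →
       Tendsto (fun m => discreteSeq0 acousticSymbol (Y0 m)) atTop (𝓝 b0) →
       Tendsto (fun m => discreteSeq1 opticSymbol (Y1 m)) atTop (𝓝 0) →
       Tendsto (fun m => discreteSeq0 opticSymbol (Y0 m)) atTop (𝓝 0) →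
       Tendsto vh atTop (𝓝 v)) := by
  have hT0 : 0 < T := by linarith
  obtain ⟨⟨c₀, rfl⟩, hc₀⟩ := (isHUMControl_iff hT0 hb0 hb1 v).1 hv
  have hvh' := fun m => (isDiscreteHUMControl_iff hT0.le (X m) (Y0 m) (Y1 m) (vh m)).1 (hvh m)
  choose hr hEL using hvh'
  choose c hcv using hr
  have hcv' : ∀ m, vh m = modeSignal (N m) T (c m : Mode → ℂ) := fun m => (hcv m).symm
  obtain rfl : vh = fun m => modeSignal (N m) T (c m : Mode → ℂ) := funext hcv'
  have hD0 : ∀ m, seqAmp (N m) false (modeData (N m) (Y0 m) (Y1 m)) =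
      dataAmp (discreteSeq0 acousticSymbol (Y0 m)) (discreteSeq1 acousticSymbol (Y1 m)) :=
    fun m => seqAmp_modeData (N m) false (Y0 m) (Y1 m)
  have hD1 : ∀ m, seqAmp (N m) true (modeData (N m) (Y0 m) (Y1 m)) =
      dataAmp (discreteSeq0 opticSymbol (Y0 m)) (discreteSeq1 opticSymbol (Y1 m)) :=
    fun m => seqAmp_modeData (N m) true (Y0 m) (Y1 m)
  have hw0 := tendsto_inner_dataAmp hac0 hac1
  have hw1 := tendsto_inner_dataAmp hop0 hop1
  obtain ⟨K0, hK0, hKb0⟩ := exists_bound_of_inner_tendsto hw0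
  obtain ⟨K1, hK1, hKb1⟩ := exists_bound_of_inner_tendsto hw1
  have hK : ∀ m b, ‖seqAmp (N m) b (modeData (N m) (Y0 m) (Y1 m))‖ ≤ max K0 K1 := by
    intro m b
    cases b
    · rw [hD0]; exact (hKb0 m).trans (le_max_left _ _)
    · rw [hD1]; exact (hKb1 m).trans (le_max_right _ _)
  have hKpos : 0 ≤ max K0 K1 := hK0.le.trans (le_max_left _ _)
  have hEL' : ∀ m, ∀ d ∈ amplitudes (N m) T (X m),
      inner ℂ (modeSignal (N m) T d) (modeSignal (N m) T (c m : Mode → ℂ)) =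
        modeFunctional (N m) (Y0 m) (Y1 m) d := fun m d hd => hEL m ⟨d, hd⟩
  have hmem : ∀ m, (c m : Mode → ℂ) ∈ amplitudes (N m) T (X m) := fun m => (c m).2
  have hweak := tendsto_inner_controls hT hN hX hmem hEL' hKpos hK
    (fun y => by simp only [hD0]; exact hw0 y) hc₀
  refine ⟨weaklyTendsto_of_inner hweak.2, fun s1 s0 o1 o0 => ?_⟩
  refine tendsto_of_inner_of_norm_sq hweak.2 ?_
  refine tendsto_norm_sq_controls hX hmem hEL' hKpos hK hc₀ hweak.1 ?_ ?_
  · simp only [hD0]; exact tendsto_dataAmp s0 s1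
  · simp only [hD1]; rw [← dataAmp_zero]; exact tendsto_dataAmp o0 o1

theorem admissible_truncated {Λa Λm Λp : ℝ} (h1 : 0 < Λa) (h2 : Λa < 10) (h3 : 12 < Λm)
    (h4 : Λm ≤ Λp) (h5 : Λp < 60) (hT : truncationTime Λa Λm Λp < T) (hN : Tendsto N atTop atTop) :
    Admissible T N fun m => keptCoeffs (N m) Λa Λm Λp := by
  obtain ⟨κ, hκ, hobs⟩ := observability_truncated h1 h2 h3 h4 h5 hT
  refine ⟨⟨κ, hκ, hN.eventually hobs⟩, fun σ n => ⟨fun _ => Pi.single (false, σ, n) 1, ?_, ?_⟩⟩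
  · exact hN.eventually (eventually_single_mem_truncated h1 h2 T σ n)
  · simp

theorem admissible_bigrid (hT : 2 < T) (hN : Tendsto N atTop atTop) :
    Admissible T N fun m => bigridCoeffs (N m) := by
  obtain ⟨κ, hκ, hobs⟩ := observability_bigrid hT
  refine ⟨⟨κ, hκ, hN.eventually hobs⟩, fun σ n => ?_⟩
  obtain ⟨d, hd, hlim⟩ := exists_bigrid_approx T σ n
  exact ⟨fun m => d (N m), hN.eventually hd, hlim.comp hN⟩

theorem two_lt_of_truncationTime_lt {Λa Λm Λp : ℝ} (h1 : 0 < Λa) (h2 : Λa < 10) (h3 : 12 < Λm)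
    (h4 : Λm ≤ Λp) (h5 : Λp < 60) (hT : truncationTime Λa Λm Λp < T) : 2 < T := by
  obtain ⟨m, hm0, hm1, hmT, -⟩ := truncation_gap h1 h2 h3 h4 h5 hT
  by_contra! h
  nlinarith

end Convergence

end P2Wave

end

theorem mainTheorem4 (T : ℝ)
    -- the meshes, with `h = 1/(N m + 1) → 0`
    (N : ℕ → ℕ) (hN : Tendsto N atTop atTop)
    -- the filtered spaces: Fourier truncation or bi-grid
    (S : ∀ m, Submodule ℂ (P2Wave.GridVec (N m) × P2Wave.GridVec (N m)))
    (hS : (∃ Λa Λm Λp : ℝ, 0 < Λa ∧ Λa < 10 ∧ 12 < Λm ∧ Λm ≤ Λp ∧ Λp < 60 ∧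
              P2Wave.truncationTime Λa Λm Λp < T ∧
              ∀ m, S m = P2Wave.truncatedSpace (N m) Λa Λm Λp) ∨
          (2 < T ∧ (∀ m, Odd (N m)) ∧ ∀ m, S m = P2Wave.bigridSpace (N m)))
    -- the continuous and the discrete data to be controlled
    (y0 : P2Wave.L2I) (y1 : P2Wave.HNegOne)
    (Y0 Y1 : ∀ m, P2Wave.GridVec (N m))
    -- the sequences of Fourier coefficients of the continuous data
    (b0 b1 : P2Wave.Ell2)
    (hb0 : ∀ n, b0 n = P2Wave.fourierCoeff0 y0 (n + 1))
    (hb1 : ∀ n, b1 n = P2Wave.fourierCoeff1 y1 (n + 1) / ((((n : ℝ) + 1) * Real.pi : ℝ) : ℂ))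
    -- weak convergence of the acoustic coefficients
    (hac1 : P2Wave.WeaklyTendsto
      (fun m => P2Wave.discreteSeq1 P2Wave.acousticSymbol (Y1 m)) b1)
    (hac0 : P2Wave.WeaklyTendsto
      (fun m => P2Wave.discreteSeq0 P2Wave.acousticSymbol (Y0 m)) b0)
    -- weak convergence to zero of the optic coefficients
    (hop1 : P2Wave.WeaklyTendsto
      (fun m => P2Wave.discreteSeq1 P2Wave.opticSymbol (Y1 m)) 0)
    (hop0 : P2Wave.WeaklyTendsto
      (fun m => P2Wave.discreteSeq0 P2Wave.opticSymbol (Y0 m)) 0) :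
    -- the discrete and the continuous HUM controls exist and are unique
    (∀ m, ∃! v : P2Wave.L2T T, P2Wave.IsDiscreteHUMControl T (S m) (Y0 m) (Y1 m) v) ∧
    (∃! v : P2Wave.L2T T, P2Wave.IsHUMControl T y0 y1 v) ∧
    ∀ (vh : ℕ → P2Wave.L2T T) (v : P2Wave.L2T T),
      (∀ m, P2Wave.IsDiscreteHUMControl T (S m) (Y0 m) (Y1 m) (vh m)) →
      P2Wave.IsHUMControl T y0 y1 v →
      -- weak convergence of the controls
      P2Wave.WeaklyTendsto vh v ∧
      -- strong convergence of the controls for strongly convergent coefficients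
      (Tendsto (fun m => P2Wave.discreteSeq1 P2Wave.acousticSymbol (Y1 m)) atTop (𝓝 b1) →
       Tendsto (fun m => P2Wave.discreteSeq0 P2Wave.acousticSymbol (Y0 m)) atTop (𝓝 b0) →
       Tendsto (fun m => P2Wave.discreteSeq1 P2Wave.opticSymbol (Y1 m)) atTop (𝓝 0) →
       Tendsto (fun m => P2Wave.discreteSeq0 P2Wave.opticSymbol (Y0 m)) atTop (𝓝 0) →
       Tendsto vh atTop (𝓝 v)) := by
  obtain ⟨X, hT, hX, hSX⟩ : ∃ X : ∀ _ : ℕ, Submodule ℂ (Bool → ℕ → ℂ), 2 < T ∧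
      P2Wave.Admissible T N X ∧
      ∀ m, S m = ((X m).map (P2Wave.synth (N m))).prod ((X m).map (P2Wave.synth (N m))) := by
    rcases hS with ⟨Λa, Λm, Λp, h1, h2, h3, h4, h5, hT, hS⟩ | ⟨hT, hodd, hS⟩
    · exact ⟨_, P2Wave.two_lt_of_truncationTime_lt h1 h2 h3 h4 h5 hT,
        P2Wave.admissible_truncated h1 h2 h3 h4 h5 hT hN,
        fun m => by rw [hS, P2Wave.truncatedSpace_eq]⟩
    · exact ⟨_, hT, P2Wave.admissible_bigrid hT hN,
        fun m => by rw [hS, P2Wave.bigridSpace_eq (hodd m)]⟩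
  obtain rfl : S = fun m => ((X m).map (P2Wave.synth (N m))).prod ((X m).map (P2Wave.synth (N m))) :=
    funext hSX
  exact ⟨fun m => P2Wave.existsUnique_discreteHUMControl (by linarith) _ _ _,
    P2Wave.existsUnique_HUMControl hT hb0 hb1,
    fun vh v hvh hv => P2Wave.convergence_of_admissible hT hN hX hb0 hb1 hac1 hac0 hop1 hop0 hvh hv⟩
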